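/- Let $M=\mathbb H^3/\Gamma$ be a convex co-compact complete hyperbolic $3$-manifold, and let $\partial M=\Omega(\Gamma)/\Gamma$ be its conformal boundary at infinity, with Euler characteristic $\chi(\partial M)$. Let $(M_r)_{r\ge r_0}$ be an equidistant foliation of the ends of $M$ by compact convex sets: the $M_r$ are compact convex subsets of $M$ with smooth boundary, $M_r=\{x\in M: d(x,M_s)\le r-s\}$ for $r\ge s\ge r_0$, and for each $r$ the map that sends a point of $\partial M_r$ to the endpoint of its outward normal geodesic ray is a diffeomorphism $\partial M_r\to\partial M$. Let $g_r$ be the induced metric of $\partial M_r$, carried to $\partial M$ by this diffeomorphism. Such a foliation induces on $\partial M$ the metric $h=\lim_{r\to\infty}e^{-2r}g_r$, which lies in the conformal class at infinity, and the W-volume of $M$ with respect to $h$ is $$W(M,h)=\mathrm{Vol}(M_r)-\frac12\int_{\partial M_r}H\,da+r\pi\chi(\partial M),$$ which does not depend on $r$; here $H$ is the mean curvature, that is, half the sum of the principal curvatures of $\partial M_r$ with respect to the outward normal, positive for spheres. The renormalized volume of $M$ is $V_R(M)=W(M,h_0)$, where $h_0$ is the hyperbolic metric of Gauss curvature $-4$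 in the conformal class of $\partial M$. Suppose that $(M_r)$ induces $h_0$. Then $$\lim_{r\to\infty}\left(\mathrm{Vol}(M_r)-\frac12\mathrm{Area}(\partial M_r)+\pi\chi(\partial M)\log\sqrt{\frac{2\,\mathrm{Area}(\partial M_r)}{\pi|\chi(\partial M)|}}\right)=V_R(M)+\frac{\pi}{2}\chi(\partial M),$$ and moreover $$\lim_{r\to\infty}\int_{\partial M_r}(H-1)\,da=\pi\chi(\partial M).$$ -/

import Mathlib

open Set Filter Topology MeasureTheory
open scoped ContDiff

noncomputable section

namespace RenVol

/-! ### Hyperbolic space: the hyperboloid model -/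

/-- Minkowski space `ℝ^{1,3}`; the first coordinate is the time coordinate. -/
abbrev Mink : Type := ℝ × EuclideanSpace ℝ (Fin 3)

/-- The Lorentzian form `-x₀y₀ + x₁y₁ + x₂y₂ + x₃y₃`. -/
def form (x y : Mink) : ℝ := inner ℝ x.2 y.2 - x.1 * y.1

/-- Hyperbolic 3-space; the Riemannian metric is the restriction of `form` to tangent vectors. -/
def H3 : Set Mink := {x | form x x = -1 ∧ 0 < x.1}

/-- The hyperbolic distance. -/
def hdist (x y : Mink) : ℝ := Real.arcosh (-form x y)

/-- The hyperbolic volume, in the coordinates given by the vertical projection `(x₀, y) ↦ y`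
of the hyperboloid to `ℝ³`, where it has the density `1 / √(1 + |y|²)`. -/
def hypVolume : Measure Mink :=
  ((volume : Measure (EuclideanSpace ℝ (Fin 3))).withDensity
    (fun y => ENNReal.ofReal (1 / √(1 + ‖y‖ ^ 2)))).map (fun y => (√(1 + ‖y‖ ^ 2), y))

/-- Geodesic convexity in `H3`: the geodesic segment between `x` and `y` consists of the points
of `H3` that are nonnegative combinations of `x` and `y`. -/
def GeodConvex (C : Set Mink) : Prop :=
  ∀ x ∈ C, ∀ y ∈ C, ∀ a b : ℝ, 0 ≤ a → 0 ≤ b → a • x + b • y ∈ H3 → a • x + b • y ∈ C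

/-- The boundary, relative to `H3`, of a closed subset `C` of `H3`. -/
def bdry (C : Set Mink) : Set Mink := C ∩ closure (H3 \ C)

/-! ### The sphere at infinity -/

/-- The sphere at infinity: null directions, normalized to have time coordinate `1`. -/
def idealSphere : Set Mink := {b | form b b = 0 ∧ b.1 = 1}

/-- The action of a Lorentz transformation on the sphere at infinity. -/
def idealAct (γ : Mink ≃ₗ[ℝ] Mink) (b : Mink) : Mink := (γ b).1⁻¹ • γ b

/-- The unit tangent vector at `x ∈ H3` that points to the ideal point `b`: the unique `N` with
`form x N = 0`, `form N N = 1` and `x + N` a multiple of `b`. The geodesic ray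
`cosh t • x + sinh t • N` ends at `b`. -/
def unitToward (x b : Mink) : Mink := (-form x b)⁻¹ • b - x

/-- Stereographic parametrization of the sphere at infinity minus one point. -/
def stereo (u : ℝ × ℝ) : Mink :=
  (1, !₂[2 * u.1 / (1 + u.1 ^ 2 + u.2 ^ 2), 2 * u.2 / (1 + u.1 ^ 2 + u.2 ^ 2),
    (u.1 ^ 2 + u.2 ^ 2 - 1) / (1 + u.1 ^ 2 + u.2 ^ 2)])

/-! ### Complete hyperbolic 3-manifolds `M = H3 / Γ` -/

/-- `Γ` is a group of isometries of `H3` that acts freely and properly discontinuously, so that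
`M = H3 / Γ` is a complete hyperbolic 3-manifold. -/
structure IsHyperbolicManifoldGroup (Γ : Subgroup (Mink ≃ₗ[ℝ] Mink)) : Prop where
  form_eq : ∀ γ ∈ Γ, ∀ x y, form (γ x) (γ y) = form x y
  mapsTo : ∀ γ ∈ Γ, ∀ x ∈ H3, γ x ∈ H3
  free : ∀ γ ∈ Γ, ∀ x ∈ H3, γ x = x → γ = 1
  properly_discontinuous : ∀ K ⊆ H3, IsCompact K →
    {γ : Mink ≃ₗ[ℝ] Mink | γ ∈ Γ ∧ ∃ x ∈ K, γ x ∈ K}.Finite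

/-- The domain of discontinuity `Ω(Γ)` in the sphere at infinity. -/
def discontinuityDomain (Γ : Subgroup (Mink ≃ₗ[ℝ] Mink)) : Set Mink :=
  {b | b ∈ idealSphere ∧ ∃ U : Set Mink, IsOpen U ∧ b ∈ U ∧
    {γ : Mink ≃ₗ[ℝ] Mink | γ ∈ Γ ∧ ∃ c ∈ U ∩ idealSphere, idealAct γ c ∈ U}.Finite}

/-- The boundary at infinity `∂M = Ω(Γ) / Γ`, with the quotient topology. -/
abbrev BoundaryAtInfinity (Γ : Subgroup (Mink ≃ₗ[ℝ] Mink)) : Type :=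
  Quot (fun b c : discontinuityDomain Γ => ∃ γ ∈ Γ, idealAct γ b = (c : Mink))

/-- A smooth local parametrization (immersion) of `Ω(Γ)`. -/
structure IsLocalParam (Γ : Subgroup (Mink ≃ₗ[ℝ] Mink)) (U : Set (ℝ × ℝ)) (p : ℝ × ℝ → Mink) :
    Prop where
  isOpen : IsOpen U
  smooth : ContDiffOn ℝ ∞ p U
  mapsTo : MapsTo p U (discontinuityDomain Γ)
  immersion : ∀ u ∈ U, Function.Injective (fderiv ℝ p u)

/-- `D` is a Borel set that contains exactly one point of each `Γ`-orbit in `X`. -/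
structure IsFundDomain (Γ : Subgroup (Mink ≃ₗ[ℝ] Mink)) (act : (Mink ≃ₗ[ℝ] Mink) → Mink → Mink)
    (X D : Set Mink) : Prop where
  measurable : MeasurableSet D
  subset : D ⊆ X
  existsUnique : ∀ x ∈ X, ∃! γ : Mink ≃ₗ[ℝ] Mink, γ ∈ Γ ∧ act γ x ∈ D

/-! ### Euler characteristic of `∂M` -/

/-- The geometric realization of the simplicial complex on `Fin n` generated by `faces`. -/
def realization (n : ℕ) (faces : Finset (Finset (Fin n))) : Set (Fin n → ℝ) :=
  {t | (∀ i, 0 ≤ t i) ∧ ∑ i, t i = 1 ∧ ∃ f ∈ faces, ∀ i ∉ f, t i = 0}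

/-- A smooth finite triangulation of `∂M`: a homeomorphism from a pure two-dimensional finite
simplicial complex to `∂M` whose restriction to each closed triangle is a smooth immersion. -/
structure SmoothTriangulation (Γ : Subgroup (Mink ≃ₗ[ℝ] Mink)) where
  /-- the number of vertices -/
  n : ℕ
  /-- the triangles, as sets of vertices -/
  faces : Finset (Finset (Fin n))
  card_face : ∀ f ∈ faces, f.card = 3
  vertex_mem : ∀ i, ∃ f ∈ faces, i ∈ f
  /-- the homeomorphism -/
  homeo : realization n faces ≃ₜ BoundaryAtInfinity Γ
  smooth : ∀ f ∈ faces, ∃ τ : (Fin n → ℝ) → Mink, ContDiff ℝ ∞ τ ∧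
    ∀ t : realization n faces, (∀ i ∉ f, t.1 i = 0) →
      (∃ h : τ t ∈ discontinuityDomain Γ, homeo t = Quot.mk _ ⟨τ t, h⟩) ∧
      ∀ v : Fin n → ℝ, (∀ i ∉ f, v i = 0) → ∑ i, v i = 0 → fderiv ℝ τ t v = 0 → v = 0

/-- `V - E + F`. -/
def SmoothTriangulation.eulerChar {Γ : Subgroup (Mink ≃ₗ[ℝ] Mink)} (T : SmoothTriangulation Γ) :
    ℤ :=
  T.n - (T.faces.biUnion (fun f => f.powersetCard 2)).card + T.faces.card

/-- `χ` is the Euler characteristic of `∂M`. -/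
def IsEulerCharacteristic (Γ : Subgroup (Mink ≃ₗ[ℝ] Mink)) (χ : ℤ) : Prop :=
  ∃ T : SmoothTriangulation Γ, T.eulerChar = χ

/-! ### Surfaces in local coordinates -/

/-- Partial derivative with respect to the first coordinate. -/
def d1 {W : Type*} [NormedAddCommGroup W] [NormedSpace ℝ W] (f : ℝ × ℝ → W) (u : ℝ × ℝ) : W :=
  fderiv ℝ f u (1, 0)

/-- Partial derivative with respect to the second coordinate. -/
def d2 {W : Type*} [NormedAddCommGroup W] [NormedSpace ℝ W] (f : ℝ × ℝ → W) (u : ℝ × ℝ) : W :=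
  fderiv ℝ f u (0, 1)

/-- Gauss curvature of the metric `E du² + 2 F du dv + G dv²` (Brioschi's formula). -/
def gaussCurvature (E F G : ℝ × ℝ → ℝ) (u : ℝ × ℝ) : ℝ :=
  (Matrix.det !![-(d2 (d2 E) u) / 2 + d1 (d2 F) u - d1 (d1 G) u / 2, d1 E u / 2,
        d1 F u - d2 E u / 2;
      d2 F u - d1 G u / 2, E u, F u;
      d2 G u / 2, F u, G u]
    - Matrix.det !![0, d2 E u / 2, d1 G u / 2;
      d2 E u / 2, E u, F u;
      d1 G u / 2, F u, G u]) / (E u * G u - F u ^ 2) ^ 2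

/-- The area density `√(EG - F²)` of an immersed surface `f`. -/
def areaDensity (f : ℝ × ℝ → Mink) (u : ℝ × ℝ) : ℝ :=
  √(form (d1 f u) (d1 f u) * form (d2 f u) (d2 f u) - form (d1 f u) (d2 f u) ^ 2)

/-- The mean curvature, half the trace of the shape operator `df ↦ dN`, of an immersed surface
`f` in `H3` with unit normal `N`. (Spheres with the outward normal have positive curvature.) -/
def meanCurvature (f N : ℝ × ℝ → Mink) (u : ℝ × ℝ) : ℝ :=
  (form (d1 f u) (d1 N u) * form (d2 f u) (d2 f u)
      - (form (d1 f u) (d2 N u) + form (d2 f u) (d1 N u)) * form (d1 f u) (d2 f u)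
      + form (d2 f u) (d2 N u) * form (d1 f u) (d1 f u)) /
    (2 * (form (d1 f u) (d1 f u) * form (d2 f u) (d2 f u) - form (d1 f u) (d2 f u) ^ 2))

/-! ### Conformal metrics on `∂M` -/

/-- `ρ` is the conformal factor of a smooth Riemannian metric `h = ρ² · (round metric)` on `∂M`
in the conformal class at infinity, given as a `Γ`-invariant metric on `Ω(Γ)`. On vectors tangent
to the sphere at infinity `form` is the round metric. -/
structure IsConformalMetric (Γ : Subgroup (Mink ≃ₗ[ℝ] Mink)) (ρ : Mink → ℝ) : Prop where
  pos : ∀ b ∈ discontinuityDomain Γ, 0 < ρ b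
  smooth : ∀ U p, IsLocalParam Γ U p → ContDiffOn ℝ ∞ (ρ ∘ p) U
  invariant : ∀ U p, IsLocalParam Γ U p → ∀ γ ∈ Γ, ∀ u ∈ U, ∀ v w : ℝ × ℝ,
    ρ (idealAct γ (p u)) ^ 2 *
        form (fderiv ℝ (idealAct γ ∘ p) u v) (fderiv ℝ (idealAct γ ∘ p) u w) =
      ρ (p u) ^ 2 * form (fderiv ℝ p u v) (fderiv ℝ p u w)

/-- The metric `ρ² · (round metric)` is the hyperbolic metric on `∂M` of Gauss curvature `-4` in
the conformal class at infinity. -/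
structure IsHyperbolicMetric (Γ : Subgroup (Mink ≃ₗ[ℝ] Mink)) (ρ : Mink → ℝ) : Prop
    extends IsConformalMetric Γ ρ where
  curvature : ∀ U p, IsLocalParam Γ U p → ∀ u ∈ U,
    gaussCurvature (fun z => ρ (p z) ^ 2 * form (d1 p z) (d1 p z))
      (fun z => ρ (p z) ^ 2 * form (d1 p z) (d2 p z))
      (fun z => ρ (p z) ^ 2 * form (d2 p z) (d2 p z)) u = -4

/-! ### Equidistant foliations -/

/-- An equidistant foliation `M_r`, `r ≥ r₀`, of the ends of `M` by compact convex sets with smooth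
boundary. `body r` is the preimage of `M_r` in `H3`. The exponential map, which takes a point of
`∂M_r` to the endpoint of its outward normal ray, is a diffeomorphism to `∂M`, and `pt r` is its
inverse, lifted to a map from `Ω(Γ)` to the boundary of `body r`. In particular `M` is convex
co-compact. -/
structure EquidistantFoliation (Γ : Subgroup (Mink ≃ₗ[ℝ] Mink)) where
  /-- the first parameter -/
  r₀ : ℝ
  /-- the preimage of `M_r` -/
  body : ℝ → Set Mink
  subset : ∀ r, r₀ ≤ r → body r ⊆ H3
  nonempty : ∀ r, r₀ ≤ r → (body r).Nonempty
  isClosed : ∀ r, r₀ ≤ r → IsClosed (body r)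
  invariant : ∀ r, r₀ ≤ r → ∀ γ ∈ Γ, ∀ x ∈ body r, γ x ∈ body r
  cocompact : ∀ r, r₀ ≤ r → ∃ K : Set Mink, IsCompact K ∧ K ⊆ body r ∧
    ∀ x ∈ body r, ∃ γ ∈ Γ, γ x ∈ K
  convex : ∀ r, r₀ ≤ r → GeodConvex (body r)
  equidistant : ∀ s r, r₀ ≤ s → s ≤ r →
    body r = {x | x ∈ H3 ∧ ∃ y ∈ body s, hdist x y ≤ r - s}
  /-- the boundary point of `M_r` whose outward normal ray ends at the given point of `∂M` -/
  pt : ℝ → Mink → Mink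
  bijOn : ∀ r, r₀ ≤ r → BijOn (pt r) (discontinuityDomain Γ) (bdry (body r))
  normal : ∀ r, r₀ ≤ r → ∀ b ∈ discontinuityDomain Γ, ∀ y ∈ body r,
    form y (unitToward (pt r b) b) ≤ 0
  smooth : ∀ r, r₀ ≤ r → ∀ U p, IsLocalParam Γ U p → ContDiffOn ℝ ∞ (pt r ∘ p) U
  immersion : ∀ r, r₀ ≤ r → ∀ U p, IsLocalParam Γ U p → ∀ u ∈ U,
    Function.Injective (fderiv ℝ (pt r ∘ p) u)

namespace EquidistantFoliation

variable {Γ : Subgroup (Mink ≃ₗ[ℝ] Mink)}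

/-- The foliation induces the metric `h = ρ² · (round metric)` on `∂M`, that is,
`h = lim e^{-2r} g_r`, where `g_r` is the metric of `∂M_r`, carried to `∂M`. -/
def Induces (F : EquidistantFoliation Γ) (ρ : Mink → ℝ) : Prop :=
  ∀ U p, IsLocalParam Γ U p → ∀ u ∈ U, ∀ v w : ℝ × ℝ,
    Tendsto (fun r => Real.exp (-2 * r) *
        form (fderiv ℝ (F.pt r ∘ p) u v) (fderiv ℝ (F.pt r ∘ p) u w)) atTop
      (𝓝 (ρ (p u) ^ 2 * form (fderiv ℝ p u v) (fderiv ℝ p u w)))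

/-- The boundary of `M_r` in stereographic coordinates on the sphere at infinity. -/
def surf (F : EquidistantFoliation Γ) (r : ℝ) (u : ℝ × ℝ) : Mink := F.pt r (stereo u)

/-- The outward unit normal of `M_r` in stereographic coordinates. -/
def nor (F : EquidistantFoliation Γ) (r : ℝ) (u : ℝ × ℝ) : Mink :=
  unitToward (F.pt r (stereo u)) (stereo u)

/-- The volume of `M_r`; `D` is a fundamental domain for the action on `H3`. -/
def vol (F : EquidistantFoliation Γ) (D : Set Mink) (r : ℝ) : ℝ :=
  (hypVolume (F.body r ∩ D)).toReal

/-- The area of `∂M_r`; `B` is a fundamental domain for the action on `Ω(Γ)`. -/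
def area (F : EquidistantFoliation Γ) (B : Set Mink) (r : ℝ) : ℝ :=
  ∫ u in stereo ⁻¹' B, areaDensity (F.surf r) u

/-- The integral over `∂M_r` of the mean curvature. -/
def totalMeanCurvature (F : EquidistantFoliation Γ) (B : Set Mink) (r : ℝ) : ℝ :=
  ∫ u in stereo ⁻¹' B, meanCurvature (F.surf r) (F.nor r) u * areaDensity (F.surf r) u

/-- The integral over `∂M_r` of `H - 1`. -/
def totalMeanCurvatureSubOne (F : EquidistantFoliation Γ) (B : Set Mink) (r : ℝ) : ℝ :=
  ∫ u in stereo ⁻¹' B, (meanCurvature (F.surf r) (F.nor r) u - 1) * areaDensity (F.surf r) u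

end EquidistantFoliation

/-! ### Renormalized volume -/

/-- `w` is the W-volume `W(M, h) = vol(M_r) - ½ ∫_{∂M_r} H da + r π χ(∂M)` of `M` with respect to
the metric `h = ρ² · (round metric)`; here `M_r` is the equidistant foliation that induces `h`. -/
def IsWVolume (Γ : Subgroup (Mink ≃ₗ[ℝ] Mink)) (ρ : Mink → ℝ) (w : ℝ) : Prop :=
  ∃ F : EquidistantFoliation Γ, F.Induces ρ ∧
    ∃ D B : Set Mink, IsFundDomain Γ (fun γ => γ) H3 D ∧
      IsFundDomain Γ idealAct (discontinuityDomain Γ) B ∧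
    ∃ χ : ℤ, IsEulerCharacteristic Γ χ ∧
    ∃ r, F.r₀ ≤ r ∧ w = F.vol D r - 1 / 2 * F.totalMeanCurvature B r + r * Real.pi * χ

/-- `v` is the W-volume with respect to the hyperbolic metric of Gauss curvature `-4`. -/
def IsRenormalizedVolume (Γ : Subgroup (Mink ≃ₗ[ℝ] Mink)) (v : ℝ) : Prop :=
  ∃ ρ : Mink → ℝ, IsHyperbolicMetric Γ ρ ∧ IsWVolume Γ ρ v

open Classical in
/-- The renormalized volume `V_R(M) = W(M, h₀)` of `M = H3 / Γ`, where `h₀` is the hyperbolic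
metric of Gauss curvature `-4` in the conformal class at infinity. -/
def renormalizedVolume (Γ : Subgroup (Mink ≃ₗ[ℝ] Mink)) : ℝ :=
  if h : ∃ v, IsRenormalizedVolume Γ v then h.choose else 0

end RenVol

end

open Set Filter Topology MeasureTheory
open scoped ContDiff Pointwise

noncomputable section

namespace RenVol

/-! ### Minkowski space -/

/-! The computation takes place on the light cone. A conformal metric h = ρ² · (round) is the same
as the section X = ρ b of the cone of null vectors over Ω(Γ): `form` restricted to the section is h,
and invariance of h is linear invariance of the section (`conformal_equivariant`). The normal plane
of X contains a second null vector Q, normalized by ⟨X, Q⟩ = -1/2 (`conjVec`). The leaves of the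
foliation that induces h are e^r X + e^{-r} Q, with unit normal e^r X - e^{-r} Q (`pt_chart`,
`unitToward_chart`). The reason is that the point of the leaf with normal ray ending at b minimizes
the Busemann function at b on M_r (`pt_min`), and this extremal property makes it orthogonal to dX.

One has dQ = dX ∘ S with S self-adjoint for h, so the leaf is immersed by dX ∘ (e^r + e^{-r} S).
Curvature -4 is Liouville's equation, and it says exactly tr S = 2 (`sff_trace`). Hence, relative to
the area form of h, the area density of the leaf is det(e^r + e^{-r} S) = e^{2r} + 2 + e^{-2r} det
S, and H times this density is e^{2r} - e^{-2r} det S (`leaf_densities`). Let A be the area of h and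
I the integral of det S. Then Area = (e^{2r} + 2) A + e^{-2r} I, ∫ H = e^{2r} A - e^{-2r} I, Vol = w
+ e^{2r} A / 2 + 2rA - e^{-2r} I / 2, the last by integrating the area over the parameter
(`hypVolume_body`, `vol_eq`).

Gauss–Bonnet gives A = -πχ/2. Therefore the W-volume equals w for every r, and ∫ (H - 1) = -2A +
o(1) tends to πχ. Moreover Vol - Area/2 = w + 2rA - A + o(1), while the logarithm is r + o(1)
because 2 Area / (π|χ|) = Area / A ~ e^{2r}; the terms 2rA and πχ r cancel, and w - A = w + πχ/2
remains.

Three supporting facts carry the rest. First, I exists because det S is bounded: above by tr S = 2,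
below because the leaves are immersed (`areaFactor_pos`). Second, Gauss–Bonnet is proved from a
smooth triangulation: a triangle formula (`gauss_bonnet_triangle`), cancellation of geodesic
curvature along edges (`kap_add_kap`), angle sum 2π at vertices (`sum_ang`), and a transfer of the
area of the triangles to an arbitrary fundamental domain (`idealArea_fundDomain`). Third, the
renormalized volume is defined by an arbitrary choice of metric, foliation, domains and χ, so each
must be shown not to matter: the metric is unique by a maximum principle (`hyperbolic_unique`), the
metric determines the foliation (`body_eq_body`), and χ is determined by the area
(`eulerCharacteristic_unique`). -/

theorem form_coord (x y : Mink) :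
    form x y = x.2 0 * y.2 0 + x.2 1 * y.2 1 + x.2 2 * y.2 2 - x.1 * y.1 := by
  simp [form, PiLp.inner_apply, Fin.sum_univ_three]
  ring

theorem form_comm (x y : Mink) : form x y = form y x := by
  simp only [form_coord]; ring

theorem form_add_left (x y z : Mink) : form (x + y) z = form x z + form y z := by
  simp only [form_coord, Prod.fst_add, Prod.snd_add, PiLp.add_apply]; ring

theorem form_smul_left (a : ℝ) (x z : Mink) : form (a • x) z = a * form x z := by
  simp only [form_coord, Prod.smul_fst, Prod.smul_snd, PiLp.smul_apply, smul_eq_mul]; ring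

theorem form_add_right (x y z : Mink) : form x (y + z) = form x y + form x z := by
  rw [form_comm, form_add_left, form_comm y, form_comm z]

theorem form_smul_right (a : ℝ) (x z : Mink) : form x (a • z) = a * form x z := by
  rw [form_comm, form_smul_left, form_comm]

theorem form_neg_left (x z : Mink) : form (-x) z = -form x z := by
  simpa using form_smul_left (-1) x z

theorem form_neg_right (x z : Mink) : form x (-z) = -form x z := by
  simpa using form_smul_right (-1) x z

theorem form_sub_left (x y z : Mink) : form (x - y) z = form x z - form y z := by
  rw [sub_eq_add_neg, form_add_left, form_neg_left]; ring

theorem form_sub_right (x y z : Mink) : form x (y - z) = form x y - form x z := by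
  rw [sub_eq_add_neg, form_add_right, form_neg_right]; ring

theorem form_zero_left (x : Mink) : form 0 x = 0 := by simp [form]

theorem form_zero_right (x : Mink) : form x 0 = 0 := by simp [form]

/-- The Lorentzian form as a continuous bilinear map. -/
def formL : Mink →L[ℝ] Mink →L[ℝ] ℝ :=
  LinearMap.toContinuousLinearMap
    { toFun := fun x => LinearMap.toContinuousLinearMap
        { toFun := fun y => form x y
          map_add' := form_add_right x
          map_smul' := fun a y => form_smul_right a x y }
      map_add' := fun x y => by ext z <;> simp [form_add_left]
      map_smul' := fun a x => by ext z <;> simp [form_smul_left] }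

@[simp] theorem formL_apply (x y : Mink) : formL x y = form x y := rfl

theorem continuous_form : Continuous fun z : Mink × Mink => form z.1 z.2 := by
  simp only [form]; fun_prop

section calculus
variable {V : Type*} [NormedAddCommGroup V] [NormedSpace ℝ V] {f g : V → Mink} {u : V}

theorem hasFDerivAt_form {f' g' : V →L[ℝ] Mink} (hf : HasFDerivAt f f' u)
    (hg : HasFDerivAt g g' u) :
    HasFDerivAt (fun z => form (f z) (g z)) ((formL (f u)).comp g' + (formL (g u)).comp f') u := by
  have h := formL.hasFDerivAt_of_bilinear hf hg
  refine h.congr_fderiv ?_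
  ext v
  simp [form_comm]

theorem fderiv_form (hf : DifferentiableAt ℝ f u) (hg : DifferentiableAt ℝ g u) (v : V) :
    fderiv ℝ (fun z => form (f z) (g z)) u v =
      form (f u) (fderiv ℝ g u v) + form (fderiv ℝ f u v) (g u) := by
  rw [(hasFDerivAt_form hf.hasFDerivAt hg.hasFDerivAt).fderiv]
  simp [form_comm (fderiv ℝ f u v)]

theorem contDiffOn_form {s : Set V} {n : WithTop ℕ∞} (hf : ContDiffOn ℝ n f s)
    (hg : ContDiffOn ℝ n g s) : ContDiffOn ℝ n (fun z => form (f z) (g z)) s := by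
  simp only [form]
  exact ((contDiff_snd.comp_contDiffOn hf).inner ℝ (contDiff_snd.comp_contDiffOn hg)).sub
    ((contDiff_fst.comp_contDiffOn hf).mul (contDiff_fst.comp_contDiffOn hg))

end calculus


theorem mink_ext {x y : Mink} (h : x.1 = y.1) (h0 : x.2 0 = y.2 0) (h1 : x.2 1 = y.2 1)
    (h2 : x.2 2 = y.2 2) : x = y := by
  refine Prod.ext h ?_
  ext i; fin_cases i <;> assumption

theorem normSq_coord (y : EuclideanSpace ℝ (Fin 3)) :
    ‖y‖ ^ 2 = y 0 ^ 2 + y 1 ^ 2 + y 2 ^ 2 := by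
  rw [EuclideanSpace.norm_sq_eq]; simp [Fin.sum_univ_three]

theorem form_self (x : Mink) : form x x = ‖x.2‖ ^ 2 - x.1 ^ 2 := by
  rw [normSq_coord, form_coord]; ring

theorem H3.fst_sq {x : Mink} (hx : x ∈ H3) : x.1 ^ 2 = 1 + ‖x.2‖ ^ 2 := by
  have := hx.1; rw [form_self] at this; linarith

theorem isClosed_H3 : IsClosed H3 := by
  have : H3 = {x : Mink | form x x = -1} ∩ {x : Mink | 0 ≤ x.1} := by
    ext x
    simp only [H3, mem_ofPred_eq, mem_inter_iff]
    refine ⟨fun h => ⟨h.1, h.2.le⟩, fun h => ⟨h.1, lt_of_le_of_ne h.2 fun h0 => ?_⟩⟩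
    have := h.1; rw [form_self, ← h0] at this
    nlinarith [sq_nonneg ‖x.2‖]
  rw [this]
  exact (isClosed_eq (continuous_form.comp (continuous_id.prodMk continuous_id))
    continuous_const).inter (isClosed_le continuous_const continuous_fst)

theorem inner_sq_le (x y : Mink) : (inner ℝ x.2 y.2) ^ 2 ≤ ‖x.2‖ ^ 2 * ‖y.2‖ ^ 2 := by
  have := abs_real_inner_le_norm x.2 y.2
  rw [← mul_pow, ← sq_abs (inner ℝ x.2 y.2)]
  exact pow_le_pow_left₀ (abs_nonneg _) this 2

/-- The form is positive definite on the tangent space of `H3`. -/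
theorem normSq_le_of_orthogonal {x v : Mink} (hx : x ∈ H3) (hv : form x v = 0) :
    ‖v.2‖ ^ 2 ≤ x.1 ^ 2 * form v v := by
  have h1 := H3.fst_sq hx
  have h2 := inner_sq_le x v
  -- Orthogonality turns Cauchy–Schwarz into x₀² v₀² ≤ (x₀² - 1) |v|², which rearranges to the
  -- claim.
  have h3 : inner ℝ x.2 v.2 = x.1 * v.1 := by simp only [form] at hv; linarith
  rw [h3] at h2
  rw [form_self]; nlinarith

theorem form_self_nonneg {x v : Mink} (hx : x ∈ H3) (hv : form x v = 0) : 0 ≤ form v v := by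
  have h1 := normSq_le_of_orthogonal hx hv
  have h2 : 0 < x.1 ^ 2 := pow_pos hx.2 2
  by_contra h
  nlinarith [sq_nonneg ‖v.2‖]

theorem eq_zero_of_form_self_nonpos {x v : Mink} (hx : x ∈ H3) (hv : form x v = 0)
    (h : form v v ≤ 0) : v = 0 := by
  have h1 := normSq_le_of_orthogonal hx hv
  have h2 : 0 < x.1 ^ 2 := pow_pos hx.2 2
  have h3 : ‖v.2‖ ^ 2 ≤ 0 := by nlinarith
  have h4 : v.2 = 0 := by simpa using le_antisymm h3 (sq_nonneg _)
  have h5 : x.1 * v.1 = 0 := by simpa [form, h4] using hv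
  have h6 : v.1 = 0 := by simpa [hx.2.ne'] using h5
  exact Prod.ext h6 h4

theorem one_le_neg_form {x y : Mink} (hx : x ∈ H3) (hy : y ∈ H3) : 1 ≤ -form x y := by
  have h1 := H3.fst_sq hx
  have h2 := H3.fst_sq hy
  have h3 := inner_sq_le x y
  have hxy : 0 < x.1 * y.1 := mul_pos hx.2 hy.2
  simp only [form]
  by_contra h
  push Not at h
  have h4 : x.1 * y.1 - 1 < inner ℝ x.2 y.2 := by linarith
  have h5 : 1 ≤ x.1 * y.1 := by
    have a1 : 1 ≤ x.1 := by nlinarith [sq_nonneg ‖x.2‖, hx.2]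
    have a2 : 1 ≤ y.1 := by nlinarith [sq_nonneg ‖y.2‖, hy.2]
    nlinarith
  have h6 : (x.1 * y.1 - 1) ^ 2 < (inner ℝ x.2 y.2) ^ 2 :=
    pow_lt_pow_left₀ h4 (by linarith) two_ne_zero
  nlinarith [sq_nonneg (x.1 - y.1)]

/-- In the equality case x - y is orthogonal to x and has nonpositive square, while the tangent
space at x is positive definite. -/
theorem eq_of_neg_form_le_one {x y : Mink} (hx : x ∈ H3) (hy : y ∈ H3) (h : -form x y ≤ 1) :
    x = y := by
  have h1 : -form x y = 1 := le_antisymm h (one_le_neg_form hx hy)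
  have h2 : form x (x - y) = 0 := by rw [form_sub_right, hx.1]; linarith
  have h3 : form (x - y) (x - y) ≤ 0 := by
    rw [form_sub_left, h2, form_sub_right, hy.1, form_comm y x]; linarith
  exact sub_eq_zero.1 (eq_zero_of_form_self_nonpos hx h2 h3)

theorem ideal_norm {b : Mink} (hb : b ∈ idealSphere) : ‖b.2‖ = 1 := by
  have h := hb.1
  rw [form_self, hb.2] at h
  nlinarith [norm_nonneg b.2]

theorem neg_form_null_pos {x b : Mink} (hx : x ∈ H3) (hb : form b b = 0) (hb' : 0 < b.1) :
    0 < -form x b := by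
  have h1 := H3.fst_sq hx
  have h3 := inner_sq_le x b
  have h4 : ‖b.2‖ ^ 2 = b.1 ^ 2 := by have := hb; rw [form_self] at this; linarith
  have hxy : 0 < x.1 * b.1 := mul_pos hx.2 hb'
  simp only [form]
  by_contra h
  push Not at h
  have h5 : (x.1 * b.1) ^ 2 ≤ (inner ℝ x.2 b.2) ^ 2 := pow_le_pow_left₀ hxy.le (by linarith) 2
  have h6 : 0 < b.1 ^ 2 := pow_pos hb' 2
  nlinarith

theorem neg_form_ideal_pos {x b : Mink} (hx : x ∈ H3) (hb : b ∈ idealSphere) :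
    0 < -form x b :=
  neg_form_null_pos hx hb.1 (by rw [hb.2]; exact one_pos)

theorem hdist_le_iff {x y : Mink} (hx : x ∈ H3) (hy : y ∈ H3) {t : ℝ} (ht : 0 ≤ t) :
    hdist x y ≤ t ↔ -form x y ≤ Real.cosh t := by
  have h1 := one_le_neg_form hx hy
  have h2 := Real.cosh_le_cosh (x := Real.arcosh (-form x y)) (y := t)
  rw [Real.cosh_arcosh h1, abs_of_nonneg ht, abs_of_nonneg (Real.arcosh_nonneg h1)] at h2
  exact h2.symm

theorem base_mem_H3 : ((1, 0) : Mink) ∈ H3 := by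
  constructor
  · simp [form]
  · simp

/-- Points of `H3` at bounded distance from a given point form a bounded set. -/
theorem fst_le_of_neg_form {x y : Mink} (hx : x ∈ H3) (hy : y ∈ H3) :
    x.1 ≤ 2 * y.1 * (-form x y) := by
  have h1 := H3.fst_sq hx
  have h2 := H3.fst_sq hy
  have h0 : inner ℝ x.2 y.2 ≤ ‖x.2‖ * ‖y.2‖ := real_inner_le_norm _ _
  simp only [form]
  have a1 : ‖x.2‖ ≤ x.1 := by nlinarith [norm_nonneg x.2, hx.2]
  have a2 : ‖y.2‖ ≤ y.1 := by nlinarith [norm_nonneg y.2, hy.2]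
  have a3 : inner ℝ x.2 y.2 ≤ x.1 * ‖y.2‖ := h0.trans (by nlinarith [norm_nonneg y.2])
  have a4 : (y.1 - ‖y.2‖) * (y.1 + ‖y.2‖) = 1 := by linarith [h2]
  -- The factor 2 y₀ bounds y₀ + |y|, the inverse of y₀ - |y|.
  have a5 : 1 ≤ 2 * y.1 * (y.1 - ‖y.2‖) := by nlinarith
  have a6 : x.1 * (y.1 - ‖y.2‖) ≤ -(inner ℝ x.2 y.2 - x.1 * y.1) := by nlinarith
  calc x.1 ≤ x.1 * (2 * y.1 * (y.1 - ‖y.2‖)) := by nlinarith [hx.2]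
    _ = 2 * y.1 * (x.1 * (y.1 - ‖y.2‖)) := by ring
    _ ≤ _ := by gcongr; exact mul_nonneg zero_le_two hy.2.le

theorem isCompact_fst_le (c : ℝ) : IsCompact {x : Mink | x ∈ H3 ∧ x.1 ≤ c} := by
  refine (ProperSpace.isCompact_closedBall (0 : Mink) (|c|)).of_isClosed_subset
    (isClosed_H3.inter (isClosed_le continuous_fst continuous_const)) ?_
  intro x hx
  have h1 := H3.fst_sq hx.1
  have hp := hx.1.2
  have hx2 : x.1 ≤ c := hx.2
  rw [mem_closedBall_zero_iff, Prod.norm_def, max_le_iff, Real.norm_eq_abs, abs_of_pos hp]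
  have : x.1 ≤ |c| := hx2.trans (le_abs_self c)
  exact ⟨this, by nlinarith [norm_nonneg x.2]⟩

/-! ### The action on the sphere at infinity -/

variable {Γ : Subgroup (Mink ≃ₗ[ℝ] Mink)}

theorem continuous_lorentz (γ : Mink ≃ₗ[ℝ] Mink) : Continuous γ :=
  γ.toLinearMap.continuous_of_finiteDimensional

/-- Elements of Γ preserve the time direction: if γ b pointed to the past, -γ b would be a future
null vector whose product with a point of H3 has the wrong sign. -/
theorem fst_pos_of_null (hΓ : IsHyperbolicManifoldGroup Γ) {γ : Mink ≃ₗ[ℝ] Mink} (hγ : γ ∈ Γ)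
    {b : Mink} (hb : form b b = 0) (hb' : 0 < b.1) : 0 < (γ b).1 := by
  have h1 : form (γ b) (γ b) = 0 := by rw [hΓ.form_eq γ hγ, hb]
  have h2 : 0 < -form (γ (1, 0)) (γ b) := by
    rw [hΓ.form_eq γ hγ]; exact neg_form_null_pos base_mem_H3 hb hb'
  have h3 := hΓ.mapsTo γ hγ _ base_mem_H3
  rcases lt_trichotomy (γ b).1 0 with h | h | h
  · have h4 : 0 < -form (γ (1, 0)) (-γ b) :=
      neg_form_null_pos h3 (by rw [form_neg_left, form_neg_right, h1]; simp)
        (by simpa using h)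
    rw [form_neg_right] at h4; linarith
  · have h5 : (γ b).2 = 0 := by
      rw [form_self, h] at h1; simpa using h1
    have h6 : γ b = 0 := Prod.ext h h5
    rw [h6, form_zero_right] at h2; simp at h2
  · exact h

theorem ideal_fst_pos (hΓ : IsHyperbolicManifoldGroup Γ) {γ : Mink ≃ₗ[ℝ] Mink} (hγ : γ ∈ Γ)
    {b : Mink} (hb : b ∈ idealSphere) : 0 < (γ b).1 :=
  fst_pos_of_null hΓ hγ hb.1 (by rw [hb.2]; exact one_pos)

theorem idealAct_mem (hΓ : IsHyperbolicManifoldGroup Γ) {γ : Mink ≃ₗ[ℝ] Mink} (hγ : γ ∈ Γ)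
    {b : Mink} (hb : b ∈ idealSphere) : idealAct γ b ∈ idealSphere := by
  have h := ideal_fst_pos hΓ hγ hb
  refine ⟨?_, ?_⟩
  · rw [idealAct, form_smul_left, form_smul_right, hΓ.form_eq γ hγ, hb.1]; simp
  · simp [idealAct, h.ne']

theorem idealAct_smul (γ : Mink ≃ₗ[ℝ] Mink) {c : ℝ} (hc : c ≠ 0) (b : Mink) :
    idealAct γ (c • b) = idealAct γ b := by
  simp only [idealAct, map_smul, Prod.smul_fst, smul_eq_mul, mul_inv, smul_smul]
  congr 1; field_simp

theorem idealAct_one {b : Mink} (hb : b ∈ idealSphere) : idealAct 1 b = b := by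
  simp [idealAct, hb.2]

theorem idealAct_mul (hΓ : IsHyperbolicManifoldGroup Γ) (γ : Mink ≃ₗ[ℝ] Mink)
    {δ : Mink ≃ₗ[ℝ] Mink} (hδ : δ ∈ Γ) {b : Mink} (hb : b ∈ idealSphere) :
    idealAct (γ * δ) b = idealAct γ (idealAct δ b) := by
  have h := ideal_fst_pos hΓ hδ hb
  rw [show idealAct δ b = (δ b).1⁻¹ • δ b from rfl, idealAct_smul γ (inv_ne_zero h.ne')]
  rfl

theorem idealAct_inv_cancel (hΓ : IsHyperbolicManifoldGroup Γ) {γ : Mink ≃ₗ[ℝ] Mink} (hγ : γ ∈ Γ)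
    {b : Mink} (hb : b ∈ idealSphere) : idealAct γ⁻¹ (idealAct γ b) = b := by
  rw [← idealAct_mul hΓ _ hγ hb, inv_mul_cancel, idealAct_one hb]

theorem idealAct_cancel_inv (hΓ : IsHyperbolicManifoldGroup Γ) {γ : Mink ≃ₗ[ℝ] Mink} (hγ : γ ∈ Γ)
    {b : Mink} (hb : b ∈ idealSphere) : idealAct γ (idealAct γ⁻¹ b) = b := by
  rw [← idealAct_mul hΓ _ (Γ.inv_mem hγ) hb, mul_inv_cancel, idealAct_one hb]

theorem contDiffAt_idealAct (γ : Mink ≃ₗ[ℝ] Mink) {b : Mink} (h : (γ b).1 ≠ 0)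
    {n : WithTop ℕ∞} : ContDiffAt ℝ n (idealAct γ) b := by
  have hγ : ContDiff ℝ n γ := γ.toLinearMap.toContinuousLinearMap.contDiff
  unfold idealAct
  exact ((contDiff_fst.comp hγ).contDiffAt.inv h).smul hγ.contDiffAt

theorem continuousAt_idealAct (γ : Mink ≃ₗ[ℝ] Mink) {b : Mink} (h : (γ b).1 ≠ 0) :
    ContinuousAt (idealAct γ) b :=
  (contDiffAt_idealAct γ h (n := 0)).continuousAt

theorem omega_subset : discontinuityDomain Γ ⊆ idealSphere := fun _ h => h.1

theorem exists_open_omega {b : Mink} (hb : b ∈ discontinuityDomain Γ) :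
    ∃ U : Set Mink, IsOpen U ∧ b ∈ U ∧ U ∩ idealSphere ⊆ discontinuityDomain Γ := by
  obtain ⟨hb1, U, hU, hbU, hfin⟩ := hb
  exact ⟨U, hU, hbU, fun c hc => ⟨hc.2, U, hU, hc.1, hfin⟩⟩

theorem omega_mem_nhdsWithin {b : Mink} (hb : b ∈ discontinuityDomain Γ) :
    discontinuityDomain Γ ∈ 𝓝[idealSphere] b := by
  obtain ⟨U, hU, hbU, hs⟩ := exists_open_omega hb
  rw [inter_comm] at hs
  exact mem_of_superset (inter_mem_nhdsWithin _ (hU.mem_nhds hbU)) hs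

theorem idealAct_omega (hΓ : IsHyperbolicManifoldGroup Γ) {γ : Mink ≃ₗ[ℝ] Mink} (hγ : γ ∈ Γ)
    {b : Mink} (hb : b ∈ discontinuityDomain Γ) : idealAct γ b ∈ discontinuityDomain Γ := by
  obtain ⟨hb1, U, hU, hbU, hfin⟩ := hb
  have hγi := Γ.inv_mem hγ
  have h2 := idealAct_mem hΓ hγ hb1
  have hc : ContinuousAt (idealAct γ⁻¹) (idealAct γ b) :=
    continuousAt_idealAct _ (ideal_fst_pos hΓ hγi h2).ne'
  have hn : (idealAct γ⁻¹) ⁻¹' U ∈ 𝓝 (idealAct γ b) := by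
    apply hc.preimage_mem_nhds
    rw [idealAct_inv_cancel hΓ hγ hb1]; exact hU.mem_nhds hbU
  obtain ⟨V, hV, hVo, hbV⟩ := mem_nhds_iff.1 hn
  refine ⟨h2, V, hVo, hbV, ?_⟩
  -- The elements that bring points of V back to V are conjugates by γ of those that bring points of
  -- U back to U.
  refine (hfin.image fun δ => γ * δ * γ⁻¹).subset ?_
  rintro δ ⟨hδ, c, ⟨hcV, hc1⟩, hδc⟩
  refine ⟨γ⁻¹ * δ * γ, ⟨Γ.mul_mem (Γ.mul_mem hγi hδ) hγ, idealAct γ⁻¹ c,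
    ⟨hV hcV, idealAct_mem hΓ hγi hc1⟩, ?_⟩, by group⟩
  rw [idealAct_mul hΓ _ hγ (idealAct_mem hΓ hγi hc1), idealAct_cancel_inv hΓ hγ hc1,
    idealAct_mul hΓ _ hδ hc1]
  exact hV hδc

/-- The group acts freely on the domain of discontinuity. -/
def FreeAtInfinity (Γ : Subgroup (Mink ≃ₗ[ℝ] Mink)) : Prop :=
  ∀ γ ∈ Γ, ∀ b ∈ discontinuityDomain Γ, idealAct γ b = b → γ = 1

/-- If γ fixes b and δ brings b into B, then so does δγ, and uniqueness gives γ = 1. -/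
theorem freeAtInfinity_of_fundDomain (hΓ : IsHyperbolicManifoldGroup Γ) {B : Set Mink}
    (hB : IsFundDomain Γ idealAct (discontinuityDomain Γ) B) : FreeAtInfinity Γ := by
  intro γ hγ b hb h
  obtain ⟨δ, ⟨hδ, hδb⟩, hu⟩ := hB.existsUnique b hb
  have h1 := hu (δ * γ) ⟨Γ.mul_mem hδ hγ, by rwa [idealAct_mul hΓ _ hγ hb.1, h]⟩
  simpa using h1

/-- Each point of the domain of discontinuity has a neighborhood disjoint from its translates. -/
theorem exists_nhds_injective (hΓ : IsHyperbolicManifoldGroup Γ) (hfree : FreeAtInfinity Γ)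
    {b : Mink} (hb : b ∈ discontinuityDomain Γ) :
    ∃ W ∈ 𝓝 b, ∀ γ ∈ Γ, ∀ c ∈ W ∩ idealSphere, idealAct γ c ∈ W → γ = 1 := by
  obtain ⟨hb1, U, hU, hbU, hfin⟩ := id hb
  set S := {γ : Mink ≃ₗ[ℝ] Mink | γ ∈ Γ ∧ ∃ c ∈ U ∩ idealSphere, idealAct γ c ∈ U}
  -- Only finitely many elements return to U. Each nontrivial one moves b, and is excluded by
  -- separating b from its image.
  have key : ∀ γ ∈ S, ∃ W ∈ 𝓝 b, γ ≠ 1 → ∀ c ∈ W ∩ idealSphere, idealAct γ c ∉ W := by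
    intro γ hγ
    by_cases h1 : γ = 1
    · exact ⟨univ, univ_mem, fun h => absurd h1 h⟩
    have hne : idealAct γ b ≠ b := fun h => h1 (hfree γ hγ.1 b hb h)
    obtain ⟨V1, V2, hV1, hV2, hd⟩ := t2_separation_nhds hne
    have hc : ContinuousAt (idealAct γ) b :=
      continuousAt_idealAct _ (ideal_fst_pos hΓ hγ.1 hb1).ne'
    refine ⟨V2 ∩ idealAct γ ⁻¹' V1, inter_mem hV2 (hc.preimage_mem_nhds hV1), ?_⟩
    intro _ c hc hc'
    exact disjoint_left.1 hd hc.1.2 hc'.1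
  choose! W hW hW' using key
  refine ⟨U ∩ ⋂ γ ∈ S, W γ, inter_mem (hU.mem_nhds hbU) ((biInter_mem hfin).2 hW), ?_⟩
  intro γ hγ c hc hc'
  by_contra h1
  have hS : γ ∈ S := ⟨hγ, c, ⟨hc.1.1, hc.2⟩, hc'.1⟩
  exact hW' γ hS h1 c ⟨mem_iInter₂.1 hc.1.2 γ hS, hc.2⟩ (mem_iInter₂.1 hc'.2 γ hS)

/-! ### Stereographic charts -/

/-- The vector `(1, 0, 0, s)`. -/
def vecM (s : ℝ) : Mink := (1, !₂[0, 0, s])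

/-- The first spatial unit vector. -/
def vecA : Mink := (0, !₂[1, 0, 0])

/-- The second spatial unit vector. -/
def vecB : Mink := (0, !₂[0, 1, 0])

/-- Parametrization of the light cone section `form x (vecM s) = -1`, on which the induced metric
is flat. -/
def nul (s : ℝ) (u : ℝ × ℝ) : Mink :=
  u.1 • vecA + u.2 • vecB + ((u.1 ^ 2 + u.2 ^ 2) / 2) • vecM s + (1 / 2 : ℝ) • vecM (-s)

/-- Stereographic projection from the pole `(1, 0, 0, s)`. -/
def chart (s : ℝ) (u : ℝ × ℝ) : Mink := (2 / (1 + u.1 ^ 2 + u.2 ^ 2)) • nul s u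

/-- The inverse of `chart s`. -/
def chartInv (s : ℝ) (x : Mink) : ℝ × ℝ := (x.2 0 / (1 - s * x.2 2), x.2 1 / (1 - s * x.2 2))

theorem one_add_sq_pos (u : ℝ × ℝ) : 0 < 1 + u.1 ^ 2 + u.2 ^ 2 := by positivity

theorem nul_fst (s : ℝ) (u : ℝ × ℝ) : (nul s u).1 = (1 + u.1 ^ 2 + u.2 ^ 2) / 2 := by
  simp [nul, vecM, vecA, vecB]; ring

theorem nul_0 (s : ℝ) (u : ℝ × ℝ) : (nul s u).2 0 = u.1 := by
  simp [nul, vecM, vecA, vecB]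

theorem nul_1 (s : ℝ) (u : ℝ × ℝ) : (nul s u).2 1 = u.2 := by
  simp [nul, vecM, vecA, vecB]

theorem nul_2 (s : ℝ) (u : ℝ × ℝ) : (nul s u).2 2 = s * (u.1 ^ 2 + u.2 ^ 2 - 1) / 2 := by
  simp [nul, vecM, vecA, vecB]; ring

theorem chart_one : chart 1 = stereo := by
  funext u
  have := one_add_sq_pos u
  refine mink_ext ?_ ?_ ?_ ?_ <;>
    simp only [chart, stereo, Prod.smul_fst, Prod.smul_snd, PiLp.smul_apply, smul_eq_mul,
      nul_fst, nul_0, nul_1, nul_2]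
  · field_simp
  all_goals simp
  all_goals field_simp

theorem form_nul_nul {s : ℝ} (hs : s ^ 2 = 1) (u : ℝ × ℝ) : form (nul s u) (nul s u) = 0 := by
  rw [form_coord, nul_fst, nul_0, nul_1, nul_2]
  linear_combination (u.1 ^ 2 + u.2 ^ 2 - 1) ^ 2 / 4 * hs

theorem chart_mem {s : ℝ} (hs : s ^ 2 = 1) (u : ℝ × ℝ) : chart s u ∈ idealSphere := by
  have := one_add_sq_pos u
  refine ⟨?_, ?_⟩
  · rw [chart, form_smul_left, form_smul_right, form_nul_nul hs]; simp
  · simp only [chart, Prod.smul_fst, nul_fst, smul_eq_mul]; field_simp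

theorem chart_denom {s : ℝ} (hs : s ^ 2 = 1) (u : ℝ × ℝ) :
    1 - s * (chart s u).2 2 = 2 / (1 + u.1 ^ 2 + u.2 ^ 2) := by
  have := one_add_sq_pos u
  simp only [chart, Prod.smul_snd, PiLp.smul_apply, nul_2, smul_eq_mul]
  field_simp
  linear_combination (-(u.1 ^ 2 + u.2 ^ 2 - 1)) * hs

theorem chartInv_chart {s : ℝ} (hs : s ^ 2 = 1) (u : ℝ × ℝ) : chartInv s (chart s u) = u := by
  have := one_add_sq_pos u
  rw [chartInv, chart_denom hs]
  simp only [chart, Prod.smul_snd, PiLp.smul_apply, nul_0, nul_1, smul_eq_mul]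
  ext <;> simp <;> field_simp

theorem chart_chartInv {s : ℝ} (hs : s ^ 2 = 1) {x : Mink} (hx : x ∈ idealSphere)
    (h : s * x.2 2 ≠ 1) : chart s (chartInv s x) = x := by
  have h0 : 1 - s * x.2 2 ≠ 0 := fun h' => h (by linarith)
  have h1 := hx.1
  rw [form_coord, hx.2] at h1
  set d := 1 - s * x.2 2 with hd
  have hc : 1 + (chartInv s x).1 ^ 2 + (chartInv s x).2 ^ 2 = 2 / d := by
    simp only [chartInv]; rw [← hd]; field_simp
    rw [hd]
    linear_combination h1 + (x.2 2) ^ 2 * hs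
  have e : (2 / (2 / d)) = d := by field_simp
  refine mink_ext ?_ ?_ ?_ ?_ <;>
    simp only [chart, Prod.smul_fst, Prod.smul_snd, PiLp.smul_apply, smul_eq_mul,
      nul_fst, nul_0, nul_1, nul_2, hc, e]
  · rw [hx.2]; field_simp
  · simp only [chartInv]; rw [← hd]; field_simp
  · simp only [chartInv]; rw [← hd]; field_simp
  · have : (chartInv s x).1 ^ 2 + (chartInv s x).2 ^ 2 - 1 = 2 / d - 2 := by linarith
    rw [this]; field_simp; rw [hd]; linear_combination (x.2 2) * hs

/-- The two poles give an atlas: a local question at any ideal point, including the pole of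
`stereo`, can be settled in one of the two charts. -/
theorem exists_pole_ne (x : Mink) : ∃ s : ℝ, s ^ 2 = 1 ∧ s * x.2 2 ≠ 1 := by
  by_cases h : x.2 2 = 1
  · exact ⟨-1, by norm_num, by rw [h]; norm_num⟩
  · exact ⟨1, by norm_num, by simpa using h⟩

theorem contDiff_nul (s : ℝ) {n : WithTop ℕ∞} : ContDiff ℝ n (nul s) := by
  unfold nul; fun_prop

theorem contDiff_chart (s : ℝ) {n : WithTop ℕ∞} : ContDiff ℝ n (chart s) := by
  unfold chart
  exact (contDiff_const.div (by fun_prop) fun u => (one_add_sq_pos u).ne').smul (contDiff_nul s)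

theorem contDiffAt_chartInv (s : ℝ) {n : WithTop ℕ∞} {x : Mink} (h : s * x.2 2 ≠ 1) :
    ContDiffAt ℝ n (chartInv s) x := by
  have h0 : 1 - s * x.2 2 ≠ 0 := fun h' => h (by linarith)
  have hc : ∀ i : Fin 3, ContDiff ℝ n fun y : Mink => y.2 i := fun i =>
    (contDiff_euclidean.1 contDiff_snd) i
  unfold chartInv
  have hd : ContDiff ℝ n fun y : Mink => 1 - s * y.2 2 :=
    contDiff_const.sub (contDiff_const.mul (hc 2))
  exact ((hc 0).contDiffAt.div hd.contDiffAt h0).prodMk ((hc 1).contDiffAt.div hd.contDiffAt h0)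

theorem pole_ne_chart {s : ℝ} (hs : s ^ 2 = 1) (u : ℝ × ℝ) : s * (chart s u).2 2 ≠ 1 := by
  intro h
  have h1 := chart_denom hs u
  have h2 := one_add_sq_pos u
  rw [h, sub_self] at h1
  exact (div_pos two_pos h2).ne h1

theorem chart_injective {s : ℝ} (hs : s ^ 2 = 1) : Function.Injective (chart s) :=
  Function.LeftInverse.injective (chartInv_chart hs)

theorem isOpen_chart_preimage {s : ℝ} (hs : s ^ 2 = 1) :
    IsOpen (chart s ⁻¹' discontinuityDomain Γ) := by
  rw [isOpen_iff_mem_nhds]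
  intro u hu
  obtain ⟨U, hU, hbU, hsub⟩ := exists_open_omega hu
  exact mem_of_superset
    ((contDiff_chart s (n := 0)).continuous.continuousAt.preimage_mem_nhds (hU.mem_nhds hbU))
    fun v hv => hsub ⟨hv, chart_mem hs v⟩

theorem isLocalParam_chart {s : ℝ} (hs : s ^ 2 = 1) :
    IsLocalParam Γ (chart s ⁻¹' discontinuityDomain Γ) (chart s) where
  isOpen := isOpen_chart_preimage hs
  smooth := (contDiff_chart s).contDiffOn
  mapsTo := fun _ h => h
  -- The smooth left inverse `chartInv s` forces the derivative of the chart to be injective.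
  immersion := by
    intro u _
    have h1 : HasFDerivAt (chart s) (fderiv ℝ (chart s) u) u :=
      ((contDiff_chart s (n := 1)).differentiable one_ne_zero u).hasFDerivAt
    have h2 := ((contDiffAt_chartInv s (n := 1) (pole_ne_chart hs u)).differentiableAt
      one_ne_zero).hasFDerivAt
    have h3 := h2.comp u h1
    have h4 : chartInv s ∘ chart s = id := funext (chartInv_chart hs)
    rw [h4] at h3
    have h5 := h3.unique (hasFDerivAt_id u)
    intro v w hvw
    have := congrArg (fun L => L (v - w)) h5
    simp only [ContinuousLinearMap.comp_apply, map_sub, hvw, sub_self,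
      ContinuousLinearMap.id_apply] at this
    exact (sub_eq_zero.1 this.symm)

/-! ### Geometry of equidistant foliations -/

/-- Busemann functions are 1-Lipschitz. -/
theorem exp_neg_mul_le {x y b : Mink} (hx : x ∈ H3) (hy : y ∈ H3) (hb : form b b = 0)
    (hb' : 0 < b.1) {t : ℝ} (ht : 0 ≤ t) (h : -form x y ≤ Real.cosh t) :
    Real.exp (-t) * (-form y b) ≤ -form x b := by
  have hA := neg_form_null_pos hx hb hb'
  have hc := neg_form_null_pos hy hb hb'
  set A := -form x b with hAd
  set c := -form y b with hcd
  set C := -form x y with hCd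
  have e1 : form x b = -A := by rw [hAd]; ring
  have e2 : form y b = -c := by rw [hcd]; ring
  have e3 : form x y = -C := by rw [hCd]; ring
  -- Here x - C y is tangent at y with square C² - 1, c⁻¹ b - y is the unit vector at y toward b,
  -- and C - A/c is their product. Removing the projection gives (C - A/c)² ≤ C² - 1.
  have hk : 0 ≤ form ((x - C • y) - (C - A / c) • (c⁻¹ • b - y))
      ((x - C • y) - (C - A / c) • (c⁻¹ • b - y)) := by
    apply form_self_nonneg hy
    simp only [form_sub_right, form_smul_right, hy.1, form_comm y x, e2, e3]
    field_simp; ring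
  simp only [form_sub_right, form_sub_left, form_smul_right, form_smul_left, hy.1, hx.1, hb,
    form_comm y x, form_comm b x, form_comm b y, e1, e2, e3] at hk
  have h2 : A ^ 2 + c ^ 2 ≤ 2 * A * C * c := by
    have e : C ^ 2 - 1 - (C - A / c) ^ 2 = (2 * A * C * c - A ^ 2 - c ^ 2) / c ^ 2 := by
      field_simp; ring
    have h3 : 0 ≤ (2 * A * C * c - A ^ 2 - c ^ 2) / c ^ 2 := by
      rw [← e]; refine hk.trans_eq ?_; field_simp; ring
    have h4 := (div_nonneg_iff.1 h3)
    rcases h4 with h4 | h4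
    · linarith [h4.1]
    · have := pow_pos hc 2; linarith [h4.2]
  have h3 : A ^ 2 + c ^ 2 ≤ A * c * (Real.exp t + Real.exp (-t)) := by
    rw [Real.cosh_eq] at h
    have : A * c * C ≤ A * c * ((Real.exp t + Real.exp (-t)) / 2) :=
      mul_le_mul_of_nonneg_left h (mul_pos hA hc).le
    linarith
  have h4 : Real.exp t * Real.exp (-t) = 1 := by rw [← Real.exp_add]; simp
  have h5 : Real.exp (-t) ≤ Real.exp t := Real.exp_le_exp.2 (by linarith)
  by_contra hlt
  push Not at hlt
  -- The quadratic inequality places A between its roots c e^{-t} and c e^t.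
  have h6 : (A - c * Real.exp t) * (A - c * Real.exp (-t)) ≤ 0 := by
    have : (A - c * Real.exp t) * (A - c * Real.exp (-t)) =
      A ^ 2 - A * c * (Real.exp t + Real.exp (-t)) + c ^ 2 * (Real.exp t * Real.exp (-t)) := by ring
    rw [this, h4]; linarith
  have h7 : c * Real.exp (-t) ≤ c * Real.exp t := mul_le_mul_of_nonneg_left h5 hc.le
  nlinarith

namespace EquidistantFoliation

variable {Γ : Subgroup (Mink ≃ₗ[ℝ] Mink)} (F : EquidistantFoliation Γ)

theorem pt_mem {r : ℝ} (hr : F.r₀ ≤ r) {b : Mink} (hb : b ∈ discontinuityDomain Γ) :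
    F.pt r b ∈ F.body r := ((F.bijOn r hr).mapsTo hb).1

theorem pt_mem_H3 {r : ℝ} (hr : F.r₀ ≤ r) {b : Mink} (hb : b ∈ discontinuityDomain Γ) :
    F.pt r b ∈ H3 := F.subset r hr (F.pt_mem hr hb)

theorem neg_form_pt_pos {r : ℝ} (hr : F.r₀ ≤ r) {b : Mink} (hb : b ∈ discontinuityDomain Γ) :
    0 < -form (F.pt r b) b := neg_form_ideal_pos (F.pt_mem_H3 hr hb) hb.1

/-- The supporting half-space condition, cleared of its denominator. Since -⟨y, pt r b⟩ is at least
1, with equality only at y = pt r b, it makes pt r b the unique minimum of the Busemann function at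
b on the body. -/
theorem mul_le_neg_form {r : ℝ} (hr : F.r₀ ≤ r) {b : Mink} (hb : b ∈ discontinuityDomain Γ)
    {y : Mink} (hy : y ∈ F.body r) :
    -form (F.pt r b) b * (-form y (F.pt r b)) ≤ -form y b := by
  have h := F.normal r hr b hb y hy
  have hp := F.neg_form_pt_pos hr hb
  rw [unitToward, form_sub_right, form_smul_right] at h
  have h2 : (-form (F.pt r b) b) * ((-form (F.pt r b) b)⁻¹ * form y b - form y (F.pt r b)) ≤ 0 :=
    mul_nonpos_of_nonneg_of_nonpos hp.le h
  rw [mul_sub, mul_inv_cancel_left₀ hp.ne'] at h2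
  linarith

/-- The point `pt r b` minimizes the Busemann function at `b` on `body r`. -/
theorem pt_min {r : ℝ} (hr : F.r₀ ≤ r) {b : Mink} (hb : b ∈ discontinuityDomain Γ)
    {y : Mink} (hy : y ∈ F.body r) : -form (F.pt r b) b ≤ -form y b := by
  have h := F.mul_le_neg_form hr hb hy
  have h1 := one_le_neg_form (F.subset r hr hy) (F.pt_mem_H3 hr hb)
  have hp := F.neg_form_pt_pos hr hb
  nlinarith

theorem eq_pt_of_le {r : ℝ} (hr : F.r₀ ≤ r) {b : Mink} (hb : b ∈ discontinuityDomain Γ)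
    {y : Mink} (hy : y ∈ F.body r) (h : -form y b ≤ -form (F.pt r b) b) : y = F.pt r b := by
  have h' := F.mul_le_neg_form hr hb hy
  have hp := F.neg_form_pt_pos hr hb
  refine eq_of_neg_form_le_one (F.subset r hr hy) (F.pt_mem_H3 hr hb) ?_
  by_contra hlt
  push Not at hlt
  nlinarith

theorem mem_body_iff {s r : ℝ} (hs : F.r₀ ≤ s) (hsr : s ≤ r) {x : Mink} (hx : x ∈ H3) :
    x ∈ F.body r ↔ ∃ y ∈ F.body s, -form x y ≤ Real.cosh (r - s) := by
  rw [F.equidistant s r hs hsr]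
  constructor
  · rintro ⟨_, y, hy, h⟩
    exact ⟨y, hy, (hdist_le_iff hx (F.subset s hs hy) (by linarith)).1 h⟩
  · rintro ⟨y, hy, h⟩
    exact ⟨hx, y, hy, (hdist_le_iff hx (F.subset s hs hy) (by linarith)).2 h⟩

theorem body_mono {s r : ℝ} (hs : F.r₀ ≤ s) (hsr : s ≤ r) : F.body s ⊆ F.body r := by
  intro x hx
  have hx' := F.subset s hs hx
  refine (F.mem_body_iff hs hsr hx').2 ⟨x, hx, ?_⟩
  rw [hx'.1, neg_neg]; exact Real.one_le_cosh _

/-- The right-hand side is cosh t · x + sinh t · N, the point at distance t on the normal ray. It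
has e^{-t} times the Busemann value of pt s b, and no point within distance t of `body s` has a
smaller value by `exp_neg_mul_le`; uniqueness of the minimum identifies it. -/
theorem pt_add {s t : ℝ} (hs : F.r₀ ≤ s) (ht : 0 ≤ t) {b : Mink}
    (hb : b ∈ discontinuityDomain Γ) :
    F.pt (s + t) b =
      Real.exp (-t) • F.pt s b + (Real.sinh t / (-form (F.pt s b) b)) • b := by
  have hx := F.pt_mem_H3 hs hb
  have hp := F.neg_form_pt_pos hs hb
  have hb0 : form b b = 0 := hb.1.1
  have hb1 : b.1 = 1 := hb.1.2
  set x := F.pt s b with hxd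
  obtain ⟨β, hβ⟩ : ∃ β, β = -form x b := ⟨_, rfl⟩
  have e1 : form x b = -β := by rw [hβ]; ring
  rw [← hβ] at hp ⊢
  set z := Real.exp (-t) • x + (Real.sinh t / β) • b with hz
  have hexp : Real.exp t * Real.exp (-t) = 1 := by rw [← Real.exp_add]; simp
  have hsinh := Real.sinh_eq t
  have hcosh := Real.cosh_eq t
  have hs0 : 0 ≤ Real.sinh t := Real.sinh_nonneg_iff.2 ht
  have hzH : z ∈ H3 := by
    refine ⟨?_, ?_⟩
    · simp only [hz, form_add_left, form_add_right, form_smul_left, form_smul_right, hx.1, hb0, e1,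
        form_comm b x]
      field_simp
      rw [hsinh]; linear_combination (-β ^ 2) * hexp
    · simp only [hz, Prod.fst_add, Prod.smul_fst, smul_eq_mul, hb1]
      have := mul_pos (Real.exp_pos (-t)) hx.2
      have := div_nonneg hs0 hp.le
      linarith
  have hzx : -form z x = Real.cosh t := by
    simp only [hz, form_add_left, form_smul_left, hx.1, form_comm b x, e1]
    field_simp
    rw [hsinh, hcosh]; ring
  have hzb : -form z b = Real.exp (-t) * β := by
    simp only [hz, form_add_left, form_smul_left, hb0, e1]; ring
  have hr : F.r₀ ≤ s + t := by linarith
  have hmem : z ∈ F.body (s + t) := by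
    refine (F.mem_body_iff hs (by linarith) hzH).2 ⟨x, F.pt_mem hs hb, ?_⟩
    rw [hzx]; simp
  refine (F.eq_pt_of_le hr hb hmem ?_).symm
  rw [hzb]
  have hw := F.pt_mem_H3 hr hb
  obtain ⟨y, hy, hyd⟩ := (F.mem_body_iff hs (by linarith) hw).1 (F.pt_mem hr hb)
  have h1 := exp_neg_mul_le hw (F.subset s hs hy) hb0 (by rw [hb1]; exact one_pos) ht
    (by simpa using hyd)
  refine le_trans ?_ h1
  rw [hβ]
  exact mul_le_mul_of_nonneg_left (F.pt_min hs hb hy) (Real.exp_pos _).le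

/-- The conformal factor at infinity of the foliation. -/
def rad (b : Mink) : ℝ := Real.exp (-F.r₀) / (2 * (-form (F.pt F.r₀ b) b))

/-- The coefficient of `e^{-r}` in `pt r b`. -/
def conj (b : Mink) : Mink :=
  Real.exp F.r₀ • F.pt F.r₀ b - (Real.exp F.r₀ ^ 2 * F.rad b) • b

theorem rad_pos {b : Mink} (hb : b ∈ discontinuityDomain Γ) : 0 < F.rad b :=
  div_pos (Real.exp_pos _) (mul_pos two_pos (F.neg_form_pt_pos le_rfl hb))

theorem pt_eq {r : ℝ} (hr : F.r₀ ≤ r) {b : Mink} (hb : b ∈ discontinuityDomain Γ) :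
    F.pt r b = (Real.exp r * F.rad b) • b + Real.exp (-r) • F.conj b := by
  have h := F.pt_add (s := F.r₀) (t := r - F.r₀) le_rfl (by linarith) hb
  have hp := F.neg_form_pt_pos le_rfl hb
  rw [add_sub_cancel] at h
  rw [h, conj, smul_sub, smul_smul, smul_smul]
  have e1 : Real.exp (-(r - F.r₀)) = Real.exp (-r) * Real.exp F.r₀ := by
    rw [← Real.exp_add]; congr 1; ring
  have e2 : Real.exp (r - F.r₀) = Real.exp r * Real.exp (-F.r₀) := by
    rw [← Real.exp_add]; congr 1
  have e3 : Real.exp F.r₀ * Real.exp (-F.r₀) = 1 := by rw [← Real.exp_add]; simp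
  have e4 : Real.sinh (r - F.r₀) / (-form (F.pt F.r₀ b) b) =
      Real.exp r * F.rad b - Real.exp (-r) * (Real.exp F.r₀ ^ 2 * F.rad b) := by
    rw [Real.sinh_eq, e1, e2, rad]
    generalize -form (F.pt F.r₀ b) b = β at hp
    field_simp
    linear_combination Real.exp (-r) * Real.exp F.r₀ * e3
  rw [e4, e1, sub_smul]; abel

theorem neg_form_pt_eq {r : ℝ} (hr : F.r₀ ≤ r) {b : Mink} (hb : b ∈ discontinuityDomain Γ) :
    -form (F.pt r b) b = Real.exp (-r) / (2 * F.rad b) := by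
  have hp := F.neg_form_pt_pos le_rfl hb
  have hb0 : form b b = 0 := hb.1.1
  have e3 : Real.exp F.r₀ * Real.exp (-F.r₀) = 1 := by rw [← Real.exp_add]; simp
  rw [F.pt_eq hr hb, conj]
  simp only [form_add_left, form_sub_left, form_smul_left, hb0, rad]
  obtain ⟨β, hβ⟩ : ∃ β, β = -form (F.pt F.r₀ b) b := ⟨_, rfl⟩
  rw [show form (F.pt F.r₀ b) b = -β by rw [hβ]; ring] at hp ⊢
  rw [neg_neg] at hp ⊢
  field_simp
  linear_combination (2 * Real.exp (-r) * β ^ 2) * e3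

theorem isOpen_near {x : Mink} {c : ℝ} : IsOpen {z : Mink | -form z x < c} :=
  isOpen_lt (continuous_form.comp (continuous_id.prodMk continuous_const)).neg continuous_const

/-- A point of `body s` has a whole neighborhood of H3 in `body t`, so it cannot be on the boundary
of `body t`. -/
theorem pt_notMem_body {s t : ℝ} (hs : F.r₀ ≤ s) (hst : s < t) {b : Mink}
    (hb : b ∈ discontinuityDomain Γ) : F.pt t b ∉ F.body s := by
  intro h
  have ht : F.r₀ ≤ t := by linarith
  have h2 := ((F.bijOn t ht).mapsTo hb).2
  have hx := F.pt_mem_H3 ht hb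
  have hc : 1 < Real.cosh (t - s) := Real.one_lt_cosh.2 (by linarith)
  obtain ⟨z, hz, hzH, hzb⟩ := mem_closure_iff.1 h2 _ (isOpen_near (x := F.pt t b)
    (c := Real.cosh (t - s))) (by simp only [mem_ofPred_eq]; rw [hx.1]; simpa using hc)
  exact hzb ((F.mem_body_iff hs hst.le hzH).2 ⟨_, h, hz.le⟩)

/-- Every point outside `body s` lies on a leaf. -/
theorem exists_pt_eq {s : ℝ} (hs : F.r₀ ≤ s) {y : Mink} (hy : y ∈ H3) (hys : y ∉ F.body s) :
    ∃ t, s < t ∧ ∃ b ∈ discontinuityDomain Γ, F.pt t b = y := by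
  -- the nearest point of `body s`
  obtain ⟨x₀, hx₀⟩ := F.nonempty s hs
  have hcomp : IsCompact (F.body s ∩ {x : Mink | x ∈ H3 ∧ x.1 ≤ 2 * y.1 * (-form x₀ y)}) :=
    (isCompact_fst_le _).inter_left (F.isClosed s hs)
  have hcont : Continuous fun x : Mink => -form x y :=
    (continuous_form.comp (continuous_id.prodMk continuous_const)).neg
  obtain ⟨x, ⟨hxs, hxH, -⟩, hmin'⟩ := hcomp.exists_isMinOn
    ⟨x₀, hx₀, F.subset s hs hx₀, fst_le_of_neg_form (F.subset s hs hx₀) hy⟩ hcont.continuousOn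
  have hmin0 : -form x y ≤ -form x₀ y :=
    hmin' ⟨hx₀, F.subset s hs hx₀, fst_le_of_neg_form (F.subset s hs hx₀) hy⟩
  have hmin : ∀ w ∈ F.body s, -form x y ≤ -form w y := by
    intro w hw
    by_cases h : -form w y ≤ -form x₀ y
    · refine hmin' ⟨hw, F.subset s hs hw, ?_⟩
      refine (fst_le_of_neg_form (F.subset s hs hw) hy).trans ?_
      exact mul_le_mul_of_nonneg_left h (mul_nonneg zero_le_two hy.2.le)
    · linarith
  set c := -form x y with hc
  have exy : form x y = -c := by rw [hc]; ring
  have hc1 : 1 < c := by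
    by_contra h
    have := eq_of_neg_form_le_one hxH hy (by linarith)
    exact hys (this ▸ hxs)
  set d := Real.arcosh c
  have hd : 0 < d := Real.arcosh_pos hc1
  have hcd : Real.cosh d = c := Real.cosh_arcosh hc1.le
  have hsd : 0 < Real.sinh d := Real.sinh_pos_iff.2 hd
  have hss : Real.sinh d ^ 2 = c ^ 2 - 1 := by rw [← hcd, Real.cosh_sq]; ring
  -- convexity
  have hconv : ∀ w ∈ F.body s, c * (-form w x) ≤ -form w y := by
    intro w hw
    have hwH := F.subset s hs hw
    set C := -form w x with hC
    set D' := -form w y with hD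
    have ewx : form w x = -C := by rw [hC]; ring
    have ewy : form w y = -D' := by rw [hD]; ring
    have hC1 : 1 ≤ C := one_le_neg_form hwH hxH
    have hD1 : 1 ≤ D' := one_le_neg_form hwH hy
    -- The normalization of x + τ w lies on the segment from x to w, hence in the body, and is no
    -- closer to y than x is. As τ → 0 this is the first variation inequality: the angle at x
    -- between w and y is at least π/2, that is, cosh d(w, y) ≥ cosh d(x, y) cosh d(w, x).
    have key : ∀ τ : ℝ, 0 < τ → c ^ 2 * (2 * C + τ) ≤ 2 * c * D' + τ * D' ^ 2 := by
      intro τ hτ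
      have hq : 0 < 1 + 2 * τ * C + τ ^ 2 := by positivity
      set q := √(1 + 2 * τ * C + τ ^ 2) with hqd
      have hqpos : 0 < q := Real.sqrt_pos.2 hq
      have hq2 : q ^ 2 = 1 + 2 * τ * C + τ ^ 2 := Real.sq_sqrt hq.le
      have hmem : q⁻¹ • x + (q⁻¹ * τ) • w ∈ H3 := by
        refine ⟨?_, ?_⟩
        · simp only [form_add_left, form_add_right, form_smul_left, form_smul_right, hxH.1, hwH.1,
            form_comm x w, ewx]
          field_simp
          rw [hq2]; ring
        · have h1 := hxH.2
          have h2 := hwH.2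
          simp only [Prod.fst_add, Prod.smul_fst, smul_eq_mul]
          positivity
      have h1 := hmin _ (F.convex s hs x hxs w hw q⁻¹ (q⁻¹ * τ) (by positivity) (by positivity) hmem)
      simp only [form_add_left, form_smul_left, exy, ewy] at h1
      have h2 : c * q ≤ c + τ * D' := by
        have h3 := mul_le_mul_of_nonneg_right h1 hqpos.le
        refine h3.trans_eq ?_
        field_simp; ring
      have h3 : (c * q) ^ 2 ≤ (c + τ * D') ^ 2 := pow_le_pow_left₀ (by positivity) h2 2
      rw [mul_pow, hq2] at h3
      have h4 : τ * (c ^ 2 * (2 * C + τ)) ≤ τ * (2 * c * D' + τ * D' ^ 2) := by nlinarith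
      exact le_of_mul_le_mul_left h4 hτ
    have hlim : c ^ 2 * (2 * C + 0) ≤ 2 * c * D' + 0 * D' ^ 2 := by
      have t1 : Tendsto (fun τ : ℝ => c ^ 2 * (2 * C + τ)) (𝓝[>] 0) (𝓝 (c ^ 2 * (2 * C + 0))) :=
        (Continuous.tendsto (by fun_prop) 0).mono_left nhdsWithin_le_nhds
      have t2 : Tendsto (fun τ : ℝ => 2 * c * D' + τ * D' ^ 2) (𝓝[>] 0)
          (𝓝 (2 * c * D' + 0 * D' ^ 2)) :=
        (Continuous.tendsto (by fun_prop) 0).mono_left nhdsWithin_le_nhds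
      exact le_of_tendsto_of_tendsto t1 t2 (eventually_mem_nhdsWithin.mono fun τ hτ => key τ hτ)
    have hc0 : 0 < c := by linarith
    have : c * (c * C) ≤ c * D' := by nlinarith
    exact le_of_mul_le_mul_left this hc0
  have hr : F.r₀ ≤ s + d := by linarith
  have hyb : y ∈ F.body (s + d) :=
    (F.mem_body_iff hs (by linarith) hy).2 ⟨x, hxs, by rw [form_comm, add_sub_cancel_left, hcd]⟩
  -- The point z ε lies at distance ε beyond y on the geodesic from x through y. By the obtuse angle
  -- at x it is at distance at least d + ε from `body s`, hence outside `body (s + d)`. Thus y is on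
  -- the boundary of `body (s + d)`, whose points are all of the form pt (s + d) b.
  have hyc : y ∈ closure (H3 \ F.body (s + d)) := by
    set z : ℝ → Mink := fun ε => Real.cosh ε • y +
      (Real.sinh ε / Real.sinh d) • (c • y - x) with hz
    have hz0 : Tendsto z (𝓝[>] 0) (𝓝 y) := by
      have : Continuous z := by rw [hz]; fun_prop
      have h := this.tendsto 0
      simp only [hz, Real.cosh_zero, Real.sinh_zero, zero_div, zero_smul, one_smul, add_zero] at h
      exact h.mono_left nhdsWithin_le_nhds
    refine mem_closure_of_tendsto hz0 (eventually_mem_nhdsWithin.mono fun ε (hε : 0 < ε) => ?_)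
    have hse : 0 < Real.sinh ε := Real.sinh_pos_iff.2 hε
    have hce := Real.cosh_sq ε
    have hzform : ∀ w ∈ F.body s, Real.cosh (d + ε) ≤ -form (z ε) w := by
      intro w hw
      have h1 := hconv w hw
      have h2 := one_le_neg_form (F.subset s hs hw) hxH
      have e : -form (z ε) w = Real.cosh ε * (-form w y) +
          (Real.sinh ε / Real.sinh d) * (c * (-form w y) - (-form w x)) := by
        simp only [hz, form_add_left, form_smul_left, form_sub_left, form_comm w]; ring
      have e2 : Real.cosh (d + ε) = Real.cosh ε * c +
          (Real.sinh ε / Real.sinh d) * (c * c - 1) := by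
        rw [Real.cosh_add, hcd]
        have : c * c - 1 = Real.sinh d * Real.sinh d := by rw [← sq, ← sq, hss]
        rw [this]; field_simp
      rw [e, e2]
      have hc0 : 0 < c := by linarith
      have h3 : c ≤ -form w y := by nlinarith
      have h4 : c * c - 1 ≤ c * (-form w y) - (-form w x) := by nlinarith
      have := Real.cosh_pos ε
      have : 0 < Real.sinh ε / Real.sinh d := div_pos hse hsd
      gcongr
    have hzz : form (z ε) (z ε) = -1 := by
      simp only [hz, form_add_left, form_add_right, form_smul_left, form_smul_right,
        form_sub_left, form_sub_right, hy.1, hxH.1, form_comm y x, exy]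
      clear_value c d
      field_simp
      linear_combination (-(Real.sinh d) ^ 2) * hce - (Real.sinh ε) ^ 2 * hss
    have hzH : z ε ∈ H3 := by
      refine ⟨hzz, ?_⟩
      · have h1 := hzform x hxs
        by_contra hneg
        push Not at hneg
        have hq : form (-z ε) (-z ε) = -1 := by
          rw [form_neg_left, form_neg_right, neg_neg, hzz]
        have hz1 : (z ε).1 ≠ 0 := by
          intro h0
          rw [form_neg_left, form_neg_right, neg_neg, form_self, h0] at hq
          nlinarith [sq_nonneg ‖(z ε).2‖]
        have : -z ε ∈ H3 := ⟨hq, by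
          have := lt_of_le_of_ne hneg hz1
          simpa using this⟩
        have h5 := one_le_neg_form this hxH
        rw [form_neg_left] at h5
        have := Real.cosh_pos (d + ε)
        linarith
    refine ⟨hzH, fun hmem => ?_⟩
    obtain ⟨w, hw, hwd⟩ := (F.mem_body_iff hs (by linarith) hzH).1 hmem
    rw [add_sub_cancel_left] at hwd
    have h1 := (hzform w hw).trans hwd
    have h2 : Real.cosh d < Real.cosh (d + ε) := by
      rw [Real.cosh_lt_cosh, abs_of_pos hd, abs_of_pos (by linarith)]; linarith
    linarith
  obtain ⟨b, hb, hbe⟩ := (F.bijOn (s + d) hr).surjOn ⟨hyb, hyc⟩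
  exact ⟨s + d, by linarith, b, hb, hbe⟩

theorem pt_inj {t t' : ℝ} (ht : F.r₀ ≤ t) (ht' : F.r₀ ≤ t') {b b' : Mink}
    (hb : b ∈ discontinuityDomain Γ) (hb' : b' ∈ discontinuityDomain Γ)
    (h : F.pt t b = F.pt t' b') : t = t' ∧ b = b' := by
  have h1 : t = t' := by
    rcases lt_trichotomy t t' with h1 | h1 | h1
    · exact absurd (h ▸ F.pt_mem ht hb) (F.pt_notMem_body ht h1 hb')
    · exact h1
    · exact absurd (h ▸ F.pt_mem ht' hb') (F.pt_notMem_body ht' h1 hb)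
  subst h1
  exact ⟨rfl, (F.bijOn t ht).injOn hb hb' h⟩

theorem body_diff {s r : ℝ} (hs : F.r₀ ≤ s) (hsr : s ≤ r) :
    F.body r \ F.body s = {y | ∃ t ∈ Ioc s r, ∃ b ∈ discontinuityDomain Γ, F.pt t b = y} := by
  ext y
  constructor
  · rintro ⟨h1, h2⟩
    obtain ⟨t, ht, b, hb, hbe⟩ := F.exists_pt_eq hs (F.subset r (hs.trans hsr) h1) h2
    refine ⟨t, ⟨ht, ?_⟩, b, hb, hbe⟩
    by_contra h
    exact F.pt_notMem_body (hs.trans hsr) (not_le.1 h) hb (hbe ▸ h1)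
  · rintro ⟨t, ht, b, hb, rfl⟩
    exact ⟨F.body_mono (hs.trans ht.1.le) ht.2 (F.pt_mem (hs.trans ht.1.le) hb),
      F.pt_notMem_body hs ht.1 hb⟩

/-- The point γ (pt r b) lies in the invariant body, and since γ only rescales Busemann functions it
minimizes the one at γ b; the minimum is unique. -/
theorem pt_equivariant (hΓ : IsHyperbolicManifoldGroup Γ) {γ : Mink ≃ₗ[ℝ] Mink} (hγ : γ ∈ Γ)
    {r : ℝ} (hr : F.r₀ ≤ r) {b : Mink} (hb : b ∈ discontinuityDomain Γ) :
    F.pt r (idealAct γ b) = γ (F.pt r b) := by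
  have hb' := idealAct_omega hΓ hγ hb
  have hpos := ideal_fst_pos hΓ hγ hb.1
  symm
  refine F.eq_pt_of_le hr hb' (F.invariant r hr γ hγ _ (F.pt_mem hr hb)) ?_
  have h1 := F.pt_min hr hb (F.invariant r hr γ⁻¹ (Γ.inv_mem hγ) _ (F.pt_mem hr hb'))
  have h2 := hΓ.form_eq γ hγ (γ⁻¹ (F.pt r (idealAct γ b))) b
  rw [show γ (γ⁻¹ (F.pt r (idealAct γ b))) = F.pt r (idealAct γ b) from
    γ.apply_symm_apply _] at h2
  rw [← h2] at h1
  generalize F.pt r (idealAct γ b) = w at h1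
  rw [idealAct, form_smul_right, form_smul_right, hΓ.form_eq γ hγ]
  have : 0 < (γ b).1⁻¹ := inv_pos.2 hpos
  nlinarith

end EquidistantFoliation

/-! ### Partial derivatives -/

section partials
variable {V : Type*} [NormedAddCommGroup V] [NormedSpace ℝ V] {W : Set (ℝ × ℝ)}

theorem contDiffOn_fderiv_apply {f : ℝ × ℝ → V} (hW : IsOpen W) (hf : ContDiffOn ℝ ∞ f W)
    (v : ℝ × ℝ) : ContDiffOn ℝ ∞ (fun u => fderiv ℝ f u v) W :=
  (hf.fderiv_of_isOpen hW (by simp)).clm_apply contDiffOn_const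

theorem contDiffOn_d1 {f : ℝ × ℝ → V} (hW : IsOpen W) (hf : ContDiffOn ℝ ∞ f W) :
    ContDiffOn ℝ ∞ (d1 f) W := contDiffOn_fderiv_apply hW hf _

theorem contDiffOn_d2 {f : ℝ × ℝ → V} (hW : IsOpen W) (hf : ContDiffOn ℝ ∞ f W) :
    ContDiffOn ℝ ∞ (d2 f) W := contDiffOn_fderiv_apply hW hf _

theorem differentiableAt_of_smooth {f : ℝ × ℝ → V} (hW : IsOpen W) (hf : ContDiffOn ℝ ∞ f W)
    {u : ℝ × ℝ} (hu : u ∈ W) : DifferentiableAt ℝ f u :=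
  (hf.contDiffAt (hW.mem_nhds hu)).differentiableAt (by simp)

theorem fderiv_eq_d (f : ℝ × ℝ → V) (u v : ℝ × ℝ) :
    fderiv ℝ f u v = v.1 • d1 f u + v.2 • d2 f u := by
  have : v = v.1 • ((1, 0) : ℝ × ℝ) + v.2 • ((0, 1) : ℝ × ℝ) := by ext <;> simp
  conv_lhs => rw [this, map_add, map_smul, map_smul]
  rfl

theorem fderiv_fderiv_comm {f : ℝ × ℝ → V} (hW : IsOpen W) (hf : ContDiffOn ℝ ∞ f W)
    {u : ℝ × ℝ} (hu : u ∈ W) (v w : ℝ × ℝ) :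
    fderiv ℝ (fun z => fderiv ℝ f z v) u w = fderiv ℝ (fun z => fderiv ℝ f z w) u v := by
  have h1 : ContDiffAt ℝ ∞ f u := hf.contDiffAt (hW.mem_nhds hu)
  have h2 : IsSymmSndFDerivAt ℝ f u := h1.isSymmSndFDerivAt (by
    simp only [minSmoothness_of_isRCLikeNormedField]; norm_cast)
  have h3 : DifferentiableAt ℝ (fderiv ℝ f) u :=
    (h1.fderiv_right (m := 1) (by norm_cast)).differentiableAt one_ne_zero
  rw [fderiv_clm_apply h3 (differentiableAt_const _), fderiv_clm_apply h3 (differentiableAt_const _)]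
  simpa using h2 w v

theorem d1_d2_comm {f : ℝ × ℝ → V} (hW : IsOpen W) (hf : ContDiffOn ℝ ∞ f W)
    {u : ℝ × ℝ} (hu : u ∈ W) : d1 (d2 f) u = d2 (d1 f) u :=
  fderiv_fderiv_comm hW hf hu _ _

theorem fderiv_congr_on {f g : ℝ × ℝ → V} (hW : IsOpen W) (h : EqOn f g W) {u : ℝ × ℝ}
    (hu : u ∈ W) : fderiv ℝ f u = fderiv ℝ g u :=
  (h.eventuallyEq_of_mem (hW.mem_nhds hu)).fderiv_eq

end partials

/-! ### The null frame -/

/-- The first partial derivative of `nul s`. -/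
def nul1 (s : ℝ) (u : ℝ × ℝ) : Mink := vecA + u.1 • vecM s

/-- The second partial derivative of `nul s`. -/
def nul2 (s : ℝ) (u : ℝ × ℝ) : Mink := vecB + u.2 • vecM s

theorem hasFDerivAt_nul (s : ℝ) (u : ℝ × ℝ) : HasFDerivAt (nul s)
    ((ContinuousLinearMap.fst ℝ ℝ ℝ).smulRight (nul1 s u) +
      (ContinuousLinearMap.snd ℝ ℝ ℝ).smulRight (nul2 s u)) u := by
  have h1 : HasFDerivAt (fun z : ℝ × ℝ => z.1) (ContinuousLinearMap.fst ℝ ℝ ℝ) u := hasFDerivAt_fst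
  have h2 : HasFDerivAt (fun z : ℝ × ℝ => z.2) (ContinuousLinearMap.snd ℝ ℝ ℝ) u := hasFDerivAt_snd
  have h := (((h1.smul_const vecA).add (h2.smul_const vecB)).add
    (((h1.pow 2).add (h2.pow 2)).mul_const (1 / 2) |>.smul_const (vecM s))).add_const
      ((1 / 2 : ℝ) • vecM (-s))
  have e : nul s = fun z : ℝ × ℝ => z.1 • vecA + z.2 • vecB +
      ((z.1 ^ 2 + z.2 ^ 2) * (1 / 2)) • vecM s + (1 / 2 : ℝ) • vecM (-s) := by
    funext z; simp only [nul]; congr 3; ring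
  rw [e]
  refine h.congr_fderiv ?_
  ext v <;> simp [nul1, nul2]

theorem hasFDerivAt_nul1 (s : ℝ) (u : ℝ × ℝ) : HasFDerivAt (nul1 s)
    ((ContinuousLinearMap.fst ℝ ℝ ℝ).smulRight (vecM s)) u := by
  have h1 : HasFDerivAt (fun z : ℝ × ℝ => z.1) (ContinuousLinearMap.fst ℝ ℝ ℝ) u := hasFDerivAt_fst
  exact (h1.smul_const (vecM s)).const_add vecA

theorem hasFDerivAt_nul2 (s : ℝ) (u : ℝ × ℝ) : HasFDerivAt (nul2 s)
    ((ContinuousLinearMap.snd ℝ ℝ ℝ).smulRight (vecM s)) u := by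
  have h1 : HasFDerivAt (fun z : ℝ × ℝ => z.2) (ContinuousLinearMap.snd ℝ ℝ ℝ) u := hasFDerivAt_snd
  exact (h1.smul_const (vecM s)).const_add vecB

section frame
variable {s : ℝ} (hs : s ^ 2 = 1) (u : ℝ × ℝ)
include hs

theorem frame_form : form (nul s u) (nul1 s u) = 0 ∧ form (nul s u) (nul2 s u) = 0 ∧
    form (nul s u) (vecM s) = -1 ∧ form (nul1 s u) (nul1 s u) = 1 ∧
    form (nul1 s u) (nul2 s u) = 0 ∧ form (nul2 s u) (nul2 s u) = 1 ∧
    form (nul1 s u) (vecM s) = 0 ∧ form (nul2 s u) (vecM s) = 0 ∧ form (vecM s) (vecM s) = 0 := by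
  simp only [form_coord, nul_fst, nul_0, nul_1, nul_2]
  simp [nul1, nul2, vecM, vecA, vecB]
  refine ⟨?_, ?_, ?_, ?_, ?_, ?_, ?_, ?_, ?_⟩
  · linear_combination u.1 * (u.1 ^ 2 + u.2 ^ 2 - 1) / 2 * hs
  · linear_combination u.2 * (u.1 ^ 2 + u.2 ^ 2 - 1) / 2 * hs
  · linear_combination (u.1 ^ 2 + u.2 ^ 2 - 1) / 2 * hs
  · linear_combination u.1 ^ 2 * hs
  · linear_combination u.1 * u.2 * hs
  · linear_combination u.2 ^ 2 * hs
  · linear_combination u.1 * hs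
  · linear_combination u.2 * hs
  · linear_combination hs

/-- The vectors `nul` and `vecM` are null with product -1, and `nul1`, `nul2` are orthonormal and
orthogonal to both. Coefficients are therefore read off by pairing, with the two null vectors
exchanged. -/
theorem frame_expand (v : Mink) : v = (-form v (vecM s)) • nul s u + form v (nul1 s u) • nul1 s u +
    form v (nul2 s u) • nul2 s u + (-form v (nul s u)) • vecM s := by
  refine mink_ext ?_ ?_ ?_ ?_ <;>
  simp only [form_coord, Prod.fst_add, Prod.snd_add, Prod.smul_fst, Prod.smul_snd, PiLp.add_apply,
    PiLp.smul_apply, smul_eq_mul, nul_fst, nul_0, nul_1, nul_2] <;>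
  simp [nul1, nul2, vecM, vecA, vecB]
  · ring
  · ring
  · ring
  · linear_combination (-v.2 2) * hs

theorem form_expand (v w : Mink) : form v w = -form v (vecM s) * form w (nul s u) -
    form w (vecM s) * form v (nul s u) + form v (nul1 s u) * form w (nul1 s u) +
    form v (nul2 s u) * form w (nul2 s u) := by
  conv_lhs => rw [frame_expand hs u v]
  simp only [form_add_left, form_smul_left]
  simp only [form_comm _ w]
  ring

end frame

/-! ### The light cone lift of a conformal metric and its conjugate -/

/-- The conformal factor of `ρ² · (round metric)` in stereographic coordinates. -/
def lam (ρ : Mink → ℝ) (s : ℝ) (u : ℝ × ℝ) : ℝ := ρ (chart s u) * (2 / (1 + u.1 ^ 2 + u.2 ^ 2))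

/-- The null vector conjugate to `l • nul s` with respect to its tangent plane. -/
def conjVec (l : ℝ × ℝ → ℝ) (s : ℝ) (u : ℝ × ℝ) : Mink :=
  ((d1 l u ^ 2 + d2 l u ^ 2) / (4 * l u ^ 3)) • nul s u + (d1 l u / (2 * l u ^ 2)) • nul1 s u +
    (d2 l u / (2 * l u ^ 2)) • nul2 s u + (1 / (2 * l u)) • vecM s

theorem lam_smul_nul (ρ : Mink → ℝ) (s : ℝ) (u : ℝ × ℝ) :
    lam ρ s u • nul s u = ρ (chart s u) • chart s u := by
  rw [lam, chart, smul_smul]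

section conformal
variable {s : ℝ} (hs : s ^ 2 = 1) {W : Set (ℝ × ℝ)} (hW : IsOpen W) {l : ℝ × ℝ → ℝ}
  (hl : ContDiffOn ℝ ∞ l W) (hpos : ∀ u ∈ W, 0 < l u)

theorem fderiv_smul_nul {u : ℝ × ℝ} (hu : DifferentiableAt ℝ l u) (v : ℝ × ℝ) :
    fderiv ℝ (fun z => l z • nul s z) u v =
      fderiv ℝ l u v • nul s u + l u • (v.1 • nul1 s u + v.2 • nul2 s u) := by
  have h := hu.hasFDerivAt.smul (hasFDerivAt_nul s u)
  change fderiv ℝ (l • nul s) u v = _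
  rw [h.fderiv]
  simp [add_comm]

include hs in
theorem form_fderiv_smul_nul {u : ℝ × ℝ} (hu : DifferentiableAt ℝ l u) (v w : ℝ × ℝ) :
    form (fderiv ℝ (fun z => l z • nul s z) u v) (fderiv ℝ (fun z => l z • nul s z) u w) =
      l u ^ 2 * (v.1 * w.1 + v.2 * w.2) := by
  obtain ⟨f1, f2, f3, f4, f5, f6, f7, f8, f9⟩ := frame_form hs u
  rw [fderiv_smul_nul hu, fderiv_smul_nul hu]
  simp only [form_add_left, form_add_right, form_smul_left, form_smul_right, f1, f2, f4, f5,
    f6, form_comm (nul1 s u) (nul s u), form_comm (nul2 s u) (nul s u),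
    form_comm (nul2 s u) (nul1 s u), form_nul_nul hs]
  ring

include hs in
-- For X = l · nul and Q the conjugate, these products amount to ⟨Q, X⟩ = -1/2, ⟨Q, dX⟩ = 0 and ⟨Q,
-- Q⟩ = 0, the conditions that characterize Q.
theorem conjVec_form {u : ℝ × ℝ} (hu : l u ≠ 0) :
    form (conjVec l s u) (nul s u) = -1 / (2 * l u) ∧
    form (conjVec l s u) (nul1 s u) = d1 l u / (2 * l u ^ 2) ∧
    form (conjVec l s u) (nul2 s u) = d2 l u / (2 * l u ^ 2) ∧
    form (conjVec l s u) (vecM s) = -(d1 l u ^ 2 + d2 l u ^ 2) / (4 * l u ^ 3) ∧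
    form (conjVec l s u) (conjVec l s u) = 0 := by
  obtain ⟨f1, f2, f3, f4, f5, f6, f7, f8, f9⟩ := frame_form hs u
  have h1 : form (conjVec l s u) (nul s u) = -1 / (2 * l u) := by
    simp only [conjVec, form_add_left, form_smul_left, form_nul_nul hs,
      form_comm (nul1 s u) (nul s u), form_comm (nul2 s u) (nul s u),
      form_comm (vecM s) (nul s u), f1, f2, f3]
    ring
  have h2 : form (conjVec l s u) (nul1 s u) = d1 l u / (2 * l u ^ 2) := by
    simp only [conjVec, form_add_left, form_smul_left,
      form_comm (nul2 s u) (nul1 s u), form_comm (vecM s) (nul1 s u), f1, f4, f5, f7]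
    ring
  have h3 : form (conjVec l s u) (nul2 s u) = d2 l u / (2 * l u ^ 2) := by
    simp only [conjVec, form_add_left, form_smul_left, form_comm (vecM s) (nul2 s u),
      f2, f5, f6, f8]
    ring
  have h4 : form (conjVec l s u) (vecM s) = -(d1 l u ^ 2 + d2 l u ^ 2) / (4 * l u ^ 3) := by
    simp only [conjVec, form_add_left, form_smul_left, f3, f7, f8, f9]
    ring
  refine ⟨h1, h2, h3, h4, ?_⟩
  rw [form_expand hs u, h1, h2, h3, h4]
  field_simp; ring

/-- A point of `H3` is determined by its height over the light cone lift and by its being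
orthogonal to the tangent plane of the lift. -/
theorem eq_of_orthogonal (hs : s ^ 2 = 1) {u : ℝ × ℝ} (hu : DifferentiableAt ℝ l u)
    (hpos : 0 < l u) {x : Mink} {r : ℝ} (hx : form x x = -1)
    (h0 : form x (l u • nul s u) = -(Real.exp (-r) / 2))
    (h1 : ∀ v, form x (fderiv ℝ (fun z => l z • nul s z) u v) = 0) :
    x = Real.exp r • (l u • nul s u) + Real.exp (-r) • conjVec l s u := by
  have hl0 := hpos.ne'
  have a1 := h1 (1, 0)
  have a2 := h1 (0, 1)
  have he : Real.exp r * Real.exp (-r) = 1 := by rw [← Real.exp_add]; simp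
  rw [fderiv_smul_nul hu] at a1 a2
  simp only [form_add_right, form_smul_right, zero_smul, one_smul, add_zero,
    zero_add] at a1 a2 h0
  change d1 l u * _ + _ = 0 at a1
  change d2 l u * _ + _ = 0 at a2
  have e0 : form x (nul s u) = -Real.exp (-r) / (2 * l u) := by
    field_simp; linarith
  rw [e0] at a1 a2
  have e1 : form x (nul1 s u) = Real.exp (-r) * d1 l u / (2 * l u ^ 2) := by
    field_simp at a1 ⊢; linarith
  have e2 : form x (nul2 s u) = Real.exp (-r) * d2 l u / (2 * l u ^ 2) := by
    field_simp at a2 ⊢; linarith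
  -- This is the only frame coefficient still unknown, and ⟨x, x⟩ = -1 is linear in it.
  have e3 : form x (vecM s) = -Real.exp r * l u -
      Real.exp (-r) * ((d1 l u ^ 2 + d2 l u ^ 2) / (4 * l u ^ 3)) := by
    rw [form_expand hs u x x, e0, e1, e2] at hx
    have hE := (Real.exp_pos (-r)).ne'
    have h5 : form x (vecM s) * Real.exp (-r) = -l u -
      Real.exp (-r) ^ 2 * ((d1 l u ^ 2 + d2 l u ^ 2) / (4 * l u ^ 3)) := by
      field_simp at hx ⊢
      linear_combination hx
    have h6 : form x (vecM s) * Real.exp (-r) * Real.exp r = form x (vecM s) := by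
      rw [mul_assoc, mul_comm (Real.exp (-r)), he, mul_one]
    rw [← h6, h5]
    linear_combination (-(Real.exp (-r) * ((d1 l u ^ 2 + d2 l u ^ 2) / (4 * l u ^ 3)))) * he
  conv_lhs => rw [frame_expand hs u x, e0, e1, e2, e3]
  rw [conjVec]
  module

include hW hl hpos in
theorem contDiffOn_conjVec : ContDiffOn ℝ ∞ (conjVec l s) W := by
  have h1 := contDiffOn_d1 hW hl
  have h2 := contDiffOn_d2 hW hl
  have n0 : ContDiff ℝ ∞ (nul s) := contDiff_nul s
  have n1 : ContDiff ℝ ∞ (nul1 s) := by unfold nul1; fun_prop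
  have n2 : ContDiff ℝ ∞ (nul2 s) := by unfold nul2; fun_prop
  unfold conjVec
  have p1 : ∀ u ∈ W, 4 * l u ^ 3 ≠ 0 := fun u hu => by have := hpos u hu; positivity
  have p2 : ∀ u ∈ W, 2 * l u ^ 2 ≠ 0 := fun u hu => by have := hpos u hu; positivity
  have p3 : ∀ u ∈ W, 2 * l u ≠ 0 := fun u hu => by have := hpos u hu; positivity
  exact ((((((h1.pow 2).add (h2.pow 2)).div (contDiffOn_const.mul (hl.pow 3)) p1).smul
    n0.contDiffOn).add ((h1.div (contDiffOn_const.mul (hl.pow 2)) p2).smul n1.contDiffOn)).add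
    ((h2.div (contDiffOn_const.mul (hl.pow 2)) p2).smul n2.contDiffOn)).add
    ((contDiffOn_const.div (contDiffOn_const.mul hl) p3).smul contDiffOn_const)

end conformal

section conformal
variable {s : ℝ} {W : Set (ℝ × ℝ)} {l : ℝ × ℝ → ℝ}

/-- Matrix entry of the second fundamental form at infinity of the metric `l² |du|²`. -/
def sff11 (l : ℝ × ℝ → ℝ) (u : ℝ × ℝ) : ℝ :=
  d1 (d1 l) u / (2 * l u) - d1 l u ^ 2 / l u ^ 2 + (d1 l u ^ 2 + d2 l u ^ 2) / (4 * l u ^ 2)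

/-- Matrix entry of the second fundamental form at infinity of the metric `l² |du|²`. -/
def sff12 (l : ℝ × ℝ → ℝ) (u : ℝ × ℝ) : ℝ :=
  d1 (d2 l) u / (2 * l u) - d1 l u * d2 l u / l u ^ 2

/-- Matrix entry of the second fundamental form at infinity of the metric `l² |du|²`. -/
def sff22 (l : ℝ × ℝ → ℝ) (u : ℝ × ℝ) : ℝ :=
  d2 (d2 l) u / (2 * l u) - d2 l u ^ 2 / l u ^ 2 + (d1 l u ^ 2 + d2 l u ^ 2) / (4 * l u ^ 2)

theorem contDiffOn_smul_nul (hl : ContDiffOn ℝ ∞ l W) :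
    ContDiffOn ℝ ∞ (fun z => l z • nul s z) W :=
  hl.smul (contDiff_nul s).contDiffOn

/-- The relations between the derivatives of the light cone lift and of its conjugate. -/
theorem conjVec_deriv_form (hs : s ^ 2 = 1) (hW : IsOpen W) (hl : ContDiffOn ℝ ∞ l W)
    (hpos : ∀ u ∈ W, 0 < l u) {u : ℝ × ℝ} (hu : u ∈ W) (v w : ℝ × ℝ) :
    form (fderiv ℝ (conjVec l s) u v) (fderiv ℝ (fun z => l z • nul s z) u w) =
      v.1 * w.1 * sff11 l u + (v.1 * w.2 + v.2 * w.1) * sff12 l u + v.2 * w.2 * sff22 l u ∧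
    form (fderiv ℝ (conjVec l s) u v) (fderiv ℝ (conjVec l s) u w) =
      ((v.1 * sff11 l u + v.2 * sff12 l u) * (w.1 * sff11 l u + w.2 * sff12 l u) +
       (v.1 * sff12 l u + v.2 * sff22 l u) * (w.1 * sff12 l u + w.2 * sff22 l u)) / l u ^ 2 := by
  have hdl : ∀ z ∈ W, DifferentiableAt ℝ l z := fun z hz => differentiableAt_of_smooth hW hl hz
  have hQ := contDiffOn_conjVec (s := s) hW hl hpos
  have hQd := differentiableAt_of_smooth hW hQ hu
  have hlu := (hpos u hu).ne'
  have hn := hasFDerivAt_nul s u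
  have hn1 := hasFDerivAt_nul1 s u
  have hn2 := hasFDerivAt_nul2 s u
  have hd1l := differentiableAt_of_smooth hW (contDiffOn_d1 hW hl) hu
  have hd2l := differentiableAt_of_smooth hW (contDiffOn_d2 hW hl) hu
  obtain ⟨c1, c2, c3, c4, -⟩ := conjVec_form (l := l) hs hlu
  have hsymm := d1_d2_comm hW hl hu
  have hl1 : HasFDerivAt l (fderiv ℝ l u) u := (hdl u hu).hasFDerivAt
  -- `form (dQ v) n = 0`
  have k0 : ∀ v, form (fderiv ℝ (conjVec l s) u v) (nul s u) = 0 := by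
    intro v
    have h1 : HasFDerivAt (fun z => form (conjVec l s z) (l z • nul s z))
        (0 : ℝ × ℝ →L[ℝ] ℝ) u := by
      refine (hasFDerivAt_const (-1 / 2 : ℝ) u).congr_of_eventuallyEq ?_
      filter_upwards [hW.mem_nhds hu] with z hz
      rw [form_smul_right, (conjVec_form (l := l) hs (hpos z hz).ne').1]
      have := hpos z hz
      field_simp
    have hX := ((hdl u hu).smul hn.differentiableAt)
    have h2 := fderiv_form hQd hX v
    change fderiv ℝ (fun z => form (conjVec l s z) (l z • nul s z)) u v = _ at h2
    rw [h1.fderiv] at h2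
    have h3 : fderiv ℝ (l • nul s) u v = _ := fderiv_smul_nul (s := s) (hdl u hu) v
    rw [h3, fderiv_eq_d l] at h2
    simp only [form_add_right, form_smul_right, c1, c2, c3, Pi.smul_apply', smul_eq_mul] at h2
    simp only [zero_apply] at h2
    have h4 : l u * form (fderiv ℝ (conjVec l s) u v) (nul s u) = 0 := by
      rw [h2]; field_simp; ring
    simpa [hlu] using h4
  -- Differentiating ⟨Q, X_u⟩ = 0 gives ⟨dQ, X_u⟩ = -⟨Q, dX_u⟩; the `nul` component of X_u does not
  -- contribute on the left, by `k0`.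
  have k1 : ∀ v, form (fderiv ℝ (conjVec l s) u v) (nul1 s u) =
      (v.1 * sff11 l u + v.2 * sff12 l u) / l u := by
    intro v
    have h1 : HasFDerivAt (fun z => form (conjVec l s z) (d1 l z • nul s z + l z • nul1 s z))
        (0 : ℝ × ℝ →L[ℝ] ℝ) u := by
      refine (hasFDerivAt_const (0 : ℝ) u).congr_of_eventuallyEq ?_
      filter_upwards [hW.mem_nhds hu] with z hz
      obtain ⟨c1, c2, -⟩ := conjVec_form (l := l) hs (hpos z hz).ne'
      rw [form_add_right, form_smul_right, form_smul_right, c1, c2]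
      have := hpos z hz
      field_simp; ring
    have hX := (hd1l.hasFDerivAt.smul hn).add (hl1.smul hn1)
    have h2 := fderiv_form hQd hX.differentiableAt v
    change fderiv ℝ (fun z => form (conjVec l s z) (d1 l z • nul s z + l z • nul1 s z)) u v = _ at h2
    rw [h1.fderiv, hX.fderiv] at h2
    simp only [add_apply, smul_apply,
      ContinuousLinearMap.smulRight_apply, ContinuousLinearMap.coe_fst',
      ContinuousLinearMap.coe_snd', Pi.add_apply, Pi.smul_apply', zero_apply,
      form_add_right, form_smul_right, c1, c2, c3, c4, k0, fderiv_eq_d l, fderiv_eq_d (d1 l),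
      smul_eq_mul, ← hsymm] at h2
    rw [sff11, sff12]
    have h4 : l u * form (fderiv ℝ (conjVec l s) u v) (nul1 s u) =
      v.1 * sff11 l u + v.2 * sff12 l u := by
      rw [sff11, sff12]
      rw [eq_comm, ← sub_eq_zero] at h2
      rw [← sub_eq_zero, ← h2]
      field_simp; ring
    rw [eq_div_iff hlu, mul_comm, h4, sff11, sff12]
  have k2 : ∀ v, form (fderiv ℝ (conjVec l s) u v) (nul2 s u) =
      (v.1 * sff12 l u + v.2 * sff22 l u) / l u := by
    intro v
    have h1 : HasFDerivAt (fun z => form (conjVec l s z) (d2 l z • nul s z + l z • nul2 s z))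
        (0 : ℝ × ℝ →L[ℝ] ℝ) u := by
      refine (hasFDerivAt_const (0 : ℝ) u).congr_of_eventuallyEq ?_
      filter_upwards [hW.mem_nhds hu] with z hz
      obtain ⟨c1, c2, c3, -⟩ := conjVec_form (l := l) hs (hpos z hz).ne'
      rw [form_add_right, form_smul_right, form_smul_right, c1, c3]
      have := hpos z hz
      field_simp; ring
    have hX := (hd2l.hasFDerivAt.smul hn).add (hl1.smul hn2)
    have h2 := fderiv_form hQd hX.differentiableAt v
    change fderiv ℝ (fun z => form (conjVec l s z) (d2 l z • nul s z + l z • nul2 s z)) u v = _ at h2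
    rw [h1.fderiv, hX.fderiv] at h2
    simp only [add_apply, smul_apply,
      ContinuousLinearMap.smulRight_apply, ContinuousLinearMap.coe_fst',
      ContinuousLinearMap.coe_snd', Pi.add_apply, Pi.smul_apply', zero_apply,
      form_add_right, form_smul_right, c1, c2, c3, c4, k0, fderiv_eq_d l, fderiv_eq_d (d2 l),
      smul_eq_mul] at h2
    have h4 : l u * form (fderiv ℝ (conjVec l s) u v) (nul2 s u) =
      v.1 * sff12 l u + v.2 * sff22 l u := by
      rw [sff22, sff12]
      rw [eq_comm, ← sub_eq_zero] at h2
      rw [← sub_eq_zero, ← h2]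
      field_simp; ring
    rw [eq_div_iff hlu, mul_comm, h4]
  constructor
  · rw [fderiv_smul_nul (hdl u hu)]
    simp only [form_add_right, form_smul_right, k0, k1, k2]
    field_simp; ring
  · rw [form_expand hs u, k0, k0, k1, k1, k2, k2]
    field_simp; ring

/-- Liouville's equation for conformal metrics of curvature `-4`. -/
theorem gaussCurvature_conformal (hW : IsOpen W) (hl : ContDiffOn ℝ ∞ l W)
    {u : ℝ × ℝ} (hu : u ∈ W) (hpos : 0 < l u) :
    gaussCurvature (fun z => l z ^ 2) (fun _ => 0) (fun z => l z ^ 2) u =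
      -(l u * (d1 (d1 l) u + d2 (d2 l) u) - (d1 l u ^ 2 + d2 l u ^ 2)) / l u ^ 4 := by
  have hdl : ∀ z ∈ W, DifferentiableAt ℝ l z := fun z hz => differentiableAt_of_smooth hW hl hz
  have hf : ∀ z ∈ W, ∀ v, fderiv ℝ (fun z => l z ^ 2) z v = 2 * l z * fderiv ℝ l z v := by
    intro z hz v
    have := ((hdl z hz).hasFDerivAt.pow 2).fderiv
    rw [this]; simp
  have h1 : ∀ z ∈ W, d1 (fun z => l z ^ 2) z = 2 * l z * d1 l z := fun z hz => hf z hz _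
  have h2 : ∀ z ∈ W, d2 (fun z => l z ^ 2) z = 2 * l z * d2 l z := fun z hz => hf z hz _
  have hd1l := differentiableAt_of_smooth hW (contDiffOn_d1 hW hl) hu
  have hd2l := differentiableAt_of_smooth hW (contDiffOn_d2 hW hl) hu
  have hl1 : HasFDerivAt l (fderiv ℝ l u) u := (hdl u hu).hasFDerivAt
  have h11 : d1 (d1 (fun z => l z ^ 2)) u = 2 * d1 l u ^ 2 + 2 * l u * d1 (d1 l) u := by
    have e := ((hl1.const_mul 2).mul hd1l.hasFDerivAt).fderiv
    change fderiv ℝ (fun z => 2 * l z * d1 l z) u = _ at e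
    have e' := fderiv_congr_on hW (f := d1 fun z => l z ^ 2) h1 hu
    rw [d1, e', e]
    simp [d1]; ring
  have h22 : d2 (d2 (fun z => l z ^ 2)) u = 2 * d2 l u ^ 2 + 2 * l u * d2 (d2 l) u := by
    have e := ((hl1.const_mul 2).mul hd2l.hasFDerivAt).fderiv
    change fderiv ℝ (fun z => 2 * l z * d2 l z) u = _ at e
    have e' := fderiv_congr_on hW (f := d2 fun z => l z ^ 2) h2 hu
    rw [d2, e', e]
    simp [d2]; ring
  have z1 : d1 (fun _ : ℝ × ℝ => (0 : ℝ)) = fun _ => 0 := by funext z; simp [d1]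
  have z2 : d2 (fun _ : ℝ × ℝ => (0 : ℝ)) = fun _ => 0 := by funext z; simp [d2]
  simp only [gaussCurvature, Matrix.det_fin_three, h11, h22, h1 u hu, h2 u hu, z1, z2]
  simp
  field_simp
  ring

end conformal

/-! ### Metrics in local parametrizations and Liouville's equation -/

section param
variable {Γ : Subgroup (Mink ≃ₗ[ℝ] Mink)} {U : Set (ℝ × ℝ)} {p : ℝ × ℝ → Mink}

theorem IsLocalParam.differentiableAt (hp : IsLocalParam Γ U p) {u : ℝ × ℝ} (hu : u ∈ U) :
    DifferentiableAt ℝ p u := differentiableAt_of_smooth hp.isOpen hp.smooth hu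

theorem IsLocalParam.form_self (hp : IsLocalParam Γ U p) {u : ℝ × ℝ} (hu : u ∈ U) :
    form (p u) (p u) = 0 := (hp.mapsTo hu).1.1

theorem IsLocalParam.form_fderiv (hp : IsLocalParam Γ U p) {u : ℝ × ℝ} (hu : u ∈ U)
    (v : ℝ × ℝ) : form (p u) (fderiv ℝ p u v) = 0 := by
  have h := fderiv_form (hp.differentiableAt hu) (hp.differentiableAt hu) v
  have h0 : fderiv ℝ (fun z => form (p z) (p z)) u = fderiv ℝ (fun _ : ℝ × ℝ => (0 : ℝ)) u :=
    fderiv_congr_on hp.isOpen (fun z hz => hp.form_self hz) hu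
  rw [h0, form_comm (fderiv ℝ p u v)] at h
  simp at h; linarith

theorem IsLocalParam.fderiv_fst (hp : IsLocalParam Γ U p) {u : ℝ × ℝ} (hu : u ∈ U)
    (v : ℝ × ℝ) : (fderiv ℝ p u v).1 = 0 := by
  have h1 := (hp.differentiableAt hu).hasFDerivAt
  have h2 := (ContinuousLinearMap.fst ℝ ℝ (EuclideanSpace ℝ (Fin 3))).hasFDerivAt.comp u h1
  have h3 : HasFDerivAt (⇑(ContinuousLinearMap.fst ℝ ℝ (EuclideanSpace ℝ (Fin 3))) ∘ p)
      (0 : ℝ × ℝ →L[ℝ] ℝ) u := by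
    refine (hasFDerivAt_const (1 : ℝ) u).congr_of_eventuallyEq ?_
    filter_upwards [hp.isOpen.mem_nhds hu] with z hz
    exact (hp.mapsTo hz).1.2
  have := congrArg (fun L => L v) (h2.unique h3)
  simpa using this

theorem IsLocalParam.form_fderiv_pos (hp : IsLocalParam Γ U p) {u : ℝ × ℝ} (hu : u ∈ U)
    {v : ℝ × ℝ} (hv : v ≠ 0) : 0 < form (fderiv ℝ p u v) (fderiv ℝ p u v) := by
  rw [RenVol.form_self, hp.fderiv_fst hu]
  have h1 : fderiv ℝ p u v ≠ 0 := fun h => hv (hp.immersion u hu (by rw [h, map_zero]))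
  have h2 : (fderiv ℝ p u v).2 ≠ 0 := fun h => h1 (Prod.ext (hp.fderiv_fst hu v) h)
  have := pow_pos (norm_pos_iff.2 h2) 2
  linarith

/-- Rescaling a parametrization of the sphere at infinity rescales the metric. -/
theorem IsLocalParam.form_fderiv_smul (hp : IsLocalParam Γ U p) {u : ℝ × ℝ} (hu : u ∈ U)
    {a : ℝ × ℝ → ℝ} (ha : DifferentiableAt ℝ a u) (v w : ℝ × ℝ) :
    form (fderiv ℝ (fun z => a z • p z) u v) (fderiv ℝ (fun z => a z • p z) u w) =
      a u ^ 2 * form (fderiv ℝ p u v) (fderiv ℝ p u w) := by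
  have h := (ha.hasFDerivAt.smul (hp.differentiableAt hu).hasFDerivAt).fderiv
  change fderiv ℝ (fun z => a z • p z) u = _ at h
  rw [h]
  simp only [add_apply, smul_apply,
      ContinuousLinearMap.smulRight_apply, form_add_left, form_add_right, form_smul_left,
      form_smul_right, hp.form_self hu, hp.form_fderiv hu, form_comm _ (p u)]
  ring

theorem form_fderiv_chart {s : ℝ} (hs : s ^ 2 = 1) (u v w : ℝ × ℝ) :
    form (fderiv ℝ (chart s) u v) (fderiv ℝ (chart s) u w) =
      (2 / (1 + u.1 ^ 2 + u.2 ^ 2)) ^ 2 * (v.1 * w.1 + v.2 * w.2) := by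
  have hd : DifferentiableAt ℝ (fun z : ℝ × ℝ => 2 / (1 + z.1 ^ 2 + z.2 ^ 2)) u := by
    have : ContDiff ℝ 1 (fun z : ℝ × ℝ => 2 / (1 + z.1 ^ 2 + z.2 ^ 2)) :=
      contDiff_const.div (by fun_prop) fun u => (one_add_sq_pos u).ne'
    exact this.differentiable one_ne_zero u
  exact form_fderiv_smul_nul hs hd v w

variable {ρ : Mink → ℝ}

theorem contDiffOn_lam (hρ : IsConformalMetric Γ ρ) {s : ℝ} (hs : s ^ 2 = 1) :
    ContDiffOn ℝ ∞ (lam ρ s) (chart s ⁻¹' discontinuityDomain Γ) := by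
  have h1 := hρ.smooth _ _ (isLocalParam_chart (Γ := Γ) hs)
  have h2 : ContDiff ℝ ∞ (fun z : ℝ × ℝ => 2 / (1 + z.1 ^ 2 + z.2 ^ 2)) :=
      contDiff_const.div (by fun_prop) fun u => (one_add_sq_pos u).ne'
  exact h1.mul h2.contDiffOn

theorem lam_pos (hρ : IsConformalMetric Γ ρ) {s : ℝ} {u : ℝ × ℝ}
    (hu : u ∈ chart s ⁻¹' discontinuityDomain Γ) : 0 < lam ρ s u :=
  mul_pos (hρ.pos _ hu) (div_pos two_pos (one_add_sq_pos u))

/-- In the chart the metric is l² |du|², so K = -4 reads Δ log l = 4 l²; this is the same equation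
without denominators. -/
theorem liouville (hρ : IsHyperbolicMetric Γ ρ) {s : ℝ} (hs : s ^ 2 = 1) {u : ℝ × ℝ}
    (hu : u ∈ chart s ⁻¹' discontinuityDomain Γ) :
    lam ρ s u * (d1 (d1 (lam ρ s)) u + d2 (d2 (lam ρ s)) u) -
      (d1 (lam ρ s) u ^ 2 + d2 (lam ρ s) u ^ 2) = 4 * lam ρ s u ^ 4 := by
  have h := hρ.curvature _ _ (isLocalParam_chart (Γ := Γ) hs) u hu
  have e1 : (fun z => ρ (chart s z) ^ 2 * form (d1 (chart s) z) (d1 (chart s) z)) =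
      fun z => lam ρ s z ^ 2 := by
    funext z; rw [d1, form_fderiv_chart hs, lam]; simp; ring
  have e2 : (fun z => ρ (chart s z) ^ 2 * form (d1 (chart s) z) (d2 (chart s) z)) =
      fun z => 0 := by
    funext z; rw [d1, d2, form_fderiv_chart hs]; simp
  have e3 : (fun z => ρ (chart s z) ^ 2 * form (d2 (chart s) z) (d2 (chart s) z)) =
      fun z => lam ρ s z ^ 2 := by
    funext z; rw [d2, form_fderiv_chart hs, lam]; simp; ring
  have hl := lam_pos hρ.toIsConformalMetric hu
  rw [e1, e2, e3, gaussCurvature_conformal (isOpen_chart_preimage hs)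
    (contDiffOn_lam hρ.toIsConformalMetric hs) hu hl] at h
  have h4 : 0 < lam ρ s u ^ 4 := by positivity
  rw [div_eq_iff h4.ne'] at h
  linarith

end param

/-- The determinant of the shape operator at infinity of the metric `l² |du|²`. -/
def shapeDet (l : ℝ × ℝ → ℝ) (u : ℝ × ℝ) : ℝ :=
  (sff11 l u * sff22 l u - sff12 l u ^ 2) / l u ^ 4

/-- The left side equals (l Δl - |∇l|²) / (2 l²), so Liouville's equation says that the shape
operator at infinity has trace 2. This constant produces both the term 2rA of the volume and the
limit of ∫ (H - 1). -/
theorem sff_trace {Γ : Subgroup (Mink ≃ₗ[ℝ] Mink)} {ρ : Mink → ℝ} (hρ : IsHyperbolicMetric Γ ρ)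
    {s : ℝ} (hs : s ^ 2 = 1) {u : ℝ × ℝ} (hu : u ∈ chart s ⁻¹' discontinuityDomain Γ) :
    sff11 (lam ρ s) u + sff22 (lam ρ s) u = 2 * lam ρ s u ^ 2 := by
  have h := liouville hρ hs hu
  have hl := lam_pos hρ.toIsConformalMetric hu
  rw [sff11, sff22]
  generalize lam ρ s u = l at *
  field_simp
  linear_combination 4 * h

/-- A symmetric 2 × 2 matrix of trace 2 has determinant at most 1. -/
theorem shapeDet_le_one {Γ : Subgroup (Mink ≃ₗ[ℝ] Mink)} {ρ : Mink → ℝ}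
    (hρ : IsHyperbolicMetric Γ ρ) {s : ℝ} (hs : s ^ 2 = 1) {u : ℝ × ℝ}
    (hu : u ∈ chart s ⁻¹' discontinuityDomain Γ) : shapeDet (lam ρ s) u ≤ 1 := by
  have h := sff_trace hρ hs hu
  have hl := lam_pos hρ.toIsConformalMetric hu
  rw [shapeDet, div_le_one (by positivity)]
  have h2 : lam ρ s u ^ 4 = ((sff11 (lam ρ s) u + sff22 (lam ρ s) u) / 2) ^ 2 := by rw [h]; ring
  rw [h2]
  nlinarith [sq_nonneg (sff11 (lam ρ s) u - sff22 (lam ρ s) u), sq_nonneg (sff12 (lam ρ s) u)]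

/-! ### The leaves in terms of the metric at infinity -/

namespace EquidistantFoliation

variable {Γ : Subgroup (Mink ≃ₗ[ℝ] Mink)} (F : EquidistantFoliation Γ) {ρ : Mink → ℝ}

/-- Since pt r b = e^r (rad b) b + e^{-r} conj b, the rescaled metrics e^{-2r} g_r converge to the
metric of the section (rad b) b of the light cone, which is rad² times the round one. Comparing the
two limits on one nonzero tangent vector gives rad² = ρ², and both factors are positive. -/
theorem rad_eq (hρ : IsConformalMetric Γ ρ) (hF : F.Induces ρ) {b : Mink}
    (hb : b ∈ discontinuityDomain Γ) : F.rad b = ρ b := by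
  obtain ⟨s, hs, hsb⟩ := exists_pole_ne b
  set W := chart s ⁻¹' discontinuityDomain Γ
  have hp : IsLocalParam Γ W (chart s) := isLocalParam_chart hs
  set u := chartInv s b
  have hub : chart s u = b := chart_chartInv hs hb.1 hsb
  have hu : u ∈ W := by
    change chart s u ∈ discontinuityDomain Γ
    rwa [hub]
  have hpt := differentiableAt_of_smooth hp.isOpen (F.smooth F.r₀ le_rfl W _ hp) hu
  have hpd := hp.differentiableAt hu
  have hne : (2 * (-form (F.pt F.r₀ (chart s u)) (chart s u))) ≠ 0 :=
    (mul_pos two_pos (F.neg_form_pt_pos le_rfl hu)).ne'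
  have hrad : DifferentiableAt ℝ (fun z => F.rad (chart s z)) u := by
    unfold rad
    have h := ((hasFDerivAt_form hpt.hasFDerivAt hpd.hasFDerivAt).differentiableAt.neg).const_mul 2
    change DifferentiableAt ℝ (fun z => 2 * (-form (F.pt F.r₀ (chart s z)) (chart s z))) u at h
    have h' := h.inv hne
    exact h'.const_mul (Real.exp (-F.r₀))
  have hA : DifferentiableAt ℝ (fun z => F.rad (chart s z) • chart s z) u := hrad.smul hpd
  have hC : DifferentiableAt ℝ (fun z => F.conj (chart s z)) u := by
    unfold conj
    have h1 : DifferentiableAt ℝ (fun z => Real.exp F.r₀ • F.pt F.r₀ (chart s z)) u :=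
      hpt.const_smul (Real.exp F.r₀)
    exact h1.fun_sub ((hrad.const_mul _).smul hpd)
  set v : ℝ × ℝ := (1, 0)
  set A := fderiv ℝ (fun z => F.rad (chart s z) • chart s z) u v with hAd
  set C := fderiv ℝ (fun z => F.conj (chart s z)) u v with hCd
  have key : ∀ r, F.r₀ ≤ r → fderiv ℝ (F.pt r ∘ chart s) u v =
      Real.exp r • A + Real.exp (-r) • C := by
    intro r hr
    have e : EqOn (F.pt r ∘ chart s) (fun z => Real.exp r • (F.rad (chart s z) • chart s z) +
        Real.exp (-r) • F.conj (chart s z)) W := by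
      intro z hz
      rw [Function.comp_apply, F.pt_eq hr hz, mul_smul]
    have h := (hA.hasFDerivAt.const_smul (Real.exp r)).add
      (hC.hasFDerivAt.const_smul (Real.exp (-r)))
    rw [fderiv_congr_on hp.isOpen e hu]
    exact congrArg (fun L => L v) h.fderiv
  have hlim := hF W _ hp u hu v v
  have hlim2 : Tendsto (fun r : ℝ => Real.exp (-2 * r) *
      form (fderiv ℝ (F.pt r ∘ chart s) u v) (fderiv ℝ (F.pt r ∘ chart s) u v)) atTop
      (𝓝 (form A A)) := by
    have e0 : Tendsto (fun r : ℝ => Real.exp (-r)) atTop (𝓝 0) := Real.tendsto_exp_neg_atTop_nhds_zero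
    have h1 : Tendsto (fun r : ℝ => form A A + 2 * Real.exp (-r) ^ 2 * form A C +
        Real.exp (-r) ^ 4 * form C C) atTop
        (𝓝 (form A A + 2 * 0 ^ 2 * form A C + 0 ^ 4 * form C C)) :=
      (tendsto_const_nhds.add (((e0.pow 2).const_mul 2).mul_const _)).add ((e0.pow 4).mul_const _)
    simp only [ne_eq, OfNat.ofNat_ne_zero, not_false_eq_true, zero_pow, mul_zero, zero_mul,
      add_zero] at h1
    refine h1.congr' ?_
    filter_upwards [eventually_ge_atTop F.r₀] with r hr
    rw [key r hr]
    have e1 : Real.exp r * Real.exp (-r) = 1 := by rw [← Real.exp_add]; simp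
    have e2 : Real.exp (-2 * r) = Real.exp (-r) ^ 2 := by rw [← Real.exp_nat_mul]; congr 1; push_cast; ring
    simp only [form_add_left, form_add_right, form_smul_left, form_smul_right, form_comm C A, e2]
    linear_combination (-(Real.exp r * Real.exp (-r) + 1) * form A A -
      2 * Real.exp (-r) ^ 2 * form A C) * e1
  have h1 := tendsto_nhds_unique hlim hlim2
  rw [hAd, hp.form_fderiv_smul hu hrad] at h1
  have hpos := hp.form_fderiv_pos hu (v := v) (by simp [v])
  rw [hub] at h1
  have h2 := mul_right_cancel₀ hpos.ne' h1
  exact ((pow_left_inj₀ (hρ.pos b hb).le (F.rad_pos hb).le two_ne_zero).1 h2).symm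

/-- Fix x = pt r (chart s u). By `pt_min`, z ↦ -⟨x, X(z)⟩ is bounded below by the value with pt r
(chart s z) in place of x, which is the constant e^{-r}/2, attained at z = u. So its derivative
vanishes there: x is orthogonal to dX, and `eq_of_orthogonal` identifies it. -/
theorem pt_chart (hρ : IsConformalMetric Γ ρ) (hF : F.Induces ρ) {s : ℝ} (hs : s ^ 2 = 1)
    {r : ℝ} (hr : F.r₀ ≤ r) {u : ℝ × ℝ} (hu : u ∈ chart s ⁻¹' discontinuityDomain Γ) :
    F.pt r (chart s u) = Real.exp r • (lam ρ s u • nul s u) +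
      Real.exp (-r) • conjVec (lam ρ s) s u := by
  have hW : IsOpen (chart s ⁻¹' discontinuityDomain Γ) := isOpen_chart_preimage hs
  have hd := differentiableAt_of_smooth hW (contDiffOn_lam hρ hs) hu
  have hx := F.pt_mem_H3 hr hu
  have hval : ∀ z ∈ chart s ⁻¹' discontinuityDomain Γ,
      -form (F.pt r (chart s z)) (lam ρ s z • nul s z) = Real.exp (-r) / 2 := by
    intro z hz
    have h1 := F.neg_form_pt_eq hr hz
    rw [F.rad_eq hρ hF hz] at h1
    have := hρ.pos _ hz
    rw [lam_smul_nul, form_smul_right, ← mul_neg, h1]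
    field_simp
  refine eq_of_orthogonal hs hd (lam_pos hρ hu) hx.1 (by linarith [hval u hu]) fun v => ?_
  have hmin : IsLocalMin (fun z => -form (F.pt r (chart s u)) (lam ρ s z • nul s z)) u := by
    filter_upwards [hW.mem_nhds hu] with z hz
    rw [hval u hu, ← hval z hz, lam_smul_nul, form_smul_right, form_smul_right, ← mul_neg, ← mul_neg]
    exact mul_le_mul_of_nonneg_left (F.pt_min hr hz (F.pt_mem hr hu)) (hρ.pos _ hz).le
  have h0 := hmin.fderiv_eq_zero
  have hX : DifferentiableAt ℝ (fun z => lam ρ s z • nul s z) u :=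
    hd.smul (hasFDerivAt_nul s u).differentiableAt
  have h1 := (hasFDerivAt_form (hasFDerivAt_const (F.pt r (chart s u)) u) hX.hasFDerivAt).neg.fderiv
  change fderiv ℝ (fun z => -form (F.pt r (chart s u)) (lam ρ s z • nul s z)) u = _ at h1
  rw [h0] at h1
  have h2 := congrArg (fun L => L v) h1
  simp at h2
  linarith

theorem unitToward_chart (hρ : IsConformalMetric Γ ρ) (hF : F.Induces ρ) {s : ℝ} (hs : s ^ 2 = 1)
    {r : ℝ} (hr : F.r₀ ≤ r) {u : ℝ × ℝ} (hu : u ∈ chart s ⁻¹' discontinuityDomain Γ) :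
    unitToward (F.pt r (chart s u)) (chart s u) = Real.exp r • (lam ρ s u • nul s u) -
      Real.exp (-r) • conjVec (lam ρ s) s u := by
  have h1 := F.neg_form_pt_eq hr hu
  rw [F.rad_eq hρ hF hu] at h1
  rw [unitToward, h1, F.pt_chart hρ hF hs hr hu]
  have hpos := hρ.pos _ hu
  have e1 : Real.exp r * Real.exp (-r) = 1 := by rw [← Real.exp_add]; simp
  have e2 : (Real.exp (-r) / (2 * ρ (chart s u)))⁻¹ • chart s u =
      (2 * Real.exp r) • (lam ρ s u • nul s u) := by
    rw [lam_smul_nul, smul_smul]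
    congr 1
    have := Real.exp_pos (-r)
    field_simp
    linear_combination -e1
  rw [e2]; module

theorem fderiv_combination (hρ : IsConformalMetric Γ ρ) {s : ℝ} (hs : s ^ 2 = 1) (a c : ℝ)
    {f : ℝ × ℝ → Mink}
    (hf : ∀ u ∈ chart s ⁻¹' discontinuityDomain Γ, f u =
      a • (lam ρ s u • nul s u) + c • conjVec (lam ρ s) s u)
    {u : ℝ × ℝ} (hu : u ∈ chart s ⁻¹' discontinuityDomain Γ) :
    HasFDerivAt f (a • fderiv ℝ (fun z => lam ρ s z • nul s z) u +
      c • fderiv ℝ (conjVec (lam ρ s) s) u) u := by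
  have hW : IsOpen (chart s ⁻¹' discontinuityDomain Γ) := isOpen_chart_preimage hs
  have hl := contDiffOn_lam hρ hs
  have hX := differentiableAt_of_smooth hW (contDiffOn_smul_nul (s := s) hl) hu
  have hQ := differentiableAt_of_smooth hW
    (contDiffOn_conjVec (s := s) hW hl fun z hz => lam_pos hρ hz) hu
  refine ((hX.hasFDerivAt.const_smul a).add (hQ.hasFDerivAt.const_smul c)).congr_of_eventuallyEq ?_
  filter_upwards [hW.mem_nhds hu] with z hz using hf z hz

/-- A, B, C are the entries of the shape operator S at infinity, for which dQ = dX ∘ S; the two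
vectors are the images under dX of (a + cS) v and (a' + c'S) w. -/
theorem form_combination (hρ : IsConformalMetric Γ ρ) {s : ℝ} (hs : s ^ 2 = 1) (a c a' c' : ℝ)
    {u : ℝ × ℝ} (hu : u ∈ chart s ⁻¹' discontinuityDomain Γ) (v w : ℝ × ℝ) {A B C : ℝ}
    (hA : sff11 (lam ρ s) u = lam ρ s u ^ 2 * A) (hB : sff12 (lam ρ s) u = lam ρ s u ^ 2 * B)
    (hC : sff22 (lam ρ s) u = lam ρ s u ^ 2 * C) :
    form ((a • fderiv ℝ (fun z => lam ρ s z • nul s z) u + c • fderiv ℝ (conjVec (lam ρ s) s) u) v)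
      ((a' • fderiv ℝ (fun z => lam ρ s z • nul s z) u + c' • fderiv ℝ (conjVec (lam ρ s) s) u) w) =
    lam ρ s u ^ 2 * ((a * v.1 + c * (A * v.1 + B * v.2)) * (a' * w.1 + c' * (A * w.1 + B * w.2)) +
      (a * v.2 + c * (B * v.1 + C * v.2)) * (a' * w.2 + c' * (B * w.1 + C * w.2))) := by
  have hW : IsOpen (chart s ⁻¹' discontinuityDomain Γ) := isOpen_chart_preimage hs
  have hl := contDiffOn_lam hρ hs
  have hd := differentiableAt_of_smooth hW hl hu
  have hp := lam_pos hρ hu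
  have k := fun v w => conjVec_deriv_form hs hW hl (fun z hz => lam_pos hρ hz) hu v w
  simp only [add_apply, smul_apply, form_add_left, form_add_right, form_smul_left,
    form_smul_right, form_fderiv_smul_nul hs hd, (k _ _).1, (k _ _).2,
    form_comm (fderiv ℝ (fun z => lam ρ s z • nul s z) u v) (fderiv ℝ (conjVec (lam ρ s) s) u w),
    hA, hB, hC]
  generalize lam ρ s u = l at *
  field_simp
  ring

section
variable (hρ : IsHyperbolicMetric Γ ρ) (hF : F.Induces ρ)
include hρ hF

/-- The expression is det(e^r + e^{-r} S). It does not vanish for any parameter from r₀ on, since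
the leaves are immersed, and it tends to infinity, so it is positive by the intermediate value
theorem. Besides fixing the sign of the square root in the area density, this bounds det S from
below. -/
theorem areaFactor_pos {r : ℝ} (hr : F.r₀ ≤ r) {s : ℝ} (hs : s ^ 2 = 1) {u : ℝ × ℝ}
    (hu : u ∈ chart s ⁻¹' discontinuityDomain Γ) :
    0 < Real.exp r ^ 2 + 2 + Real.exp (-r) ^ 2 * shapeDet (lam ρ s) u := by
  have hρ' := hρ.toIsConformalMetric
  have hl := lam_pos hρ' hu
  have htr := sff_trace hρ hs hu
  obtain ⟨A, hA⟩ : ∃ A, sff11 (lam ρ s) u = lam ρ s u ^ 2 * A :=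
    ⟨sff11 (lam ρ s) u / lam ρ s u ^ 2, by field_simp⟩
  obtain ⟨B, hB⟩ : ∃ A, sff12 (lam ρ s) u = lam ρ s u ^ 2 * A :=
    ⟨sff12 (lam ρ s) u / lam ρ s u ^ 2, by field_simp⟩
  obtain ⟨C, hC⟩ : ∃ A, sff22 (lam ρ s) u = lam ρ s u ^ 2 * A :=
    ⟨sff22 (lam ρ s) u / lam ρ s u ^ 2, by field_simp⟩
  have hAC : A + C = 2 := by
    rw [hA, hC] at htr
    have : lam ρ s u ^ 2 * (A + C) = lam ρ s u ^ 2 * 2 := by linarith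
    exact mul_left_cancel₀ (by positivity) this
  have hdet : shapeDet (lam ρ s) u = A * C - B ^ 2 := by
    rw [shapeDet, hA, hB, hC]; field_simp
  have hcont : ∀ r', F.r₀ ≤ r' →
      Real.exp r' ^ 2 + 2 + Real.exp (-r') ^ 2 * shapeDet (lam ρ s) u ≠ 0 := by
    intro r' hr' h0
    have e1 : Real.exp r' * Real.exp (-r') = 1 := by rw [← Real.exp_add]; simp
    set a := Real.exp r'
    set c := Real.exp (-r')
    have hM : (a + c * A) * (a + c * C) - (c * B) ^ 2 = 0 := by
      rw [← h0, hdet]; linear_combination (a * c) * hAC + 2 * e1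
    -- A kernel vector of the singular symmetric matrix e^r + e^{-r} S: orthogonal to the first row,
    -- unless that row is zero.
    obtain ⟨v, hv, hv1, hv2⟩ : ∃ v : ℝ × ℝ, v ≠ 0 ∧ a * v.1 + c * (A * v.1 + B * v.2) = 0 ∧
        a * v.2 + c * (B * v.1 + C * v.2) = 0 := by
      by_cases hq : c * B = 0 ∧ a + c * A = 0
      · refine ⟨(1, 0), by simp, ?_, ?_⟩
        · simp only; linarith [hq.2]
        · simp only; linarith [hq.1]
      · refine ⟨(c * B, -(a + c * A)), ?_, ?_, ?_⟩
        · intro h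
          rw [Prod.mk_eq_zero, neg_eq_zero] at h
          exact hq h
        · simp only; ring
        · simp only; linear_combination -hM
    have hform := form_combination hρ' hs a c a c hu v v hA hB hC
    rw [hv1, hv2] at hform
    have hf := fderiv_combination hρ' hs a c
      (f := F.pt r' ∘ chart s) (fun z hz => F.pt_chart hρ' hF hs hr' hz) hu
    have htan : form (F.pt r' (chart s u)) (fderiv ℝ (F.pt r' ∘ chart s) u v) = 0 := by
      have h1 := fderiv_form hf.differentiableAt hf.differentiableAt v
      have h2 : fderiv ℝ (fun z => form ((F.pt r' ∘ chart s) z) ((F.pt r' ∘ chart s) z)) u =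
          fderiv ℝ (fun _ : ℝ × ℝ => (-1 : ℝ)) u :=
        fderiv_congr_on (isOpen_chart_preimage hs) (fun z hz => (F.pt_mem_H3 hr' hz).1) hu
      rw [h2, form_comm (fderiv ℝ (F.pt r' ∘ chart s) u v)] at h1
      simp only [Function.comp_apply, fderiv_fun_const, Pi.zero_apply, zero_apply] at h1
      linarith
    have hz : fderiv ℝ (F.pt r' ∘ chart s) u v = 0 := by
      refine eq_zero_of_form_self_nonpos (F.pt_mem_H3 hr' hu) htan ?_
      rw [hf.fderiv, hform]; simp
    exact hv (F.immersion r' hr' _ _ (isLocalParam_chart hs) u hu (by rw [hz, map_zero]))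
  by_contra hneg
  push Not at hneg
  set f : ℝ → ℝ := fun r => Real.exp r ^ 2 + 2 + Real.exp (-r) ^ 2 * shapeDet (lam ρ s) u with hf
  have hfc : Continuous f := by rw [hf]; fun_prop
  have hlim : Tendsto f atTop atTop := by
    have h1 : Tendsto (fun r : ℝ => Real.exp r ^ 2 + 2) atTop atTop :=
      tendsto_atTop_add_const_right _ _ ((tendsto_pow_atTop two_ne_zero).comp Real.tendsto_exp_atTop)
    have h2 : Tendsto (fun r : ℝ => Real.exp (-r) ^ 2 * shapeDet (lam ρ s) u) atTop
        (𝓝 (0 ^ 2 * shapeDet (lam ρ s) u)) :=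
      (Real.tendsto_exp_neg_atTop_nhds_zero.pow 2).mul_const _
    exact h1.atTop_add h2
  obtain ⟨R, hR, hRr⟩ := ((hlim.eventually_gt_atTop 0).and (eventually_ge_atTop r)).exists
  obtain ⟨r', hr', h0⟩ := intermediate_value_Icc hRr hfc.continuousOn ⟨hneg, hR.le⟩
  exact hcont r' (hr.trans hr'.1) h0

/-- Area and mean curvature of the leaves. -/
theorem leaf_densities {r : ℝ} (hr : F.r₀ ≤ r) {u : ℝ × ℝ}
    (hu : u ∈ stereo ⁻¹' discontinuityDomain Γ) :
    areaDensity (F.surf r) u = lam ρ 1 u ^ 2 *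
      (Real.exp r ^ 2 + 2 + Real.exp (-r) ^ 2 * shapeDet (lam ρ 1) u) ∧
    meanCurvature (F.surf r) (F.nor r) u * areaDensity (F.surf r) u = lam ρ 1 u ^ 2 *
      (Real.exp r ^ 2 - Real.exp (-r) ^ 2 * shapeDet (lam ρ 1) u) := by
  have hs : (1 : ℝ) ^ 2 = 1 := one_pow 2
  have hu' := hu
  rw [← chart_one] at hu'
  have hρ' := hρ.toIsConformalMetric
  have hl := lam_pos hρ' hu'
  have hpos := F.areaFactor_pos hρ hF hr hs hu'
  have htr := sff_trace hρ hs hu'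
  have hfs := (fderiv_combination hρ' hs (Real.exp r) (Real.exp (-r))
    (f := F.surf r) (fun z hz => by
      rw [surf, ← chart_one]; exact F.pt_chart hρ' hF hs hr hz) hu').fderiv
  have hfn := (fderiv_combination hρ' hs (Real.exp r) (-Real.exp (-r))
    (f := F.nor r) (fun z hz => by
      rw [nor, ← chart_one, F.unitToward_chart hρ' hF hs hr hz]; module) hu').fderiv
  have e1 : Real.exp r * Real.exp (-r) = 1 := by rw [← Real.exp_add]; simp
  obtain ⟨A, hA⟩ : ∃ A, sff11 (lam ρ 1) u = lam ρ 1 u ^ 2 * A :=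
    ⟨sff11 (lam ρ 1) u / lam ρ 1 u ^ 2, by field_simp⟩
  obtain ⟨B, hB⟩ : ∃ A, sff12 (lam ρ 1) u = lam ρ 1 u ^ 2 * A :=
    ⟨sff12 (lam ρ 1) u / lam ρ 1 u ^ 2, by field_simp⟩
  obtain ⟨C, hC⟩ : ∃ A, sff22 (lam ρ 1) u = lam ρ 1 u ^ 2 * A :=
    ⟨sff22 (lam ρ 1) u / lam ρ 1 u ^ 2, by field_simp⟩
  have hAC : A + C = 2 := by
    rw [hA, hC] at htr
    have : lam ρ 1 u ^ 2 * (A + C) = lam ρ 1 u ^ 2 * 2 := by linarith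
    exact mul_left_cancel₀ (by positivity) this
  have hdet : shapeDet (lam ρ 1) u = A * C - B ^ 2 := by
    rw [shapeDet, hA, hB, hC]; field_simp
  have ff := fun a c a' c' v w => form_combination hρ' hs a c a' c' hu' v w hA hB hC
  rw [hdet] at hpos ⊢
  have hgram : form (d1 (F.surf r) u) (d1 (F.surf r) u) * form (d2 (F.surf r) u) (d2 (F.surf r) u) -
      form (d1 (F.surf r) u) (d2 (F.surf r) u) ^ 2 = (lam ρ 1 u ^ 2 *
      (Real.exp r ^ 2 + 2 + Real.exp (-r) ^ 2 * (A * C - B ^ 2))) ^ 2 := by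
    have hM : (Real.exp r + Real.exp (-r) * A) * (Real.exp r + Real.exp (-r) * C) -
        (Real.exp (-r) * B) ^ 2 = Real.exp r ^ 2 + 2 + Real.exp (-r) ^ 2 * (A * C - B ^ 2) := by
      linear_combination (Real.exp r * Real.exp (-r)) * hAC + 2 * e1
    rw [← hM]
    simp only [d1, d2, hfs, ff]
    ring
  have harea : areaDensity (F.surf r) u = lam ρ 1 u ^ 2 *
      (Real.exp r ^ 2 + 2 + Real.exp (-r) ^ 2 * (A * C - B ^ 2)) := by
    rw [areaDensity, hgram, Real.sqrt_sq (by positivity)]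
  refine ⟨harea, ?_⟩
  rw [meanCurvature, harea, hgram]
  set T := Real.exp r ^ 2 + 2 + Real.exp (-r) ^ 2 * (A * C - B ^ 2) with hT
  have hTM : T = (Real.exp r + Real.exp (-r) * A) * (Real.exp r + Real.exp (-r) * C) -
        (Real.exp (-r) * B) ^ 2 := by
      rw [hT]; linear_combination -(Real.exp r * Real.exp (-r)) * hAC - 2 * e1
  have hTne := hpos.ne'
  -- With M = e^r + e^{-r} S and N = e^r - e^{-r} S the shape operator of the leaf is M⁻¹N, and
  -- tr(adj(M) N) = 2 (e^{2r} - e^{-2r} det S).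
  have hnum : form (d1 (F.surf r) u) (d1 (F.nor r) u) * form (d2 (F.surf r) u) (d2 (F.surf r) u) -
      (form (d1 (F.surf r) u) (d2 (F.nor r) u) + form (d2 (F.surf r) u) (d1 (F.nor r) u)) *
        form (d1 (F.surf r) u) (d2 (F.surf r) u) +
      form (d2 (F.surf r) u) (d2 (F.nor r) u) * form (d1 (F.surf r) u) (d1 (F.surf r) u) =
      lam ρ 1 u ^ 4 * (T * (2 * (Real.exp r ^ 2 - Real.exp (-r) ^ 2 * (A * C - B ^ 2)))) := by
    rw [hTM]
    simp only [d1, d2, hfs, hfn, ff]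
    ring
  rw [hnum]
  field_simp

end
end EquidistantFoliation

/-! ### Hyperbolic volume -/

/-- Euclidean 3-space. -/
abbrev E3 : Type := EuclideanSpace ℝ (Fin 3)

/-- The Gram determinant of three vectors. -/
def gram (v : Fin 3 → Mink) : ℝ := Matrix.det (Matrix.of fun i j => form (v i) (v j))

/-- For a vector v tangent at x the time coordinate is determined by x₀ v₀ = x · v, so x₀² times the
Gram matrix is Aᵀ N A, where A has the spatial parts as columns and N = x₀² - x xᵀ has determinant
x₀⁴. This links the coordinate density of `hypVolume` to Riemannian volume. -/
theorem sq_det_eq_gram {x : Mink} (hx : x ∈ H3) (v : Fin 3 → Mink) (hv : ∀ i, form x (v i) = 0) :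
    (Matrix.of fun i j => (v j).2 i).det ^ 2 = x.1 ^ 2 * gram v := by
  set A : Matrix (Fin 3) (Fin 3) ℝ := Matrix.of fun i j => (v j).2 i with hA
  set N : Matrix (Fin 3) (Fin 3) ℝ := Matrix.of fun i j =>
    (if i = j then x.1 ^ 2 else 0) - x.2 i * x.2 j with hN
  have hx2 := H3.fst_sq hx
  rw [normSq_coord] at hx2
  have hG : x.1 ^ 2 • Matrix.of (fun i j => form (v i) (v j)) =
      A.transpose * N * A := by
    ext i j
    have hi := hv i
    have hj := hv j
    rw [form_coord] at hi hj
    simp only [Matrix.smul_apply, Matrix.of_apply, form_coord,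
      Matrix.mul_apply, Matrix.transpose_apply, hA, hN, Fin.sum_univ_three, smul_eq_mul]
    simp
    linear_combination (x.1 * (v j).1) * hi + (x.2 0 * (v i).2 0 + x.2 1 * (v i).2 1 + x.2 2 * (v i).2 2) * hj
  have hdN : N.det = x.1 ^ 4 := by
    rw [Matrix.det_fin_three]
    simp [hN]
    linear_combination (x.1 ^ 4) * hx2
  have h := congrArg Matrix.det hG
  rw [Matrix.det_mul, Matrix.det_mul, Matrix.det_transpose, hdN, Matrix.det_smul,
    Fintype.card_fin] at h
  have hx1 : x.1 ≠ 0 := hx.2.ne'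
  have h4 : x.1 ^ 4 ≠ 0 := pow_ne_zero 4 hx1
  have : x.1 ^ 4 * A.det ^ 2 = x.1 ^ 4 * (x.1 ^ 2 * gram v) := by
    rw [gram]; linear_combination -h
  exact mul_left_cancel₀ h4 this

/-- The vertical lift of `ℝ³` to the hyperboloid. -/
def lift (y : E3) : Mink := (√(1 + ‖y‖ ^ 2), y)

theorem lift_mem (y : E3) : lift y ∈ H3 := by
  have h : 0 < 1 + ‖y‖ ^ 2 := by positivity
  refine ⟨?_, Real.sqrt_pos.2 h⟩
  rw [form_self, lift, Real.sq_sqrt h.le]; ring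

theorem lift_snd {x : Mink} (hx : x ∈ H3) : lift x.2 = x := by
  refine Prod.ext ?_ rfl
  rw [lift, ← H3.fst_sq hx]
  exact Real.sqrt_sq hx.2.le

theorem contDiff_lift : ContDiff ℝ 1 lift := by
  unfold lift
  refine ContDiff.prodMk ?_ contDiff_id
  exact (contDiff_const.add (contDiff_norm_sq ℝ)).sqrt fun y => by positivity

theorem measurableEmbedding_lift : MeasurableEmbedding lift :=
  contDiff_lift.continuous.measurableEmbedding fun _ _ h => congrArg Prod.snd h

theorem hypVolume_apply (A : Set Mink) : hypVolume A =
    ((volume : Measure E3).withDensity (fun y => ENNReal.ofReal (1 / √(1 + ‖y‖ ^ 2))))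
      (lift ⁻¹' A) :=
  measurableEmbedding_lift.map_apply _ _

theorem hypVolume_compl_H3 : hypVolume H3ᶜ = 0 := by
  rw [hypVolume_apply]
  have : lift ⁻¹' H3ᶜ = ∅ := by
    ext y; simp [lift_mem y]
  rw [this, measure_empty]

theorem ae_mem_H3 : ∀ᵐ x ∂hypVolume, x ∈ H3 := hypVolume_compl_H3

/-- The standard basis vectors of Euclidean 3-space. -/
def stdVec (i : Fin 3) : E3 := EuclideanSpace.single i 1

theorem det_eq_matrix (L : E3 →L[ℝ] E3) : L.det = (Matrix.of fun i j => (L (stdVec j)) i).det := by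
  rw [ContinuousLinearMap.det, ← LinearMap.det_toMatrix (EuclideanSpace.basisFun (Fin 3) ℝ).toBasis]
  congr 1

/-- The Jacobian of the vertical projection of f times the density 1/x₀ is the root of the Gram
determinant, by `sq_det_eq_gram`. In this form the volume depends only on `form`. -/
theorem hypVolume_image {f : E3 → Mink} {f' : E3 → E3 →L[ℝ] Mink} {S : Set E3}
    (hS : MeasurableSet S) (hf : ∀ x ∈ S, HasFDerivWithinAt f (f' x) S x) (hinj : InjOn f S)
    (hH : ∀ x ∈ S, f x ∈ H3) (htan : ∀ x ∈ S, ∀ v, form (f x) (f' x v) = 0) :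
    hypVolume (f '' S) = ∫⁻ x in S, ENNReal.ofReal √(gram fun i => f' x (stdVec i)) := by
  set sn := ContinuousLinearMap.snd ℝ ℝ E3
  set g : E3 → E3 := fun x => (f x).2
  set g' : E3 → E3 →L[ℝ] E3 := fun x => sn.comp (f' x)
  have hg : ∀ x ∈ S, HasFDerivWithinAt g (g' x) S x := fun x hx =>
    sn.hasFDerivAt.comp_hasFDerivWithinAt x (hf x hx)
  have hginj : InjOn g S := by
    intro x hx y hy h
    apply hinj hx hy
    rw [← lift_snd (hH x hx), ← lift_snd (hH y hy)]
    exact congrArg lift h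
  have hmeas : MeasurableSet (g '' S) := measurable_image_of_fderivWithin hS hg hginj
  have hpre : lift ⁻¹' (f '' S) = g '' S := by
    ext y
    constructor
    · rintro ⟨x, hx, h⟩
      exact ⟨x, hx, congrArg Prod.snd h⟩
    · rintro ⟨x, hx, rfl⟩
      exact ⟨x, hx, (lift_snd (hH x hx)).symm⟩
  rw [hypVolume_apply, hpre, withDensity_apply _ hmeas,
    lintegral_image_eq_lintegral_abs_det_fderiv_mul volume hS hg hginj]
  refine setLIntegral_congr_fun hS fun x hx => ?_
  have hxH := hH x hx
  have h1 : √(1 + ‖g x‖ ^ 2) = (f x).1 := congrArg Prod.fst (lift_snd hxH)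
  have h2 := sq_det_eq_gram hxH (fun i => f' x (stdVec i)) fun i => htan x hx _
  have h3 : (g' x).det = (Matrix.of fun i j => (f' x (stdVec j)).2 i).det := det_eq_matrix (g' x)
  have hpos := hxH.2
  have h4 : √(gram fun i => f' x (stdVec i)) = |(g' x).det| / (f x).1 := by
    have : gram (fun i => f' x (stdVec i)) = ((g' x).det / (f x).1) ^ 2 := by
      rw [h3, div_pow, h2]; field_simp
    rw [this, Real.sqrt_sq_eq_abs, abs_div, abs_of_pos hpos]
  simp only [h1]
  rw [← ENNReal.ofReal_mul (abs_nonneg _), h4]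
  congr 1; ring

section action
variable {Γ : Subgroup (Mink ≃ₗ[ℝ] Mink)} (hΓ : IsHyperbolicManifoldGroup Γ)

theorem smul_eq_apply (γ : Γ) (x : Mink) : γ • x = (γ : Mink ≃ₗ[ℝ] Mink) x := rfl

theorem measurableConstSMul : MeasurableConstSMul Γ Mink :=
  ⟨fun γ => (continuous_lorentz (γ : Mink ≃ₗ[ℝ] Mink)).measurable⟩

include hΓ

/-- A set and its preimage are parametrized over the same subset of ℝ³, with Gram determinants that
agree because γ preserves `form`. -/
theorem smulInvariant_hypVolume : SMulInvariantMeasure Γ Mink hypVolume := by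
  refine ⟨fun γ A hA => ?_⟩
  set L : Mink →L[ℝ] Mink := (γ : Mink ≃ₗ[ℝ] Mink).toLinearMap.toContinuousLinearMap
  have hL : ∀ x y, form (L x) (L y) = form x y := hΓ.form_eq _ γ.2
  have hLapp : ∀ x, L x = γ • x := fun _ => rfl
  set S : Set E3 := {y | γ • lift y ∈ A}
  have hSm : MeasurableSet S :=
    (((continuous_lorentz (γ : Mink ≃ₗ[ℝ] Mink)).comp contDiff_lift.continuous).measurable) hA
  have hder : ∀ y, HasFDerivAt lift (fderiv ℝ lift y) y := fun y =>
    (contDiff_lift.differentiable one_ne_zero y).hasFDerivAt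
  have htan : ∀ y v, form (lift y) (fderiv ℝ lift y v) = 0 := by
    intro y v
    have h1 := fderiv_form (hder y).differentiableAt (hder y).differentiableAt v
    have h2 : (fun z => form (lift z) (lift z)) = fun _ => (-1 : ℝ) :=
      funext fun z => (lift_mem z).1
    rw [h2, form_comm (fderiv ℝ lift y v)] at h1
    simp at h1; linarith
  have e1 : hypVolume (lift '' S) = hypVolume ((fun x => γ • x) ⁻¹' A) := by
    rw [hypVolume_apply, hypVolume_apply, preimage_image_eq _ measurableEmbedding_lift.injective]
    rfl
  have e2 : hypVolume ((fun y => L (lift y)) '' S) = hypVolume A := by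
    rw [hypVolume_apply, hypVolume_apply]
    congr 1
    ext z
    constructor
    · rintro ⟨y, hy, h⟩
      change lift z ∈ A
      rw [← h]; exact hy
    · intro hz
      have hz' : γ⁻¹ • lift z ∈ H3 := hΓ.mapsTo _ (γ⁻¹).2 _ (lift_mem z)
      refine ⟨(γ⁻¹ • lift z).2, ?_, ?_⟩
      · change γ • lift _ ∈ A
        rw [lift_snd hz', smul_inv_smul]; exact hz
      · change γ • lift _ = lift z
        rw [lift_snd hz', smul_inv_smul]
  rw [← e1, ← e2, hypVolume_image hSm (fun y _ => (hder y).hasFDerivWithinAt)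
    measurableEmbedding_lift.injective.injOn (fun y _ => lift_mem y) fun y _ => htan y]
  rw [hypVolume_image (f := fun y => L (lift y)) (f' := fun y => L.comp (fderiv ℝ lift y)) hSm
    (fun y _ => (L.hasFDerivAt.comp y (hder y)).hasFDerivWithinAt)
    (fun x _ y _ h => measurableEmbedding_lift.injective
      ((γ : Mink ≃ₗ[ℝ] Mink).injective h))
    (fun y _ => hΓ.mapsTo _ γ.2 _ (lift_mem y)) (fun y _ v => (hL _ _).trans (htan y v))]
  refine lintegral_congr fun y => ?_
  congr 2
  simp only [gram, ContinuousLinearMap.comp_apply, hL]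

/-- Each γ is among the finitely many elements that return to a compact ball large enough to contain
the base point and its image; countably many balls suffice. -/
theorem countable_group : Countable Γ := by
  have h : ∀ n : ℕ, {γ : Mink ≃ₗ[ℝ] Mink | γ ∈ Γ ∧ ∃ x ∈ {x : Mink | x ∈ H3 ∧ x.1 ≤ n},
      γ x ∈ {x : Mink | x ∈ H3 ∧ x.1 ≤ n}}.Finite := fun n =>
    hΓ.properly_discontinuous _ (fun x hx => hx.1) (isCompact_fst_le n)
  have hsub : (Γ : Set (Mink ≃ₗ[ℝ] Mink)) ⊆ ⋃ n : ℕ, {γ : Mink ≃ₗ[ℝ] Mink | γ ∈ Γ ∧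
      ∃ x ∈ {x : Mink | x ∈ H3 ∧ x.1 ≤ n}, γ x ∈ {x : Mink | x ∈ H3 ∧ x.1 ≤ n}} := by
    intro γ hγ
    obtain ⟨n, hn⟩ := exists_nat_ge (max 1 (γ (1, 0)).1)
    refine mem_iUnion.2 ⟨n, hγ, (1, 0), ⟨base_mem_H3, (le_max_left _ _).trans hn⟩,
      hΓ.mapsTo γ hγ _ base_mem_H3, (le_max_right _ _).trans hn⟩
  exact ((countable_iUnion fun n => (h n).countable).mono hsub).to_subtype

theorem isFundamentalDomain_hyp {D : Set Mink} (hD : IsFundDomain Γ (fun γ => γ) H3 D) :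
    IsFundamentalDomain Γ D hypVolume where
  nullMeasurableSet := hD.measurable.nullMeasurableSet
  ae_covers := by
    filter_upwards [ae_mem_H3] with x hx
    obtain ⟨γ, ⟨hγ, h⟩, -⟩ := hD.existsUnique x hx
    exact ⟨⟨γ, hγ⟩, h⟩
  aedisjoint := by
    intro γ δ hne
    refine Disjoint.aedisjoint (disjoint_left.2 fun x hx hx' => ?_)
    rw [mem_smul_set_iff_inv_smul_mem] at hx hx'
    have hxH : x ∈ H3 := by
      have := hΓ.mapsTo _ γ.2 _ (hD.subset hx)
      rwa [← smul_eq_apply, smul_inv_smul] at this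
    obtain ⟨α, -, hu⟩ := hD.existsUnique x hxH
    have h1 := hu _ ⟨(γ⁻¹).2, hx⟩
    have h2 := hu _ ⟨(δ⁻¹).2, hx'⟩
    exact hne (inv_injective (Subtype.ext (h1.trans h2.symm)))

end action

theorem hypVolume_lt_top_of_isCompact {K : Set Mink} (hK : IsCompact K) : hypVolume K < ⊤ := by
  rw [hypVolume_apply]
  have hsub : lift ⁻¹' K ⊆ Prod.snd '' K := fun y hy => ⟨_, hy, rfl⟩
  have hc : IsCompact (Prod.snd '' K) := hK.image continuous_snd
  have hle : ((volume : Measure E3).withDensity fun y => ENNReal.ofReal (1 / √(1 + ‖y‖ ^ 2))) ≤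
      volume := by
    rw [← withDensity_one (μ := (volume : Measure E3))]
    conv_lhs => rw [withDensity_one]
    refine withDensity_mono (Eventually.of_forall fun y => ?_)
    rw [Pi.one_apply, ENNReal.ofReal_le_one, div_le_one (Real.sqrt_pos.2 (by positivity))]
    exact Real.one_le_sqrt.2 (by nlinarith [sq_nonneg ‖y‖])
  exact ((hle _).trans (measure_mono hsub)).trans_lt hc.measure_lt_top

/-! ### The volume between two leaves -/

/-- Euclidean 3-space as a product, with the last coordinate first. -/
def coords : E3 ≃ᵐ ℝ × (ℝ × ℝ) :=
  (MeasurableEquiv.toLp 2 (Fin 3 → ℝ)).symm.trans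
    ((MeasurableEquiv.piFinSuccAbove (fun _ : Fin 3 => ℝ) 2).trans
      (MeasurableEquiv.prodCongr (MeasurableEquiv.refl ℝ) MeasurableEquiv.finTwoArrow))

theorem coords_apply (y : E3) : coords y = (y 2, (y 0, y 1)) := rfl

theorem measurePreserving_coords : MeasurePreserving coords :=
  (EuclideanSpace.volume_preserving_symm_measurableEquiv_toLp (Fin 3)).trans
    ((volume_preserving_piFinSuccAbove (fun _ : Fin 3 => ℝ) 2).trans
      ((MeasurePreserving.id volume).prod (volume_preserving_finTwoArrow ℝ)))

/-- Orthogonality relations between the light cone lift, its conjugate and their derivatives. -/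
theorem lift_conj_orthogonal {s : ℝ} (hs : s ^ 2 = 1) {W : Set (ℝ × ℝ)} (hW : IsOpen W)
    {l : ℝ × ℝ → ℝ} (hl : ContDiffOn ℝ ∞ l W) (hpos : ∀ u ∈ W, 0 < l u) {u : ℝ × ℝ} (hu : u ∈ W)
    (v : ℝ × ℝ) :
    form (l u • nul s u) (fderiv ℝ (fun z => l z • nul s z) u v) = 0 ∧
    form (conjVec l s u) (fderiv ℝ (fun z => l z • nul s z) u v) = 0 ∧
    form (l u • nul s u) (fderiv ℝ (conjVec l s) u v) = 0 ∧
    form (conjVec l s u) (fderiv ℝ (conjVec l s) u v) = 0 := by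
  have hX := differentiableAt_of_smooth hW (contDiffOn_smul_nul (s := s) hl) hu
  have hQ := differentiableAt_of_smooth hW (contDiffOn_conjVec (s := s) hW hl hpos) hu
  have hlu := (hpos u hu).ne'
  obtain ⟨f1, f2, -⟩ := frame_form hs u
  obtain ⟨c1, c2, c3, -⟩ := conjVec_form (l := l) hs hlu
  have h2 : form (conjVec l s u) (fderiv ℝ (fun z => l z • nul s z) u v) = 0 := by
    rw [fderiv_smul_nul (differentiableAt_of_smooth hW hl hu), fderiv_eq_d l]
    simp only [form_add_right, form_smul_right, c1, c2, c3, smul_eq_mul]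
    field_simp; ring
  refine ⟨?_, h2, ?_, ?_⟩
  · rw [fderiv_smul_nul (differentiableAt_of_smooth hW hl hu)]
    simp only [form_add_right, form_smul_right, form_smul_left, f1, f2, form_nul_nul hs]
    ring
  · have h3 := fderiv_form hX hQ v
    have e : fderiv ℝ (fun z => form (l z • nul s z) (conjVec l s z)) u =
        fderiv ℝ (fun _ : ℝ × ℝ => (-1 / 2 : ℝ)) u := by
      refine fderiv_congr_on hW (fun z hz => ?_) hu
      have := hpos z hz
      rw [form_comm, form_smul_right, (conjVec_form (l := l) hs this.ne').1]
      field_simp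
    rw [e, form_comm (fderiv ℝ (fun z => l z • nul s z) u v), h2] at h3
    simpa using h3.symm
  · have h3 := fderiv_form hQ hQ v
    have e : fderiv ℝ (fun z => form (conjVec l s z) (conjVec l s z)) u =
        fderiv ℝ (fun _ : ℝ × ℝ => (0 : ℝ)) u :=
      fderiv_congr_on hW (fun z hz => (conjVec_form (l := l) hs (hpos z hz).ne').2.2.2.2) hu
    rw [e, form_comm (fderiv ℝ (conjVec l s) u v)] at h3
    simp at h3; linarith

/-- The points of the leaves over the pole of `stereo`, which the coordinates miss, lie in such a
plane. Its projection to ℝ³ is contained in a proper subspace. -/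
theorem hypVolume_plane (a b : Mink) :
    hypVolume {x | ∃ c d : ℝ, x = c • a + d • b} = 0 := by
  rw [hypVolume_apply]
  refine withDensity_absolutelyContinuous _ _ ?_
  set M : Submodule ℝ E3 := Submodule.span ℝ (range ![a.2, b.2])
  have hM : M ≠ ⊤ := by
    intro h
    have h1 : Module.finrank ℝ M = 3 := by rw [h, finrank_top]; simp
    have h2 : Module.finrank ℝ M ≤ Fintype.card (Fin 2) := finrank_range_le_card ![a.2, b.2]
    rw [Fintype.card_fin] at h2
    omega
  refine measure_mono_null ?_ (Measure.addHaar_submodule volume M hM)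
  rintro y ⟨c, d, h⟩
  have h' : y = c • a.2 + d • b.2 := congrArg Prod.snd h
  rw [h']
  exact M.add_mem (M.smul_mem _ (Submodule.subset_span ⟨0, rfl⟩))
    (M.smul_mem _ (Submodule.subset_span ⟨1, rfl⟩))

namespace EquidistantFoliation

variable {Γ : Subgroup (Mink ≃ₗ[ℝ] Mink)} (F : EquidistantFoliation Γ) {ρ : Mink → ℝ}

/-- The union of the leaves with parameter in `I` over a subset `A` of the sphere at infinity. -/
def leaves (I : Set ℝ) (A : Set Mink) : Set Mink := {y | ∃ t ∈ I, ∃ b ∈ A, F.pt t b = y}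

/-- The foliation in stereographic coordinates. -/
def leafMap (y : E3) : Mink := F.pt (y 2) (stereo (y 0, y 1))

section
variable (hρ : IsConformalMetric Γ ρ) (hF : F.Induces ρ)
include hρ hF

/-- In the coordinates (r, u) the derivative in r of e^r X + e^{-r} Q is the unit normal, orthogonal
to the leaf, so the 3 × 3 Gram determinant reduces to that of the leaf and the volume density is the
area density. -/
theorem leafMap_props {B : Set Mink} (hB : MeasurableSet B) (hBΩ : B ⊆ discontinuityDomain Γ)
    {I : Set ℝ} (hI : MeasurableSet I) (hIr : I ⊆ Ici F.r₀) :
    MeasurableSet (F.leafMap '' (coords ⁻¹' (I ×ˢ (stereo ⁻¹' B)))) ∧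
    hypVolume (F.leafMap '' (coords ⁻¹' (I ×ˢ (stereo ⁻¹' B)))) =
      ∫⁻ z in I ×ˢ (stereo ⁻¹' B), ENNReal.ofReal (areaDensity (F.surf z.1) z.2) := by
  have hs : (1 : ℝ) ^ 2 = 1 := one_pow 2
  rw [← chart_one]
  set W := chart 1 ⁻¹' discontinuityDomain Γ with hWd
  have hW : IsOpen W := isOpen_chart_preimage hs
  have hl := contDiffOn_lam hρ hs
  have hlp : ∀ u ∈ W, 0 < lam ρ 1 u := fun u hu => lam_pos hρ hu
  set X : ℝ × ℝ → Mink := fun z => lam ρ 1 z • nul 1 z with hX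
  set Q : ℝ × ℝ → Mink := conjVec (lam ρ 1) 1 with hQ
  have hchm : Measurable (chart 1) := (contDiff_chart 1 (n := 0)).continuous.measurable
  set S : Set E3 := coords ⁻¹' (I ×ˢ (chart 1 ⁻¹' B)) with hS
  have hSm : MeasurableSet S := coords.measurable (hI.prod (hchm hB))
  have hSI : ∀ y ∈ S, y 2 ∈ I := fun y hy => hy.1
  have hSW : ∀ y ∈ S, (y 0, y 1) ∈ W := fun y hy => hBΩ hy.2
  -- the linear projections
  set π : E3 →L[ℝ] ℝ × ℝ := (EuclideanSpace.proj 0 : E3 →L[ℝ] ℝ).prod (EuclideanSpace.proj 1)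
  set τ : E3 →L[ℝ] ℝ := EuclideanSpace.proj 2
  set f : E3 → Mink := fun y => Real.exp (y 2) • X (y 0, y 1) + Real.exp (-y 2) • Q (y 0, y 1)
    with hf
  set f' : E3 → E3 →L[ℝ] Mink := fun y =>
    (Real.exp (y 2) • (fderiv ℝ X (y 0, y 1)).comp π +
      (Real.exp (y 2) • τ).smulRight (X (y 0, y 1))) +
    (Real.exp (-y 2) • (fderiv ℝ Q (y 0, y 1)).comp π +
      (Real.exp (-y 2) • -τ).smulRight (Q (y 0, y 1))) with hf'
  have hder : ∀ y ∈ S, HasFDerivAt f (f' y) y := by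
    intro y hy
    have hXd := (differentiableAt_of_smooth hW (contDiffOn_smul_nul (s := 1) hl)
      (hSW y hy)).hasFDerivAt
    have hQd := (differentiableAt_of_smooth hW (contDiffOn_conjVec (s := 1) hW hl hlp)
      (hSW y hy)).hasFDerivAt
    have hπ : HasFDerivAt (fun y : E3 => (y 0, y 1)) π y := π.hasFDerivAt
    have hτ : HasFDerivAt (fun y : E3 => y 2) τ y := τ.hasFDerivAt
    have h1 := hXd.comp y hπ
    have h2 := hQd.comp y hπ
    exact (hτ.exp.smul h1).add (hτ.neg.exp.smul h2)
  have hfe : ∀ y ∈ S, f y = F.leafMap y := by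
    intro y hy
    rw [leafMap, ← chart_one, F.pt_chart hρ hF hs (hIr (hSI y hy)) (hSW y hy)]
  have hinj : InjOn f S := by
    intro y hy z hz h
    rw [hfe y hy, hfe z hz, leafMap, leafMap, ← chart_one] at h
    obtain ⟨h1, h2⟩ := F.pt_inj (hIr (hSI y hy)) (hIr (hSI z hz)) (hSW y hy) (hSW z hz) h
    have h3 := chart_injective hs h2
    ext i; fin_cases i
    · exact congrArg Prod.fst h3
    · exact congrArg Prod.snd h3
    · exact h1
  have hH : ∀ y ∈ S, f y ∈ H3 := by
    intro y hy
    rw [hfe y hy, leafMap, ← chart_one]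
    exact F.pt_mem_H3 (hIr (hSI y hy)) (hSW y hy)
  have hXX : ∀ u, form (X u) (X u) = 0 := by
    intro u; simp only [hX, form_smul_left, form_smul_right, form_nul_nul hs]; ring
  have hQQ : ∀ u ∈ W, form (Q u) (Q u) = 0 := fun u hu =>
    (conjVec_form (l := lam ρ 1) hs (hlp u hu).ne').2.2.2.2
  have hXQ : ∀ u ∈ W, form (X u) (Q u) = -1 / 2 := by
    intro u hu
    have := hlp u hu
    rw [form_comm]
    simp only [hX, form_smul_right]
    rw [(conjVec_form (l := lam ρ 1) hs this.ne').1]; field_simp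
  have horth := fun u (hu : u ∈ W) v => lift_conj_orthogonal hs hW hl hlp hu v
  have hf'app : ∀ y v, f' y v = (Real.exp (y 2) • fderiv ℝ X (y 0, y 1) (v 0, v 1) +
      Real.exp (-y 2) • fderiv ℝ Q (y 0, y 1) (v 0, v 1)) +
      (v 2) • (Real.exp (y 2) • X (y 0, y 1) - Real.exp (-y 2) • Q (y 0, y 1)) := by
    intro y v
    simp only [hf', add_apply, smul_apply, ContinuousLinearMap.comp_apply,
      ContinuousLinearMap.smulRight_apply, neg_apply]
    have e1 : π v = (v 0, v 1) := rfl
    have e2 : τ v = v 2 := rfl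
    rw [e1, e2]
    module
  have htan : ∀ y ∈ S, ∀ v, form (f y) (f' y v) = 0 := by
    intro y hy v
    obtain ⟨o1, o2, o3, o4⟩ := horth _ (hSW y hy) (v 0, v 1)
    rw [hf'app]
    simp only [hf, form_add_left, form_add_right, form_sub_right, form_smul_left, form_smul_right,
      hXX, hQQ _ (hSW y hy), hXQ _ (hSW y hy), form_comm (Q _) (X _)]
    rw [show form (X (y 0, y 1)) (fderiv ℝ X (y 0, y 1) (v 0, v 1)) = 0 from o1,
      show form (Q (y 0, y 1)) (fderiv ℝ X (y 0, y 1) (v 0, v 1)) = 0 from o2,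
      show form (X (y 0, y 1)) (fderiv ℝ Q (y 0, y 1) (v 0, v 1)) = 0 from o3,
      show form (Q (y 0, y 1)) (fderiv ℝ Q (y 0, y 1) (v 0, v 1)) = 0 from o4]
    ring
  have himg : F.leafMap '' S = f '' S := (image_congr fun y hy => (hfe y hy)).symm
  have hmeas : MeasurableSet (f '' S) := by
    have hS' : f '' S = lift '' ((fun y => (f y).2) '' S) := by
      rw [image_image]
      exact image_congr fun y hy => (lift_snd (hH y hy)).symm
    rw [hS', measurableEmbedding_lift.measurableSet_image]
    refine measurable_image_of_fderivWithin hSm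
      (f' := fun y => (ContinuousLinearMap.snd ℝ ℝ E3).comp (f' y)) (fun y hy =>
      (ContinuousLinearMap.snd ℝ ℝ E3).hasFDerivAt.comp_hasFDerivWithinAt y
        (hder y hy).hasFDerivWithinAt) ?_
    intro x hx y hy h
    apply hinj hx hy
    rw [← lift_snd (hH x hx), ← lift_snd (hH y hy)]
    exact congrArg lift h
  refine ⟨himg ▸ hmeas, ?_⟩
  rw [himg, hypVolume_image hSm (fun y hy => (hder y hy).hasFDerivWithinAt) hinj hH htan]
  rw [← measurePreserving_coords.setLIntegral_comp_preimage_emb coords.measurableEmbedding]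
  refine setLIntegral_congr_fun hSm fun y hy => ?_
  simp only [coords_apply]
  congr 1
  rw [areaDensity]
  congr 1
  have hr := hIr (hSI y hy)
  have hu := hSW y hy
  have hfs := (fderiv_combination hρ hs (Real.exp (y 2)) (Real.exp (-y 2))
    (f := F.surf (y 2)) (fun z hz => by
      rw [surf, ← chart_one]; exact F.pt_chart hρ hF hs hr hz) hu).fderiv
  have g0 : f' y (stdVec 0) = d1 (F.surf (y 2)) (y 0, y 1) := by
    rw [hf'app, d1, hfs]; simp [stdVec, hX, hQ]
  have g1 : f' y (stdVec 1) = d2 (F.surf (y 2)) (y 0, y 1) := by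
    rw [hf'app, d2, hfs]; simp [stdVec, hX, hQ]
  have g2 : f' y (stdVec 2) = Real.exp (y 2) • X (y 0, y 1) - Real.exp (-y 2) • Q (y 0, y 1) := by
    rw [hf'app]; simp [stdVec, Prod.mk_zero_zero]
  have e1 : Real.exp (y 2) * Real.exp (-y 2) = 1 := by rw [← Real.exp_add]; simp
  have k22 : form (f' y (stdVec 2)) (f' y (stdVec 2)) = 1 := by
    rw [g2]
    simp only [form_sub_left, form_sub_right, form_smul_left, form_smul_right,
      hXX, hQQ _ hu, hXQ _ hu, form_comm (Q _) (X _)]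
    linear_combination e1
  have k2 : ∀ v : E3, v 2 = 0 → form (f' y (stdVec 2)) (f' y v) = 0 := by
    intro v hv
    obtain ⟨o1, o2, o3, o4⟩ := horth _ hu (v 0, v 1)
    rw [g2, hf'app, hv, zero_smul, add_zero]
    simp only [form_add_right, form_sub_left, form_smul_left, form_smul_right]
    rw [show form (X (y 0, y 1)) (fderiv ℝ X (y 0, y 1) (v 0, v 1)) = 0 from o1,
      show form (Q (y 0, y 1)) (fderiv ℝ X (y 0, y 1) (v 0, v 1)) = 0 from o2,
      show form (X (y 0, y 1)) (fderiv ℝ Q (y 0, y 1) (v 0, v 1)) = 0 from o3,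
      show form (Q (y 0, y 1)) (fderiv ℝ Q (y 0, y 1) (v 0, v 1)) = 0 from o4]
    ring
  have k20 := k2 (stdVec 0) (by simp [stdVec])
  have k21 := k2 (stdVec 1) (by simp [stdVec])
  rw [gram, Matrix.det_fin_three]
  simp only [Matrix.of_apply, k22, k20, k21, form_comm _ (f' y (stdVec 2))]
  rw [g0, g1, form_comm (d2 (F.surf (y 2)) (y 0, y 1)) (d1 (F.surf (y 2)) (y 0, y 1))]
  ring

end

theorem leaves_eq {I : Set ℝ} {B : Set Mink} (hB : B ⊆ idealSphere) :
    ∃ N ⊆ {y | ∃ t ∈ I, vecM 1 ∈ B ∧ F.pt t (vecM 1) = y},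
      F.leaves I B = F.leafMap '' (coords ⁻¹' (I ×ˢ (stereo ⁻¹' B))) ∪ N := by
  have hs : (1 : ℝ) ^ 2 = 1 := one_pow 2
  refine ⟨_, subset_rfl, ?_⟩
  ext y
  constructor
  · rintro ⟨t, ht, b, hb, rfl⟩
    by_cases h : (1 : ℝ) * b.2 2 = 1
    · right
      have hb1 := hB hb
      have h1 := hb1.1
      rw [form_coord, hb1.2] at h1
      rw [one_mul] at h
      have h2 : b.2 0 ^ 2 + b.2 1 ^ 2 = 0 := by rw [h] at h1; linarith
      have h3 : b = vecM 1 := by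
        refine mink_ext hb1.2 ?_ ?_ h
        · have : b.2 0 = 0 := by nlinarith [sq_nonneg (b.2 0), sq_nonneg (b.2 1)]
          rw [this]; simp [vecM]
        · have : b.2 1 = 0 := by nlinarith [sq_nonneg (b.2 0), sq_nonneg (b.2 1)]
          rw [this]; simp [vecM]
      exact ⟨t, ht, h3 ▸ hb, by rw [h3]⟩
    · left
      have h1 := chart_chartInv hs (hB hb) h
      rw [chart_one] at h1
      refine ⟨!₂[(chartInv 1 b).1, (chartInv 1 b).2, t], ⟨ht, ?_⟩, ?_⟩
      · change stereo (chartInv 1 b) ∈ B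
        rwa [h1]
      · change F.pt t (stereo (chartInv 1 b)) = _
        rw [h1]
  · rintro (⟨y, ⟨h1, h2⟩, rfl⟩ | ⟨t, ht, hm, rfl⟩)
    · exact ⟨y 2, h1, _, h2, rfl⟩
    · exact ⟨t, ht, _, hm, rfl⟩

theorem hypVolume_pole_leaf {I : Set ℝ} (hI : I ⊆ Ici F.r₀) {B : Set Mink}
    (hB : B ⊆ discontinuityDomain Γ) :
    hypVolume {y | ∃ t ∈ I, vecM 1 ∈ B ∧ F.pt t (vecM 1) = y} = 0 := by
  refine measure_mono_null ?_ (hypVolume_plane (vecM 1) (F.conj (vecM 1)))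
  rintro y ⟨t, ht, hm, rfl⟩
  exact ⟨_, _, F.pt_eq (hI ht) (hB hm)⟩

end EquidistantFoliation

section
variable {Γ : Subgroup (Mink ≃ₗ[ℝ] Mink)}

theorem isFundamentalDomain_of {T : Set Mink} {μ : Measure Mink} (hT : NullMeasurableSet T μ)
    (hcov : ∀ᵐ x ∂μ, ∃ γ : Γ, γ • x ∈ T)
    (hdisj : ∀ γ : Γ, ∀ x ∈ T, γ • x ∈ T → γ = 1) : IsFundamentalDomain Γ T μ where
  nullMeasurableSet := hT
  ae_covers := hcov
  aedisjoint := by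
    intro γ δ hne
    refine Disjoint.aedisjoint (disjoint_left.2 fun x hx hx' => ?_)
    rw [mem_smul_set_iff_inv_smul_mem] at hx hx'
    have h := hdisj (δ⁻¹ * γ) _ hx (by rwa [mul_smul, smul_inv_smul])
    exact hne (inv_mul_eq_one.1 h).symm

theorem eq_one_of_mem {act : (Mink ≃ₗ[ℝ] Mink) → Mink → Mink} {X D : Set Mink}
    (hD : IsFundDomain Γ act X D) {x : Mink} (hx : x ∈ D) (h1 : act 1 x = x)
    {γ : Mink ≃ₗ[ℝ] Mink} (hγ : γ ∈ Γ) (h : act γ x ∈ D) : γ = 1 := by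
  obtain ⟨α, -, hu⟩ := hD.existsUnique x (hD.subset hx)
  exact (hu γ ⟨hγ, h⟩).trans (hu 1 ⟨Γ.one_mem, by rwa [h1]⟩).symm

end

theorem continuousOn_shapeDet {W : Set (ℝ × ℝ)} (hW : IsOpen W) {l : ℝ × ℝ → ℝ}
    (hl : ContDiffOn ℝ ∞ l W) (hpos : ∀ u ∈ W, 0 < l u) : ContinuousOn (shapeDet l) W := by
  have h1 := contDiffOn_d1 hW hl
  have h2 := contDiffOn_d2 hW hl
  have c0 := hl.continuousOn
  have c1 := h1.continuousOn
  have c2 := h2.continuousOn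
  have c11 := (contDiffOn_d1 hW h1).continuousOn
  have c12 := (contDiffOn_d1 hW h2).continuousOn
  have c22 := (contDiffOn_d2 hW h2).continuousOn
  have n1 : ∀ u ∈ W, 2 * l u ≠ 0 := fun u hu => by have := hpos u hu; positivity
  have n2 : ∀ u ∈ W, l u ^ 2 ≠ 0 := fun u hu => by have := hpos u hu; positivity
  have n3 : ∀ u ∈ W, 4 * l u ^ 2 ≠ 0 := fun u hu => by have := hpos u hu; positivity
  have n4 : ∀ u ∈ W, l u ^ 4 ≠ 0 := fun u hu => by have := hpos u hu; positivity
  have hd2 := continuousOn_const (c := (2 : ℝ)) |>.mul c0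
  have hd4 := continuousOn_const (c := (4 : ℝ)) |>.mul (c0.pow 2)
  have s11 : ContinuousOn (sff11 l) W := ((c11.div hd2 n1).sub ((c1.pow 2).div (c0.pow 2) n2)).add
    (((c1.pow 2).add (c2.pow 2)).div hd4 n3)
  have s12 : ContinuousOn (sff12 l) W := (c12.div hd2 n1).sub ((c1.mul c2).div (c0.pow 2) n2)
  have s22 : ContinuousOn (sff22 l) W := ((c22.div hd2 n1).sub ((c2.pow 2).div (c0.pow 2) n2)).add
    (((c1.pow 2).add (c2.pow 2)).div hd4 n3)
  exact ((s11.mul s22).sub (s12.pow 2)).div (c0.pow 4) n4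

theorem measurableSet_stereo_preimage {B : Set Mink} (hB : MeasurableSet B) :
    MeasurableSet (stereo ⁻¹' B) := by
  rw [← chart_one]
  exact (contDiff_chart 1 (n := 0)).continuous.measurable hB

/-! ### Volume of the bodies and exact expansions in the parameter -/

namespace EquidistantFoliation

variable {Γ : Subgroup (Mink ≃ₗ[ℝ] Mink)} (F : EquidistantFoliation Γ) {ρ : Mink → ℝ}

/-- Translates of a compact set K cover the body, and the volumes of the parts of these translates
in D add up to that of K. -/
theorem hypVolume_body_lt_top (hΓ : IsHyperbolicManifoldGroup Γ) {D : Set Mink}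
    (hD : IsFundDomain Γ (fun γ => γ) H3 D) {r : ℝ} (hr : F.r₀ ≤ r) :
    hypVolume (F.body r ∩ D) < ⊤ := by
  have := countable_group hΓ
  have := smulInvariant_hypVolume hΓ
  have := measurableConstSMul (Γ := Γ)
  obtain ⟨K, hK, -, hcov⟩ := F.cocompact r hr
  have hfd := isFundamentalDomain_hyp hΓ hD
  have h1 := hfd.measure_eq_tsum K
  have hsub : F.body r ∩ D ⊆ ⋃ γ : Γ, γ • K ∩ D := by
    rintro x ⟨hx, hxD⟩
    obtain ⟨γ, hγ, hγx⟩ := hcov x hx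
    refine mem_iUnion.2 ⟨⟨γ, hγ⟩⁻¹, ?_, hxD⟩
    rw [mem_smul_set_iff_inv_smul_mem, inv_inv]; exact hγx
  calc hypVolume (F.body r ∩ D) ≤ hypVolume (⋃ γ : Γ, γ • K ∩ D) := measure_mono hsub
    _ ≤ ∑' γ : Γ, hypVolume (γ • K ∩ D) := measure_iUnion_le _
    _ = hypVolume K := h1.symm
    _ < ⊤ := hypVolume_lt_top_of_isCompact hK

/-- The domain D need not respect the foliation, so the shell `body r \ body s` is measured in
another fundamental domain T: the part of D inside `body s` together with the normal rays over B
outside. The shell is Γ-invariant and has the same volume in D and in T, and its part in T consists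
of the leaves over B. -/
theorem hypVolume_body (hΓ : IsHyperbolicManifoldGroup Γ) {D : Set Mink}
    (hD : IsFundDomain Γ (fun γ => γ) H3 D) {B : Set Mink}
    (hB : IsFundDomain Γ idealAct (discontinuityDomain Γ) B) (hρ : IsConformalMetric Γ ρ)
    (hF : F.Induces ρ) {s r : ℝ} (hs : F.r₀ ≤ s) (hsr : s ≤ r) :
    hypVolume (F.body r ∩ D) = hypVolume (F.body s ∩ D) +
      ∫⁻ z in Ioc s r ×ˢ (stereo ⁻¹' B), ENNReal.ofReal (areaDensity (F.surf z.1) z.2) := by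
  have := countable_group hΓ
  have := smulInvariant_hypVolume hΓ
  have := measurableConstSMul (Γ := Γ)
  have hfd := isFundamentalDomain_hyp hΓ hD
  have hBΩ := hB.subset
  have hleafnull : ∀ I : Set ℝ, MeasurableSet I → I ⊆ Ici F.r₀ →
      NullMeasurableSet (F.leaves I B) hypVolume ∧ hypVolume (F.leaves I B) =
      ∫⁻ z in I ×ˢ (stereo ⁻¹' B), ENNReal.ofReal (areaDensity (F.surf z.1) z.2) := by
    intro I hI hIr
    obtain ⟨N, hN, he⟩ := F.leaves_eq (I := I) (hBΩ.trans omega_subset)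
    have hN0 : hypVolume N = 0 := measure_mono_null hN (F.hypVolume_pole_leaf hIr hBΩ)
    obtain ⟨h1, h2⟩ := F.leafMap_props hρ hF hB.measurable hBΩ hI hIr
    rw [he]
    refine ⟨h1.nullMeasurableSet.union (NullMeasurableSet.of_null hN0), ?_⟩
    rw [← h2]
    exact measure_congr (union_ae_eq_left_of_ae_eq_empty (ae_eq_empty.2 hN0))
  have hIoi : Ioi s ⊆ Ici F.r₀ := fun t ht => hs.trans (le_of_lt ht)
  have hIoc : Ioc s r ⊆ Ici F.r₀ := fun t ht => hs.trans (le_of_lt ht.1)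
  have hbm : ∀ {r : ℝ}, F.r₀ ≤ r → MeasurableSet (F.body r) := fun h => (F.isClosed _ h).measurableSet
  set T := (F.body s ∩ D) ∪ F.leaves (Ioi s) B with hTd
  have hinv : ∀ {r : ℝ}, F.r₀ ≤ r → ∀ (γ : Γ) (x : Mink), γ • x ∈ F.body r ↔ x ∈ F.body r := by
    intro r hr γ x
    refine ⟨fun h => ?_, fun h => F.invariant r hr _ γ.2 x h⟩
    have := F.invariant r hr _ (γ⁻¹).2 _ h
    rwa [← smul_eq_apply, inv_smul_smul] at this
  have hleafB : ∀ y ∈ F.leaves (Ioi s) B, y ∉ F.body s := by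
    rintro y ⟨t, ht, b, hb, rfl⟩
    exact F.pt_notMem_body hs ht (hBΩ hb)
  have hT : IsFundamentalDomain Γ T hypVolume := by
    refine isFundamentalDomain_of (((hbm hs).inter hD.measurable).nullMeasurableSet.union
      (hleafnull _ measurableSet_Ioi hIoi).1) ?_ ?_
    · filter_upwards [ae_mem_H3] with x hx
      by_cases hxs : x ∈ F.body s
      · obtain ⟨γ, ⟨hγ, h⟩, -⟩ := hD.existsUnique x hx
        exact ⟨⟨γ, hγ⟩, Or.inl ⟨(hinv hs _ _).2 hxs, h⟩⟩
      · obtain ⟨t, ht, b, hb, rfl⟩ := F.exists_pt_eq hs hx hxs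
        obtain ⟨γ, ⟨hγ, h⟩, -⟩ := hB.existsUnique b hb
        exact ⟨⟨γ, hγ⟩, Or.inr ⟨t, ht, _, h, F.pt_equivariant hΓ hγ (hIoi ht) hb⟩⟩
    · rintro γ x (⟨hxs, hxD⟩ | hx) hγ
      · have h1 : γ • x ∈ F.body s := (hinv hs _ _).2 hxs
        rcases hγ with hγ | hγ
        · exact Subtype.ext (eq_one_of_mem hD hxD rfl γ.2 hγ.2)
        · exact absurd h1 (hleafB _ hγ)
      · have h0 := hleafB _ hx
        rcases hγ with hγ | hγ
        · exact absurd ((hinv hs _ _).1 hγ.1) h0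
        · obtain ⟨t, ht, b, hb, rfl⟩ := hx
          obtain ⟨t', ht', b', hb', h⟩ := hγ
          rw [smul_eq_apply, ← F.pt_equivariant hΓ γ.2 (hIoi ht) (hBΩ hb)] at h
          obtain ⟨-, h2⟩ := F.pt_inj (hIoi ht') (hIoi ht) (hBΩ hb')
            (idealAct_omega hΓ γ.2 (hBΩ hb)) h
          exact Subtype.ext (eq_one_of_mem hB hb (idealAct_one (hBΩ hb).1) γ.2 (h2 ▸ hb'))
  have hr := hs.trans hsr
  have hEm : MeasurableSet (F.body r \ F.body s) := (hbm hr).diff (hbm hs)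
  have h1 := hfd.measure_set_eq hT hEm fun γ => by
    ext x
    simp only [mem_preimage, Set.mem_sdiff, hinv hr, hinv hs]
  have h2 : (F.body r \ F.body s) ∩ T = F.leaves (Ioc s r) B := by
    ext y
    constructor
    · rintro ⟨⟨hyr, hys⟩, h | h⟩
      · exact absurd h.1 hys
      · obtain ⟨t, ht, b, hb, rfl⟩ := h
        refine ⟨t, ⟨ht, ?_⟩, b, hb, rfl⟩
        by_contra hlt
        exact F.pt_notMem_body hr (not_le.1 hlt) (hBΩ hb) hyr
    · rintro ⟨t, ht, b, hb, rfl⟩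
      exact ⟨(F.body_diff hs hsr).symm ▸ ⟨t, ht, b, hBΩ hb, rfl⟩, Or.inr ⟨t, ht.1, b, hb, rfl⟩⟩
  rw [h2, (hleafnull _ measurableSet_Ioc hIoc).2] at h1
  rw [← h1]
  have h3 : F.body r ∩ D = (F.body s ∩ D) ∪ ((F.body r \ F.body s) ∩ D) := by
    rw [← union_inter_distrib_right, union_sdiff_cancel (F.body_mono hs hsr)]
  conv_lhs => rw [h3]
  refine measure_union ?_ (hEm.inter hD.measurable)
  exact disjoint_left.2 fun x hx hx' => hx'.1.2 hx.1

section
variable {B : Set Mink} (hB : IsFundDomain Γ idealAct (discontinuityDomain Γ) B)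
  (hρ : IsHyperbolicMetric Γ ρ) (hF : F.Induces ρ)
  (hsq : IntegrableOn (fun u => lam ρ 1 u ^ 2) (stereo ⁻¹' B))
include hB hρ hF hsq

/-- The function det S is bounded, above by `shapeDet_le_one` and below by positivity of the area
density of the first leaf, and the area of the metric is finite. -/
theorem integrable_shapeDet :
    IntegrableOn (fun u => lam ρ 1 u ^ 2 * shapeDet (lam ρ 1) u) (stereo ⁻¹' B) := by
  have hs : (1 : ℝ) ^ 2 = 1 := one_pow 2
  have hm := measurableSet_stereo_preimage hB.measurable
  have hsub : stereo ⁻¹' B ⊆ chart 1 ⁻¹' discontinuityDomain Γ := by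
    rw [← chart_one]; exact preimage_mono hB.subset
  have hc := continuousOn_shapeDet (isOpen_chart_preimage hs)
    (contDiffOn_lam hρ.toIsConformalMetric hs) fun u hu => lam_pos hρ.toIsConformalMetric hu
  -- The first summand comes from `areaFactor_pos` at r₀ multiplied by e^{2 r₀}; the 1 is the upper
  -- bound of det S.
  set C := Real.exp F.r₀ ^ 2 * (Real.exp F.r₀ ^ 2 + 2) + 1
  have hbd : ∀ u ∈ stereo ⁻¹' B, ‖shapeDet (lam ρ 1) u‖ ≤ C := by
    intro u hu
    have h1 := shapeDet_le_one hρ hs (hsub hu)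
    have h2 := F.areaFactor_pos hρ hF le_rfl hs (hsub hu)
    have e1 : Real.exp F.r₀ * Real.exp (-F.r₀) = 1 := by rw [← Real.exp_add]; simp
    have h3 : 0 < Real.exp F.r₀ ^ 2 * (Real.exp F.r₀ ^ 2 + 2 +
      Real.exp (-F.r₀) ^ 2 * shapeDet (lam ρ 1) u) := mul_pos (by positivity) h2
    have h4 : Real.exp F.r₀ ^ 2 * (Real.exp (-F.r₀) ^ 2 * shapeDet (lam ρ 1) u) =
        shapeDet (lam ρ 1) u := by
      rw [← mul_assoc, ← mul_pow, e1]; ring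
    have h5 : 0 < Real.exp F.r₀ ^ 2 * (Real.exp F.r₀ ^ 2 + 2) := by positivity
    rw [Real.norm_eq_abs, abs_le]
    rw [mul_add, h4] at h3
    constructor
    · change -(Real.exp F.r₀ ^ 2 * (Real.exp F.r₀ ^ 2 + 2) + 1) ≤ _
      linarith
    · change _ ≤ Real.exp F.r₀ ^ 2 * (Real.exp F.r₀ ^ 2 + 2) + 1
      linarith
  have h := Integrable.bdd_mul (c := C) hsq ((hc.mono hsub).aestronglyMeasurable hm)
    ((ae_restrict_mem hm).mono hbd)
  refine h.congr (Eventually.of_forall fun u => ?_)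
  simp only; ring

theorem area_eq {r : ℝ} (hr : F.r₀ ≤ r) :
    F.area B r = (Real.exp r ^ 2 + 2) * (∫ u in stereo ⁻¹' B, lam ρ 1 u ^ 2) +
      Real.exp (-r) ^ 2 * ∫ u in stereo ⁻¹' B, lam ρ 1 u ^ 2 * shapeDet (lam ρ 1) u := by
  have hm := measurableSet_stereo_preimage hB.measurable
  have hI := F.integrable_shapeDet hB hρ hF hsq
  rw [area, ← integral_const_mul, ← integral_const_mul,
    ← integral_add (hsq.const_mul _) (hI.const_mul _)]
  refine setIntegral_congr_fun hm fun u hu => ?_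
  simp only [(F.leaf_densities hρ hF hr (hB.subset hu)).1]
  ring

theorem totalMeanCurvature_eq {r : ℝ} (hr : F.r₀ ≤ r) :
    F.totalMeanCurvature B r = Real.exp r ^ 2 * (∫ u in stereo ⁻¹' B, lam ρ 1 u ^ 2) -
      Real.exp (-r) ^ 2 * ∫ u in stereo ⁻¹' B, lam ρ 1 u ^ 2 * shapeDet (lam ρ 1) u := by
  have hm := measurableSet_stereo_preimage hB.measurable
  have hI := F.integrable_shapeDet hB hρ hF hsq
  rw [totalMeanCurvature, ← integral_const_mul, ← integral_const_mul,
    ← integral_sub (hsq.const_mul _) (hI.const_mul _)]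
  refine setIntegral_congr_fun hm fun u hu => ?_
  simp only [(F.leaf_densities hρ hF hr (hB.subset hu)).2]
  ring

theorem totalMeanCurvatureSubOne_eq {r : ℝ} (hr : F.r₀ ≤ r) :
    F.totalMeanCurvatureSubOne B r = -2 * (∫ u in stereo ⁻¹' B, lam ρ 1 u ^ 2) -
      2 * Real.exp (-r) ^ 2 * ∫ u in stereo ⁻¹' B, lam ρ 1 u ^ 2 * shapeDet (lam ρ 1) u := by
  have hm := measurableSet_stereo_preimage hB.measurable
  have hI := F.integrable_shapeDet hB hρ hF hsq
  rw [totalMeanCurvatureSubOne, ← integral_const_mul, ← integral_const_mul,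
    ← integral_sub (hsq.const_mul _) (hI.const_mul _)]
  refine setIntegral_congr_fun hm fun u hu => ?_
  obtain ⟨h1, h2⟩ := F.leaf_densities hρ hF hr (hB.subset hu)
  simp only [sub_mul, one_mul]
  rw [h2, h1]
  ring

/-- Fubini on parameters times B. The constant 2 in the area density, the trace of S, yields the
linear growth 2 (r - s). -/
theorem vol_eq (hΓ : IsHyperbolicManifoldGroup Γ) {D : Set Mink}
    (hD : IsFundDomain Γ (fun γ => γ) H3 D) {s r : ℝ} (hs : F.r₀ ≤ s) (hsr : s ≤ r) :
    F.vol D r = F.vol D s + ((Real.exp r ^ 2 - Real.exp s ^ 2) / 2 + 2 * (r - s)) *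
      (∫ u in stereo ⁻¹' B, lam ρ 1 u ^ 2) -
      (Real.exp (-r) ^ 2 - Real.exp (-s) ^ 2) / 2 *
        ∫ u in stereo ⁻¹' B, lam ρ 1 u ^ 2 * shapeDet (lam ρ 1) u := by
  have hm := measurableSet_stereo_preimage hB.measurable
  have hI := F.integrable_shapeDet hB hρ hF hsq
  have hv := F.hypVolume_body hΓ hD hB hρ.toIsConformalMetric hF hs hsr
  set A := stereo ⁻¹' B
  have hIoc : MeasurableSet (Ioc s r ×ˢ A) := measurableSet_Ioc.prod hm
  set f : ℝ × (ℝ × ℝ) → ℝ := fun z => (Real.exp z.1 ^ 2 + 2) * lam ρ 1 z.2 ^ 2 +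
    Real.exp (-z.1) ^ 2 * (lam ρ 1 z.2 ^ 2 * shapeDet (lam ρ 1) z.2) with hf
  have hle : ∫⁻ z in Ioc s r ×ˢ A, ENNReal.ofReal (areaDensity (F.surf z.1) z.2) =
      ∫⁻ z in Ioc s r ×ˢ A, ENNReal.ofReal (f z) := by
    refine setLIntegral_congr_fun hIoc fun z hz => ?_
    simp only [(F.leaf_densities hρ hF (hs.trans hz.1.1.le) (hB.subset hz.2)).1, hf]
    congr 1; ring
  have hc1 : IntegrableOn (fun t : ℝ => Real.exp t ^ 2 + 2) (Ioc s r) :=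
    ((by fun_prop : Continuous fun t : ℝ => Real.exp t ^ 2 + 2).integrableOn_Icc).mono_set
      Ioc_subset_Icc_self
  have hc2 : IntegrableOn (fun t : ℝ => Real.exp (-t) ^ 2) (Ioc s r) :=
    ((by fun_prop : Continuous fun t : ℝ => Real.exp (-t) ^ 2).integrableOn_Icc).mono_set
      Ioc_subset_Icc_self
  have hi1 : IntegrableOn (fun z : ℝ × (ℝ × ℝ) => (Real.exp z.1 ^ 2 + 2) * lam ρ 1 z.2 ^ 2)
      (Ioc s r ×ˢ A) := by
    rw [IntegrableOn, Measure.volume_eq_prod, ← Measure.prod_restrict]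
    exact Integrable.mul_prod hc1 hsq
  have hi2 : IntegrableOn (fun z : ℝ × (ℝ × ℝ) =>
      Real.exp (-z.1) ^ 2 * (lam ρ 1 z.2 ^ 2 * shapeDet (lam ρ 1) z.2)) (Ioc s r ×ˢ A) := by
    rw [IntegrableOn, Measure.volume_eq_prod, ← Measure.prod_restrict]
    exact Integrable.mul_prod hc2 hI
  have hfi : IntegrableOn f (Ioc s r ×ˢ A) := hi1.add hi2
  have hnn : 0 ≤ᵐ[volume.restrict (Ioc s r ×ˢ A)] f := by
    filter_upwards [ae_restrict_mem hIoc] with z hz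
    have h1 := F.areaFactor_pos hρ hF (hs.trans hz.1.1.le) (s := 1) (one_pow 2)
      (u := z.2) (by rw [chart_one]; exact hB.subset hz.2)
    have : f z = lam ρ 1 z.2 ^ 2 * (Real.exp z.1 ^ 2 + 2 +
      Real.exp (-z.1) ^ 2 * shapeDet (lam ρ 1) z.2) := by simp only [hf]; ring
    rw [Pi.zero_apply, this]
    positivity
  rw [hle, ← ofReal_integral_eq_lintegral_ofReal hfi hnn] at hv
  have hval : ∫ z in Ioc s r ×ˢ A, f z = ((Real.exp r ^ 2 - Real.exp s ^ 2) / 2 + 2 * (r - s)) *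
      (∫ u in A, lam ρ 1 u ^ 2) - (Real.exp (-r) ^ 2 - Real.exp (-s) ^ 2) / 2 *
        ∫ u in A, lam ρ 1 u ^ 2 * shapeDet (lam ρ 1) u := by
    rw [hf, integral_add hi1 hi2, Measure.volume_eq_prod,
      setIntegral_prod_mul (fun t => Real.exp t ^ 2 + 2) (fun u => lam ρ 1 u ^ 2),
      setIntegral_prod_mul (fun t => Real.exp (-t) ^ 2)
        (fun u => lam ρ 1 u ^ 2 * shapeDet (lam ρ 1) u),
      ← intervalIntegral.integral_of_le hsr, ← intervalIntegral.integral_of_le hsr]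
    have d1 : ∀ t ∈ uIcc s r, HasDerivAt (fun t => Real.exp t ^ 2 / 2 + 2 * t)
        (Real.exp t ^ 2 + 2) t := by
      intro t _
      have h := (((Real.hasDerivAt_exp t).pow 2).div_const 2).add ((hasDerivAt_id t).const_mul 2)
      refine h.congr_deriv ?_
      simp; ring
    have d2 : ∀ t ∈ uIcc s r, HasDerivAt (fun t => -(Real.exp (-t) ^ 2 / 2))
        (Real.exp (-t) ^ 2) t := by
      intro t _
      have h := ((((hasDerivAt_id t).neg.exp).pow 2).div_const 2).neg
      refine h.congr_deriv ?_
      simp; ring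
    rw [intervalIntegral.integral_eq_sub_of_hasDerivAt d1
        ((by fun_prop : Continuous fun t : ℝ => Real.exp t ^ 2 + 2).intervalIntegrable _ _),
      intervalIntegral.integral_eq_sub_of_hasDerivAt d2
        ((by fun_prop : Continuous fun t : ℝ => Real.exp (-t) ^ 2).intervalIntegrable _ _)]
    ring
  rw [vol, hv, ENNReal.toReal_add (F.hypVolume_body_lt_top hΓ hD hs).ne ENNReal.ofReal_ne_top,
    ENNReal.toReal_ofReal (integral_nonneg_of_ae hnn), hval, vol]
  ring

end
end EquidistantFoliation

/-! ### Gauss–Bonnet for a single triangle -/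

/-- The closed standard triangle in the plane. -/
def tri : Set (ℝ × ℝ) := {z | 0 ≤ z.1 ∧ 0 ≤ z.2 ∧ z.1 + z.2 ≤ 1}

theorem isClosed_tri : IsClosed tri :=
  (isClosed_le continuous_const continuous_fst).inter
    ((isClosed_le continuous_const continuous_snd).inter
      (isClosed_le (continuous_fst.add continuous_snd) continuous_const))

theorem isCompact_tri : IsCompact tri := by
  refine (isCompact_Icc (a := ((0 : ℝ), (0 : ℝ))) (b := (1, 1))).of_isClosed_subset isClosed_tri ?_
  rintro ⟨a, b⟩ ⟨h1, h2, h3⟩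
  simp only at h1 h2 h3
  exact ⟨⟨h1, h2⟩, ⟨by simp only; linarith, by simp only; linarith⟩⟩

theorem setIntegral_tri {f : ℝ × ℝ → ℝ} (hf : ContinuousOn f tri) :
    ∫ z in tri, f z = ∫ u in (0 : ℝ)..1, ∫ v in (0 : ℝ)..(1 - u), f (u, v) := by
  have hi : Integrable (tri.indicator f) (volume.prod volume) := by
    rw [← Measure.volume_eq_prod, integrable_indicator_iff isClosed_tri.measurableSet]
    exact hf.integrableOn_compact isCompact_tri
  rw [← integral_indicator isClosed_tri.measurableSet, Measure.volume_eq_prod, integral_prod _ hi,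
    intervalIntegral.integral_of_le zero_le_one, ← integral_Icc_eq_integral_Ioc,
    ← integral_indicator measurableSet_Icc]
  refine integral_congr_ae (Eventually.of_forall fun u => ?_)
  simp only
  by_cases hu : u ∈ Icc (0 : ℝ) 1
  · rw [indicator_of_mem hu, intervalIntegral.integral_of_le (by linarith [hu.2]),
      ← integral_Icc_eq_integral_Ioc, ← integral_indicator measurableSet_Icc]
    refine integral_congr_ae (Eventually.of_forall fun v => ?_)
    have : (u, v) ∈ tri ↔ v ∈ Icc 0 (1 - u) :=
      ⟨fun h => ⟨h.2.1, by have := h.2.2; simp only at this; linarith⟩,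
        fun h => ⟨hu.1, h.1, by have := h.2; simp only; linarith⟩⟩
    by_cases hv : v ∈ Icc 0 (1 - u)
    · simp only [indicator_of_mem hv, indicator_of_mem (this.2 hv)]
    · simp only [indicator_of_notMem hv, indicator_of_notMem (mt this.1 hv)]
  · rw [indicator_of_notMem hu]
    refine integral_eq_zero_of_ae (Eventually.of_forall fun v => ?_)
    refine indicator_of_notMem (fun h => hu ⟨h.1, ?_⟩) _
    have h2 := h.2.1
    have h3 := h.2.2
    simp only at h2 h3
    linarith

theorem setIntegral_tri_swap (f : ℝ × ℝ → ℝ) : ∫ z in tri, f z.swap = ∫ z in tri, f z := by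
  have h : Prod.swap ⁻¹' tri = tri := by
    ext ⟨a, b⟩
    simp only [tri, mem_preimage, mem_ofPred_eq, Prod.swap_prod_mk]
    rw [add_comm]; tauto
  have hmp : MeasurePreserving (Prod.swap : ℝ × ℝ → ℝ × ℝ) volume volume :=
    Measure.measurePreserving_swap
  have := hmp.setIntegral_preimage_emb MeasurableEquiv.prodComm.measurableEmbedding f tri
  rwa [h] at this

/-- The geodesic curvature density along the `u`-lines of the metric `E du² + 2F du dv + G dv²`. -/
def kap (E F G : ℝ × ℝ → ℝ) (z : ℝ × ℝ) : ℝ :=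
  (2 * E z * d1 F z - E z * d2 E z - F z * d1 E z) / (2 * E z * √(E z * G z - F z ^ 2))

/-- The `v`-component of the connection form of the frame along the `u`-lines. -/
def conn2 (E F G : ℝ × ℝ → ℝ) (z : ℝ × ℝ) : ℝ :=
  (E z * d1 G z - F z * d2 E z) / (2 * E z * √(E z * G z - F z ^ 2))

/-- The angle between the coordinate lines. -/
def ang (E F G : ℝ × ℝ → ℝ) (z : ℝ × ℝ) : ℝ := Real.arccos (F z / √(E z * G z))

/-- An angle with cosine N/√D has sine √(g/D), where g = D - N². In the applications g is EG - F²,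
and naming it lets the derivative be matched with the connection form. -/
theorem hasDerivAt_arccos_div {N D : ℝ → ℝ} {N' D' x g : ℝ} (hN : HasDerivAt N N' x)
    (hD : HasDerivAt D D' x) (hg : D x - N x ^ 2 = g) (hgpos : 0 < g) :
    HasDerivAt (fun y => Real.arccos (N y / √(D y)))
      (-(N' * D x - N x * D' / 2) / (D x * √g)) x := by
  have hDp : 0 < D x := by nlinarith [sq_nonneg (N x)]
  have hs : √(D x) ^ 2 = D x := Real.sq_sqrt hDp.le
  have hsp : 0 < √(D x) := Real.sqrt_pos.2 hDp
  have hgp : 0 < √g := Real.sqrt_pos.2 hgpos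
  have hlt : (N x / √(D x)) ^ 2 < 1 := by
    rw [div_pow, hs, div_lt_one hDp]; linarith
  have habs := abs_lt.1 ((sq_lt_one_iff_abs_lt_one _).1 hlt)
  have h1 : √(1 - (N x / √(D x)) ^ 2) = √g / √(D x) := by
    rw [← Real.sqrt_div hgpos.le, div_pow, hs]
    congr 1
    field_simp
    linarith
  have h := (Real.hasDerivAt_arccos habs.1.ne' habs.2.ne).comp x
    (hN.div (hD.sqrt hDp.ne') hsp.ne')
  refine h.congr_deriv ?_
  rw [h1]
  field_simp
  rw [hs]
  ring


theorem fderiv_div_sqrt {N E g : ℝ × ℝ → ℝ} {z : ℝ × ℝ} (hN : DifferentiableAt ℝ N z)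
    (hE : DifferentiableAt ℝ E z) (hg : DifferentiableAt ℝ g z) (hE0 : E z ≠ 0) (hg0 : 0 < g z) :
    DifferentiableAt ℝ (fun z => N z / (2 * E z * √(g z))) z ∧ ∀ v,
    fderiv ℝ (fun z => N z / (2 * E z * √(g z))) z v =
      fderiv ℝ N z v / (2 * E z * √(g z)) - N z * fderiv ℝ E z v / (2 * E z ^ 2 * √(g z)) -
        N z * fderiv ℝ g z v / (4 * E z * g z * √(g z)) := by
  have hr : 0 < √(g z) := Real.sqrt_pos.2 hg0
  have hrs : √(g z) ^ 2 = g z := Real.sq_sqrt hg0.le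
  have h1 : HasFDerivAt (fun z => 2 * E z * √(g z))
      ((2 * E z) • ((1 / (2 * √(g z))) • fderiv ℝ g z) + √(g z) • ((2 : ℝ) • fderiv ℝ E z)) z :=
    (hE.hasFDerivAt.const_mul 2).mul (hg.hasFDerivAt.sqrt hg0.ne')
  have h2 : HasFDerivAt (fun z => N z / (2 * E z * √(g z))) _ z :=
    hN.hasFDerivAt.mul ((hasDerivAt_inv (by positivity)).comp_hasFDerivAt z h1)
  refine ⟨h2.differentiableAt, fun v => ?_⟩
  rw [h2.fderiv]
  simp only [smul_apply, add_apply, smul_eq_mul]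
  rw [← hrs]
  simp only [Real.sqrt_sq hr.le]
  generalize √(g z) = r at *
  field_simp
  ring

section metric
variable {U : Set (ℝ × ℝ)} {E F G : ℝ × ℝ → ℝ}

/-- Smooth coefficients of a Riemannian metric `E du² + 2F du dv + G dv²` on an open set. -/
structure IsMetricOn (U : Set (ℝ × ℝ)) (E F G : ℝ × ℝ → ℝ) : Prop where
  isOpen : IsOpen U
  smoothE : ContDiffOn ℝ ∞ E U
  smoothF : ContDiffOn ℝ ∞ F U
  smoothG : ContDiffOn ℝ ∞ G U
  pos : ∀ z ∈ U, 0 < E z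
  det_pos : ∀ z ∈ U, 0 < E z * G z - F z ^ 2

namespace IsMetricOn
variable (h : IsMetricOn U E F G)
include h

theorem smooth_kap_num : ContDiffOn ℝ ∞
    (fun z => 2 * E z * d1 F z - E z * d2 E z - F z * d1 E z) U :=
  (((contDiffOn_const.mul h.smoothE).mul (contDiffOn_d1 h.isOpen h.smoothF)).sub
    (h.smoothE.mul (contDiffOn_d2 h.isOpen h.smoothE))).sub
    (h.smoothF.mul (contDiffOn_d1 h.isOpen h.smoothE))

theorem smooth_conn2_num : ContDiffOn ℝ ∞ (fun z => E z * d1 G z - F z * d2 E z) U :=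
  (h.smoothE.mul (contDiffOn_d1 h.isOpen h.smoothG)).sub
    (h.smoothF.mul (contDiffOn_d2 h.isOpen h.smoothE))

theorem smooth_det : ContDiffOn ℝ ∞ (fun z => E z * G z - F z ^ 2) U :=
  (h.smoothE.mul h.smoothG).sub (h.smoothF.pow 2)

theorem smooth_den : ContDiffOn ℝ ∞ (fun z => 2 * E z * √(E z * G z - F z ^ 2)) U :=
  (contDiffOn_const.mul h.smoothE).mul (h.smooth_det.sqrt fun z hz => (h.det_pos z hz).ne')

theorem den_ne_zero {z : ℝ × ℝ} (hz : z ∈ U) : 2 * E z * √(E z * G z - F z ^ 2) ≠ 0 := by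
  have := h.pos z hz
  have := Real.sqrt_pos.2 (h.det_pos z hz)
  positivity

theorem smooth_kap : ContDiffOn ℝ ∞ (kap E F G) U :=
  h.smooth_kap_num.div h.smooth_den fun _ hz => h.den_ne_zero hz

theorem smooth_conn2 : ContDiffOn ℝ ∞ (conn2 E F G) U :=
  h.smooth_conn2_num.div h.smooth_den fun _ hz => h.den_ne_zero hz

/-- The structure equation `dω = K da`. -/
theorem d2_kap_sub_d1_conn2 {z : ℝ × ℝ} (hz : z ∈ U) :
    d2 (kap E F G) z - d1 (conn2 E F G) z =
      gaussCurvature E F G z * √(E z * G z - F z ^ 2) := by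
  have dd : ∀ {f : ℝ × ℝ → ℝ}, ContDiffOn ℝ ∞ f U → DifferentiableAt ℝ f z := fun hf =>
    differentiableAt_of_smooth h.isOpen hf hz
  have hE := dd h.smoothE
  have hF := dd h.smoothF
  have hG := dd h.smoothG
  have hE1 := dd (contDiffOn_d1 h.isOpen h.smoothE)
  have hE2 := dd (contDiffOn_d2 h.isOpen h.smoothE)
  have hF1 := dd (contDiffOn_d1 h.isOpen h.smoothF)
  have hG1 := dd (contDiffOn_d1 h.isOpen h.smoothG)
  have e0 := h.pos z hz
  have g0 := h.det_pos z hz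
  have hdet : ∀ v, fderiv ℝ (fun z => E z * G z - F z ^ 2) z v =
      fderiv ℝ E z v * G z + E z * fderiv ℝ G z v - 2 * F z * fderiv ℝ F z v := by
    intro v
    have := (hE.hasFDerivAt.mul hG.hasFDerivAt).sub (hF.hasFDerivAt.pow 2)
    rw [show fderiv ℝ (fun z => E z * G z - F z ^ 2) z = _ from HasFDerivAt.fderiv this]
    simp
    ring
  have hA : fderiv ℝ (fun z => 2 * E z * d1 F z - E z * d2 E z - F z * d1 E z) z (0, 1) =
      2 * d2 E z * d1 F z + 2 * E z * d2 (d1 F) z - d2 E z * d2 E z - E z * d2 (d2 E) z -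
        d2 F z * d1 E z - F z * d2 (d1 E) z := by
    have := ((((hE.hasFDerivAt.const_mul 2).mul hF1.hasFDerivAt).sub
      (hE.hasFDerivAt.mul hE2.hasFDerivAt)).sub (hF.hasFDerivAt.mul hE1.hasFDerivAt))
    rw [show fderiv ℝ (fun z => 2 * E z * d1 F z - E z * d2 E z - F z * d1 E z) z = _ from
      HasFDerivAt.fderiv this]
    simp only [smul_apply, sub_apply, add_apply, smul_eq_mul]
    change 2 * E z * d2 (d1 F) z + d1 F z * (2 * d2 E z) - (E z * d2 (d2 E) z + d2 E z * d2 E z) -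
      (F z * d2 (d1 E) z + d1 E z * d2 F z) = _
    ring
  have hB : fderiv ℝ (fun z => E z * d1 G z - F z * d2 E z) z (1, 0) =
      d1 E z * d1 G z + E z * d1 (d1 G) z - d1 F z * d2 E z - F z * d1 (d2 E) z := by
    have := (hE.hasFDerivAt.mul hG1.hasFDerivAt).sub (hF.hasFDerivAt.mul hE2.hasFDerivAt)
    rw [show fderiv ℝ (fun z => E z * d1 G z - F z * d2 E z) z = _ from HasFDerivAt.fderiv this]
    simp only [smul_apply, sub_apply, add_apply, smul_eq_mul]
    change E z * d1 (d1 G) z + d1 G z * d1 E z - (F z * d1 (d2 E) z + d2 E z * d1 F z) = _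
    ring
  have k1 := (fderiv_div_sqrt (dd h.smooth_kap_num) hE (dd h.smooth_det) e0.ne' g0).2 (0, 1)
  have k2 := (fderiv_div_sqrt (dd h.smooth_conn2_num) hE (dd h.smooth_det) e0.ne' g0).2 (1, 0)
  rw [hA, hdet] at k1
  rw [hB, hdet] at k2
  rw [show d2 (kap E F G) z = _ from k1, show d1 (conn2 E F G) z = _ from k2]
  have c1 : d2 (d1 F) z = d1 (d2 F) z := (d1_d2_comm h.isOpen h.smoothF hz).symm
  have c2 : d2 (d1 E) z = d1 (d2 E) z := (d1_d2_comm h.isOpen h.smoothE hz).symm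
  rw [c1, c2, gaussCurvature]
  change _ - _ = _
  simp only [Matrix.det_fin_three, Matrix.of_apply, Matrix.cons_val', Matrix.cons_val_zero,
    Matrix.cons_val_one, Matrix.cons_val]
  rw [show fderiv ℝ E z (0, 1) = d2 E z from rfl, show fderiv ℝ E z (1, 0) = d1 E z from rfl,
    show fderiv ℝ F z (0, 1) = d2 F z from rfl, show fderiv ℝ F z (1, 0) = d1 F z from rfl,
    show fderiv ℝ G z (0, 1) = d2 G z from rfl, show fderiv ℝ G z (1, 0) = d1 G z from rfl]
  have hrs : √(E z * G z - F z ^ 2) ^ 2 = E z * G z - F z ^ 2 := Real.sq_sqrt g0.le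
  have hr : 0 < √(E z * G z - F z ^ 2) := Real.sqrt_pos.2 g0
  generalize √(E z * G z - F z ^ 2) = r at *
  generalize d1 (d2 F) z = F12 at *
  generalize d1 (d2 E) z = E12 at *
  generalize d2 (d2 E) z = E22 at *
  generalize d1 (d1 G) z = G11 at *
  generalize d1 E z = E1 at *
  generalize d2 E z = E2 at *
  generalize d1 F z = F1 at *
  generalize d2 F z = F2 at *
  generalize d1 G z = G1 at *
  generalize d2 G z = G2 at *
  generalize E z = e at *
  generalize F z = f at *
  generalize G z = g at *
  -- Eliminating G in favour of r = √(EG - F²) turns the structure equation into an identity of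
  -- rational functions.
  have hge : g = (r ^ 2 + f ^ 2) / e := by field_simp; linarith
  rw [← hrs, hge]
  field_simp
  ring

end IsMetricOn
end metric

/-- The affine map that permutes the vertices of the standard triangle cyclically. -/
def rot (z : ℝ × ℝ) : ℝ × ℝ := (1 - z.1 - z.2, z.1)

theorem continuous_rot : Continuous rot := by unfold rot; fun_prop

theorem contDiff_rot : ContDiff ℝ ∞ rot := by unfold rot; fun_prop

theorem rot_mem_tri {z : ℝ × ℝ} (hz : z ∈ tri) : rot z ∈ tri := by
  obtain ⟨h1, h2, h3⟩ := hz
  exact ⟨by simp only [rot]; linarith, h1, by simp only [rot]; linarith⟩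

theorem fderiv_rot (z v : ℝ × ℝ) : fderiv ℝ rot z v = (-v.1 - v.2, v.1) := by
  have h : HasFDerivAt rot (((0 - ContinuousLinearMap.fst ℝ ℝ ℝ) - ContinuousLinearMap.snd ℝ ℝ ℝ).prod
      (ContinuousLinearMap.fst ℝ ℝ ℝ)) z :=
    HasFDerivAt.prodMk (((hasFDerivAt_const (1 : ℝ) z).sub hasFDerivAt_fst).sub hasFDerivAt_snd)
      hasFDerivAt_fst
  rw [h.fderiv]
  simp

theorem fderiv_comp_rot {V : Type*} [NormedAddCommGroup V] [NormedSpace ℝ V] {f : ℝ × ℝ → V}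
    {z : ℝ × ℝ} (hf : DifferentiableAt ℝ f (rot z)) (v : ℝ × ℝ) :
    fderiv ℝ (fun z => f (rot z)) z v = fderiv ℝ f (rot z) (-v.1 - v.2, v.1) := by
  rw [show (fun z => f (rot z)) = f ∘ rot from rfl,
    fderiv_comp z hf (contDiff_rot.differentiable (by simp)).differentiableAt]
  simp [fderiv_rot]

theorem d1_comp_rot {V : Type*} [NormedAddCommGroup V] [NormedSpace ℝ V] {f : ℝ × ℝ → V}
    {z : ℝ × ℝ} (hf : DifferentiableAt ℝ f (rot z)) :
    d1 (fun z => f (rot z)) z = d2 f (rot z) - d1 f (rot z) := by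
  rw [d1, fderiv_comp_rot hf, d1, d2, ← map_sub]; simp

theorem d2_comp_rot {V : Type*} [NormedAddCommGroup V] [NormedSpace ℝ V] {f : ℝ × ℝ → V}
    {z : ℝ × ℝ} (hf : DifferentiableAt ℝ f (rot z)) :
    d2 (fun z => f (rot z)) z = -d1 f (rot z) := by
  rw [d2, fderiv_comp_rot hf, d1, ← map_neg]; simp

theorem hasDerivAt_line {f : ℝ × ℝ → ℝ} {c : ℝ → ℝ × ℝ} {w : ℝ × ℝ} {s : ℝ}
    (hf : DifferentiableAt ℝ f (c s)) (hc : HasDerivAt c w s) :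
    HasDerivAt (fun s => f (c s)) (w.1 * d1 f (c s) + w.2 * d2 f (c s)) s := by
  have h := hf.hasFDerivAt.comp_hasDerivAt s hc
  refine h.congr_deriv ?_
  rw [d1, d2, ← smul_eq_mul, ← smul_eq_mul, ← map_smul, ← map_smul, ← map_add]
  simp

/-- The angle sum of a Euclidean triangle with two sides x, y of Gram matrix (e, f; f, g). The
chosen x = (√e, 0) and y = (f/√e, r/√e), with r² = eg - f², are its Cholesky factors. -/
theorem arccos_angle_sum {e f g : ℝ} (he : 0 < e) (hg : 0 < e * g - f ^ 2) :
    Real.arccos (f / √(e * g)) + Real.arccos ((g - f) / √(g * (e - 2 * f + g))) =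
      Real.arccos ((f - e) / √(e * (e - 2 * f + g))) := by
  obtain ⟨r, hr0, hr⟩ : ∃ r, 0 < r ∧ r ^ 2 = e * g - f ^ 2 :=
    ⟨√(e * g - f ^ 2), Real.sqrt_pos.2 hg, Real.sq_sqrt hg.le⟩
  obtain ⟨q, hq0, hq⟩ : ∃ q, 0 < q ∧ q ^ 2 = e := ⟨√e, Real.sqrt_pos.2 he, Real.sq_sqrt he.le⟩
  have hgp : 0 < g := by nlinarith [sq_nonneg f]
  have hhp : 0 < e - 2 * f + g := by
    have h1 : 0 < e * (e - 2 * f + g) := by nlinarith [sq_nonneg (e - f)]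
    exact (mul_pos_iff_of_pos_left he).1 h1
  set x : EuclideanSpace ℝ (Fin 2) := !₂[q, 0] with hx
  set y : EuclideanSpace ℝ (Fin 2) := !₂[f / q, r / q] with hy
  have xx : ‖x‖ = √e := by simp [hx, EuclideanSpace.norm_eq, hq]
  have hyy : (f / q) ^ 2 + (r / q) ^ 2 = g := by field_simp; rw [hr, hq]; ring
  have yy : ‖y‖ = √g := by simp [hy, EuclideanSpace.norm_eq, hyy]
  have hzz : (q - f / q) ^ 2 + (0 - r / q) ^ 2 = e - 2 * f + g := by
    rw [← hyy, ← hq]; field_simp; ring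
  have zz : ‖x - y‖ = √(e - 2 * f + g) := by
    rw [← hzz]; simp [hx, hy, EuclideanSpace.norm_eq]
  have xy : inner ℝ x y = f := by simp [hx, hy, PiLp.inner_apply]; field_simp
  have xz : inner ℝ x (x - y) = e - f := by
    rw [inner_sub_right, xy, real_inner_self_eq_norm_sq, xx, Real.sq_sqrt he.le]
  have yz : inner ℝ y (y - x) = g - f := by
    rw [inner_sub_right, real_inner_comm x y, xy, real_inner_self_eq_norm_sq, yy, Real.sq_sqrt hgp.le]
  have hx0 : x ≠ 0 := by
    rw [← norm_ne_zero_iff, xx]; exact (Real.sqrt_pos.2 he).ne'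
  have hy0 : y ≠ 0 := by
    rw [← norm_ne_zero_iff, yy]; exact (Real.sqrt_pos.2 hgp).ne'
  have h := InnerProductGeometry.angle_add_angle_sub_add_angle_sub_eq_pi x hy0
  rw [InnerProductGeometry.angle, InnerProductGeometry.angle, InnerProductGeometry.angle,
    xy, xz, yz, xx, yy, norm_sub_rev y x, zz, ← Real.sqrt_mul he.le, ← Real.sqrt_mul he.le,
    ← Real.sqrt_mul hgp.le] at h
  rw [show f - e = -(e - f) by ring, neg_div, Real.arccos_neg]
  linarith


theorem continuousOn_comp_path {U : Set (ℝ × ℝ)} (ht : tri ⊆ U) {f : ℝ × ℝ → ℝ} (hf : ContDiffOn ℝ ∞ f U)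
    {c : ℝ → ℝ × ℝ} (hc : Continuous c) (hm : ∀ s ∈ Icc (0 : ℝ) 1, c s ∈ tri) :
    ContinuousOn (fun s => f (c s)) (uIcc (0 : ℝ) 1) := by
  rw [uIcc_of_le zero_le_one]
  exact hf.continuousOn.comp hc.continuousOn fun s hs => ht (hm s hs)

namespace IsMetricOn
variable {U : Set (ℝ × ℝ)} {E F G : ℝ × ℝ → ℝ} (h : IsMetricOn U E F G)
include h

theorem pos' {z : ℝ × ℝ} (hz : z ∈ U) : 0 < G z := by
  have h1 := h.pos z hz
  have h2 := h.det_pos z hz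
  exact (mul_pos_iff_of_pos_left h1).1 (by nlinarith [sq_nonneg (F z)])

theorem hyp_pos {z : ℝ × ℝ} (hz : z ∈ U) : 0 < E z - 2 * F z + G z := by
  have h1 := h.pos z hz
  have h2 := h.det_pos z hz
  exact (mul_pos_iff_of_pos_left h1).1 (by nlinarith [sq_nonneg (E z - F z)])

/-- The coefficients are those of the pullback by `rot`, through which each edge of the triangle
becomes the first edge. -/
theorem comp_rot : IsMetricOn (rot ⁻¹' U) (fun z => E (rot z) - 2 * F (rot z) + G (rot z))
    (fun z => E (rot z) - F (rot z)) (fun z => E (rot z)) := by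
  have hm : MapsTo rot (rot ⁻¹' U) U := fun _ hz => hz
  have hE := h.smoothE.comp contDiff_rot.contDiffOn hm
  have hF := h.smoothF.comp contDiff_rot.contDiffOn hm
  have hG := h.smoothG.comp contDiff_rot.contDiffOn hm
  refine ⟨h.isOpen.preimage continuous_rot, (hE.sub (contDiffOn_const.mul hF)).add hG,
    hE.sub hF, hE, fun z hz => h.hyp_pos hz, fun z hz => ?_⟩
  have := h.det_pos _ hz
  nlinarith

theorem kap_rot {z : ℝ × ℝ} (hz : rot z ∈ U) :
    kap (fun z => E (rot z) - 2 * F (rot z) + G (rot z)) (fun z => E (rot z) - F (rot z))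
      (fun z => E (rot z)) z =
    ((E - 2 * F + G) (rot z) * (2 * (d2 E - d1 E - d2 F + d1 F) (rot z) +
      (d1 E - 2 * d1 F + d1 G) (rot z)) - (E - F) (rot z) *
      (d2 E - d1 E - 2 * d2 F + 2 * d1 F + d2 G - d1 G) (rot z)) /
      (2 * (E - 2 * F + G) (rot z) * √(E (rot z) * G (rot z) - F (rot z) ^ 2)) := by
  have dE := differentiableAt_of_smooth h.isOpen h.smoothE hz
  have dF := differentiableAt_of_smooth h.isOpen h.smoothF hz
  have dG := differentiableAt_of_smooth h.isOpen h.smoothG hz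
  have e1 : ∀ v, fderiv ℝ (fun z => E z - F z) (rot z) v =
      fderiv ℝ E (rot z) v - fderiv ℝ F (rot z) v := fun v => by
    rw [fderiv_fun_sub dE dF]; rfl
  have e2 : ∀ v, fderiv ℝ (fun z => E z - 2 * F z + G z) (rot z) v =
      fderiv ℝ E (rot z) v - 2 * fderiv ℝ F (rot z) v + fderiv ℝ G (rot z) v := fun v => by
    rw [fderiv_fun_add (dE.fun_sub (dF.const_mul 2)) dG, fderiv_fun_sub dE (dF.const_mul 2),
      fderiv_const_mul dF]
    rfl
  have a1 : d1 (fun z => E (rot z) - F (rot z)) z =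
      (d2 E - d1 E - d2 F + d1 F) (rot z) := by
    rw [d1_comp_rot (f := fun z => E z - F z) (dE.fun_sub dF), d1, d2, e1, e1]
    simp only [Pi.add_apply, Pi.sub_apply, d1, d2]; ring
  have a2 : d2 (fun z => E (rot z) - 2 * F (rot z) + G (rot z)) z =
      -(d1 E - 2 * d1 F + d1 G) (rot z) := by
    rw [d2_comp_rot (f := fun z => E z - 2 * F z + G z) ((dE.fun_sub (dF.const_mul 2)).fun_add dG),
      d1, e2]
    simp [d1]
  have a3 : d1 (fun z => E (rot z) - 2 * F (rot z) + G (rot z)) z =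
      (d2 E - d1 E - 2 * d2 F + 2 * d1 F + d2 G - d1 G) (rot z) := by
    rw [d1_comp_rot (f := fun z => E z - 2 * F z + G z) ((dE.fun_sub (dF.const_mul 2)).fun_add dG),
      d1, d2, e2, e2]
    simp [d1, d2]; ring
  rw [kap, a1, a2, a3]
  simp only [Pi.add_apply, Pi.sub_apply, Pi.mul_apply, Pi.ofNat_apply]
  congr 1
  · ring
  · congr 2; ring

/-- Along the hypotenuse, the geodesic curvature and the connection form of the frame along the
u-lines differ by the derivative of the angle between ∂_u and the edge direction (-1, 1), whose
cosine is (F - E)/√(E(E - 2F + G)). -/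
theorem integral_hypotenuse (ht : tri ⊆ U) :
    ∫ s in (0 : ℝ)..1, kap (fun z => E (rot z) - 2 * F (rot z) + G (rot z))
      (fun z => E (rot z) - F (rot z)) (fun z => E (rot z)) (s, 0) =
    (∫ s in (0 : ℝ)..1, conn2 E F G (1 - s, s)) - (∫ s in (0 : ℝ)..1, kap E F G (1 - s, s)) +
      (Real.arccos ((F (0, 1) - E (0, 1)) / √(E (0, 1) * (E (0, 1) - 2 * F (0, 1) + G (0, 1)))) -
      Real.arccos ((F (1, 0) - E (1, 0)) / √(E (1, 0) * (E (1, 0) - 2 * F (1, 0) + G (1, 0))))) := by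
  have hc : Continuous fun s : ℝ => ((1 - s, s) : ℝ × ℝ) := by fun_prop
  have hm : ∀ s ∈ Icc (0 : ℝ) 1, ((1 - s, s) : ℝ × ℝ) ∈ tri := fun s hs =>
    ⟨by simp only; linarith [hs.2], hs.1, by simp⟩
  have c1 := continuousOn_comp_path ht h.smooth_kap hc hm
  have c2 := continuousOn_comp_path ht h.smooth_conn2 hc hm
  have ht' : tri ⊆ rot ⁻¹' U := fun z hz => ht (rot_mem_tri hz)
  have c3 := continuousOn_comp_path ht' h.comp_rot.smooth_kap
    (c := fun s => (s, 0)) (by fun_prop) (fun s hs => ⟨hs.1, le_rfl, by simpa using hs.2⟩)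
  have key : ∀ s ∈ uIcc (0 : ℝ) 1, HasDerivAt (fun s => Real.arccos ((F (1 - s, s) - E (1 - s, s)) /
      √(E (1 - s, s) * (E (1 - s, s) - 2 * F (1 - s, s) + G (1 - s, s)))))
      (kap (fun z => E (rot z) - 2 * F (rot z) + G (rot z))
      (fun z => E (rot z) - F (rot z)) (fun z => E (rot z)) (s, 0) -
        (conn2 E F G (1 - s, s) - kap E F G (1 - s, s))) s := by
    intro s hs
    rw [uIcc_of_le zero_le_one] at hs
    have hz := ht (hm s hs)
    have hl : HasDerivAt (fun s : ℝ => ((1 - s, s) : ℝ × ℝ)) (-1, 1) s :=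
      HasDerivAt.prodMk (by simpa using (hasDerivAt_id s).const_sub 1) (hasDerivAt_id s)
    have dE := hasDerivAt_line (differentiableAt_of_smooth h.isOpen h.smoothE hz) (c := fun s => (1 - s, s)) hl
    have dF := hasDerivAt_line (differentiableAt_of_smooth h.isOpen h.smoothF hz) (c := fun s => (1 - s, s)) hl
    have dG := hasDerivAt_line (differentiableAt_of_smooth h.isOpen h.smoothG hz) (c := fun s => (1 - s, s)) hl
    have hg := h.det_pos _ hz
    have he := h.pos _ hz
    have hh := h.hyp_pos hz
    have hd := hasDerivAt_arccos_div (dF.fun_sub dE)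
      (dE.fun_mul ((dE.fun_sub (dF.const_mul 2)).fun_add dG))
      (g := E (1 - s, s) * G (1 - s, s) - F (1 - s, s) ^ 2) (by ring) hg
    refine hd.congr_deriv ?_
    have hr : rot (s, 0) = (1 - s, s) := by simp [rot]
    have hk := h.kap_rot (z := (s, 0)) (by rw [hr]; exact hz)
    rw [hr] at hk
    rw [hk, conn2, kap]
    simp only [Pi.add_apply, Pi.sub_apply, Pi.mul_apply, Pi.ofNat_apply]
    have hrp : 0 < √(E (1 - s, s) * G (1 - s, s) - F (1 - s, s) ^ 2) := Real.sqrt_pos.2 hg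
    generalize √(E (1 - s, s) * G (1 - s, s) - F (1 - s, s) ^ 2) = r at *
    generalize (1 - s, s) = z at *
    generalize d1 E z = E1 at *
    generalize d2 E z = E2 at *
    generalize d1 F z = F1 at *
    generalize d2 F z = F2 at *
    generalize d1 G z = G1 at *
    generalize d2 G z = G2 at *
    generalize E z = e at *
    generalize F z = f at *
    obtain ⟨H, hH⟩ : ∃ H, H = e - 2 * f + G z := ⟨_, rfl⟩
    rw [← hH] at hh ⊢
    field_simp
    ring
  have i1 := c1.intervalIntegrable (μ := volume)
  have i2 := c2.intervalIntegrable (μ := volume)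
  have i3 := c3.intervalIntegrable (μ := volume)
  have hi := i3.sub (i2.sub i1)
  have hftc := intervalIntegral.integral_eq_sub_of_hasDerivAt key hi
  rw [intervalIntegral.integral_sub i3 (i2.sub i1), intervalIntegral.integral_sub i2 i1] at hftc
  simp only [sub_zero, sub_self] at hftc
  linarith

theorem kap_rot_rot {z : ℝ × ℝ} (hz : rot (rot z) ∈ U) :
    kap (fun z => G (rot (rot z))) (fun z => G (rot (rot z)) - F (rot (rot z)))
      (fun z => E (rot (rot z)) - 2 * F (rot (rot z)) + G (rot (rot z))) z =
    (2 * G (rot (rot z)) * (d2 F - d2 G) (rot (rot z)) - G (rot (rot z)) *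
      (d1 G - d2 G) (rot (rot z)) + (G - F) (rot (rot z)) * d2 G (rot (rot z))) /
      (2 * G (rot (rot z)) * √(E (rot (rot z)) * G (rot (rot z)) - F (rot (rot z)) ^ 2)) := by
  have dF := differentiableAt_of_smooth h.isOpen h.smoothF hz
  have dG := differentiableAt_of_smooth h.isOpen h.smoothG hz
  have hrot : ∀ z, DifferentiableAt ℝ rot z := fun z =>
    (contDiff_rot.differentiable (by simp)).differentiableAt
  have b1 : ∀ {f : ℝ × ℝ → ℝ}, DifferentiableAt ℝ f (rot (rot z)) →
      d1 (fun z => f (rot (rot z))) z = -d2 f (rot (rot z)) := fun {f} hf => by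
    rw [d1_comp_rot (f := fun z => f (rot z)) (hf.comp _ (hrot _)), d1_comp_rot hf, d2_comp_rot hf]
    ring
  have b2 : ∀ {f : ℝ × ℝ → ℝ}, DifferentiableAt ℝ f (rot (rot z)) →
      d2 (fun z => f (rot (rot z))) z = d1 f (rot (rot z)) - d2 f (rot (rot z)) := fun {f} hf => by
    rw [d2_comp_rot (f := fun z => f (rot z)) (hf.comp _ (hrot _)), d1_comp_rot hf]
    ring
  have a1 : d1 (fun z => G (rot (rot z)) - F (rot (rot z))) z = (d2 F - d2 G) (rot (rot z)) := by
    rw [b1 (f := fun z => G z - F z) (dG.fun_sub dF), d2, fderiv_fun_sub dG dF]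
    simp [d2]
  rw [kap, a1, b1 dG, b2 dG]
  simp only [Pi.sub_apply]
  congr 1
  · ring
  · congr 2; ring

/-- The same comparison of frames on the left edge. Two rotations traverse this edge downward, which
accounts for the signs and for the substitution s ↦ 1 - s. -/
theorem integral_left (ht : tri ⊆ U) :
    ∫ s in (0 : ℝ)..1, kap (fun z => G (rot (rot z))) (fun z => G (rot (rot z)) - F (rot (rot z)))
      (fun z => E (rot (rot z)) - 2 * F (rot (rot z)) + G (rot (rot z))) (s, 0) =
    -(∫ s in (0 : ℝ)..1, conn2 E F G (0, s)) + (ang E F G (0, 0) - ang E F G (0, 1)) := by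
  have hc : Continuous fun s : ℝ => ((0, s) : ℝ × ℝ) := by fun_prop
  have hm : ∀ s ∈ Icc (0 : ℝ) 1, ((0, s) : ℝ × ℝ) ∈ tri := fun s hs =>
    ⟨le_rfl, hs.1, by simpa using hs.2⟩
  have hr : ∀ s : ℝ, rot (rot (1 - s, 0)) = (0, s) := fun s => by simp [rot]
  have key : ∀ s ∈ Icc (0 : ℝ) 1, HasDerivAt (fun s => -ang E F G (0, s))
      (kap (fun z => G (rot (rot z))) (fun z => G (rot (rot z)) - F (rot (rot z)))
      (fun z => E (rot (rot z)) - 2 * F (rot (rot z)) + G (rot (rot z))) (1 - s, 0) +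
        conn2 E F G (0, s)) s := by
    intro s hs
    have hz := ht (hm s hs)
    have hl : HasDerivAt (fun s : ℝ => ((0, s) : ℝ × ℝ)) (0, 1) s :=
      HasDerivAt.prodMk (hasDerivAt_const _ _) (hasDerivAt_id s)
    have dE := hasDerivAt_line (differentiableAt_of_smooth h.isOpen h.smoothE hz)
      (c := fun s => (0, s)) hl
    have dF := hasDerivAt_line (differentiableAt_of_smooth h.isOpen h.smoothF hz)
      (c := fun s => (0, s)) hl
    have dG := hasDerivAt_line (differentiableAt_of_smooth h.isOpen h.smoothG hz)
      (c := fun s => (0, s)) hl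
    have hg := h.det_pos _ hz
    have he := h.pos _ hz
    have hgp := h.pos' hz
    have hd := (hasDerivAt_arccos_div dF (dE.fun_mul dG)
      (g := E (0, s) * G (0, s) - F (0, s) ^ 2) rfl hg).fun_neg
    refine hd.congr_deriv ?_
    have hk := h.kap_rot_rot (z := (1 - s, 0)) (by rw [hr]; exact hz)
    rw [hr] at hk
    rw [hk, conn2]
    simp only [Pi.sub_apply]
    have hrp : 0 < √(E (0, s) * G (0, s) - F (0, s) ^ 2) := Real.sqrt_pos.2 hg
    generalize √(E (0, s) * G (0, s) - F (0, s) ^ 2) = r at *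
    field_simp
    ring
  have c1 := continuousOn_comp_path ht h.smooth_conn2 hc hm
  have hc3 : ContinuousOn (fun s : ℝ => kap (fun z => G (rot (rot z)))
      (fun z => G (rot (rot z)) - F (rot (rot z)))
      (fun z => E (rot (rot z)) - 2 * F (rot (rot z)) + G (rot (rot z))) (1 - s, 0))
      (uIcc (0 : ℝ) 1) := by
    have hm3 := h.comp_rot.comp_rot
    have ht' : tri ⊆ rot ⁻¹' (rot ⁻¹' U) := fun z hz => ht (rot_mem_tri (rot_mem_tri hz))
    have := continuousOn_comp_path ht' hm3.smooth_kap (c := fun s => (1 - s, 0)) (by fun_prop)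
      (fun s hs => ⟨by simp only; linarith [hs.2], le_rfl, by simp only; linarith [hs.1]⟩)
    have q1 : (fun z => E (rot (rot z)) - 2 * F (rot (rot z)) + G (rot (rot z)) -
        2 * (E (rot (rot z)) - F (rot (rot z))) + E (rot (rot z))) =
        fun z => G (rot (rot z)) := by funext z; ring
    have q2 : (fun z => E (rot (rot z)) - 2 * F (rot (rot z)) + G (rot (rot z)) -
        (E (rot (rot z)) - F (rot (rot z)))) =
        fun z => G (rot (rot z)) - F (rot (rot z)) := by funext z; ring
    rwa [q1, q2] at this
  have hftc := intervalIntegral.integral_eq_sub_of_hasDerivAt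
    (by rwa [uIcc_of_le zero_le_one]) (hc3.fun_add c1).intervalIntegrable
  rw [intervalIntegral.integral_add hc3.intervalIntegrable c1.intervalIntegrable,
    intervalIntegral.integral_comp_sub_left (fun s => kap (fun z => G (rot (rot z)))
      (fun z => G (rot (rot z)) - F (rot (rot z)))
      (fun z => E (rot (rot z)) - 2 * F (rot (rot z)) + G (rot (rot z))) (s, 0))] at hftc
  simp only [sub_zero, sub_self] at hftc
  linarith

/-- The Gauss–Bonnet formula for a triangle in a surface of curvature `-4`. -/
theorem gauss_bonnet_triangle (ht : tri ⊆ U) (hK : ∀ z ∈ U, gaussCurvature E F G z = -4) :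
    4 * ∫ z in tri, √(E z * G z - F z ^ 2) =
      (∫ s in (0 : ℝ)..1, kap E F G (s, 0)) +
      (∫ s in (0 : ℝ)..1, kap (fun z => E (rot z) - 2 * F (rot z) + G (rot z))
        (fun z => E (rot z) - F (rot z)) (fun z => E (rot z)) (s, 0)) +
      (∫ s in (0 : ℝ)..1, kap (fun z => G (rot (rot z)))
        (fun z => G (rot (rot z)) - F (rot (rot z)))
        (fun z => E (rot (rot z)) - 2 * F (rot (rot z)) + G (rot (rot z))) (s, 0)) +
      Real.pi - ang E F G (0, 0) -
      ang (fun z => E (rot z) - 2 * F (rot z) + G (rot z))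
        (fun z => E (rot z) - F (rot z)) (fun z => E (rot z)) (0, 0) -
      ang (fun z => G (rot (rot z))) (fun z => G (rot (rot z)) - F (rot (rot z)))
        (fun z => E (rot (rot z)) - 2 * F (rot (rot z)) + G (rot (rot z))) (0, 0) := by
  have cA := (contDiffOn_d2 h.isOpen h.smooth_kap).continuousOn.mono ht
  have cB := (contDiffOn_d1 h.isOpen h.smooth_conn2).continuousOn.mono ht
  -- The left side is the integral of K, which the structure equation writes as a divergence. The
  -- next two steps evaluate it on the boundary, by Fubini in the two orders: Green's theorem on the
  -- triangle.
  have hsub : -(4 * ∫ z in tri, √(E z * G z - F z ^ 2)) =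
      (∫ z in tri, d2 (kap E F G) z) - ∫ z in tri, d1 (conn2 E F G) z := by
    rw [← integral_sub (cA.integrableOn_compact isCompact_tri)
      (cB.integrableOn_compact isCompact_tri), ← neg_mul, ← integral_const_mul]
    refine setIntegral_congr_fun isClosed_tri.measurableSet fun z hz => ?_
    simp only [h.d2_kap_sub_d1_conn2 (ht hz), hK z (ht hz)]
  have hA : ∫ z in tri, d2 (kap E F G) z =
      (∫ s in (0 : ℝ)..1, kap E F G (1 - s, s)) - ∫ s in (0 : ℝ)..1, kap E F G (s, 0) := by
    have c1 := continuousOn_comp_path ht h.smooth_kap (c := fun s => (s, 1 - s)) (by fun_prop)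
      (fun s hs => ⟨hs.1, by simp only; linarith [hs.2], by simp⟩)
    have c2 := continuousOn_comp_path ht h.smooth_kap (c := fun s => (s, 0)) (by fun_prop)
      (fun s hs => ⟨hs.1, le_rfl, by simpa using hs.2⟩)
    have hs := intervalIntegral.integral_comp_sub_left (a := 0) (b := 1)
      (fun s => kap E F G (s, 1 - s)) 1
    simp only [sub_sub_cancel, sub_self, sub_zero] at hs
    rw [setIntegral_tri cA, hs, ← intervalIntegral.integral_sub c1.intervalIntegrable
      c2.intervalIntegrable]
    refine intervalIntegral.integral_congr fun u hu => ?_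
    rw [uIcc_of_le zero_le_one] at hu
    have hmem : ∀ v ∈ uIcc 0 (1 - u), ((u, v) : ℝ × ℝ) ∈ tri := fun v hv => by
      rw [uIcc_of_le (by linarith [hu.2])] at hv
      exact ⟨hu.1, hv.1, by simp only; linarith [hv.2]⟩
    refine intervalIntegral.integral_eq_sub_of_hasDerivAt (f := fun v => kap E F G (u, v))
      (fun v hv => ?_) (ContinuousOn.intervalIntegrable ?_)
    · have hl : HasDerivAt (fun s : ℝ => ((u, s) : ℝ × ℝ)) (0, 1) v :=
        HasDerivAt.prodMk (hasDerivAt_const _ _) (hasDerivAt_id v)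
      have := hasDerivAt_line (differentiableAt_of_smooth h.isOpen h.smooth_kap
        (ht (hmem v hv))) (c := fun s => (u, s)) hl
      simpa using this
    · exact cA.comp (by fun_prop) hmem
  have hB : ∫ z in tri, d1 (conn2 E F G) z =
      (∫ s in (0 : ℝ)..1, conn2 E F G (1 - s, s)) - ∫ s in (0 : ℝ)..1, conn2 E F G (0, s) := by
    have c1 := continuousOn_comp_path ht h.smooth_conn2 (c := fun s => (1 - s, s)) (by fun_prop)
      (fun s hs => ⟨by simp only; linarith [hs.2], hs.1, by simp⟩)
    have c2 := continuousOn_comp_path ht h.smooth_conn2 (c := fun s => (0, s)) (by fun_prop)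
      (fun s hs => ⟨le_rfl, hs.1, by simpa using hs.2⟩)
    have hsw : ∀ z ∈ tri, z.swap ∈ tri := fun z hz =>
      ⟨hz.2.1, hz.1, by rw [Prod.fst_swap, Prod.snd_swap, add_comm]; exact hz.2.2⟩
    rw [← setIntegral_tri_swap, setIntegral_tri (f := fun z => d1 (conn2 E F G) z.swap)
      (cB.comp continuous_swap.continuousOn hsw),
      ← intervalIntegral.integral_sub c1.intervalIntegrable c2.intervalIntegrable]
    refine intervalIntegral.integral_congr fun v hv => ?_
    rw [uIcc_of_le zero_le_one] at hv
    have hmem : ∀ u ∈ uIcc 0 (1 - v), ((u, v) : ℝ × ℝ) ∈ tri := fun u hu => by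
      rw [uIcc_of_le (by linarith [hv.2])] at hu
      exact ⟨hu.1, hv.1, by simp only; linarith [hu.2]⟩
    refine intervalIntegral.integral_eq_sub_of_hasDerivAt (f := fun u => conn2 E F G (u, v))
      (fun u hu => ?_) (ContinuousOn.intervalIntegrable ?_)
    · have hl : HasDerivAt (fun s : ℝ => ((s, v) : ℝ × ℝ)) (1, 0) u :=
        HasDerivAt.prodMk (hasDerivAt_id u) (hasDerivAt_const _ _)
      have := hasDerivAt_line (differentiableAt_of_smooth h.isOpen h.smooth_conn2
        (ht (hmem u hu))) (c := fun s => (s, v)) hl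
      simpa using this
    · exact cB.comp (by fun_prop) hmem
  have h10 : ((1, 0) : ℝ × ℝ) ∈ U := ht ⟨zero_le_one, le_rfl, by simp⟩
  have h01 : ((0, 1) : ℝ × ℝ) ∈ U := ht ⟨le_rfl, zero_le_one, by simp⟩
  have hr1 : rot (0, 0) = (1, 0) := by simp [rot]
  have hr2 : rot (1, 0) = (0, 1) := by simp [rot]
  have a1 : ang (fun z => E (rot z) - 2 * F (rot z) + G (rot z))
        (fun z => E (rot z) - F (rot z)) (fun z => E (rot z)) (0, 0) = Real.pi -
      Real.arccos ((F (1, 0) - E (1, 0)) /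
        √(E (1, 0) * (E (1, 0) - 2 * F (1, 0) + G (1, 0)))) := by
    rw [ang, hr1, ← Real.arccos_neg, ← neg_div, neg_sub, mul_comm]
  -- The angle at (0, 1) is expressed through the other two angles of the Euclidean triangle in the
  -- tangent plane, so that the boundary terms of the two edge integrals cancel.
  have a2 : ang (fun z => G (rot (rot z))) (fun z => G (rot (rot z)) - F (rot (rot z)))
        (fun z => E (rot (rot z)) - 2 * F (rot (rot z)) + G (rot (rot z))) (0, 0) =
      Real.arccos ((F (0, 1) - E (0, 1)) /
        √(E (0, 1) * (E (0, 1) - 2 * F (0, 1) + G (0, 1)))) - ang E F G (0, 1) := by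
    rw [← arccos_angle_sum (h.pos _ h01) (h.det_pos _ h01), ang, ang, hr1, hr2]
    ring
  rw [h.integral_hypotenuse ht, h.integral_left ht, a1, a2]
  linarith

end IsMetricOn

/-! ### Parametrized triangles -/

/-- The radial projection to the sphere at infinity. -/
def toSphere (x : Mink) : Mink := (1, ‖x.2‖⁻¹ • x.2)

theorem toSphere_mem {x : Mink} (hx : x.2 ≠ 0) : toSphere x ∈ idealSphere := by
  refine ⟨?_, rfl⟩
  rw [form_self, toSphere, norm_smul, norm_inv, norm_norm, inv_mul_cancel₀ (norm_ne_zero_iff.2 hx)]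
  norm_num

theorem toSphere_of_mem {x : Mink} (hx : x ∈ idealSphere) : toSphere x = x := by
  have h := ideal_norm hx
  refine Prod.ext hx.2.symm ?_
  simp [toSphere, h]

theorem contDiffAt_toSphere {x : Mink} (hx : x.2 ≠ 0) : ContDiffAt ℝ ∞ toSphere x := by
  have h2 : ContDiffAt ℝ ∞ (fun y : Mink => ‖y.2‖) x := contDiffAt_snd.norm ℝ hx
  exact contDiffAt_const.prodMk ((h2.inv (norm_ne_zero_iff.2 hx)).smul contDiffAt_snd)

theorem snd_ne_zero_of_ideal {x : Mink} (hx : x ∈ idealSphere) : x.2 ≠ 0 := by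
  rw [← norm_ne_zero_iff, ideal_norm hx]; exact one_ne_zero

theorem convex_tri : Convex ℝ tri := by
  intro x hx y hy a b ha hb hab
  obtain ⟨x1, x2, x3⟩ := hx
  obtain ⟨y1, y2, y3⟩ := hy
  refine ⟨?_, ?_, ?_⟩
  · simp only [Prod.fst_add, Prod.smul_fst, smul_eq_mul]; positivity
  · simp only [Prod.snd_add, Prod.smul_snd, smul_eq_mul]; positivity
  · simp only [Prod.fst_add, Prod.smul_fst, smul_eq_mul, Prod.snd_add, Prod.smul_snd]
    nlinarith

/-- The open standard triangle. -/
def triInt : Set (ℝ × ℝ) := {z | 0 < z.1 ∧ 0 < z.2 ∧ z.1 + z.2 < 1}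

theorem isOpen_triInt : IsOpen triInt :=
  (isOpen_lt continuous_const continuous_fst).inter
    ((isOpen_lt continuous_const continuous_snd).inter
      (isOpen_lt (continuous_fst.add continuous_snd) continuous_const))

theorem triInt_subset : triInt ⊆ tri := fun _ h => ⟨h.1.le, h.2.1.le, h.2.2.le⟩

theorem uniqueDiffOn_tri : UniqueDiffOn ℝ tri := by
  refine uniqueDiffOn_convex convex_tri ⟨(1 / 4, 1 / 4), ?_⟩
  refine interior_mono triInt_subset ?_
  rw [isOpen_triInt.interior_eq]
  refine ⟨?_, ?_, ?_⟩ <;> norm_num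

/-- Barycentric coordinates on the triangle with vertices `i`, `j`, `k`. -/
def bary {n : ℕ} (i j k : Fin n) (z : ℝ × ℝ) : Fin n → ℝ :=
  (1 - z.1 - z.2) • Pi.single i 1 + z.1 • Pi.single j 1 + z.2 • Pi.single k 1

section bary
variable {n : ℕ} {i j k : Fin n}

theorem contDiff_bary : ContDiff ℝ ∞ (bary i j k) := by unfold bary; fun_prop

theorem bary_apply (z : ℝ × ℝ) (l : Fin n) : bary i j k z l =
    (1 - z.1 - z.2) * (if l = i then 1 else 0) + z.1 * (if l = j then 1 else 0) +
      z.2 * (if l = k then 1 else 0) := by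
  simp [bary, Pi.single_apply]

theorem bary_rot (z : ℝ × ℝ) : bary i j k (rot z) = bary j k i z := by
  funext l; rw [bary_apply, bary_apply]; simp only [rot]; ring

theorem bary_swap (z : ℝ × ℝ) : bary i j k z.swap = bary i k j z := by
  funext l; rw [bary_apply, bary_apply]; simp only [Prod.fst_swap, Prod.snd_swap]; ring

theorem bary_eq_zero (z : ℝ × ℝ) {l : Fin n} (hl : l ∉ ({i, j, k} : Finset (Fin n))) :
    bary i j k z l = 0 := by
  simp only [Finset.mem_insert, Finset.mem_singleton, not_or] at hl
  rw [bary_apply, if_neg hl.1, if_neg hl.2.1, if_neg hl.2.2]; simp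

theorem sum_bary (z : ℝ × ℝ) : ∑ l, bary i j k z l = 1 := by
  simp only [bary_apply, Finset.sum_add_distrib, ← Finset.mul_sum]
  simp only [Finset.sum_ite_eq', Finset.mem_univ, if_true]
  ring

theorem bary_nonneg {z : ℝ × ℝ} (hz : z ∈ tri) (l : Fin n) : 0 ≤ bary i j k z l := by
  obtain ⟨h1, h2, h3⟩ := hz
  rw [bary_apply]
  have h4 : 0 ≤ 1 - z.1 - z.2 := by linarith
  positivity

theorem fderiv_bary (z v : ℝ × ℝ) : fderiv ℝ (bary i j k) z v =
    (-v.1 - v.2) • Pi.single i 1 + v.1 • Pi.single j 1 + v.2 • Pi.single k 1 := by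
  have h1 : HasFDerivAt (fun z : ℝ × ℝ => z.1) (ContinuousLinearMap.fst ℝ ℝ ℝ) z := hasFDerivAt_fst
  have h2 : HasFDerivAt (fun z : ℝ × ℝ => z.2) (ContinuousLinearMap.snd ℝ ℝ ℝ) z := hasFDerivAt_snd
  have h := ((((hasFDerivAt_const (1 : ℝ) z).sub h1).sub h2).smul_const
    (Pi.single i 1 : Fin n → ℝ)).add (h1.smul_const (Pi.single j 1 : Fin n → ℝ)) |>.add
    (h2.smul_const (Pi.single k 1 : Fin n → ℝ))
  rw [show fderiv ℝ (bary i j k) z = _ from HasFDerivAt.fderiv h]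
  simp

end bary

theorem distinct_of_card {n : ℕ} {i j k : Fin n} (h : ({i, j, k} : Finset (Fin n)).card = 3) :
    i ≠ j ∧ i ≠ k ∧ j ≠ k := by
  refine ⟨?_, ?_, ?_⟩ <;> rintro rfl
  · rw [Finset.insert_eq_of_mem (by simp)] at h
    have := Finset.card_le_two (a := i) (b := k); omega
  · rw [Finset.insert_eq_of_mem (by simp)] at h
    have := Finset.card_le_two (a := j) (b := i); omega
  · simp only [Finset.pair_eq_singleton] at h
    have := Finset.card_le_two (a := i) (b := j); omega

namespace SmoothTriangulation

variable {Γ : Subgroup (Mink ≃ₗ[ℝ] Mink)} (T : SmoothTriangulation Γ)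

open Classical in
/-- The smooth map that parametrizes the triangle `f`. -/
def tau (f : Finset (Fin T.n)) : (Fin T.n → ℝ) → Mink :=
  if h : f ∈ T.faces then (T.smooth f h).choose else 0

/-- The triangle with ordered vertices `i`, `j`, `k`, parametrized by the standard triangle. -/
def par (i j k : Fin T.n) (z : ℝ × ℝ) : Mink := toSphere (T.tau {i, j, k} (bary i j k z))

/-- An open domain on which the triangle is a local parametrization. -/
def parDom (i j k : Fin T.n) : Set (ℝ × ℝ) :=
  {z | (T.tau {i, j, k} (bary i j k z)).2 ≠ 0 ∧ T.par i j k z ∈ discontinuityDomain Γ ∧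
    Function.Injective (fderiv ℝ (T.par i j k) z)}

variable {i j k : Fin T.n}

theorem par_rot (z : ℝ × ℝ) : T.par i j k (rot z) = T.par j k i z := by
  have : ({j, k, i} : Finset (Fin T.n)) = {i, j, k} := by ext; simp; tauto
  rw [par, par, bary_rot, this]

theorem par_swap (z : ℝ × ℝ) : T.par i j k z.swap = T.par i k j z := by
  have : ({i, k, j} : Finset (Fin T.n)) = {i, j, k} := by ext; simp; tauto
  rw [par, par, bary_swap, this]

theorem tau_spec {f : Finset (Fin T.n)} (hf : f ∈ T.faces) : ContDiff ℝ ∞ (T.tau f) ∧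
    ∀ t : realization T.n T.faces, (∀ i ∉ f, t.1 i = 0) →
      (∃ h : T.tau f t ∈ discontinuityDomain Γ, T.homeo t = Quot.mk _ ⟨T.tau f t, h⟩) ∧
      ∀ v : Fin T.n → ℝ, (∀ i ∉ f, v i = 0) → ∑ i, v i = 0 → fderiv ℝ (T.tau f) t v = 0 → v = 0 := by
  rw [tau, dif_pos hf]
  exact (T.smooth f hf).choose_spec

theorem bary_mem (hf : {i, j, k} ∈ T.faces) {z : ℝ × ℝ} (hz : z ∈ tri) :
    bary i j k z ∈ realization T.n T.faces :=
  ⟨bary_nonneg hz, sum_bary z, _, hf, fun _ hl => bary_eq_zero z hl⟩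

theorem tau_mem (hf : {i, j, k} ∈ T.faces) {z : ℝ × ℝ} (hz : z ∈ tri) :
    T.tau {i, j, k} (bary i j k z) ∈ discontinuityDomain Γ :=
  (((T.tau_spec hf).2 ⟨_, T.bary_mem hf hz⟩ fun _ hl => bary_eq_zero z hl).1).1

theorem par_eq (hf : {i, j, k} ∈ T.faces) {z : ℝ × ℝ} (hz : z ∈ tri) :
    T.par i j k z = T.tau {i, j, k} (bary i j k z) := toSphere_of_mem (T.tau_mem hf hz).1

theorem par_mem (hf : {i, j, k} ∈ T.faces) {z : ℝ × ℝ} (hz : z ∈ tri) :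
    T.par i j k z ∈ discontinuityDomain Γ := by
  rw [T.par_eq hf hz]; exact T.tau_mem hf hz

theorem homeo_bary (hf : {i, j, k} ∈ T.faces) {z : ℝ × ℝ} (hz : z ∈ tri) :
    T.homeo ⟨_, T.bary_mem hf hz⟩ = Quot.mk _ ⟨_, T.par_mem hf hz⟩ := by
  obtain ⟨h1, h2⟩ := ((T.tau_spec hf).2 ⟨_, T.bary_mem hf hz⟩ fun _ hl => bary_eq_zero z hl).1
  rw [h2]
  congr 2
  exact (T.par_eq hf hz).symm

/-- The smooth map of the triangulation is known to lie on the sphere only over the closed triangle;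
radial projection gives a map to the sphere on a neighborhood. On the triangle the derivative is
unchanged, because the two maps agree on a set of unique differentiability, so injectivity is
inherited. -/
theorem isLocalParam_par (hf : {i, j, k} ∈ T.faces) :
    IsLocalParam Γ (T.parDom i j k) (T.par i j k) ∧ tri ⊆ T.parDom i j k := by
  have hq : ContDiff ℝ ∞ (fun z => T.tau {i, j, k} (bary i j k z)) :=
    (T.tau_spec hf).1.comp contDiff_bary
  have hW : IsOpen {z | (T.tau {i, j, k} (bary i j k z)).2 ≠ 0} :=
    isOpen_ne_fun (continuous_snd.comp hq.continuous) continuous_const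
  have hp : ContDiffOn ℝ ∞ (T.par i j k) {z | (T.tau {i, j, k} (bary i j k z)).2 ≠ 0} :=
    fun z hz => ((contDiffAt_toSphere hz).comp z hq.contDiffAt).contDiffWithinAt
  have hsub : T.parDom i j k ⊆ {z | (T.tau {i, j, k} (bary i j k z)).2 ≠ 0} := fun z hz => hz.1
  refine ⟨⟨?_, hp.mono hsub, fun z hz => hz.2.1, fun z hz => hz.2.2⟩, ?_⟩
  · rw [isOpen_iff_mem_nhds]
    rintro z ⟨h1, h2, h3⟩
    have n1 := hW.mem_nhds h1
    obtain ⟨O, hO, hbO, hOs⟩ := exists_open_omega h2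
    have hc := hp.continuousOn.continuousAt n1
    have hd : ContinuousAt (fderiv ℝ (T.par i j k)) z :=
      (hp.continuousOn_fderiv_of_isOpen hW (by simp)).continuousAt n1
    filter_upwards [n1, hc.preimage_mem_nhds (hO.mem_nhds hbO),
      hd.preimage_mem_nhds (ContinuousLinearMap.isOpen_injective.mem_nhds h3)] with w w1 w2 w3
    exact ⟨w1, hOs ⟨w2, toSphere_mem w1⟩, w3⟩
  · intro z hz
    have h1 := snd_ne_zero_of_ideal (T.tau_mem hf hz).1
    refine ⟨h1, T.par_mem hf hz, ?_⟩
    have hdp : DifferentiableAt ℝ (T.par i j k) z := differentiableAt_of_smooth hW hp h1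
    have hdq : DifferentiableAt ℝ (fun z => T.tau {i, j, k} (bary i j k z)) z :=
      (hq.differentiable (by simp)).differentiableAt
    have e : fderiv ℝ (T.par i j k) z = fderiv ℝ (fun z => T.tau {i, j, k} (bary i j k z)) z := by
      rw [← hdp.fderivWithin (uniqueDiffOn_tri z hz), ← hdq.fderivWithin (uniqueDiffOn_tri z hz)]
      exact fderivWithin_congr (fun w hw => T.par_eq hf hw) (T.par_eq hf hz)
    rw [e]
    refine (injective_iff_map_eq_zero _).2 fun v hv => ?_
    have hc : fderiv ℝ (fun z => T.tau {i, j, k} (bary i j k z)) z v =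
        fderiv ℝ (T.tau {i, j, k}) (bary i j k z) (fderiv ℝ (bary i j k) z v) := by
      have := fderiv_comp (g := T.tau {i, j, k}) (f := bary i j k) z
        ((T.tau_spec hf).1.differentiable (by simp)).differentiableAt
        (contDiff_bary.differentiable (by simp)).differentiableAt
      rw [show (fun z => T.tau {i, j, k} (bary i j k z)) = T.tau {i, j, k} ∘ bary i j k from rfl,
        this]
      rfl
    rw [hc] at hv
    obtain ⟨n1, n2, n3⟩ := distinct_of_card (T.card_face _ hf)
    have h0 := ((T.tau_spec hf).2 ⟨_, T.bary_mem hf hz⟩ fun _ hl => bary_eq_zero z hl).2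
      (fderiv ℝ (bary i j k) z v) ?_ ?_ hv
    · rw [fderiv_bary] at h0
      have a1 := congrFun h0 j
      have a2 := congrFun h0 k
      simp [n1.symm, n2.symm, n3, n3.symm] at a1 a2
      exact Prod.ext a1 a2
    · intro l hl
      simp only [Finset.mem_insert, Finset.mem_singleton, not_or] at hl
      rw [fderiv_bary]
      simp [hl.1, hl.2.1, hl.2.2]
    · rw [fderiv_bary]
      simp [Finset.sum_add_distrib, ← Finset.mul_sum]
      ring

end SmoothTriangulation

/-! ### Tangent cones of a tiling of the plane -/

/-- The tangent cone of the standard triangle at `(s, 0)`, for `0 ≤ s < 1`. -/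
def cone (s : ℝ) : Set (ℝ × ℝ) := {v | 0 ≤ v.2 ∧ (s = 0 → 0 ≤ v.1)}

/-- The interior of `cone s`. -/
def coneInt (s : ℝ) : Set (ℝ × ℝ) := {v | 0 < v.2 ∧ (s = 0 → 0 < v.1)}

theorem isClosed_cone (s : ℝ) : IsClosed (cone s) := by
  by_cases h : s = 0
  · have : cone s = {v | 0 ≤ v.2} ∩ {v | 0 ≤ v.1} := by ext v; simp [cone, h]
    rw [this]
    exact (isClosed_le continuous_const continuous_snd).inter
      (isClosed_le continuous_const continuous_fst)
  · have : cone s = {v | 0 ≤ v.2} := by ext v; simp [cone, h]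
    rw [this]
    exact isClosed_le continuous_const continuous_snd

theorem isOpen_coneInt (s : ℝ) : IsOpen (coneInt s) := by
  by_cases h : s = 0
  · have : coneInt s = {v | 0 < v.2} ∩ {v | 0 < v.1} := by ext v; simp [coneInt, h]
    rw [this]
    exact (isOpen_lt continuous_const continuous_snd).inter
      (isOpen_lt continuous_const continuous_fst)
  · have : coneInt s = {v | 0 < v.2} := by ext v; simp [coneInt, h]
    rw [this]
    exact isOpen_lt continuous_const continuous_snd

theorem smul_sub_mem_cone {s c : ℝ} (hc : 0 ≤ c) {z : ℝ × ℝ} (hz : z ∈ tri) :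
    c • (z - (s, 0)) ∈ cone s := by
  refine ⟨?_, ?_⟩
  · simp only [Prod.smul_snd, Prod.snd_sub, sub_zero, smul_eq_mul]; exact mul_nonneg hc hz.2.1
  · rintro rfl
    simp only [Prod.smul_fst, Prod.fst_sub, sub_zero, smul_eq_mul]; exact mul_nonneg hc hz.1

theorem mem_triInt_of_cone {s c : ℝ} (hc : 0 < c) {z : ℝ × ℝ}
    (hz : c • (z - (s, 0)) ∈ coneInt s) (hz1 : s ≠ 0 → 0 < z.1) (hz2 : z.1 + z.2 < 1) :
    z ∈ triInt := by
  obtain ⟨h1, h2⟩ := hz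
  simp only [Prod.smul_snd, Prod.snd_sub, sub_zero, smul_eq_mul, Prod.smul_fst,
    Prod.fst_sub] at h1 h2
  refine ⟨?_, (mul_pos_iff_of_pos_left hc).1 h1, hz2⟩
  by_cases h : s = 0
  · have := (mul_pos_iff_of_pos_left hc).1 (h2 h)
    rw [h] at this; linarith
  · exact hz1 h

section planar
variable {ι : Type*} {S : Finset ι} {ζ : ι → ℝ × ℝ → ℝ × ℝ} {L : ι → (ℝ × ℝ) ≃L[ℝ] (ℝ × ℝ)}
  {s : ℝ} {y : ℝ × ℝ} (hL : ∀ a ∈ S, HasStrictFDerivAt (ζ a) (L a : ℝ × ℝ →L[ℝ] ℝ × ℝ) (s, 0))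
  (hy : ∀ a ∈ S, ζ a (s, 0) = y)
include hL hy

/-- A blow-up at y: the local inverse g satisfies c (g(y + v/c) - (s, 0)) → L⁻¹ v as c → ∞, which
carries statements about the tiling near y over to tangent cones. -/
theorem exists_local_inverse {a : ι} (ha : a ∈ S) (v : ℝ × ℝ) : ∃ g : ℝ × ℝ → ℝ × ℝ,
    (∀ᶠ z in 𝓝 (s, 0), g (ζ a z) = z) ∧ (∀ᶠ w in 𝓝 y, ζ a (g w) = w) ∧
    Tendsto (fun c : ℝ => c • (g (y + c⁻¹ • v) - (s, 0))) atTop (𝓝 ((L a).symm v)) ∧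
    Tendsto (fun c : ℝ => g (y + c⁻¹ • v)) atTop (𝓝 (s, 0)) := by
  have h := hL a ha
  have hg := h.to_localInverse
  have hgy : h.localInverse (ζ a) (L a) (s, 0) y = (s, 0) := by
    rw [← hy a ha]; exact h.localInverse_apply_image
  rw [hy a ha] at hg
  refine ⟨h.localInverse (ζ a) (L a) (s, 0), h.eventually_left_inverse, ?_, ?_, ?_⟩
  · have := h.eventually_right_inverse
    rwa [hy a ha] at this
  · have := hg.hasFDerivAt.lim_real v
    rw [hgy] at this
    exact this
  · have h0 : Tendsto (fun c : ℝ => y + c⁻¹ • v) atTop (𝓝 y) := by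
      have : Tendsto (fun c : ℝ => y + c⁻¹ • v) atTop (𝓝 (y + (0 : ℝ) • v)) :=
        (tendsto_inv_atTop_zero.smul_const v).const_add y
      simpa using this
    have := hg.continuousAt.tendsto.comp h0
    rw [hgy] at this
    exact this

/-- For large c the point y + v/c lies in some tile, and its rescaled coordinates lie in `cone s`.
If L⁻¹ v avoided this closed cone for each of the finitely many tiles, so would the rescaled
coordinates for large c. -/
theorem cones_cover
    (hcov : ∀ ε > 0, ∀ᶠ w in 𝓝 y, ∃ a ∈ S, ∃ z ∈ tri, dist z (s, 0) < ε ∧ ζ a z = w)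
    (v : ℝ × ℝ) : ∃ a ∈ S, (L a).symm v ∈ cone s := by
  choose! g hg using fun a (ha : a ∈ S) => exists_local_inverse hL hy ha v
  have h1 : ∀ᶠ z in 𝓝 ((s, 0) : ℝ × ℝ), ∀ a ∈ S, g a (ζ a z) = z :=
    (S.eventually_all).2 fun a ha => (hg a ha).1
  obtain ⟨ε, hε, h1⟩ := Metric.eventually_nhds_iff.1 h1
  have h0 : Tendsto (fun c : ℝ => y + c⁻¹ • v) atTop (𝓝 y) := by
    have : Tendsto (fun c : ℝ => y + c⁻¹ • v) atTop (𝓝 (y + (0 : ℝ) • v)) :=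
      (tendsto_inv_atTop_zero.smul_const v).const_add y
    simpa using this
  have h2 : ∀ᶠ c : ℝ in atTop, ∃ a ∈ S, c • (g a (y + c⁻¹ • v) - (s, 0)) ∈ cone s := by
    filter_upwards [h0.eventually (hcov ε hε), eventually_ge_atTop 0] with c hc hc0
    obtain ⟨a, ha, z, hz, hd, he⟩ := hc
    refine ⟨a, ha, ?_⟩
    rw [← he, h1 hd a ha]
    exact smul_sub_mem_cone hc0 hz
  by_contra hcon
  push Not at hcon
  have h3 : ∀ᶠ c : ℝ in atTop, ∀ a ∈ S, c • (g a (y + c⁻¹ • v) - (s, 0)) ∉ cone s :=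
    (S.eventually_all).2 fun a ha =>
      (hg a ha).2.2.1.eventually ((isClosed_cone s).isOpen_compl.mem_nhds (hcon a ha))
  obtain ⟨c, ⟨a, ha, hc⟩, hc'⟩ := (h2.and h3).exists
  exact hc' a ha hc

/-- A direction interior to both cones would, for large c, put y + v/c in the interiors of two
tiles. -/
theorem cones_disjoint (hs0 : 0 ≤ s) (hs1 : s < 1) {a a' : ι} (ha : a ∈ S) (ha' : a' ∈ S)
    (hdis : ∀ᶠ p in 𝓝 (s, 0) ×ˢ 𝓝 (s, 0), p.1 ∈ triInt → p.2 ∈ triInt → ζ a p.1 ≠ ζ a' p.2)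
    {v : ℝ × ℝ} (hv : (L a).symm v ∈ coneInt s) : (L a').symm v ∉ coneInt s := by
  intro hv'
  obtain ⟨g, -, g1, g2, g3⟩ := exists_local_inverse hL hy ha v
  obtain ⟨g', -, g1', g2', g3'⟩ := exists_local_inverse hL hy ha' v
  have h0 : Tendsto (fun c : ℝ => y + c⁻¹ • v) atTop (𝓝 y) := by
    have : Tendsto (fun c : ℝ => y + c⁻¹ • v) atTop (𝓝 (y + (0 : ℝ) • v)) :=
      (tendsto_inv_atTop_zero.smul_const v).const_add y
    simpa using this
  have hN : ∀ᶠ z in 𝓝 ((s, 0) : ℝ × ℝ), (s ≠ 0 → 0 < z.1) ∧ z.1 + z.2 < 1 := by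
    have n1 : ∀ᶠ z in 𝓝 ((s, 0) : ℝ × ℝ), z.1 + z.2 < 1 :=
      (continuous_fst.add continuous_snd).continuousAt.eventually
        (gt_mem_nhds (by simpa using hs1))
    by_cases h : s = 0
    · filter_upwards [n1] with z hz
      exact ⟨fun h' => absurd h h', hz⟩
    · have n2 : ∀ᶠ z in 𝓝 ((s, 0) : ℝ × ℝ), 0 < z.1 :=
        continuous_fst.continuousAt.eventually (lt_mem_nhds (lt_of_le_of_ne hs0 (Ne.symm h)))
      filter_upwards [n1, n2] with z hz hz'
      exact ⟨fun _ => hz', hz⟩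
  have hev := (g3.prodMk g3').eventually hdis
  obtain ⟨c, hc⟩ := (((h0.eventually g1).and (h0.eventually g1')).and
    ((((g2.eventually ((isOpen_coneInt s).mem_nhds hv)).and
    (g2'.eventually ((isOpen_coneInt s).mem_nhds hv'))).and
    ((g3.eventually hN).and (g3'.eventually hN))).and
    (hev.and (eventually_gt_atTop (0 : ℝ))))).exists
  obtain ⟨⟨e1, e2⟩, ⟨⟨k1, k2⟩, n1, n2⟩, hd, hc0⟩ := hc
  exact hd (mem_triInt_of_cone hc0 k1 n1.1 n1.2) (mem_triInt_of_cone hc0 k2 n2.1 n2.2)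
    (e1.trans e2.symm)

end planar

/-! ### The triangles of ∂M around a point -/

variable {Γ : Subgroup (Mink ≃ₗ[ℝ] Mink)}

theorem IsLocalParam.act (hΓ : IsHyperbolicManifoldGroup Γ) {γ : Mink ≃ₗ[ℝ] Mink} (hγ : γ ∈ Γ)
    {U : Set (ℝ × ℝ)} {p : ℝ × ℝ → Mink} (hp : IsLocalParam Γ U p) :
    IsLocalParam Γ U (fun z => idealAct γ (p z)) := by
  have hs : ContDiffOn ℝ ∞ (fun z => idealAct γ (p z)) U := fun z hz =>
    (contDiffAt_idealAct γ (ideal_fst_pos hΓ hγ (hp.mapsTo hz).1).ne').comp_contDiffWithinAt z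
      (hp.smooth z hz)
  refine ⟨hp.isOpen, hs, fun z hz => idealAct_omega hΓ hγ (hp.mapsTo hz), fun u hu => ?_⟩
  have hm := idealAct_mem hΓ hγ (hp.mapsTo hu).1
  have hd : DifferentiableAt ℝ (idealAct γ⁻¹) (idealAct γ (p u)) :=
    (contDiffAt_idealAct γ⁻¹ (ideal_fst_pos hΓ (Γ.inv_mem hγ) hm).ne' (n := 1)).differentiableAt
      one_ne_zero
  have he : fderiv ℝ p u = fderiv ℝ (idealAct γ⁻¹ ∘ fun z => idealAct γ (p z)) u :=
    fderiv_congr_on hp.isOpen (fun z hz => (idealAct_inv_cancel hΓ hγ (hp.mapsTo hz).1).symm) hu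
  rw [fderiv_comp u hd (differentiableAt_of_smooth hp.isOpen hs hu)] at he
  have := hp.immersion u hu
  rw [he] at this
  exact Function.Injective.of_comp this

/-- Reading a parametrization in a chart of the sphere gives a planar local diffeomorphism, so all
triangles around a point can be compared in one plane. -/
theorem IsLocalParam.exists_planar {U : Set (ℝ × ℝ)} {p : ℝ × ℝ → Mink} (hp : IsLocalParam Γ U p)
    {x : ℝ × ℝ} (hx : x ∈ U) {sg : ℝ} (hsg : sg ^ 2 = 1) (hne : sg * (p x).2 2 ≠ 1) :
    ∃ L : (ℝ × ℝ) ≃L[ℝ] (ℝ × ℝ),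
      HasStrictFDerivAt (fun z => chartInv sg (p z)) (L : ℝ × ℝ →L[ℝ] ℝ × ℝ) x ∧
      (∀ᶠ z in 𝓝 x, chart sg (chartInv sg (p z)) = p z) ∧
      ∀ v, fderiv ℝ p x v = fderiv ℝ (chart sg) (chartInv sg (p x)) (L v) := by
  have hpc : ContDiffAt ℝ ∞ p x := hp.smooth.contDiffAt (hp.isOpen.mem_nhds hx)
  have hc : ContDiffAt ℝ ∞ (fun z => chartInv sg (p z)) x := (contDiffAt_chartInv sg hne).comp x hpc
  have hd := (hc.hasStrictFDerivAt (by simp)).hasFDerivAt.differentiableAt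
  have hev : ∀ᶠ z in 𝓝 x, chart sg (chartInv sg (p z)) = p z := by
    have hcont : ContinuousAt (fun z => sg * (p z).2 2) x := by
      have h2 : Continuous fun y : Mink => sg * y.2 2 := by fun_prop
      exact h2.continuousAt.comp hpc.continuousAt
    filter_upwards [hp.isOpen.mem_nhds hx, hcont.eventually_ne hne] with z hz hz'
    exact chart_chartInv hsg (hp.mapsTo hz).1 hz'
  have hdc : DifferentiableAt ℝ (chart sg) (chartInv sg (p x)) :=
    ((contDiff_chart sg (n := 1)).differentiable one_ne_zero).differentiableAt
  have hf : fderiv ℝ p x = (fderiv ℝ (chart sg) (chartInv sg (p x))).comp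
      (fderiv ℝ (fun z => chartInv sg (p z)) x) := by
    rw [← fderiv_comp x hdc hd]
    exact (Filter.EventuallyEq.fderiv_eq hev).symm
  have hinj : Function.Injective (fderiv ℝ (fun z => chartInv sg (p z)) x) := by
    have := hp.immersion x hx
    rw [hf] at this
    exact Function.Injective.of_comp this
  obtain ⟨L, hL⟩ : ∃ L : (ℝ × ℝ) ≃L[ℝ] (ℝ × ℝ), (L : ℝ × ℝ →L[ℝ] ℝ × ℝ) =
      fderiv ℝ (fun z => chartInv sg (p z)) x :=
    ⟨(LinearEquiv.ofInjectiveEndo _ hinj).toContinuousLinearEquiv,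
      ContinuousLinearMap.ext fun v => rfl⟩
  refine ⟨L, ?_, hev, fun v => ?_⟩
  · rw [hL]; exact hc.hasStrictFDerivAt (by simp)
  · rw [hf, ← hL]; rfl

/-- Lying in the same orbit is already an equivalence relation, so the equivalence generated by the
quotient adds nothing. -/
theorem quot_eq_iff (hΓ : IsHyperbolicManifoldGroup Γ) {b c : discontinuityDomain Γ} :
    (Quot.mk _ b : BoundaryAtInfinity Γ) = Quot.mk _ c ↔ ∃ γ ∈ Γ, idealAct γ b = (c : Mink) := by
  refine ⟨fun h => ?_, fun h => Quot.sound h⟩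
  have he : Equivalence fun b c : discontinuityDomain Γ => ∃ γ ∈ Γ, idealAct γ b = (c : Mink) :=
    ⟨fun b => ⟨1, Γ.one_mem, idealAct_one b.2.1⟩,
      fun {b c} ⟨γ, hγ, h⟩ => ⟨γ⁻¹, Γ.inv_mem hγ, by
        rw [← h]; exact idealAct_inv_cancel hΓ hγ b.2.1⟩,
      fun {b c d} ⟨γ, hγ, h⟩ ⟨δ, hδ, h'⟩ => ⟨δ * γ, Γ.mul_mem hδ hγ, by
        rw [idealAct_mul hΓ _ hγ b.2.1, h, h']⟩⟩
  exact he.eqvGen_iff.1 (Quot.eqvGen_exact h)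

namespace SmoothTriangulation
variable (T : SmoothTriangulation Γ)

/-- The point of the complex that corresponds to a point of the domain of discontinuity. -/
def loc (b : discontinuityDomain Γ) : realization T.n T.faces := T.homeo.symm (Quot.mk _ b)

theorem continuous_loc : Continuous T.loc :=
  T.homeo.symm.continuous.comp continuous_quot_mk

theorem loc_eq_iff (hΓ : IsHyperbolicManifoldGroup Γ) {b c : discontinuityDomain Γ} :
    T.loc b = T.loc c ↔ ∃ γ ∈ Γ, idealAct γ b = (c : Mink) := by
  rw [loc, loc, T.homeo.symm.injective.eq_iff, quot_eq_iff hΓ]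

theorem loc_act (hΓ : IsHyperbolicManifoldGroup Γ) {γ : Mink ≃ₗ[ℝ] Mink} (hγ : γ ∈ Γ)
    (b : discontinuityDomain Γ) : T.loc ⟨idealAct γ b, idealAct_omega hΓ hγ b.2⟩ = T.loc b :=
  ((T.loc_eq_iff hΓ).2 ⟨γ, hγ, rfl⟩).symm

theorem loc_par {i j k : Fin T.n} (hf : {i, j, k} ∈ T.faces) {z : ℝ × ℝ} (hz : z ∈ tri) :
    T.loc ⟨_, T.par_mem hf hz⟩ = ⟨_, T.bary_mem hf hz⟩ := by
  rw [loc, ← T.homeo_bary hf hz, Homeomorph.symm_apply_apply]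

/-- The set of vertices of an ordered triangle. -/
def verts (a : Fin T.n × Fin T.n × Fin T.n) : Finset (Fin T.n) := {a.1, a.2.1, a.2.2}

/-- `S` lists once each triangle that contains the point `t`, ordered in such a way that `t` has
the coordinates `(s, 0)`. -/
structure IsStar (t : Fin T.n → ℝ) (s : ℝ) (S : Finset (Fin T.n × Fin T.n × Fin T.n)) : Prop where
  mem_faces : ∀ a ∈ S, T.verts a ∈ T.faces
  coord : ∀ a ∈ S, bary a.1 a.2.1 a.2.2 (s, 0) = t
  complete : ∀ f ∈ T.faces, (∀ l ∉ f, t l = 0) → ∃ a ∈ S, T.verts a = f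
  inj : ∀ a ∈ S, ∀ a' ∈ S, T.verts a = T.verts a' → a = a'

theorem exists_bary_eq {i j k : Fin T.n} (hf : {i, j, k} ∈ T.faces) {t : Fin T.n → ℝ}
    (ht : t ∈ realization T.n T.faces) (h0 : ∀ l ∉ ({i, j, k} : Finset (Fin T.n)), t l = 0) :
    (t j, t k) ∈ tri ∧ bary i j k (t j, t k) = t := by
  obtain ⟨n1, n2, n3⟩ := distinct_of_card (T.card_face _ hf)
  have hsum : t i + t j + t k = 1 := by
    rw [← ht.2.1, ← Finset.sum_subset (Finset.subset_univ {i, j, k}) fun l _ hl => h0 l hl,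
      Finset.sum_insert (by simp [n1, n2]), Finset.sum_insert (by simp [n3]), Finset.sum_singleton]
    ring
  refine ⟨⟨ht.1 j, ht.1 k, ?_⟩, ?_⟩
  · have := ht.1 i; simp only; linarith
  · funext l
    by_cases hl : l ∈ ({i, j, k} : Finset (Fin T.n))
    · rw [bary_apply]
      simp only [Finset.mem_insert, Finset.mem_singleton] at hl
      rcases hl with rfl | rfl | rfl
      · rw [if_pos rfl, if_neg n1, if_neg n2]; linarith
      · rw [if_neg n1.symm, if_pos rfl, if_neg n3]; linarith
      · rw [if_neg n2.symm, if_neg n3.symm, if_pos rfl]; linarith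
    · rw [bary_eq_zero _ hl, h0 l hl]

theorem bary_pos_iff {i j k : Fin T.n} (hf : {i, j, k} ∈ T.faces) {z : ℝ × ℝ} (hz : z ∈ triInt)
    (l : Fin T.n) : 0 < bary i j k z l ↔ l ∈ ({i, j, k} : Finset (Fin T.n)) := by
  obtain ⟨n1, n2, n3⟩ := distinct_of_card (T.card_face _ hf)
  obtain ⟨h1, h2, h3⟩ := hz
  constructor
  · intro h
    by_contra hl
    rw [bary_eq_zero _ hl] at h
    exact lt_irrefl _ h
  · intro hl
    rw [bary_apply]
    simp only [Finset.mem_insert, Finset.mem_singleton] at hl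
    rcases hl with rfl | rfl | rfl
    · rw [if_pos rfl, if_neg n1, if_neg n2]; linarith
    · rw [if_neg n1.symm, if_pos rfl, if_neg n3]; linarith
    · rw [if_neg n2.symm, if_neg n3.symm, if_pos rfl]; linarith

/-- The point of the complex is an invariant of the orbit, and for an interior point of a triangle
its set of positive barycentric coordinates is the vertex set. -/
theorem act_par_ne (hΓ : IsHyperbolicManifoldGroup Γ) {i j k i' j' k' : Fin T.n}
    (hf : {i, j, k} ∈ T.faces) (hf' : {i', j', k'} ∈ T.faces)
    {γ γ' : Mink ≃ₗ[ℝ] Mink} (hγ : γ ∈ Γ) (hγ' : γ' ∈ Γ) {z z' : ℝ × ℝ} (hz : z ∈ triInt)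
    (hz' : z' ∈ triInt) (h : idealAct γ (T.par i j k z) = idealAct γ' (T.par i' j' k' z')) :
    ({i, j, k} : Finset (Fin T.n)) = {i', j', k'} ∧ bary i j k z = bary i' j' k' z' := by
  have h1 := T.loc_act hΓ hγ ⟨_, T.par_mem hf (triInt_subset hz)⟩
  have h2 := T.loc_act hΓ hγ' ⟨_, T.par_mem hf' (triInt_subset hz')⟩
  have h3 : (⟨_, T.bary_mem hf (triInt_subset hz)⟩ : realization T.n T.faces) =
      ⟨_, T.bary_mem hf' (triInt_subset hz')⟩ := by
    rw [← T.loc_par hf (triInt_subset hz), ← T.loc_par hf' (triInt_subset hz'), ← h1, ← h2]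
    congr 1
    exact Subtype.ext h
  have h4 := congrArg Subtype.val h3
  simp only at h4
  refine ⟨?_, h4⟩
  ext l
  rw [← T.bary_pos_iff hf hz, ← T.bary_pos_iff hf' hz', h4]

/-- The triangles around a point cover a neighborhood of it. -/
theorem eventually_covered (hΓ : IsHyperbolicManifoldGroup Γ) (hfree : FreeAtInfinity Γ)
    {s : ℝ} {S : Finset (Fin T.n × Fin T.n × Fin T.n)} {b : discontinuityDomain Γ}
    (hS : T.IsStar (T.loc b) s S) (hs : (s, 0) ∈ tri)
    {γ : Fin T.n × Fin T.n × Fin T.n → Mink ≃ₗ[ℝ] Mink}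
    (hγ : ∀ a ∈ S, γ a ∈ Γ)
    (hb : ∀ a ∈ S, idealAct (γ a) (T.par a.1 a.2.1 a.2.2 (s, 0)) = b) {ε : ℝ} (hε : 0 < ε) :
    ∀ᶠ c in 𝓝 (b : Mink), c ∈ idealSphere → ∃ a ∈ S, ∃ z ∈ tri, dist z (s, 0) < ε ∧
      idealAct (γ a) (T.par a.1 a.2.1 a.2.2 z) = c := by
  obtain ⟨W, hW, hinj⟩ := exists_nhds_injective hΓ hfree b.2
  have hcont : ∀ a ∈ S, ContinuousAt (fun z => idealAct (γ a) (T.par a.1 a.2.1 a.2.2 z)) (s, 0) := by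
    intro a ha
    obtain ⟨hp, ht⟩ := T.isLocalParam_par (hS.mem_faces a ha)
    exact ((hp.act hΓ (hγ a ha)).differentiableAt (ht hs)).continuousAt
  have hδ : ∀ᶠ z in 𝓝 ((s, 0) : ℝ × ℝ), dist z (s, 0) < ε ∧
      ∀ a ∈ S, idealAct (γ a) (T.par a.1 a.2.1 a.2.2 z) ∈ W :=
    (Metric.eventually_nhds_iff.2 ⟨ε, hε, fun _ h => h⟩).and ((S.eventually_all).2 fun a ha =>
      (hcont a ha).preimage_mem_nhds (by rw [hb a ha]; exact hW))
  obtain ⟨δ, hδ0, hδ⟩ := Metric.eventually_nhds_iff.1 hδ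
  set t := T.loc b with ht
  -- Coordinates positive at t stay positive nearby, so a triangle that contains t' also contains t
  -- and belongs to the star.
  have h1 : ∀ᶠ t' : realization T.n T.faces in 𝓝 t, (∀ l, 0 < t.1 l → 0 < t'.1 l) ∧
      ∀ l, dist (t'.1 l) (t.1 l) < δ := by
    have hc : ∀ l, Continuous fun t' : realization T.n T.faces => t'.1 l := fun l =>
      (continuous_apply l).comp continuous_subtype_val
    refine (eventually_all.2 fun l => ?_).and (eventually_all.2 fun l =>
      (hc l).continuousAt.eventually (Metric.ball_mem_nhds _ hδ0))
    by_cases hl : 0 < t.1 l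
    · filter_upwards [(hc l).continuousAt.eventually (lt_mem_nhds hl)] with t' ht' _
      exact ht'
    · exact Eventually.of_forall fun t' h => absurd h hl
  have h2 := T.continuous_loc.continuousAt.eventually h1
  rw [nhds_subtype_eq_comap, eventually_comap] at h2
  have hΩ : ∀ᶠ c in 𝓝 (b : Mink), c ∈ idealSphere → c ∈ discontinuityDomain Γ :=
    eventually_nhdsWithin_iff.1 (omega_mem_nhdsWithin b.2)
  filter_upwards [h2, hΩ, hW] with c hc hcΩ hcW hcs
  specialize hc ⟨c, hcΩ hcs⟩ rfl
  obtain ⟨hc1, hc2⟩ := hc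
  set t' := T.loc ⟨c, hcΩ hcs⟩ with ht'
  obtain ⟨f, hf, hf0⟩ := t'.2.2.2
  obtain ⟨a, ha, rfl⟩ := hS.complete f hf fun l hl => by
    by_contra hne
    have := hc1 l (lt_of_le_of_ne (t.2.1 l) (Ne.symm hne))
    rw [hf0 l hl] at this
    exact lt_irrefl _ this
  obtain ⟨e1, e2⟩ := T.exists_bary_eq hf t'.2 hf0
  have e3 := T.exists_bary_eq hf t.2 (fun l hl => by
    rw [← hS.coord a ha]; exact bary_eq_zero _ hl)
  obtain ⟨n1, n2, n3⟩ := distinct_of_card (T.card_face _ hf)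
  have hst : (t.1 a.2.1, t.1 a.2.2) = (s, 0) := by
    rw [← hS.coord a ha, bary_apply, bary_apply]
    simp [n1.symm, n2.symm, n3, n3.symm]
  have hdist : dist ((t'.1 a.2.1, t'.1 a.2.2) : ℝ × ℝ) (s, 0) < δ := by
    rw [← hst, Prod.dist_eq]
    exact max_lt (hc2 _) (hc2 _)
  obtain ⟨d1, d2⟩ := hδ hdist
  refine ⟨a, ha, _, e1, d1, ?_⟩
  have hl := T.loc_par hf e1
  have hl' : T.loc ⟨_, T.par_mem hf e1⟩ = T.loc ⟨c, hcΩ hcs⟩ := by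
    rw [hl]; exact Subtype.ext e2
  obtain ⟨β, hβ, hβc⟩ := (T.loc_eq_iff hΓ).1 hl'
  simp only at hβc
  have hpm := (T.par_mem hf e1).1
  have hga := hγ a ha
  -- The triangle point is carried to c by some β, and by γ a to another point of W. No nontrivial
  -- element of Γ identifies points of W, so β = γ a.
  have key := hinj (β * (γ a)⁻¹) (Γ.mul_mem hβ (Γ.inv_mem hga))
    (idealAct (γ a) (T.par a.1 a.2.1 a.2.2 (t'.1 a.2.1, t'.1 a.2.2)))
    ⟨d2 a ha, idealAct_mem hΓ hga hpm⟩ (by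
      rw [idealAct_mul hΓ _ (Γ.inv_mem hga) (idealAct_mem hΓ hga hpm),
        idealAct_inv_cancel hΓ hga hpm, hβc]; exact hcW)
  rw [mul_inv_eq_one] at key
  rw [← key, hβc]

end SmoothTriangulation

/-! ### Areas of sectors -/

/-- The open unit disc. -/
def disc : Set (ℝ × ℝ) := {v | v.1 ^ 2 + v.2 ^ 2 < 1}

theorem isOpen_disc : IsOpen disc := isOpen_lt (by fun_prop) continuous_const

theorem volume_of_polar {A : Set (ℝ × ℝ)} (hA : MeasurableSet A) {a b : ℝ} (ha : -Real.pi ≤ a)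
    (hb : b ≤ Real.pi) (h : ∀ r θ, 0 < r → θ ∈ Ioo (-Real.pi) Real.pi →
      ((r * Real.cos θ, r * Real.sin θ) ∈ A ↔ r < 1 ∧ a < θ ∧ θ < b)) :
    volume A = ENNReal.ofReal ((b - a) / 2) := by
  have h1 := lintegral_comp_polarCoord_symm (A.indicator 1)
  rw [lintegral_indicator_one hA] at h1
  rw [← h1]
  have hsub : Ioo (0 : ℝ) 1 ×ˢ Ioo a b ⊆ polarCoord.target := by
    rintro ⟨r, θ⟩ ⟨hr, hθ⟩
    exact ⟨hr.1, ha.trans_lt hθ.1, hθ.2.trans_le hb⟩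
  have h2 : ∫⁻ p in polarCoord.target,
      ENNReal.ofReal p.1 • A.indicator (1 : ℝ × ℝ → ENNReal) (polarCoord.symm p) =
      ∫⁻ p in polarCoord.target,
        (Ioo (0 : ℝ) 1 ×ˢ Ioo a b).indicator (fun p => ENNReal.ofReal p.1) p := by
    refine setLIntegral_congr_fun polarCoord.open_target.measurableSet ?_
    rintro ⟨r, θ⟩ ⟨hr, hθ⟩
    have hr' : 0 < r := hr
    have hk := h r θ hr' hθ
    have hsym : polarCoord.symm (r, θ) = (r * Real.cos θ, r * Real.sin θ) := rfl
    simp only [hsym]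
    by_cases hm : (r * Real.cos θ, r * Real.sin θ) ∈ A
    · obtain ⟨k1, k2, k3⟩ := hk.1 hm
      have hmem : (r, θ) ∈ Ioo (0 : ℝ) 1 ×ˢ Ioo a b := ⟨⟨hr', k1⟩, k2, k3⟩
      rw [indicator_of_mem hm, indicator_of_mem hmem]
      simp
    · rw [indicator_of_notMem hm, indicator_of_notMem
        (fun hh : (r, θ) ∈ Ioo (0 : ℝ) 1 ×ˢ Ioo a b => hm (hk.2 ⟨hh.1.2, hh.2.1, hh.2.2⟩))]
      simp
  have hms : MeasurableSet (Ioo (0 : ℝ) 1 ×ˢ Ioo a b) := measurableSet_Ioo.prod measurableSet_Ioo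
  rw [h2, setLIntegral_indicator hms, inter_eq_left.2 hsub, Measure.volume_eq_prod,
    ← Measure.prod_restrict, lintegral_prod _ (by fun_prop)]
  simp only [lintegral_const, Measure.restrict_apply_univ, Real.volume_Ioo]
  rw [lintegral_mul_const _ (by fun_prop), ← ofReal_integral_eq_lintegral_ofReal,
    ← integral_Ioc_eq_integral_Ioo, ← intervalIntegral.integral_of_le zero_le_one, integral_id,
    ← ENNReal.ofReal_mul (by norm_num)]
  · congr 1; ring
  · exact (continuous_id.integrableOn_Icc).mono_set Ioo_subset_Icc_self
  · filter_upwards [ae_restrict_mem measurableSet_Ioo] with x hx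
    exact hx.1.le

theorem mem_disc_polar (r θ : ℝ) (hr : 0 < r) :
    (r * Real.cos θ, r * Real.sin θ) ∈ disc ↔ r < 1 := by
  have : (r * Real.cos θ) ^ 2 + (r * Real.sin θ) ^ 2 = r ^ 2 := by
    rw [mul_pow, mul_pow, ← mul_add, Real.cos_sq_add_sin_sq, mul_one]
  rw [disc, mem_ofPred_eq]
  simp only [this]
  exact sq_lt_one_iff₀ hr.le

theorem volume_disc : volume disc = ENNReal.ofReal Real.pi := by
  rw [volume_of_polar isOpen_disc.measurableSet le_rfl le_rfl]
  · congr 1; ring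
  · intro r θ hr hθ
    rw [mem_disc_polar r θ hr]
    exact ⟨fun h => ⟨h, hθ.1, hθ.2⟩, fun h => h.1⟩

theorem volume_standard_sector {α : ℝ} (h0 : 0 < α) (h1 : α ≤ Real.pi) :
    volume ({w : ℝ × ℝ | 0 < w.2 ∧ 0 < w.1 * Real.sin α - w.2 * Real.cos α} ∩ disc) =
      ENNReal.ofReal (α / 2) := by
  have ho : IsOpen ({w : ℝ × ℝ | 0 < w.2 ∧ 0 < w.1 * Real.sin α - w.2 * Real.cos α} ∩ disc) :=
    ((isOpen_lt continuous_const continuous_snd).and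
      (isOpen_lt continuous_const ((continuous_fst.mul continuous_const).sub
        (continuous_snd.mul continuous_const)))).inter isOpen_disc
  rw [volume_of_polar ho.measurableSet (a := 0) (by linarith [Real.pi_pos]) h1, sub_zero]
  intro r θ hr hθ
  have e : r * Real.cos θ * Real.sin α - r * Real.sin θ * Real.cos α = r * Real.sin (α - θ) := by
    rw [Real.sin_sub]; ring
  rw [mem_inter_iff, mem_disc_polar r θ hr, mem_ofPred_eq]
  simp only [e, mul_pos_iff_of_pos_left hr]
  constructor
  · rintro ⟨⟨k1, k2⟩, k3⟩
    have t0 : 0 < θ := by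
      by_contra hn
      exact absurd (Real.sin_nonpos_of_nonpos_of_neg_pi_le (not_lt.1 hn) hθ.1.le) (not_le.2 k1)
    refine ⟨k3, t0, ?_⟩
    by_contra hn
    exact absurd (Real.sin_nonpos_of_nonpos_of_neg_pi_le (by linarith : α - θ ≤ 0)
      (by linarith [hθ.2])) (not_le.2 k2)
  · rintro ⟨k1, k2, k3⟩
    exact ⟨⟨Real.sin_pos_of_pos_of_lt_pi k2 hθ.2, Real.sin_pos_of_pos_of_lt_pi (by linarith)
      (by linarith)⟩, k1⟩

/-- The cross product in the plane. -/
def cross (x y : ℝ × ℝ) : ℝ := x.1 * y.2 - x.2 * y.1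

/-- The dot product in the plane. -/
def dot (x y : ℝ × ℝ) : ℝ := x.1 * y.1 + x.2 * y.2

/-- Rotating a nonzero vector `x` to the positive first axis preserves areas in the disc. -/
theorem volume_rotate {x : ℝ × ℝ} (hx : 0 < dot x x) {e : ℝ} (he : e ^ 2 = 1) (A : Set (ℝ × ℝ)) :
    volume ({v | (dot v x / √(dot x x), e * cross x v / √(dot x x)) ∈ A} ∩ disc) =
      volume (A ∩ disc) := by
  obtain ⟨q, hq⟩ : ∃ q, q = √(dot x x) := ⟨_, rfl⟩
  have hq0 : 0 < q := hq ▸ Real.sqrt_pos.2 hx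
  have hqs : q ^ 2 = x.1 ^ 2 + x.2 ^ 2 := by rw [hq, Real.sq_sqrt hx.le, dot]; ring
  rw [← hq]
  set f : ℝ × ℝ →ₗ[ℝ] ℝ × ℝ := Matrix.toLin (Module.Basis.finTwoProd ℝ) (Module.Basis.finTwoProd ℝ)
    !![x.1 / q, x.2 / q; -(e * x.2 / q), e * x.1 / q] with hf
  have hfa : ∀ v, f v = (dot v x / q, e * cross x v / q) := fun v => by
    rw [hf, Matrix.toLin_finTwoProd_apply, dot, cross]
    ext <;> simp only <;> ring
  have hdet : LinearMap.det f = e := by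
    rw [hf, LinearMap.det_toLin, Matrix.det_fin_two_of]
    field_simp
    rw [hqs]; ring
  have he1 : |e⁻¹| = 1 := by
    rw [abs_inv, ← sq_eq_sq₀ (by positivity) zero_le_one, inv_pow, sq_abs, he]; norm_num
  have he0 : e ≠ 0 := by rintro rfl; norm_num at he
  have h := Measure.addHaar_preimage_linearMap (volume : Measure (ℝ × ℝ)) (f := f)
    (by rw [hdet]; exact he0) (A ∩ disc)
  rw [hdet, he1, ENNReal.ofReal_one, one_mul] at h
  rw [← h]
  congr 1
  ext v
  simp only [mem_inter_iff, mem_ofPred_eq, mem_preimage, hfa]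
  refine and_congr_right fun _ => ?_
  have : (dot v x / q) ^ 2 + (e * cross x v / q) ^ 2 = v.1 ^ 2 + v.2 ^ 2 := by
    rw [div_pow, div_pow, mul_pow, he, hqs, dot, cross]
    have : x.1 ^ 2 + x.2 ^ 2 ≠ 0 := by rw [← hqs]; positivity
    field_simp
    ring
  simp only [disc, mem_ofPred_eq, this]

/-- The two conditions say that v has positive coordinates in the basis (x, y). An orthogonal map
taking x to the positive first axis, with the sign e correcting the orientation of (x, y), reduces
the sector to the standard one. -/
theorem volume_sector {x y : ℝ × ℝ} (h : cross x y ≠ 0) :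
    volume ({v | 0 < cross x v / cross x y ∧ 0 < cross v y / cross x y} ∩ disc) =
      ENNReal.ofReal (Real.arccos (dot x y / √(dot x x * dot y y)) / 2) := by
  have hlag : dot x x * dot y y - dot x y ^ 2 = cross x y ^ 2 := by simp only [dot, cross]; ring
  have hc2 : 0 < cross x y ^ 2 := by positivity
  have hxx : 0 < dot x x := by
    have h0 : 0 ≤ dot x x := by simp only [dot]; nlinarith [sq_nonneg x.1, sq_nonneg x.2]
    refine lt_of_le_of_ne h0 fun hz => ?_
    rw [← hz] at hlag; nlinarith [sq_nonneg (dot x y)]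
  have hyy : 0 < dot y y := by
    have h0 : 0 ≤ dot y y := by simp only [dot]; nlinarith [sq_nonneg y.1, sq_nonneg y.2]
    refine lt_of_le_of_ne h0 fun hz => ?_
    rw [← hz] at hlag; nlinarith [sq_nonneg (dot x y)]
  obtain ⟨e, he, hec⟩ : ∃ e : ℝ, e ^ 2 = 1 ∧ 0 < e * cross x y := by
    rcases lt_or_gt_of_ne h with h | h
    · exact ⟨-1, by norm_num, by linarith⟩
    · exact ⟨1, by norm_num, by linarith⟩
  obtain ⟨q, hq⟩ : ∃ q, q = √(dot x x) := ⟨_, rfl⟩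
  obtain ⟨p, hp⟩ : ∃ p, p = √(dot y y) := ⟨_, rfl⟩
  have hq0 : 0 < q := hq ▸ Real.sqrt_pos.2 hxx
  have hp0 : 0 < p := hp ▸ Real.sqrt_pos.2 hyy
  have hqs : q ^ 2 = dot x x := by rw [hq, Real.sq_sqrt hxx.le]
  have hps : p ^ 2 = dot y y := by rw [hp, Real.sq_sqrt hyy.le]
  have hqp : √(dot x x * dot y y) = q * p := by rw [Real.sqrt_mul hxx.le, hq, hp]
  rw [hqp]
  set α := Real.arccos (dot x y / (q * p)) with hα
  have hlt : (dot x y / (q * p)) ^ 2 < 1 := by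
    rw [div_pow, mul_pow, hqs, hps, div_lt_one (by positivity)]; linarith
  have habs := abs_lt.1 ((sq_lt_one_iff_abs_lt_one _).1 hlt)
  have hcos : Real.cos α = dot x y / (q * p) := Real.cos_arccos habs.1.le habs.2.le
  have hsin : Real.sin α = e * cross x y / (q * p) := by
    rw [hα, Real.sin_arccos, Real.sqrt_eq_iff_mul_self_eq_of_pos (by positivity)]
    rw [← sq, div_pow, div_pow, mul_pow, mul_pow, he, hqs, hps]
    field_simp
    linarith
  rw [← volume_standard_sector (Real.arccos_pos.2 habs.2) (Real.arccos_le_pi _),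
    ← hα, hcos, hsin, ← volume_rotate hxx he {w | 0 < w.2 ∧
      0 < w.1 * (e * cross x y / (q * p)) - w.2 * (dot x y / (q * p))}, ← hq]
  congr 2
  ext v
  simp only [mem_ofPred_eq]
  have hid : dot v x * cross x y - cross x v * dot x y = dot x x * cross v y := by
    simp only [dot, cross]; ring
  have e1 : 0 < cross x v / cross x y ↔ 0 < e * cross x v / q := by
    rw [show cross x v / cross x y = (e * cross x v / q) * (q / (e * cross x y)) by
      have : e ≠ 0 := by rintro rfl; norm_num at he
      field_simp, mul_pos_iff_of_pos_right (by positivity)]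
  have e2 : 0 < cross v y / cross x y ↔
      0 < dot v x / q * (e * cross x y / (q * p)) - e * cross x v / q * (dot x y / (q * p)) := by
    rw [show dot v x / q * (e * cross x y / (q * p)) - e * cross x v / q * (dot x y / (q * p)) =
      cross v y / cross x y * (e * cross x y / p) by
      field_simp
      rw [hqs]; linear_combination e * hid,
      mul_pos_iff_of_pos_right (by positivity)]
  rw [e1, e2]

theorem volume_half_disc {x y : ℝ × ℝ} (h : cross x y ≠ 0) :
    volume ({v | 0 < cross x v / cross x y} ∩ disc) = ENNReal.ofReal (Real.pi / 2) := by
  have hxx : 0 < dot x x := by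
    by_contra hn
    simp only [dot] at hn
    have h1 : x.1 = 0 := by nlinarith [sq_nonneg x.1, sq_nonneg x.2]
    have h2 : x.2 = 0 := by nlinarith [sq_nonneg x.1, sq_nonneg x.2]
    exact h (by simp [cross, h1, h2])
  obtain ⟨e, he, hec⟩ : ∃ e : ℝ, e ^ 2 = 1 ∧ 0 < e * cross x y := by
    rcases lt_or_gt_of_ne h with h | h
    · exact ⟨-1, by norm_num, by linarith⟩
    · exact ⟨1, by norm_num, by linarith⟩
  obtain ⟨q, hq⟩ : ∃ q, q = √(dot x x) := ⟨_, rfl⟩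
  have hq0 : 0 < q := hq ▸ Real.sqrt_pos.2 hxx
  rw [← volume_standard_sector Real.pi_pos le_rfl, ← volume_rotate hxx he {w | 0 < w.2 ∧
    0 < w.1 * Real.sin Real.pi - w.2 * Real.cos Real.pi}, ← hq]
  congr 2
  ext v
  simp only [mem_ofPred_eq, Real.sin_pi, Real.cos_pi, mul_zero, mul_neg, mul_one, zero_sub, neg_neg,
    and_self]
  rw [show cross x v / cross x y = (e * cross x v / q) * (q / (e * cross x y)) by
      have : e ≠ 0 := by rintro rfl; norm_num at he
      field_simp, mul_pos_iff_of_pos_right (by positivity)]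

/-- The angle at the apex of the image of the cone `cone s` under `L`. -/
def coneAngle (s : ℝ) (L : (ℝ × ℝ) ≃L[ℝ] (ℝ × ℝ)) : ℝ :=
  if s = 0 then Real.arccos (dot (L (1, 0)) (L (0, 1)) /
    √(dot (L (1, 0)) (L (1, 0)) * dot (L (0, 1)) (L (0, 1)))) else Real.pi

theorem coneAngle_nonneg (s : ℝ) (L : (ℝ × ℝ) ≃L[ℝ] (ℝ × ℝ)) : 0 ≤ coneAngle s L := by
  unfold coneAngle
  split_ifs
  · exact Real.arccos_nonneg _
  · exact Real.pi_pos.le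

theorem cross_apply_ne_zero (L : (ℝ × ℝ) ≃L[ℝ] (ℝ × ℝ)) : cross (L (1, 0)) (L (0, 1)) ≠ 0 ∧
    ∀ v, L.symm v = (cross v (L (0, 1)) / cross (L (1, 0)) (L (0, 1)),
      cross (L (1, 0)) v / cross (L (1, 0)) (L (0, 1))) := by
  have hv : ∀ w, L w = w.1 • L (1, 0) + w.2 • L (0, 1) := fun w => by
    rw [← map_smul, ← map_smul, ← map_add]; simp
  have hne : cross (L (1, 0)) (L (0, 1)) ≠ 0 := by
    intro h0
    have key : ∀ w : ℝ × ℝ, cross (L (1, 0)) (L w) = 0 := fun w => by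
      rw [hv w]
      simp only [cross, Prod.fst_add, Prod.snd_add, Prod.smul_fst, Prod.smul_snd, smul_eq_mul] at *
      linear_combination w.2 * h0
    have k1 := key (L.symm (1, 0))
    have k2 := key (L.symm (0, 1))
    simp only [ContinuousLinearEquiv.apply_symm_apply, cross] at k1 k2
    have : L (1, 0) = 0 := Prod.ext (by simpa using k2) (by simpa using k1)
    have := (map_eq_zero_iff L L.injective).1 this
    simp at this
  refine ⟨hne, fun v => ?_⟩
  rw [ContinuousLinearEquiv.symm_apply_eq, hv]
  simp only [cross] at *
  ext
  · simp only [Prod.fst_add, Prod.smul_fst, smul_eq_mul]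
    rw [div_mul_eq_mul_div, div_mul_eq_mul_div, ← add_div, eq_div_iff hne]; ring
  · simp only [Prod.snd_add, Prod.smul_snd, smul_eq_mul]
    rw [div_mul_eq_mul_div, div_mul_eq_mul_div, ← add_div, eq_div_iff hne]; ring

theorem volume_coneInt (s : ℝ) (L : (ℝ × ℝ) ≃L[ℝ] (ℝ × ℝ)) :
    volume (L.symm ⁻¹' coneInt s ∩ disc) = ENNReal.ofReal (coneAngle s L / 2) := by
  obtain ⟨hne, hs⟩ := cross_apply_ne_zero L
  by_cases h : s = 0
  · rw [coneAngle, if_pos h, ← volume_sector hne]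
    congr 2
    ext v
    simp [coneInt, h, hs]
  · rw [coneAngle, if_neg h, ← volume_half_disc hne]
    congr 2
    ext v
    simp [coneInt, h, hs]

/-- The open cones are disjoint and fill the unit disc up to a null set; a cone of angle θ has area
θ/2 there and the disc has area π. Comparing areas makes it unnecessary to order the cones
cyclically. -/
theorem sum_coneAngle {ι : Type*} {S : Finset ι} {L : ι → (ℝ × ℝ) ≃L[ℝ] (ℝ × ℝ)} {s : ℝ}
    (hcov : ∀ v, ∃ a ∈ S, (L a).symm v ∈ cone s)
    (hdis : ∀ a ∈ S, ∀ a' ∈ S, a ≠ a' → ∀ v, (L a).symm v ∈ coneInt s → (L a').symm v ∉ coneInt s) :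
    ∑ a ∈ S, coneAngle s (L a) = 2 * Real.pi := by
  set N : Set (ℝ × ℝ) := {v | v.1 = 0} ∪ {v | v.2 = 0} with hN
  have hN0 : volume N = 0 := by
    have e1 : {v : ℝ × ℝ | v.1 = 0} = {0} ×ˢ univ := by ext v; simp
    have e2 : {v : ℝ × ℝ | v.2 = 0} = univ ×ˢ {0} := by ext v; simp
    refine measure_union_null ?_ ?_
    · rw [e1, Measure.volume_eq_prod, Measure.prod_prod]; simp
    · rw [e2, Measure.volume_eq_prod, Measure.prod_prod]; simp
  have hNa : ∀ a, volume ((L a).symm ⁻¹' N) = 0 := fun a => by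
    rw [Measure.addHaar_preimage_continuousLinearEquiv, hN0, mul_zero]
  have hm : ∀ a, MeasurableSet ((L a).symm ⁻¹' coneInt s ∩ disc) := fun a =>
    (((isOpen_coneInt s).preimage (L a).symm.continuous).inter isOpen_disc).measurableSet
  have h1 : volume (⋃ a ∈ S, ((L a).symm ⁻¹' coneInt s ∩ disc)) = volume disc := by
    refine le_antisymm (measure_mono (iUnion₂_subset fun a _ => inter_subset_right)) ?_
    have hsub : disc ⊆ (⋃ a ∈ S, ((L a).symm ⁻¹' coneInt s ∩ disc)) ∪
        ⋃ a ∈ S, (L a).symm ⁻¹' N := by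
      intro v hv
      obtain ⟨a, ha, hva⟩ := hcov v
      by_cases hn : (L a).symm v ∈ N
      · exact Or.inr (mem_biUnion ha hn)
      · refine Or.inl (mem_biUnion ha ⟨?_, hv⟩)
        simp only [hN, mem_union, mem_ofPred_eq, not_or] at hn
        exact ⟨lt_of_le_of_ne hva.1 (Ne.symm hn.2),
          fun hs => lt_of_le_of_ne (hva.2 hs) (Ne.symm hn.1)⟩
    refine (measure_mono hsub).trans ((measure_union_le _ _).trans ?_)
    have hz : volume (⋃ a ∈ S, (L a).symm ⁻¹' N) = 0 :=
      (measure_biUnion_null_iff S.countable_toSet).2 fun a _ => hNa a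
    rw [hz, add_zero]
  rw [measure_biUnion_finset (fun a ha a' ha' hne => disjoint_left.2 fun v hv hv' =>
      hdis a ha a' ha' hne v hv.1 hv'.1) fun a _ => hm a, volume_disc,
    Finset.sum_congr rfl fun a _ => volume_coneInt s (L a),
    ← ENNReal.ofReal_sum_of_nonneg fun a _ => by have := coneAngle_nonneg s (L a); positivity,
    ← Finset.sum_div] at h1
  have h2 := (ENNReal.ofReal_eq_ofReal_iff (by
    have := Finset.sum_nonneg fun a (_ : a ∈ S) => coneAngle_nonneg s (L a)
    positivity) Real.pi_pos.le).1 h1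
  linarith

/-! ### Tangent cones of the star of a point -/

variable {Γ : Subgroup (Mink ≃ₗ[ℝ] Mink)}

namespace SmoothTriangulation
variable (T : SmoothTriangulation Γ)

/-- Each triangle of the star is translated by Γ so as to pass through b, and all are read in one
chart. The cover of a neighborhood and the disjointness of open triangles then pass to the tangent
cones. -/
theorem exists_star_tiling (hΓ : IsHyperbolicManifoldGroup Γ) (hfree : FreeAtInfinity Γ)
    {s : ℝ} {S : Finset (Fin T.n × Fin T.n × Fin T.n)} {b : discontinuityDomain Γ}
    (hS : T.IsStar (T.loc b) s S) (hs0 : 0 ≤ s) (hs1 : s < 1) :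
    ∃ (γ : Fin T.n × Fin T.n × Fin T.n → Mink ≃ₗ[ℝ] Mink) (sg : ℝ)
      (L : Fin T.n × Fin T.n × Fin T.n → (ℝ × ℝ) ≃L[ℝ] (ℝ × ℝ)), sg ^ 2 = 1 ∧
    chart sg (chartInv sg b) = b ∧
    (∀ a ∈ S, γ a ∈ Γ ∧ idealAct (γ a) (T.par a.1 a.2.1 a.2.2 (s, 0)) = b ∧
      HasFDerivAt (fun z => chartInv sg (idealAct (γ a) (T.par a.1 a.2.1 a.2.2 z)))
        (L a : ℝ × ℝ →L[ℝ] ℝ × ℝ) (s, 0) ∧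
      (∀ᶠ z in 𝓝 (s, 0), chart sg (chartInv sg (idealAct (γ a) (T.par a.1 a.2.1 a.2.2 z))) =
        idealAct (γ a) (T.par a.1 a.2.1 a.2.2 z))) ∧
    (∀ v, ∃ a ∈ S, (L a).symm v ∈ cone s) ∧
    (∀ a ∈ S, ∀ a' ∈ S, a ≠ a' → ∀ v, (L a).symm v ∈ coneInt s → (L a').symm v ∉ coneInt s) := by
  have hs : ((s, 0) : ℝ × ℝ) ∈ tri := ⟨hs0, le_rfl, by simpa using hs1.le⟩
  have hγ : ∀ a ∈ S, ∃ γ ∈ Γ, idealAct γ (T.par a.1 a.2.1 a.2.2 (s, 0)) = b := by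
    intro a ha
    have hf := hS.mem_faces a ha
    have : T.loc ⟨_, T.par_mem hf hs⟩ = T.loc b := by
      rw [T.loc_par hf hs]; exact Subtype.ext (hS.coord a ha)
    exact (T.loc_eq_iff hΓ).1 this
  choose! γ hγ hb using hγ
  obtain ⟨sg, hsg, hne⟩ := exists_pole_ne (b : Mink)
  have hp : ∀ a ∈ S, IsLocalParam Γ (T.parDom a.1 a.2.1 a.2.2)
      (fun z => idealAct (γ a) (T.par a.1 a.2.1 a.2.2 z)) := fun a ha =>
    (T.isLocalParam_par (hS.mem_faces a ha)).1.act hΓ (hγ a ha)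
  have hL : ∀ a ∈ S, _ := fun a ha => (hp a ha).exists_planar
    ((T.isLocalParam_par (hS.mem_faces a ha)).2 hs) hsg (by simp only [hb a ha]; exact hne)
  choose! L hL hev hfd using hL
  have hy : ∀ a ∈ S, chartInv sg (idealAct (γ a) (T.par a.1 a.2.1 a.2.2 (s, 0))) =
      chartInv sg b := fun a ha => by rw [hb a ha]
  have hcb : chart sg (chartInv sg b) = b := chart_chartInv hsg b.2.1 hne
  refine ⟨γ, sg, L, hsg, hcb, fun a ha => ⟨hγ a ha, hb a ha, (hL a ha).hasFDerivAt, hev a ha⟩,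
    ?_, ?_⟩
  · refine cones_cover hL hy fun ε hε => ?_
    have h := T.eventually_covered hΓ hfree hS hs hγ hb hε
    have hc : ContinuousAt (chart sg) (chartInv sg b) :=
      (contDiff_chart sg (n := 0)).continuous.continuousAt
    rw [← hcb] at h
    filter_upwards [hc.eventually h] with w hw
    obtain ⟨a, ha, z, hz, hd, he⟩ := hw (chart_mem hsg w)
    refine ⟨a, ha, z, hz, hd, ?_⟩
    rw [he, chartInv_chart hsg]
  · intro a ha a' ha' hne' v hv
    refine cones_disjoint hL hy hs0 hs1 ha ha' ?_ hv
    rw [eventually_prod_iff]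
    refine ⟨_, hev a ha, _, hev a' ha', fun {z} hz {z'} hz' ht ht' he => hne' ?_⟩
    have h1 : idealAct (γ a) (T.par a.1 a.2.1 a.2.2 z) =
        idealAct (γ a') (T.par a'.1 a'.2.1 a'.2.2 z') := by
      rw [← hz, ← hz']; exact congrArg _ he
    exact hS.inj a ha a' ha' (T.act_par_ne hΓ (hS.mem_faces a ha) (hS.mem_faces a' ha')
      (hγ a ha) (hγ a' ha') ht ht' h1).1

end SmoothTriangulation

/-! ### Geodesic curvature and invariance on the light cone -/

/-- The parametrization of the section of the light cone determined by a conformal factor. -/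
def lift2 (ρ : Mink → ℝ) (p : ℝ × ℝ → Mink) (z : ℝ × ℝ) : Mink := ρ (p z) • p z

section lift2
variable {ρ : Mink → ℝ} {U : Set (ℝ × ℝ)} {p : ℝ × ℝ → Mink}

theorem contDiffOn_lift2 (hρ : IsConformalMetric Γ ρ) (hp : IsLocalParam Γ U p) :
    ContDiffOn ℝ ∞ (lift2 ρ p) U := (hρ.smooth U p hp).smul hp.smooth

theorem form_fderiv_lift2 (hρ : IsConformalMetric Γ ρ) (hp : IsLocalParam Γ U p) {u : ℝ × ℝ}
    (hu : u ∈ U) (v w : ℝ × ℝ) :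
    form (fderiv ℝ (lift2 ρ p) u v) (fderiv ℝ (lift2 ρ p) u w) =
      ρ (p u) ^ 2 * form (fderiv ℝ p u v) (fderiv ℝ p u w) :=
  hp.form_fderiv_smul hu (differentiableAt_of_smooth hp.isOpen (hρ.smooth U p hp) hu) v w

/-- The metric coefficient `E` of `ρ² · (round metric)` in the parametrization `p`. -/
def mE (ρ : Mink → ℝ) (p : ℝ × ℝ → Mink) (z : ℝ × ℝ) : ℝ := ρ (p z) ^ 2 * form (d1 p z) (d1 p z)

/-- The metric coefficient `F` of `ρ² · (round metric)` in the parametrization `p`. -/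
def mF (ρ : Mink → ℝ) (p : ℝ × ℝ → Mink) (z : ℝ × ℝ) : ℝ := ρ (p z) ^ 2 * form (d1 p z) (d2 p z)

/-- The metric coefficient `G` of `ρ² · (round metric)` in the parametrization `p`. -/
def mG (ρ : Mink → ℝ) (p : ℝ × ℝ → Mink) (z : ℝ × ℝ) : ℝ := ρ (p z) ^ 2 * form (d2 p z) (d2 p z)

/-- The geodesic curvature density in terms of a surface in the light cone. -/
def kapForm (e w ee : Mink) : ℝ :=
  (form e e * form ee w - form e w * form ee e) /
    (form e e * √(form e e * form w w - form e w ^ 2))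

theorem isMetricOn (hρ : IsConformalMetric Γ ρ) (hp : IsLocalParam Γ U p) :
    IsMetricOn U (mE ρ p) (mF ρ p) (mG ρ p) := by
  have h1 := contDiffOn_d1 hp.isOpen hp.smooth
  have h2 := contDiffOn_d2 hp.isOpen hp.smooth
  have hr := (hρ.smooth U p hp).pow 2
  refine ⟨hp.isOpen, hr.mul (contDiffOn_form h1 h1), hr.mul (contDiffOn_form h1 h2),
    hr.mul (contDiffOn_form h2 h2), fun z hz => ?_, fun z hz => ?_⟩
  · exact mul_pos (pow_pos (hρ.pos _ (hp.mapsTo hz)) 2) (hp.form_fderiv_pos hz (by simp))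
  · have hr4 : 0 < ρ (p z) ^ 4 := pow_pos (hρ.pos _ (hp.mapsTo hz)) 4
    have a1 : 0 < form (d1 p z) (d1 p z) := hp.form_fderiv_pos hz (by simp)
    -- The vector -F ∂_u + E ∂_v is orthogonal to ∂_u and has square E (EG - F²); here the
    -- coefficients are those of the round metric.
    have key := hp.form_fderiv_pos hz (v := (-form (d1 p z) (d2 p z), form (d1 p z) (d1 p z)))
      (fun h => a1.ne' (congrArg Prod.snd h))
    have e : fderiv ℝ p z (-form (d1 p z) (d2 p z), form (d1 p z) (d1 p z)) =
        (-form (d1 p z) (d2 p z)) • d1 p z + form (d1 p z) (d1 p z) • d2 p z := by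
      rw [d1, d2, ← map_smul, ← map_smul, ← map_add]; simp
    rw [e] at key
    simp only [form_add_left, form_add_right, form_smul_left, form_smul_right,
      form_comm (d2 p z) (d1 p z)] at key
    have k2 : 0 < form (d1 p z) (d1 p z) * (form (d1 p z) (d1 p z) * form (d2 p z) (d2 p z) -
        form (d1 p z) (d2 p z) ^ 2) := by linarith
    have k3 := (mul_pos_iff_of_pos_left a1).1 k2
    have := mul_pos hr4 k3
    simp only [mE, mF, mG]
    linarith

/-- When E_u, E_v and F_u are expressed by derivatives of the lift X, the mixed derivative X_uv
cancels. So the curvature of an edge sees the triangle only through the transverse vector X_v, which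
is what allows the two sides to be compared. -/
theorem kap_eq_kapForm (hρ : IsConformalMetric Γ ρ) (hp : IsLocalParam Γ U p) {z : ℝ × ℝ}
    (hz : z ∈ U) : kap (mE ρ p) (mF ρ p) (mG ρ p) z =
      kapForm (d1 (lift2 ρ p) z) (d2 (lift2 ρ p) z) (d1 (d1 (lift2 ρ p)) z) := by
  have hX := contDiffOn_lift2 hρ hp
  have c1 := contDiffOn_d1 hp.isOpen hX
  have c2 := contDiffOn_d2 hp.isOpen hX
  have t1 := differentiableAt_of_smooth hp.isOpen c1 hz
  have t2 := differentiableAt_of_smooth hp.isOpen c2 hz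
  have eE : EqOn (mE ρ p) (fun z => form (d1 (lift2 ρ p) z) (d1 (lift2 ρ p) z)) U := fun u hu =>
    (form_fderiv_lift2 hρ hp hu _ _).symm
  have eF : EqOn (mF ρ p) (fun z => form (d1 (lift2 ρ p) z) (d2 (lift2 ρ p) z)) U := fun u hu =>
    (form_fderiv_lift2 hρ hp hu _ _).symm
  have eG : EqOn (mG ρ p) (fun z => form (d2 (lift2 ρ p) z) (d2 (lift2 ρ p) z)) U := fun u hu =>
    (form_fderiv_lift2 hρ hp hu _ _).symm
  have f1 : d1 (mF ρ p) z = form (d1 (lift2 ρ p) z) (d1 (d2 (lift2 ρ p)) z) +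
      form (d1 (d1 (lift2 ρ p)) z) (d2 (lift2 ρ p) z) := by
    rw [d1, fderiv_congr_on hp.isOpen eF hz, fderiv_form t1 t2]; rfl
  have f2 : d1 (mE ρ p) z = 2 * form (d1 (d1 (lift2 ρ p)) z) (d1 (lift2 ρ p) z) := by
    rw [d1, fderiv_congr_on hp.isOpen eE hz, fderiv_form t1 t1, form_comm (d1 (lift2 ρ p) z)]
    change form (d1 (d1 (lift2 ρ p)) z) _ + form (d1 (d1 (lift2 ρ p)) z) _ = _
    ring
  have f3 : d2 (mE ρ p) z = 2 * form (d1 (lift2 ρ p) z) (d1 (d2 (lift2 ρ p)) z) := by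
    rw [d2, fderiv_congr_on hp.isOpen eE hz, fderiv_form t1 t1, form_comm _ (d1 (lift2 ρ p) z),
      d1_d2_comm hp.isOpen hX hz]
    change form _ (d2 (d1 (lift2 ρ p)) z) + form _ (d2 (d1 (lift2 ρ p)) z) = _
    ring
  rw [kap, f1, f2, f3, eE hz, eF hz, eG hz, kapForm]
  refine Eq.trans ?_ (mul_div_mul_left _ _ (two_ne_zero (α := ℝ)))
  congr 1 <;> ring

/-- The geodesic curvature changes sign with the side of the curve. -/
theorem kapForm_opposite {e w ee : Mink} {α β : ℝ} (hβ : β < 0) :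
    kapForm e (α • e + β • w) ee = -kapForm e w ee := by
  simp only [kapForm, form_add_left, form_add_right, form_smul_left, form_smul_right,
    form_comm w e]
  rw [show form e e * (α * (α * form e e + β * form e w) + β * (α * form e w + β * form w w)) -
      (α * form e e + β * form e w) ^ 2 = β ^ 2 * (form e e * form w w - form e w ^ 2) by ring,
    Real.sqrt_mul (sq_nonneg β), Real.sqrt_sq_eq_abs, abs_of_neg hβ,
    show form e e * (α * form ee e + β * form ee w) - (α * form e e + β * form e w) * form ee e =
      (-β) * -(form e e * form ee w - form e w * form ee e) by ring,
    show form e e * (-β * √(form e e * form w w - form e w ^ 2)) =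
      (-β) * (form e e * √(form e e * form w w - form e w ^ 2)) by ring,
    mul_div_mul_left _ _ (neg_ne_zero.2 hβ.ne), neg_div]

theorem kapForm_lorentz (hΓ : IsHyperbolicManifoldGroup Γ) {γ : Mink ≃ₗ[ℝ] Mink} (hγ : γ ∈ Γ)
    (e w ee : Mink) : kapForm (γ e) (γ w) (γ ee) = kapForm e w ee := by
  simp only [kapForm, hΓ.form_eq γ hγ]

/-- The section of the light cone determined by an invariant metric is invariant. -/
theorem conformal_equivariant (hΓ : IsHyperbolicManifoldGroup Γ) (hρ : IsConformalMetric Γ ρ)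
    {γ : Mink ≃ₗ[ℝ] Mink} (hγ : γ ∈ Γ) {b : Mink} (hb : b ∈ discontinuityDomain Γ) :
    γ (ρ b • b) = ρ (idealAct γ b) • idealAct γ b := by
  have hfst := ideal_fst_pos hΓ hγ hb.1
  suffices h : ρ (idealAct γ b) = ρ b * (γ b).1 by
    rw [map_smul, h, idealAct, smul_smul, mul_assoc, mul_inv_cancel₀ hfst.ne', mul_one]
  obtain ⟨sg, hsg, hne⟩ := exists_pole_ne b
  have hcb : chart sg (chartInv sg b) = b := chart_chartInv hsg hb.1 hne
  have hp := isLocalParam_chart (Γ := Γ) hsg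
  have hu : chartInv sg b ∈ chart sg ⁻¹' discontinuityDomain Γ := by rwa [mem_preimage, hcb]
  set u := chartInv sg b
  have hinv := hρ.invariant _ _ hp γ hγ u hu (1, 0) (1, 0)
  have hdp := hp.differentiableAt hu
  have hcl : ContDiff ℝ 1 γ := γ.toLinearMap.toContinuousLinearMap.contDiff
  have hdγ : DifferentiableAt ℝ (fun z => γ (chart sg z)) u :=
    (hcl.differentiable one_ne_zero).differentiableAt.comp u hdp
  have hγd : ∀ v, fderiv ℝ (fun z => γ (chart sg z)) u v = γ (fderiv ℝ (chart sg) u v) := by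
    intro v
    have h := (γ.toLinearMap.toContinuousLinearMap.hasFDerivAt (x := chart sg u)).comp u
      hdp.hasFDerivAt
    rw [show fderiv ℝ (fun z => γ (chart sg z)) u = _ from h.fderiv]; rfl
  have hda : DifferentiableAt ℝ (fun z => (γ (chart sg z)).1⁻¹) u :=
    (hdγ.fst).inv (by rw [hcb]; exact hfst.ne')
  -- The second term is a multiple of the null vector γ b, orthogonal to the first, so it drops out
  -- of the metric. What remains is the factor (γ b)₀⁻², and invariance of ρ² · (round) determines
  -- how ρ changes.
  have hact : ∀ v, fderiv ℝ (idealAct γ ∘ chart sg) u v =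
      (γ (chart sg u)).1⁻¹ • γ (fderiv ℝ (chart sg) u v) +
        (fderiv ℝ (fun z => (γ (chart sg z)).1⁻¹) u v) • γ (chart sg u) := by
    intro v
    have h := (hda.hasFDerivAt.smul hdγ.hasFDerivAt).fderiv
    rw [show fderiv ℝ (idealAct γ ∘ chart sg) u = _ from h]
    simp [hγd]
  have h00 := hp.form_self hu
  have h01 := hp.form_fderiv hu (1, 0)
  rw [hact] at hinv
  rw [hcb] at h00 h01
  have h10 : form (fderiv ℝ (chart sg) u (1, 0)) b = 0 := by rw [form_comm, h01]
  simp only [form_add_left, form_add_right, form_smul_left, form_smul_right, hΓ.form_eq γ hγ,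
    hcb, h00, h01, h10] at hinv
  have hpos := hp.form_fderiv_pos hu (v := (1, 0)) (by simp)
  have h1 : ρ (idealAct γ b) ^ 2 = (ρ b * (γ b).1) ^ 2 := by
    have h2 : ρ (idealAct γ b) ^ 2 * ((γ b).1⁻¹ * ((γ b).1⁻¹ * form (fderiv ℝ (chart sg) u (1, 0))
        (fderiv ℝ (chart sg) u (1, 0)))) =
        ρ b ^ 2 * form (fderiv ℝ (chart sg) u (1, 0)) (fderiv ℝ (chart sg) u (1, 0)) := by
      simpa using hinv
    field_simp at h2
    rw [h2]; ring
  exact (sq_eq_sq₀ (hρ.pos _ (idealAct_omega hΓ hγ hb)).le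
    (mul_pos (hρ.pos _ hb) hfst).le).1 h1

end lift2

variable {Γ : Subgroup (Mink ≃ₗ[ℝ] Mink)} {ρ : Mink → ℝ} {U : Set (ℝ × ℝ)} {p : ℝ × ℝ → Mink}

theorem fderiv_lift2_act (hΓ : IsHyperbolicManifoldGroup Γ) (hρ : IsConformalMetric Γ ρ)
    (hp : IsLocalParam Γ U p) {γ : Mink ≃ₗ[ℝ] Mink} (hγ : γ ∈ Γ) {x : ℝ × ℝ} (hx : x ∈ U)
    (v : ℝ × ℝ) : fderiv ℝ (lift2 ρ fun z => idealAct γ (p z)) x v =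
      γ (fderiv ℝ (lift2 ρ p) x v) := by
  have he : EqOn (lift2 ρ fun z => idealAct γ (p z)) (fun z => γ (lift2 ρ p z)) U := fun z hz =>
    (conformal_equivariant hΓ hρ hγ (hp.mapsTo hz)).symm
  rw [fderiv_congr_on hp.isOpen he hx]
  have hd := differentiableAt_of_smooth hp.isOpen (contDiffOn_lift2 hρ hp) hx
  have h := (γ.toLinearMap.toContinuousLinearMap.hasFDerivAt (x := lift2 ρ p x)).comp x
    hd.hasFDerivAt
  rw [show fderiv ℝ (fun z => γ (lift2 ρ p z)) x = _ from h.fderiv]; rfl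

theorem d1_d1_lift2_act (hΓ : IsHyperbolicManifoldGroup Γ) (hρ : IsConformalMetric Γ ρ)
    (hp : IsLocalParam Γ U p) {γ : Mink ≃ₗ[ℝ] Mink} (hγ : γ ∈ Γ) {x : ℝ × ℝ} (hx : x ∈ U) :
    d1 (d1 (lift2 ρ fun z => idealAct γ (p z))) x = γ (d1 (d1 (lift2 ρ p)) x) := by
  have he : EqOn (d1 (lift2 ρ fun z => idealAct γ (p z))) (fun z => γ (d1 (lift2 ρ p) z)) U :=
    fun z hz => fderiv_lift2_act hΓ hρ hp hγ hz _
  rw [d1, fderiv_congr_on hp.isOpen he hx]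
  have hd := differentiableAt_of_smooth hp.isOpen
    (contDiffOn_d1 hp.isOpen (contDiffOn_lift2 hρ hp)) hx
  have h := (γ.toLinearMap.toContinuousLinearMap.hasFDerivAt (x := d1 (lift2 ρ p) x)).comp x
    hd.hasFDerivAt
  rw [show fderiv ℝ (fun z => γ (d1 (lift2 ρ p) z)) x = _ from h.fderiv]; rfl

theorem fderiv_lift2_planar (hρ : IsConformalMetric Γ ρ) {q : ℝ × ℝ → Mink} {sg : ℝ}
    (hsg : sg ^ 2 = 1) {x : ℝ × ℝ} {L : ℝ × ℝ →L[ℝ] ℝ × ℝ}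
    (hL : HasFDerivAt (fun z => chartInv sg (q z)) L x)
    (hev : ∀ᶠ z in 𝓝 x, chart sg (chartInv sg (q z)) = q z) (hq : q x ∈ discontinuityDomain Γ)
    (v : ℝ × ℝ) :
    fderiv ℝ (lift2 ρ q) x v = fderiv ℝ (lift2 ρ (chart sg)) (chartInv sg (q x)) (L v) := by
  have he : lift2 ρ q =ᶠ[𝓝 x] lift2 ρ (chart sg) ∘ fun z => chartInv sg (q z) := by
    filter_upwards [hev] with z hz
    simp only [lift2, Function.comp, hz]
  have hu : chartInv sg (q x) ∈ chart sg ⁻¹' discontinuityDomain Γ := by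
    rw [mem_preimage, hev.self_of_nhds]; exact hq
  have hd := differentiableAt_of_smooth (isOpen_chart_preimage hsg)
    (contDiffOn_lift2 hρ (isLocalParam_chart hsg)) hu
  rw [he.fderiv_eq, (hd.hasFDerivAt.comp x hL).fderiv]; rfl

theorem form_fderiv_lift2_chart (hρ : IsConformalMetric Γ ρ) {sg : ℝ} (hsg : sg ^ 2 = 1)
    {u : ℝ × ℝ} (hu : u ∈ chart sg ⁻¹' discontinuityDomain Γ) (v w : ℝ × ℝ) :
    form (fderiv ℝ (lift2 ρ (chart sg)) u v) (fderiv ℝ (lift2 ρ (chart sg)) u w) =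
      lam ρ sg u ^ 2 * dot v w := by
  rw [form_fderiv_lift2 hρ (isLocalParam_chart hsg) hu, form_fderiv_chart hsg, lam, dot]; ring

/-- The metric in the parametrization `p`, in terms of the planar map of a translate of `p`. -/
theorem metric_planar (hΓ : IsHyperbolicManifoldGroup Γ) (hρ : IsConformalMetric Γ ρ)
    (hp : IsLocalParam Γ U p) {γ : Mink ≃ₗ[ℝ] Mink} (hγ : γ ∈ Γ) {sg : ℝ} (hsg : sg ^ 2 = 1)
    {x : ℝ × ℝ} (hx : x ∈ U) {L : ℝ × ℝ →L[ℝ] ℝ × ℝ}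
    (hL : HasFDerivAt (fun z => chartInv sg (idealAct γ (p z))) L x)
    (hev : ∀ᶠ z in 𝓝 x, chart sg (chartInv sg (idealAct γ (p z))) = idealAct γ (p z))
    (v w : ℝ × ℝ) : ρ (p x) ^ 2 * form (fderiv ℝ p x v) (fderiv ℝ p x w) =
      lam ρ sg (chartInv sg (idealAct γ (p x))) ^ 2 * dot (L v) (L w) := by
  have hm := idealAct_omega hΓ hγ (hp.mapsTo hx)
  rw [← form_fderiv_lift2 hρ hp hx, ← hΓ.form_eq γ hγ, ← fderiv_lift2_act hΓ hρ hp hγ hx,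
    ← fderiv_lift2_act hΓ hρ hp hγ hx, fderiv_lift2_planar hρ hsg hL hev hm,
    fderiv_lift2_planar hρ hsg hL hev hm, form_fderiv_lift2_chart hρ hsg]
  rw [mem_preimage, hev.self_of_nhds]; exact hm

namespace SmoothTriangulation
variable (T : SmoothTriangulation Γ)

/-- The parametrization of an ordered triangle. -/
abbrev pm (a : Fin T.n × Fin T.n × Fin T.n) : ℝ × ℝ → Mink := T.par a.1 a.2.1 a.2.2

section star
variable (hΓ : IsHyperbolicManifoldGroup Γ) (hfree : FreeAtInfinity Γ)
  {S : Finset (Fin T.n × Fin T.n × Fin T.n)}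
  {b : discontinuityDomain Γ}
include hΓ hfree

/-- The angles around a vertex add up to `2π`. -/
theorem sum_ang (hρ : IsConformalMetric Γ ρ) (hS : T.IsStar (T.loc b) 0 S) :
    ∑ a ∈ S, ang (mE ρ (T.pm a)) (mF ρ (T.pm a)) (mG ρ (T.pm a)) (0, 0) = 2 * Real.pi := by
  obtain ⟨γ, sg, L, hsg, hcb, ha, hcov, hdis⟩ :=
    T.exists_star_tiling hΓ hfree hS le_rfl zero_lt_one
  rw [← sum_coneAngle hcov hdis]
  refine Finset.sum_congr rfl fun a haS => ?_
  obtain ⟨hγ, hb, hL, hev⟩ := ha a haS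
  obtain ⟨hp, ht⟩ := T.isLocalParam_par (hS.mem_faces a haS)
  have h0 : ((0, 0) : ℝ × ℝ) ∈ T.parDom a.1 a.2.1 a.2.2 := ht ⟨le_rfl, le_rfl, by simp⟩
  have hm := metric_planar hΓ hρ hp hγ hsg h0 hL hev
  rw [hb] at hm
  have hl : 0 < lam ρ sg (chartInv sg b) := lam_pos hρ (by rw [mem_preimage, hcb]; exact b.2)
  rw [ang, coneAngle, if_pos rfl]
  simp only [mE, mF, mG, pm, d1, d2]
  -- The chart is conformal, so its factor cancels in the cosine and the angle is Euclidean.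
  rw [hm, hm, hm, show ∀ l A C : ℝ, l ^ 2 * A * (l ^ 2 * C) = (l ^ 2) ^ 2 * (A * C) from
    fun l A C => by ring, Real.sqrt_mul (by positivity), Real.sqrt_sq (by positivity),
    mul_div_mul_left _ _ (by positivity)]
  rfl

/-- An edge lies in exactly two triangles. -/
theorem card_star {s : ℝ} (hs0 : 0 < s) (hs1 : s < 1) (hS : T.IsStar (T.loc b) s S) :
    S.card = 2 := by
  obtain ⟨γ, sg, L, hsg, hcb, ha, hcov, hdis⟩ := T.exists_star_tiling hΓ hfree hS hs0.le hs1
  have h := sum_coneAngle hcov hdis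
  -- In the interior of an edge every cone is a half-plane of angle π, and the angles add up to 2π.
  simp only [coneAngle, if_neg hs0.ne', Finset.sum_const, nsmul_eq_mul] at h
  exact_mod_cast mul_right_cancel₀ Real.pi_ne_zero h

/-- The geodesic curvatures of an edge with respect to its two sides cancel. -/
theorem kap_add_kap (hρ : IsConformalMetric Γ ρ) {s : ℝ} (hs0 : 0 < s) (hs1 : s < 1)
    (hS : T.IsStar (T.loc b) s S) {a a' : Fin T.n × Fin T.n × Fin T.n} (ha : a ∈ S) (ha' : a' ∈ S)
    (hne : a ≠ a') (h1 : a.1 = a'.1) (h2 : a.2.1 = a'.2.1) :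
    kap (mE ρ (T.pm a)) (mF ρ (T.pm a)) (mG ρ (T.pm a)) (s, 0) +
      kap (mE ρ (T.pm a')) (mF ρ (T.pm a')) (mG ρ (T.pm a')) (s, 0) = 0 := by
  obtain ⟨γ, sg, L, hsg, hcb, hst, hcov, hdis⟩ := T.exists_star_tiling hΓ hfree hS hs0.le hs1
  obtain ⟨hγ, hb, hL, hev⟩ := hst a ha
  obtain ⟨hγ', hb', hL', hev'⟩ := hst a' ha'
  have hf := hS.mem_faces a ha
  have hf' := hS.mem_faces a' ha'
  obtain ⟨hp, ht⟩ := T.isLocalParam_par hf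
  obtain ⟨hp', ht'⟩ := T.isLocalParam_par hf'
  have hmem : ∀ t ∈ Ioo (0 : ℝ) 1, ((t, 0) : ℝ × ℝ) ∈ tri := fun t h =>
    ⟨h.1.le, le_rfl, by simpa using h.2.le⟩
  have hx := ht (hmem s ⟨hs0, hs1⟩)
  have hx' := ht' (hmem s ⟨hs0, hs1⟩)
  have hq := hp.act hΓ hγ
  have hq' := hp'.act hΓ hγ'
  have hline : ContinuousAt (fun t : ℝ => ((t, 0) : ℝ × ℝ)) s := by fun_prop
  have hI : ∀ᶠ t in 𝓝 s, t ∈ Ioo (0 : ℝ) 1 := isOpen_Ioo.mem_nhds ⟨hs0, hs1⟩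
  obtain ⟨W, hW, hinj⟩ := exists_nhds_injective hΓ hfree b.2
  have hqW : ∀ᶠ t in 𝓝 s, idealAct (γ a) (T.pm a (t, 0)) ∈ W := by
    have := (hq.differentiableAt hx).continuousAt.comp (f := fun t : ℝ => ((t, 0) : ℝ × ℝ)) hline
    exact this.preimage_mem_nhds (by simp only [Function.comp]; rw [hb]; exact hW)
  have hqW' : ∀ᶠ t in 𝓝 s, idealAct (γ a') (T.pm a' (t, 0)) ∈ W := by
    have := (hq'.differentiableAt hx').continuousAt.comp (f := fun t : ℝ => ((t, 0) : ℝ × ℝ)) hline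
    exact this.preimage_mem_nhds (by simp only [Function.comp]; rw [hb']; exact hW)
  -- Both parametrizations give the same point of the complex along the edge, so they differ by an
  -- element of Γ; after translation both stay in W, where that element must be trivial.
  have hagree : ∀ᶠ t in 𝓝 s, idealAct (γ a) (T.pm a (t, 0)) =
      idealAct (γ a') (T.pm a' (t, 0)) := by
    filter_upwards [hI, hqW, hqW'] with t htI hw hw'
    have hz := hmem t htI
    have hl : T.loc ⟨_, T.par_mem hf hz⟩ = T.loc ⟨_, T.par_mem hf' hz⟩ := by
      rw [T.loc_par hf hz, T.loc_par hf' hz]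
      refine Subtype.ext (funext fun l => ?_)
      simp only [bary_apply, h1, h2]
      ring
    obtain ⟨β, hβ, hβe⟩ := (T.loc_eq_iff hΓ).1 hl
    simp only at hβe
    have m1 := (T.par_mem hf hz).1
    have m2 := idealAct_mem hΓ hγ m1
    have e1 : idealAct (γ a' * β * (γ a)⁻¹) (idealAct (γ a) (T.pm a (t, 0))) =
        idealAct (γ a') (T.pm a' (t, 0)) := by
      rw [idealAct_mul hΓ _ (Γ.inv_mem hγ) m2, idealAct_inv_cancel hΓ hγ m1,
        idealAct_mul hΓ _ hβ m1, hβe]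
    have key := hinj _ (Γ.mul_mem (Γ.mul_mem hγ' hβ) (Γ.inv_mem hγ)) _ ⟨hw, m2⟩
      (by rw [e1]; exact hw')
    rw [← e1, key, idealAct_one m2]
  set X := lift2 ρ fun z => idealAct (γ a) (T.pm a z) with hXd
  set X' := lift2 ρ fun z => idealAct (γ a') (T.pm a' z) with hXd'
  have hX := contDiffOn_lift2 hρ hq
  have hX' := contDiffOn_lift2 hρ hq'
  -- Maps that agree along the edge have equal derivatives along it. Applied twice, this gives equal
  -- X_u and X_uu for the two triangles.
  have hder : ∀ {V : Set (ℝ × ℝ)} {Y Y' : ℝ × ℝ → Mink} {V' : Set (ℝ × ℝ)}, IsOpen V → IsOpen V' →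
      ContDiffOn ℝ ∞ Y V → ContDiffOn ℝ ∞ Y' V' → (s, 0) ∈ V → (s, 0) ∈ V' →
      (∀ᶠ t in 𝓝 s, Y (t, 0) = Y' (t, 0)) → ∀ᶠ t in 𝓝 s, d1 Y (t, 0) = d1 Y' (t, 0) := by
    intro V Y Y' V' hV hV' hY hY' hsV hsV' he
    have hd : ∀ {V : Set (ℝ × ℝ)} {Y : ℝ × ℝ → Mink}, IsOpen V → ContDiffOn ℝ ∞ Y V →
        (s, 0) ∈ V → ∀ᶠ t in 𝓝 s, d1 Y (t, 0) = deriv (fun t => Y (t, 0)) t := by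
      intro V Y hV hY hsV
      filter_upwards [hline.preimage_mem_nhds (hV.mem_nhds hsV)] with t htV
      have hl : HasDerivAt (fun s : ℝ => ((s, 0) : ℝ × ℝ)) (1, 0) t :=
        HasDerivAt.prodMk (hasDerivAt_id t) (hasDerivAt_const _ _)
      exact ((differentiableAt_of_smooth hV hY htV).hasFDerivAt.comp_hasDerivAt t hl).deriv.symm
    filter_upwards [hd hV hY hsV, hd hV' hY' hsV', (EventuallyEq.deriv he : _)] with t a1 a2 a3
    rw [a1, a2, a3]
  have hXX : ∀ᶠ t in 𝓝 s, X (t, 0) = X' (t, 0) := by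
    filter_upwards [hagree] with t ht
    simp only [hXd, hXd', lift2, ht]
  have hD1 := hder hp.isOpen hp'.isOpen hX hX' hx hx' hXX
  have hD2 := hder hp.isOpen hp'.isOpen (contDiffOn_d1 hp.isOpen hX)
    (contDiffOn_d1 hp'.isOpen hX') hx hx' hD1
  have e1 := hD1.self_of_nhds
  have e2 := hD2.self_of_nhds
  have hbΩ : idealAct (γ a) (T.pm a (s, 0)) ∈ discontinuityDomain Γ := by
    simp only [pm]; rw [hb]; exact b.2
  have hbΩ' : idealAct (γ a') (T.pm a' (s, 0)) ∈ discontinuityDomain Γ := by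
    simp only [pm]; rw [hb']; exact b.2
  have pl := fderiv_lift2_planar hρ hsg hL hev hbΩ
  have pl' := fderiv_lift2_planar hρ hsg hL' hev' hbΩ'
  simp only [hb] at pl
  simp only [hb'] at pl'
  have hyu : chartInv sg b ∈ chart sg ⁻¹' discontinuityDomain Γ := by
    rw [mem_preimage, hcb]; exact b.2
  have hl := lam_pos hρ hyu
  have hZinj : ∀ v w, fderiv ℝ (lift2 ρ (chart sg)) (chartInv sg b) v =
      fderiv ℝ (lift2 ρ (chart sg)) (chartInv sg b) w → v = w := by
    intro v w hvw
    have h0 : fderiv ℝ (lift2 ρ (chart sg)) (chartInv sg b) (v - w) = 0 := by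
      rw [map_sub, hvw, sub_self]
    have h3 := form_fderiv_lift2_chart hρ hsg hyu (v - w) (v - w)
    rw [h0, form_zero_left] at h3
    have h4 : dot (v - w) (v - w) = 0 := by
      rcases mul_eq_zero.1 h3.symm with h | h
      · exact absurd h (by positivity)
      · exact h
    simp only [dot] at h4
    have h5 : (v - w).1 = 0 := by nlinarith [sq_nonneg (v - w).1, sq_nonneg (v - w).2]
    have h6 : (v - w).2 = 0 := by nlinarith [sq_nonneg (v - w).1, sq_nonneg (v - w).2]
    exact sub_eq_zero.1 (Prod.ext h5 h6)
  have hL1 : L a (1, 0) = L a' (1, 0) := by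
    refine hZinj _ _ ?_
    have k1 := pl (1, 0)
    have k2 := pl' (1, 0)
    exact k1.symm.trans (e1.trans k2)
  obtain ⟨⟨α, β⟩, hαβ⟩ : ∃ w, L a w = L a' (0, 1) := ⟨(L a).symm (L a' (0, 1)), by simp⟩
  -- The two triangles lie on opposite sides of the edge: for β > 0 their open tangent half-planes
  -- would meet, and for β = 0 the differential of the second one would not be injective.
  have hβ : β < 0 := by
    by_contra hn
    rcases (not_lt.1 hn).eq_or_lt with h0 | hpos
    · have : L a' (α, 0) = L a' (0, 1) := by
        rw [← hαβ, ← h0]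
        have q1 : ((α, 0) : ℝ × ℝ) = α • (1, 0) := by simp
        rw [q1, map_smul, map_smul, hL1]
      have := (L a').injective this
      simp at this
    · refine hdis a ha a' ha' hne (L a' (0, 1)) ?_ ?_
      · rw [← hαβ, ContinuousLinearEquiv.symm_apply_apply]
        exact ⟨hpos, fun h => absurd h hs0.ne'⟩
      · rw [ContinuousLinearEquiv.symm_apply_apply]
        exact ⟨zero_lt_one, fun h => absurd h hs0.ne'⟩
  have hw : d2 X' (s, 0) = α • d1 X (s, 0) + β • d2 X (s, 0) := by
    have hv : L a' (0, 1) = α • L a (1, 0) + β • L a (0, 1) := by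
      rw [← map_smul, ← map_smul, ← map_add, ← hαβ]
      simp
    have k := congrArg (fderiv ℝ (lift2 ρ (chart sg)) (chartInv sg b)) hv
    simp only [map_add, map_smul] at k
    rw [show d2 X' (s, 0) = _ from pl' (0, 1), show d1 X (s, 0) = _ from pl (1, 0),
      show d2 X (s, 0) = _ from pl (0, 1)]
    exact k
  have kk : kap (mE ρ (T.pm a)) (mF ρ (T.pm a)) (mG ρ (T.pm a)) (s, 0) =
      kapForm (d1 X (s, 0)) (d2 X (s, 0)) (d1 (d1 X) (s, 0)) := by
    rw [kap_eq_kapForm hρ hp hx, ← kapForm_lorentz hΓ hγ, ← d1_d1_lift2_act hΓ hρ hp hγ hx]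
    rw [d1, d2, ← fderiv_lift2_act hΓ hρ hp hγ hx, ← fderiv_lift2_act hΓ hρ hp hγ hx]
    rfl
  have kk' : kap (mE ρ (T.pm a')) (mF ρ (T.pm a')) (mG ρ (T.pm a')) (s, 0) =
      kapForm (d1 X' (s, 0)) (d2 X' (s, 0)) (d1 (d1 X') (s, 0)) := by
    rw [kap_eq_kapForm hρ hp' hx', ← kapForm_lorentz hΓ hγ', ← d1_d1_lift2_act hΓ hρ hp' hγ' hx']
    rw [d1, d2, ← fderiv_lift2_act hΓ hρ hp' hγ' hx', ← fderiv_lift2_act hΓ hρ hp' hγ' hx']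
    rfl
  rw [kk, kk', hw, ← e1, ← e2, kapForm_opposite hβ]
  ring

end star
end SmoothTriangulation

/-! ### Ordered triangles, and stars of vertices and edges -/

variable {Γ : Subgroup (Mink ≃ₗ[ℝ] Mink)} {ρ : Mink → ℝ}

theorem kap_congr {V : Set (ℝ × ℝ)} (hV : IsOpen V) {E F G E' F' G' : ℝ × ℝ → ℝ}
    (hE : EqOn E E' V) (hF : EqOn F F' V) (hG : EqOn G G' V) {z : ℝ × ℝ} (hz : z ∈ V) :
    kap E F G z = kap E' F' G' z := by
  simp only [kap, d1, d2, fderiv_congr_on hV hE hz, fderiv_congr_on hV hF hz, hE hz, hF hz, hG hz]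

theorem ang_congr {E F G E' F' G' : ℝ × ℝ → ℝ} {z : ℝ × ℝ} (hE : E z = E' z) (hF : F z = F' z)
    (hG : G z = G' z) : ang E F G z = ang E' F' G' z := by
  simp only [ang, hE, hF, hG]

theorem metric_comp_rot {p : ℝ × ℝ → Mink} {z : ℝ × ℝ} (hp : DifferentiableAt ℝ p (rot z)) :
    mE ρ (fun z => p (rot z)) z = mE ρ p (rot z) - 2 * mF ρ p (rot z) + mG ρ p (rot z) ∧
    mF ρ (fun z => p (rot z)) z = mE ρ p (rot z) - mF ρ p (rot z) ∧
    mG ρ (fun z => p (rot z)) z = mE ρ p (rot z) := by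
  simp only [mE, mF, mG, d1_comp_rot hp, d2_comp_rot hp, sub_eq_add_neg, form_add_left,
    form_add_right, form_neg_left, form_neg_right, form_comm (d2 p (rot z)) (d1 p (rot z))]
  refine ⟨?_, ?_, ?_⟩ <;> ring

namespace SmoothTriangulation
variable (T : SmoothTriangulation Γ)

open Classical in
/-- The ordered triangles. -/
def flags : Finset (Fin T.n × Fin T.n × Fin T.n) := Finset.univ.filter fun a => T.verts a ∈ T.faces

theorem mem_flags {a : Fin T.n × Fin T.n × Fin T.n} : a ∈ T.flags ↔ T.verts a ∈ T.faces := by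
  simp [flags]

/-- The total geodesic curvature of the first edge of an ordered triangle. -/
def edgeCurv (ρ : Mink → ℝ) (a : Fin T.n × Fin T.n × Fin T.n) : ℝ :=
  ∫ s in (0 : ℝ)..1, kap (mE ρ (T.pm a)) (mF ρ (T.pm a)) (mG ρ (T.pm a)) (s, 0)

/-- The angle of an ordered triangle at its first vertex. -/
def vertAng (ρ : Mink → ℝ) (a : Fin T.n × Fin T.n × Fin T.n) : ℝ :=
  ang (mE ρ (T.pm a)) (mF ρ (T.pm a)) (mG ρ (T.pm a)) (0, 0)

/-- The area of an ordered triangle. -/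
def triArea (ρ : Mink → ℝ) (a : Fin T.n × Fin T.n × Fin T.n) : ℝ :=
  ∫ z in tri, √(mE ρ (T.pm a) z * mG ρ (T.pm a) z - mF ρ (T.pm a) z ^ 2)

/-- The cyclic permutation of the vertices of an ordered triangle. -/
def cyc (a : Fin T.n × Fin T.n × Fin T.n) : Fin T.n × Fin T.n × Fin T.n := (a.2.1, a.2.2, a.1)

theorem verts_cyc (a : Fin T.n × Fin T.n × Fin T.n) : T.verts (T.cyc a) = T.verts a := by
  ext; simp [verts, cyc]; tauto

theorem pm_cyc (a : Fin T.n × Fin T.n × Fin T.n) :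
    T.pm (T.cyc a) = fun z => T.pm a (rot z) := by
  funext z; exact (T.par_rot z).symm

theorem continuousOn_kap (hρ : IsConformalMetric Γ ρ) {a : Fin T.n × Fin T.n × Fin T.n}
    (ha : a ∈ T.flags) : ContinuousOn (fun s : ℝ => kap (mE ρ (T.pm a)) (mF ρ (T.pm a))
      (mG ρ (T.pm a)) (s, 0)) (uIcc 0 1) := by
  obtain ⟨hp, ht⟩ := T.isLocalParam_par (T.mem_flags.1 ha)
  exact continuousOn_comp_path ht (isMetricOn hρ hp).smooth_kap (c := fun s => (s, 0))
    (by fun_prop) fun s hs => ⟨hs.1, le_rfl, by simpa using hs.2⟩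

theorem four_mul_triArea (hρ : IsHyperbolicMetric Γ ρ) {a : Fin T.n × Fin T.n × Fin T.n}
    (ha : a ∈ T.flags) : 4 * T.triArea ρ a = T.edgeCurv ρ a + T.edgeCurv ρ (T.cyc a) +
      T.edgeCurv ρ (T.cyc (T.cyc a)) + Real.pi - T.vertAng ρ a - T.vertAng ρ (T.cyc a) -
      T.vertAng ρ (T.cyc (T.cyc a)) := by
  obtain ⟨hp, ht⟩ := T.isLocalParam_par (T.mem_flags.1 ha)
  set U := T.parDom a.1 a.2.1 a.2.2
  have hm := isMetricOn hρ.toIsConformalMetric hp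
  have h := hm.gauss_bonnet_triangle ht fun z hz => hρ.curvature U _ hp z hz
  have r1 : ∀ z ∈ rot ⁻¹' U, _ := fun z hz =>
    metric_comp_rot (ρ := ρ) (hp.differentiableAt (u := rot z) hz)
  have hd : ∀ z ∈ rot ⁻¹' (rot ⁻¹' U), DifferentiableAt ℝ (fun z => T.pm a (rot z)) (rot z) :=
    fun z hz => (hp.differentiableAt (u := rot (rot z)) hz).comp _
      (contDiff_rot.differentiable (by simp)).differentiableAt
  have r2 : ∀ z ∈ rot ⁻¹' (rot ⁻¹' U),
      mE ρ (fun z => T.pm a (rot (rot z))) z = mG ρ (T.pm a) (rot (rot z)) ∧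
      mF ρ (fun z => T.pm a (rot (rot z))) z =
        mG ρ (T.pm a) (rot (rot z)) - mF ρ (T.pm a) (rot (rot z)) ∧
      mG ρ (fun z => T.pm a (rot (rot z))) z = mE ρ (T.pm a) (rot (rot z)) -
        2 * mF ρ (T.pm a) (rot (rot z)) + mG ρ (T.pm a) (rot (rot z)) := by
    intro z hz
    obtain ⟨k1, k2, k3⟩ := metric_comp_rot (ρ := ρ) (hd z hz)
    obtain ⟨l1, l2, l3⟩ := r1 (rot z) hz
    refine ⟨?_, ?_, ?_⟩
    · rw [k1, l1, l2, l3]; ring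
    · rw [k2, l1, l2]; ring
    · rw [k3, l1]
  have o1 : IsOpen (rot ⁻¹' U) := hp.isOpen.preimage continuous_rot
  have o2 : IsOpen (rot ⁻¹' (rot ⁻¹' U)) := o1.preimage continuous_rot
  have t1 : tri ⊆ rot ⁻¹' U := fun z hz => ht (rot_mem_tri hz)
  have t2 : tri ⊆ rot ⁻¹' (rot ⁻¹' U) := fun z hz => t1 (rot_mem_tri hz)
  have hb : ∀ s ∈ uIcc (0 : ℝ) 1, ((s, 0) : ℝ × ℝ) ∈ tri := fun s hs => by
    rw [uIcc_of_le zero_le_one] at hs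
    exact ⟨hs.1, le_rfl, by simpa using hs.2⟩
  have h00 : ((0, 0) : ℝ × ℝ) ∈ tri := ⟨le_rfl, le_rfl, by simp⟩
  have p2 : T.pm (T.cyc (T.cyc a)) = fun z => T.pm a (rot (rot z)) := by
    rw [T.pm_cyc]; funext z; rw [T.pm_cyc]
  have c1 : T.edgeCurv ρ (T.cyc a) = ∫ s in (0 : ℝ)..1,
      kap (fun z => mE ρ (T.pm a) (rot z) - 2 * mF ρ (T.pm a) (rot z) + mG ρ (T.pm a) (rot z))
        (fun z => mE ρ (T.pm a) (rot z) - mF ρ (T.pm a) (rot z))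
        (fun z => mE ρ (T.pm a) (rot z)) (s, 0) := by
    rw [edgeCurv, T.pm_cyc]
    exact intervalIntegral.integral_congr fun s hs => kap_congr o1 (fun z hz => (r1 z hz).1)
      (fun z hz => (r1 z hz).2.1) (fun z hz => (r1 z hz).2.2) (t1 (hb s hs))
  have c2 : T.edgeCurv ρ (T.cyc (T.cyc a)) = ∫ s in (0 : ℝ)..1,
      kap (fun z => mG ρ (T.pm a) (rot (rot z)))
        (fun z => mG ρ (T.pm a) (rot (rot z)) - mF ρ (T.pm a) (rot (rot z)))
        (fun z => mE ρ (T.pm a) (rot (rot z)) - 2 * mF ρ (T.pm a) (rot (rot z)) +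
          mG ρ (T.pm a) (rot (rot z))) (s, 0) := by
    rw [edgeCurv, p2]
    exact intervalIntegral.integral_congr fun s hs => kap_congr o2 (fun z hz => (r2 z hz).1)
      (fun z hz => (r2 z hz).2.1) (fun z hz => (r2 z hz).2.2) (t2 (hb s hs))
  have d1' : T.vertAng ρ (T.cyc a) =
      ang (fun z => mE ρ (T.pm a) (rot z) - 2 * mF ρ (T.pm a) (rot z) + mG ρ (T.pm a) (rot z))
        (fun z => mE ρ (T.pm a) (rot z) - mF ρ (T.pm a) (rot z))
        (fun z => mE ρ (T.pm a) (rot z)) (0, 0) := by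
    rw [vertAng, T.pm_cyc]
    exact ang_congr (r1 _ (t1 h00)).1 (r1 _ (t1 h00)).2.1 (r1 _ (t1 h00)).2.2
  have d2' : T.vertAng ρ (T.cyc (T.cyc a)) =
      ang (fun z => mG ρ (T.pm a) (rot (rot z)))
        (fun z => mG ρ (T.pm a) (rot (rot z)) - mF ρ (T.pm a) (rot (rot z)))
        (fun z => mE ρ (T.pm a) (rot (rot z)) - 2 * mF ρ (T.pm a) (rot (rot z)) +
          mG ρ (T.pm a) (rot (rot z))) (0, 0) := by
    rw [vertAng, p2]
    exact ang_congr (r2 _ (t2 h00)).1 (r2 _ (t2 h00)).2.1 (r2 _ (t2 h00)).2.2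
  rw [triArea, c1, c2, d1', d2']
  exact h

theorem vertAng_swap (i j k : Fin T.n) (h : {i, j, k} ∈ T.faces) :
    T.vertAng ρ (i, k, j) = T.vertAng ρ (i, j, k) := by
  obtain ⟨hp, ht⟩ := T.isLocalParam_par h
  have h0 := hp.differentiableAt (ht (⟨le_rfl, le_rfl, by simp⟩ : ((0, 0) : ℝ × ℝ) ∈ tri))
  have hsw : T.par i k j = fun z => T.par i j k z.swap := by
    funext z; exact (T.par_swap z).symm
  have hL : HasFDerivAt (Prod.swap : ℝ × ℝ → ℝ × ℝ)
      (ContinuousLinearEquiv.prodComm ℝ ℝ ℝ : ℝ × ℝ →L[ℝ] ℝ × ℝ) (0, 0) :=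
    (ContinuousLinearEquiv.prodComm ℝ ℝ ℝ).hasFDerivAt
  have hfd : ∀ v, fderiv ℝ (T.par i k j) (0, 0) v = fderiv ℝ (T.par i j k) (0, 0) v.swap := by
    intro v
    rw [hsw]
    have := (h0.hasFDerivAt.comp ((0, 0) : ℝ × ℝ) (f := Prod.swap) hL).fderiv
    rw [show fderiv ℝ (fun z => T.par i j k z.swap) (0, 0) = _ from this]
    rfl
  have hv : T.par i k j (0, 0) = T.par i j k (0, 0) := by rw [hsw]; rfl
  simp only [vertAng, ang, mE, mF, mG, pm, d1, d2, hfd, hv, Prod.swap_prod_mk]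
  rw [form_comm (fderiv ℝ (T.par i j k) (0, 0) (0, 1)), mul_comm (ρ _ ^ 2 * _)]

theorem exists_loc_eq {t : Fin T.n → ℝ} (ht : t ∈ realization T.n T.faces) :
    ∃ b, (T.loc b : Fin T.n → ℝ) = t := by
  obtain ⟨b, hb⟩ := Quot.exists_rep (T.homeo ⟨t, ht⟩)
  refine ⟨b, ?_⟩
  rw [loc, hb, Homeomorph.symm_apply_apply]

theorem exists_third {f : Finset (Fin T.n)} (hf : f ∈ T.faces) {i j : Fin T.n} (hij : i ≠ j)
    (hi : i ∈ f) (hj : j ∈ f) : ∃ k, f = {i, j, k} := by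
  have hsub : {i, j} ⊆ f := by
    intro l hl
    simp only [Finset.mem_insert, Finset.mem_singleton] at hl
    rcases hl with rfl | rfl <;> assumption
  have hc : (f \ {i, j}).card = 1 := by
    rw [Finset.card_sdiff_of_subset hsub, T.card_face f hf, Finset.card_pair hij]
  obtain ⟨k, hk⟩ := Finset.card_eq_one.1 hc
  refine ⟨k, ?_⟩
  have := Finset.union_sdiff_of_subset hsub
  rw [hk] at this
  rw [← this]
  ext l; simp

theorem exists_second {f : Finset (Fin T.n)} (hf : f ∈ T.faces) {i : Fin T.n} (hi : i ∈ f) :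
    ∃ j k, j < k ∧ f = {i, j, k} := by
  have hc : (f.erase i).card = 2 := by rw [Finset.card_erase_of_mem hi, T.card_face f hf]
  obtain ⟨j, k, hjk, he⟩ := Finset.card_eq_two.1 hc
  have hfe : f = {i, j, k} := by rw [← Finset.insert_erase hi, he]
  rcases lt_or_gt_of_ne hjk with h | h
  · exact ⟨j, k, h, hfe⟩
  · exact ⟨k, j, h, by rw [hfe]; ext l; simp; tauto⟩

/-- The condition on the last two vertices selects one of the two orderings that start at i, so each
triangle is listed once. -/
theorem isStar_vertex (i : Fin T.n) : T.IsStar (Pi.single i 1) 0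
    (T.flags.filter fun a => a.1 = i ∧ a.2.1 < a.2.2) := by
  refine ⟨fun a ha => ?_, fun a ha => ?_, fun f hf h0 => ?_, fun a ha a' ha' he => ?_⟩
  · exact T.mem_flags.1 (Finset.mem_filter.1 ha).1
  · obtain ⟨-, rfl, -⟩ := Finset.mem_filter.1 ha
    simp [bary]
  · have hi : i ∈ f := by
      by_contra hn
      have := h0 i hn
      simp at this
    obtain ⟨j, k, hjk, rfl⟩ := T.exists_second hf hi
    exact ⟨(i, j, k), Finset.mem_filter.2 ⟨T.mem_flags.2 hf, rfl, hjk⟩, rfl⟩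
  · obtain ⟨i1, j, k⟩ := a
    obtain ⟨i2, j', k'⟩ := a'
    obtain ⟨hf, h1, h2⟩ := Finset.mem_filter.1 ha
    obtain ⟨hf', h1', h2'⟩ := Finset.mem_filter.1 ha'
    simp only at h1 h2 h1' h2'
    subst h1 h1'
    obtain ⟨n1, n2, n3⟩ := distinct_of_card (T.card_face _ (T.mem_flags.1 hf))
    obtain ⟨n1', n2', n3'⟩ := distinct_of_card (T.card_face _ (T.mem_flags.1 hf'))
    simp only [verts] at he n1 n2 n3 n1' n2' n3'
    have m1 : j ∈ ({i2, j', k'} : Finset _) := by rw [← he]; simp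
    have m2 : k ∈ ({i2, j', k'} : Finset _) := by rw [← he]; simp
    simp only [Finset.mem_insert, Finset.mem_singleton] at m1 m2
    rcases m1 with rfl | rfl | rfl
    · exact absurd rfl n1
    · rcases m2 with rfl | rfl | rfl
      · exact absurd rfl n2
      · exact absurd rfl n3
      · rfl
    · rcases m2 with rfl | rfl | rfl
      · exact absurd rfl n2
      · exact absurd h2 (lt_asymm h2')
      · exact absurd rfl n3

/-- Once the first two vertices are prescribed, the set of vertices determines the ordering. -/
theorem isStar_edge {i j : Fin T.n} (hij : i ≠ j) {s : ℝ} (hs0 : 0 < s) (hs1 : s < 1) :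
    T.IsStar ((1 - s) • Pi.single i 1 + s • Pi.single j 1) s
      (T.flags.filter fun a => a.1 = i ∧ a.2.1 = j) := by
  refine ⟨fun a ha => ?_, fun a ha => ?_, fun f hf h0 => ?_, fun a ha a' ha' he => ?_⟩
  · exact T.mem_flags.1 (Finset.mem_filter.1 ha).1
  · obtain ⟨-, rfl, rfl⟩ := Finset.mem_filter.1 ha
    simp [bary]
  · have hi : i ∈ f := by
      by_contra hn
      have := h0 i hn
      simp [hij] at this
      linarith
    have hj : j ∈ f := by
      by_contra hn
      have := h0 j hn
      simp [hij.symm] at this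
      linarith
    obtain ⟨k, rfl⟩ := T.exists_third hf hij hi hj
    exact ⟨(i, j, k), Finset.mem_filter.2 ⟨T.mem_flags.2 hf, rfl, rfl⟩, rfl⟩
  · obtain ⟨i1, j1, k⟩ := a
    obtain ⟨i2, j2, k'⟩ := a'
    obtain ⟨hf, h1, h2⟩ := Finset.mem_filter.1 ha
    obtain ⟨hf', h1', h2'⟩ := Finset.mem_filter.1 ha'
    simp only at h1 h2 h1' h2'
    subst h1 h1' h2 h2'
    obtain ⟨n1, n2, n3⟩ := distinct_of_card (T.card_face _ (T.mem_flags.1 hf))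
    simp only [verts] at he n1 n2 n3
    have m1 : k ∈ ({i2, j2, k'} : Finset _) := by rw [← he]; simp
    simp only [Finset.mem_insert, Finset.mem_singleton] at m1
    rcases m1 with rfl | rfl | rfl
    · exact absurd rfl n2
    · exact absurd rfl n3
    · rfl

end SmoothTriangulation

/-! ### Gauss–Bonnet by summation over ordered triangles -/

variable {Γ : Subgroup (Mink ≃ₗ[ℝ] Mink)} {ρ : Mink → ℝ}

namespace SmoothTriangulation
variable (T : SmoothTriangulation Γ)

theorem flags_distinct {a : Fin T.n × Fin T.n × Fin T.n} (ha : a ∈ T.flags) :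
    a.1 ≠ a.2.1 ∧ a.1 ≠ a.2.2 ∧ a.2.1 ≠ a.2.2 :=
  distinct_of_card (T.card_face _ (T.mem_flags.1 ha))

theorem sum_cyc (g : Fin T.n × Fin T.n × Fin T.n → ℝ) :
    ∑ a ∈ T.flags, g (T.cyc a) = ∑ a ∈ T.flags, g a := by
  refine Finset.sum_nbij' T.cyc (fun a => T.cyc (T.cyc a)) ?_ ?_ ?_ ?_ ?_
  · intro a ha; rw [T.mem_flags, T.verts_cyc]; exact T.mem_flags.1 ha
  · intro a ha; rw [T.mem_flags, T.verts_cyc, T.verts_cyc]; exact T.mem_flags.1 ha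
  · intro a _; rfl
  · intro a _; rfl
  · intro a _; rfl

theorem exists_star_edge {i j : Fin T.n} (hij : i ≠ j)
    (hne : (T.flags.filter fun a => a.1 = i ∧ a.2.1 = j).Nonempty) {s : ℝ} (hs0 : 0 < s)
    (hs1 : s < 1) : ∃ b, T.IsStar (T.loc b) s (T.flags.filter fun a => a.1 = i ∧ a.2.1 = j) := by
  have h := T.isStar_edge hij hs0 hs1
  obtain ⟨a, ha⟩ := hne
  have hmem := T.bary_mem (h.mem_faces a ha) (z := (s, 0)) ⟨hs0.le, le_rfl, by simpa using hs1.le⟩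
  rw [h.coord a ha] at hmem
  obtain ⟨b, hb⟩ := T.exists_loc_eq hmem
  exact ⟨b, by rw [hb]; exact h⟩

section counting
variable (hΓ : IsHyperbolicManifoldGroup Γ) (hfree : FreeAtInfinity Γ)
include hΓ hfree

theorem card_edge_fiber {i j : Fin T.n}
    (hne : (T.flags.filter fun a => a.1 = i ∧ a.2.1 = j).Nonempty) :
    (T.flags.filter fun a => a.1 = i ∧ a.2.1 = j).card = 2 := by
  have hij : i ≠ j := by
    obtain ⟨a, ha⟩ := hne
    obtain ⟨hfl, rfl, rfl⟩ := Finset.mem_filter.1 ha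
    exact (T.flags_distinct hfl).1
  obtain ⟨b, hb⟩ := T.exists_star_edge hij hne (s := 1 / 2) (by norm_num) (by norm_num)
  exact T.card_star hΓ hfree (by norm_num) (by norm_num) hb

theorem sum_edgeCurv_fiber (hρ : IsConformalMetric Γ ρ) (i j : Fin T.n) :
    ∑ a ∈ T.flags.filter (fun a => a.1 = i ∧ a.2.1 = j), T.edgeCurv ρ a = 0 := by
  rcases (T.flags.filter fun a => a.1 = i ∧ a.2.1 = j).eq_empty_or_nonempty with he | hne
  · rw [he, Finset.sum_empty]
  obtain ⟨a, a', haa, hS⟩ := Finset.card_eq_two.1 (T.card_edge_fiber hΓ hfree hne)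
  have ha : a ∈ T.flags.filter fun a => a.1 = i ∧ a.2.1 = j := by rw [hS]; simp
  have ha' : a' ∈ T.flags.filter fun a => a.1 = i ∧ a.2.1 = j := by rw [hS]; simp
  have hij : i ≠ j := by
    obtain ⟨hfl, rfl, rfl⟩ := Finset.mem_filter.1 ha
    exact (T.flags_distinct hfl).1
  obtain ⟨hf, h1, h2⟩ := Finset.mem_filter.1 ha
  obtain ⟨hf', h1', h2'⟩ := Finset.mem_filter.1 ha'
  rw [hS, Finset.sum_pair haa, edgeCurv, edgeCurv, ← intervalIntegral.integral_add
    (T.continuousOn_kap hρ hf).intervalIntegrable (T.continuousOn_kap hρ hf').intervalIntegrable]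
  refine intervalIntegral.integral_zero_ae ?_
  -- At the endpoint s = 1 the star is that of a vertex, so cancellation is only available for 0 < s
  -- < 1.
  have hz : ∀ᵐ s : ℝ, s ≠ 1 := by simp [ae_iff]
  filter_upwards [hz] with s hs1 hs
  rw [uIoc_of_le zero_le_one] at hs
  have hs1 : s < 1 := lt_of_le_of_ne hs.2 hs1
  obtain ⟨b, hb⟩ := T.exists_star_edge hij hne hs.1 hs1
  exact T.kap_add_kap hΓ hfree hρ hs.1 hs1 hb ha ha' haa (h1.trans h1'.symm) (h2.trans h2'.symm)

theorem sum_edgeCurv (hρ : IsConformalMetric Γ ρ) : ∑ a ∈ T.flags, T.edgeCurv ρ a = 0 := by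
  rw [← Finset.sum_fiberwise T.flags (fun a => (a.1, a.2.1))]
  refine Finset.sum_eq_zero fun e _ => ?_
  have := T.sum_edgeCurv_fiber hΓ hfree hρ e.1 e.2
  simpa only [Prod.ext_iff] using this

/-- The angles at each vertex add up to 2π, and each angle occurs for two orderings of the remaining
vertices. -/
theorem sum_vertAng (hρ : IsConformalMetric Γ ρ) :
    ∑ a ∈ T.flags, T.vertAng ρ a = 4 * Real.pi * T.n := by
  have hlt : ∑ a ∈ T.flags.filter (fun a => a.2.1 < a.2.2), T.vertAng ρ a = 2 * Real.pi * T.n := by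
    rw [← Finset.sum_fiberwise _ (fun a => a.1)]
    have : ∀ i : Fin T.n, ∑ a ∈ (T.flags.filter fun a => a.2.1 < a.2.2).filter (fun a => a.1 = i),
        T.vertAng ρ a = 2 * Real.pi := by
      intro i
      have h := T.isStar_vertex i
      obtain ⟨f, hf, hi⟩ := T.vertex_mem i
      obtain ⟨j, k, hjk, rfl⟩ := T.exists_second hf hi
      have hmem := T.bary_mem hf (z := (0, 0)) ⟨le_rfl, le_rfl, by simp⟩
      have : bary i j k (0, 0) = Pi.single i 1 := by simp [bary]
      rw [this] at hmem
      obtain ⟨b, hb⟩ := T.exists_loc_eq hmem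
      rw [← hb] at h
      rw [← T.sum_ang hΓ hfree hρ h, Finset.filter_filter]
      refine Finset.sum_congr ?_ fun _ _ => rfl
      exact Finset.filter_congr fun a _ => and_comm
    rw [Finset.sum_congr rfl fun i _ => this i]
    simp; ring
  have hgt : ∑ a ∈ T.flags.filter (fun a => ¬ a.2.1 < a.2.2), T.vertAng ρ a =
      ∑ a ∈ T.flags.filter (fun a => a.2.1 < a.2.2), T.vertAng ρ a := by
    have hv : ∀ a : Fin T.n × Fin T.n × Fin T.n, T.verts (a.1, a.2.2, a.2.1) = T.verts a := by
      intro a; ext; simp [verts]; tauto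
    refine Finset.sum_nbij' (fun a => (a.1, a.2.2, a.2.1)) (fun a => (a.1, a.2.2, a.2.1))
      ?_ ?_ (fun _ _ => rfl) (fun _ _ => rfl) ?_
    · intro a ha
      obtain ⟨h1, h2⟩ := Finset.mem_filter.1 ha
      refine Finset.mem_filter.2 ⟨T.mem_flags.2 (by rw [hv]; exact T.mem_flags.1 h1), ?_⟩
      exact lt_of_le_of_ne (not_lt.1 h2) (T.flags_distinct h1).2.2.symm
    · intro a ha
      obtain ⟨h1, h2⟩ := Finset.mem_filter.1 ha
      refine Finset.mem_filter.2 ⟨T.mem_flags.2 (by rw [hv]; exact T.mem_flags.1 h1), ?_⟩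
      exact not_lt.2 h2.le
    · intro a ha
      exact (T.vertAng_swap _ _ _ (T.mem_flags.1 (Finset.mem_filter.1 ha).1)).symm
  rw [← Finset.sum_filter_add_sum_filter_not T.flags (fun a => a.2.1 < a.2.2), hgt, hlt]
  ring

/-- An edge can be ordered in two ways, and each ordered edge begins exactly two ordered triangles,
by the angle count `card_star`. -/
theorem card_flags_edges :
    T.flags.card = 4 * (T.faces.biUnion (fun f => f.powersetCard 2)).card := by
  have hmaps : ∀ a ∈ T.flags, ({a.1, a.2.1} : Finset (Fin T.n)) ∈
      T.faces.biUnion (fun f => f.powersetCard 2) := by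
    intro a ha
    refine Finset.mem_biUnion.2 ⟨_, T.mem_flags.1 ha, Finset.mem_powersetCard.2 ⟨?_, ?_⟩⟩
    · intro l hl; simp only [verts, Finset.mem_insert, Finset.mem_singleton] at hl ⊢; tauto
    · exact Finset.card_pair (T.flags_distinct ha).1
  rw [Finset.card_eq_sum_card_fiberwise hmaps, mul_comm, ← smul_eq_mul, ← Finset.sum_const]
  refine Finset.sum_congr rfl fun e he => ?_
  obtain ⟨f, hf, hef⟩ := Finset.mem_biUnion.1 he
  obtain ⟨hsub, hc⟩ := Finset.mem_powersetCard.1 hef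
  obtain ⟨i, j, hij, rfl⟩ := Finset.card_eq_two.1 hc
  obtain ⟨k, rfl⟩ := T.exists_third hf hij (hsub (by simp)) (hsub (by simp))
  have h1 := T.card_edge_fiber hΓ hfree (i := i) (j := j)
    ⟨(i, j, k), Finset.mem_filter.2 ⟨T.mem_flags.2 hf, rfl, rfl⟩⟩
  have h2 := T.card_edge_fiber hΓ hfree (i := j) (j := i)
    ⟨(j, i, k), Finset.mem_filter.2 ⟨T.mem_flags.2 (by
      rw [show T.verts (j, i, k) = {i, j, k} by ext; simp [verts]; tauto]; exact hf), rfl, rfl⟩⟩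
  have hu : T.flags.filter (fun a => ({a.1, a.2.1} : Finset (Fin T.n)) = {i, j}) =
      (T.flags.filter fun a => a.1 = i ∧ a.2.1 = j) ∪
        (T.flags.filter fun a => a.1 = j ∧ a.2.1 = i) := by
    rw [← Finset.filter_or]
    refine Finset.filter_congr fun a _ => ?_
    rw [← Finset.coe_inj]
    simp only [Finset.coe_insert, Finset.coe_singleton]
    exact Set.pair_eq_pair_iff
  rw [hu, Finset.card_union_of_disjoint, h1, h2]
  refine Finset.disjoint_filter.2 fun a _ h h' => hij ?_
  rw [← h.1, h'.1]

omit hΓ hfree in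
theorem card_face_fiber {f : Finset (Fin T.n)} (hf : f ∈ T.faces) :
    (T.flags.filter fun a => T.verts a = f).card = 6 := by
  obtain ⟨i, j, k, hij, hik, hjk, rfl⟩ := Finset.card_eq_three.1 (T.card_face f hf)
  have : T.flags.filter (fun a => T.verts a = {i, j, k}) =
      {(i, j, k), (i, k, j), (j, i, k), (j, k, i), (k, i, j), (k, j, i)} := by
    ext ⟨x, y, z⟩
    simp only [Finset.mem_filter, T.mem_flags, Finset.mem_insert, Finset.mem_singleton,
      Prod.mk.injEq]
    constructor
    · rintro ⟨h1, h2⟩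
      obtain ⟨n1, n2, n3⟩ := distinct_of_card (T.card_face _ h1)
      have m : ∀ w ∈ T.verts (x, y, z), w = i ∨ w = j ∨ w = k := by
        intro w hw; rw [h2] at hw; simpa using hw
      have m1 := m x (by simp [verts])
      have m2 := m y (by simp [verts])
      have m3 := m z (by simp [verts])
      simp only at n1 n2 n3
      clear m h1 h2
      grind
    · intro h
      have hv : T.verts (x, y, z) = {i, j, k} := by
        ext w
        simp only [verts, Finset.mem_insert, Finset.mem_singleton]
        rcases h with ⟨rfl, rfl, rfl⟩ | ⟨rfl, rfl, rfl⟩ | ⟨rfl, rfl, rfl⟩ | ⟨rfl, rfl, rfl⟩ |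
          ⟨rfl, rfl, rfl⟩ | ⟨rfl, rfl, rfl⟩ <;> tauto
      exact ⟨by rw [hv]; exact hf, hv⟩
  rw [this]
  simp [Finset.card_insert_of_notMem, hij, hik, hjk, hij.symm, hik.symm, hjk.symm]

omit hΓ hfree in
theorem sum_flags_verts (ar : Finset (Fin T.n) → ℝ) :
    ∑ a ∈ T.flags, ar (T.verts a) = 6 * ∑ f ∈ T.faces, ar f := by
  rw [← Finset.sum_fiberwise_of_maps_to (t := T.faces) (g := T.verts)
    (fun a ha => T.mem_flags.1 ha), Finset.mul_sum]
  refine Finset.sum_congr rfl fun f hf => ?_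
  rw [Finset.sum_congr rfl fun a ha => congrArg ar (Finset.mem_filter.1 ha).2, Finset.sum_const,
    T.card_face_fiber hf]
  simp

/-- The Gauss–Bonnet theorem for a metric of curvature `-4`. -/
theorem gauss_bonnet (hρ : IsHyperbolicMetric Γ ρ) (ar : Finset (Fin T.n) → ℝ)
    (har : ∀ a ∈ T.flags, T.triArea ρ a = ar (T.verts a)) :
    4 * ∑ f ∈ T.faces, ar f = -2 * Real.pi * T.eulerChar := by
  have hρ' := hρ.toIsConformalMetric
  -- In the sum of the triangle formulas each of the three cyclic positions contributes the same
  -- total: curvatures contribute 0 and angles 4πn.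
  have h : ∑ a ∈ T.flags, 4 * T.triArea ρ a = Real.pi * T.flags.card - 12 * Real.pi * T.n := by
    rw [Finset.sum_congr rfl fun a ha => T.four_mul_triArea hρ ha]
    simp only [Finset.sum_sub_distrib, Finset.sum_add_distrib]
    rw [T.sum_cyc (fun a => T.edgeCurv ρ (T.cyc a)), T.sum_cyc (T.edgeCurv ρ),
      T.sum_cyc (fun a => T.vertAng ρ (T.cyc a)), T.sum_cyc (T.vertAng ρ),
      T.sum_edgeCurv hΓ hfree hρ', T.sum_vertAng hΓ hfree hρ']
    simp; ring
  rw [← Finset.mul_sum, Finset.sum_congr rfl har, T.sum_flags_verts] at h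
  have h6 : (T.flags.card : ℝ) = 6 * T.faces.card := by
    have := T.sum_flags_verts fun _ => 1
    simpa using this
  have h4 : (T.flags.card : ℝ) = 4 * (T.faces.biUnion (fun f => f.powersetCard 2)).card := by
    exact_mod_cast T.card_flags_edges hΓ hfree
  rw [eulerChar]
  push_cast
  -- Counting ordered triangles by faces and by edges gives 6F = 4E, so the number of faces and
  -- vertices alone determines V - E + F.
  have : ((T.faces.biUnion (fun f => f.powersetCard 2)).card : ℝ) = 3 / 2 * T.faces.card := by
    linarith
  rw [this]
  rw [h6] at h
  linarith

end counting
end SmoothTriangulation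

/-! ### Area at infinity as a Γ-invariant measure -/

variable {Γ : Subgroup (Mink ≃ₗ[ℝ] Mink)} {ρ : Mink → ℝ} {U : Set (ℝ × ℝ)} {p : ℝ × ℝ → Mink}

theorem det_eq_cross (L : ℝ × ℝ →L[ℝ] ℝ × ℝ) : L.det = cross (L (1, 0)) (L (0, 1)) := by
  rw [ContinuousLinearMap.det, ← LinearMap.det_toMatrix (Module.Basis.finTwoProd ℝ),
    Matrix.det_fin_two]
  simp [LinearMap.toMatrix_apply, cross]
  ring

/-- The area of a subset of the domain of discontinuity. -/
def idealArea (ρ : Mink → ℝ) (S : Set Mink) : ENNReal :=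
  ∫⁻ u in stereo ⁻¹' S, ENNReal.ofReal (lam ρ 1 u ^ 2)

theorem eq_vecM_of_ideal {b : Mink} (hb : b ∈ idealSphere) (h : b.2 2 = 1) : b = vecM 1 := by
  have h1 := ideal_norm hb
  have h2 := normSq_coord b.2
  rw [h1, h] at h2
  have h3 : b.2 0 = 0 := by nlinarith [sq_nonneg (b.2 0), sq_nonneg (b.2 1)]
  have h4 : b.2 1 = 0 := by nlinarith [sq_nonneg (b.2 0), sq_nonneg (b.2 1)]
  exact mink_ext (by rw [hb.2]; rfl) (by rw [h3]; simp [vecM]) (by rw [h4]; simp [vecM])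
    (by rw [h]; simp [vecM])

theorem stereo_preimage_image (hp : MapsTo p U idealSphere) {A : Set (ℝ × ℝ)} (hA : A ⊆ U) :
    stereo ⁻¹' (p '' A) = (fun z => chartInv 1 (p z)) '' (A \ {z | (p z).2 2 = 1}) := by
  rw [← chart_one]
  ext u
  constructor
  · rintro ⟨z, hz, h⟩
    refine ⟨z, ⟨hz, fun h1 => ?_⟩, ?_⟩
    · have := pole_ne_chart (one_pow 2) u
      rw [← h, one_mul] at this
      exact this h1
    · simp only [h]
      exact chartInv_chart (one_pow 2) u
  · rintro ⟨z, ⟨hz, hne⟩, rfl⟩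
    exact ⟨z, hz, (chart_chartInv (one_pow 2) (hp (hA hz)) (by simpa using hne)).symm⟩

/-- The area in a local parametrization. -/
theorem idealArea_image (hp : IsLocalParam Γ U p) {A : Set (ℝ × ℝ)}
    (hA : A ⊆ U) (hm : MeasurableSet A) (hinj : InjOn p A) :
    idealArea ρ (p '' A) = ∫⁻ z in A, ENNReal.ofReal √(mE ρ p z * mG ρ p z - mF ρ p z ^ 2) := by
  have hmaps : MapsTo p U idealSphere := fun z hz => (hp.mapsTo hz).1
  have hsub : (A ∩ {z | (p z).2 2 = 1}).Subsingleton := by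
    rintro z ⟨hz, h⟩ w ⟨hw, h'⟩
    exact hinj hz hw ((eq_vecM_of_ideal (hmaps (hA hz)) h).trans
      (eq_vecM_of_ideal (hmaps (hA hw)) h').symm)
  have hdiff : A \ {z | (p z).2 2 = 1} = A \ (A ∩ {z | (p z).2 2 = 1}) := by
    rw [sdiff_self_inter]
  have hm' : MeasurableSet (A \ {z | (p z).2 2 = 1}) := by
    rw [hdiff]; exact hm.diff hsub.measurableSet
  have hpl : ∀ z : ℝ × ℝ, ∃ L : ℝ × ℝ →L[ℝ] ℝ × ℝ, z ∈ A \ {z | (p z).2 2 = 1} →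
      HasFDerivAt (fun z => chartInv 1 (p z)) L z ∧
      ∀ v, fderiv ℝ p z v = fderiv ℝ (chart 1) (chartInv 1 (p z)) (L v) := by
    intro z
    by_cases hz : z ∈ A \ {z | (p z).2 2 = 1}
    · obtain ⟨L, h1, -, h3⟩ := hp.exists_planar (hA hz.1) (one_pow 2)
        (by rw [one_mul]; exact hz.2)
      exact ⟨L, fun _ => ⟨h1.hasFDerivAt, h3⟩⟩
    · exact ⟨0, fun h => absurd h hz⟩
  choose L hL using hpl
  rw [idealArea, stereo_preimage_image hmaps hA,
    lintegral_image_eq_lintegral_abs_det_fderiv_mul volume hm'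
      (fun z hz => (hL z hz).1.hasFDerivWithinAt)]
  · have hae : (A \ {z | (p z).2 2 = 1} : Set (ℝ × ℝ)) =ᵐ[volume] A := by
      rw [hdiff]; exact sdiff_null_ae_eq_self (hsub.measure_zero _)
    rw [← setLIntegral_congr hae]
    refine setLIntegral_congr_fun hm' fun z hz => ?_
    have hc : chart 1 (chartInv 1 (p z)) = p z :=
      chart_chartInv (one_pow 2) (hmaps (hA hz.1)) (by rw [one_mul]; exact hz.2)
    simp only [mE, mG, mF, d1, d2, (hL z hz).2, form_fderiv_chart (one_pow 2)]
    rw [← ENNReal.ofReal_mul (abs_nonneg _), lam, hc, det_eq_cross, cross]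
    congr 1
    generalize 2 / (1 + (chartInv 1 (p z)).1 ^ 2 + (chartInv 1 (p z)).2 ^ 2) = c
    rw [← Real.sqrt_sq (mul_nonneg (abs_nonneg _) (sq_nonneg (ρ (p z) * c))), mul_pow, sq_abs]
    congr 1
    ring
  · intro z hz w hw h
    refine hinj hz.1 hw.1 ?_
    have h1 := chart_chartInv (one_pow 2) (hmaps (hA hz.1)) (by rw [one_mul]; exact hz.2)
    have h2 := chart_chartInv (one_pow 2) (hmaps (hA hw.1)) (by rw [one_mul]; exact hw.2)
    rw [← h1, ← h2]
    exact congrArg _ h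

theorem idealArea_image_null (hp : IsLocalParam Γ U p) {N : Set (ℝ × ℝ)}
    (hN : N ⊆ U) (h0 : volume N = 0) : volume (stereo ⁻¹' (p '' N)) = 0 := by
  have hmaps : MapsTo p U idealSphere := fun z hz => (hp.mapsTo hz).1
  rw [stereo_preimage_image hmaps hN]
  refine addHaar_image_eq_zero_of_differentiableOn_of_addHaar_eq_zero volume ?_
    (measure_mono_null sdiff_subset h0)
  intro z hz
  obtain ⟨L, h1, -, h3⟩ := hp.exists_planar (hN hz.1) (one_pow 2) (by rw [one_mul]; exact hz.2)
  exact h1.hasFDerivAt.differentiableAt.differentiableWithinAt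

theorem isLocalParam_stereo : IsLocalParam Γ (stereo ⁻¹' discontinuityDomain Γ) stereo := by
  rw [← chart_one]; exact isLocalParam_chart (one_pow 2)

theorem measurableSet_preimage_lift2 (hρ : IsConformalMetric Γ ρ) {S : Set Mink}
    (hS : MeasurableSet S) :
    MeasurableSet (lift2 ρ stereo ⁻¹' S ∩ stereo ⁻¹' discontinuityDomain Γ) := by
  classical
  have hp := isLocalParam_stereo (Γ := Γ)
  have hl := (contDiffOn_lift2 hρ hp).continuousOn.measurable_piecewise
    (g := fun _ => 0) continuousOn_const hp.isOpen.measurableSet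
  have : lift2 ρ stereo ⁻¹' S ∩ stereo ⁻¹' discontinuityDomain Γ =
      ((stereo ⁻¹' discontinuityDomain Γ).piecewise (lift2 ρ stereo) fun _ => 0) ⁻¹' S ∩
        stereo ⁻¹' discontinuityDomain Γ := by
    ext u
    simp only [mem_inter_iff, mem_preimage]
    refine and_congr_left fun hu => ?_
    rw [piecewise_eq_of_mem (stereo ⁻¹' discontinuityDomain Γ) _ _ hu]
  rw [this]
  exact (hl hS).inter hp.isOpen.measurableSet

/-- The area of the conformal metric, as a measure on the corresponding section of the light
cone, on which `Γ` acts linearly. -/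
def coneMeasure (Γ : Subgroup (Mink ≃ₗ[ℝ] Mink)) (ρ : Mink → ℝ) : Measure Mink :=
  ((volume.restrict (stereo ⁻¹' discontinuityDomain Γ)).withDensity
    fun u => ENNReal.ofReal (lam ρ 1 u ^ 2)).map (lift2 ρ stereo)

theorem coneMeasure_apply (hρ : IsConformalMetric Γ ρ) {S : Set Mink} (hS : MeasurableSet S) :
    coneMeasure Γ ρ S = ∫⁻ u in lift2 ρ stereo ⁻¹' S ∩ stereo ⁻¹' discontinuityDomain Γ,
      ENNReal.ofReal (lam ρ 1 u ^ 2) := by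
  have hp := isLocalParam_stereo (Γ := Γ)
  have hae : AEMeasurable (lift2 ρ stereo)
      ((volume.restrict (stereo ⁻¹' discontinuityDomain Γ)).withDensity
        fun u => ENNReal.ofReal (lam ρ 1 u ^ 2)) :=
    ((contDiffOn_lift2 hρ hp).continuousOn.aemeasurable hp.isOpen.measurableSet).mono_ac
      (withDensity_absolutelyContinuous _ _)
  rw [coneMeasure, Measure.map_apply_of_aemeasurable hae hS, withDensity_apply',
    Measure.restrict_restrict' hp.isOpen.measurableSet]

/-- The radial projection to the sphere at infinity. -/
def proj (x : Mink) : Mink := x.1⁻¹ • x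

theorem measurable_proj : Measurable proj := by unfold proj; fun_prop

theorem proj_smul {b : Mink} (hb : b ∈ idealSphere) {c : ℝ} (hc : c ≠ 0) : proj (c • b) = b := by
  simp [proj, hb.2, smul_smul, hc]

theorem stereo_mem (u : ℝ × ℝ) : stereo u ∈ idealSphere := by
  rw [← chart_one]; exact chart_mem (one_pow 2) u

theorem stereo_injective : Function.Injective stereo := by
  rw [← chart_one]; exact chart_injective (one_pow 2)

theorem exists_stereo_eq {b : Mink} (hb : b ∈ idealSphere) (h : b ≠ vecM 1) :
    ∃ u, stereo u = b := by
  refine ⟨chartInv 1 b, ?_⟩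
  rw [← chart_one]
  exact chart_chartInv (one_pow 2) hb fun h1 => h (eq_vecM_of_ideal hb (by simpa using h1))

theorem coneMeasure_proj (hρ : IsConformalMetric Γ ρ) {S : Set Mink} (hS : MeasurableSet S)
    (hSΩ : S ⊆ discontinuityDomain Γ) : coneMeasure Γ ρ (proj ⁻¹' S) = idealArea ρ S := by
  rw [coneMeasure_apply hρ (measurable_proj hS), idealArea]
  congr 2
  ext u
  simp only [mem_inter_iff, mem_preimage]
  constructor
  · rintro ⟨h1, h2⟩
    rwa [lift2, proj_smul h2.1 (hρ.pos _ h2).ne'] at h1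
  · intro h
    have h2 := hSΩ h
    refine ⟨?_, h2⟩
    rwa [lift2, proj_smul h2.1 (hρ.pos _ h2).ne']

theorem coneMeasure_null (hρ : IsConformalMetric Γ ρ) {S : Set Mink} (hS : MeasurableSet S)
    (h0 : volume (lift2 ρ stereo ⁻¹' S ∩ stereo ⁻¹' discontinuityDomain Γ) = 0) :
    coneMeasure Γ ρ S = 0 := by
  rw [coneMeasure_apply hρ hS]
  exact setLIntegral_measure_zero _ _ h0

/-- Invariance of the metric makes the area integrals in the parametrizations `stereo` and γ ∘
`stereo` equal. Their images differ by at most one point, the image of the pole that `stereo`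
misses. -/
theorem smulInvariant_coneMeasure (hΓ : IsHyperbolicManifoldGroup Γ)
    (hρ : IsConformalMetric Γ ρ) : SMulInvariantMeasure Γ Mink (coneMeasure Γ ρ) := by
  refine ⟨fun γ S hS => ?_⟩
  have hS' : MeasurableSet ((γ • · : Mink → Mink) ⁻¹' S) :=
    (continuous_lorentz (γ : Mink ≃ₗ[ℝ] Mink)).measurable hS
  have hp := isLocalParam_stereo (Γ := Γ)
  have hpγ := hp.act hΓ γ.2
  rw [coneMeasure_apply hρ hS', coneMeasure_apply hρ hS]
  set A := lift2 ρ stereo ⁻¹' ((γ • · : Mink → Mink) ⁻¹' S) ∩ stereo ⁻¹' discontinuityDomain Γ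
    with hA
  have hAm : MeasurableSet A := measurableSet_preimage_lift2 hρ hS'
  have hAU : A ⊆ stereo ⁻¹' discontinuityDomain Γ := inter_subset_right
  have hinj : InjOn (fun z => idealAct (γ : Mink ≃ₗ[ℝ] Mink) (stereo z)) A := by
    intro z _ w _ h
    refine stereo_injective ?_
    rw [← idealAct_inv_cancel hΓ γ.2 (stereo_mem z), ← idealAct_inv_cancel hΓ γ.2 (stereo_mem w)]
    exact congrArg _ h
  have h1 := idealArea_image (ρ := ρ) hpγ hAU hAm hinj
  have h2 := idealArea_image (ρ := ρ) hp hAU hAm stereo_injective.injOn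
  rw [idealArea, preimage_image_eq _ stereo_injective] at h2
  rw [h2]
  have h3 : ∫⁻ z in A, ENNReal.ofReal √(mE ρ stereo z * mG ρ stereo z - mF ρ stereo z ^ 2) =
      ∫⁻ z in A, ENNReal.ofReal √(mE ρ (fun z => idealAct (γ : Mink ≃ₗ[ℝ] Mink) (stereo z)) z *
        mG ρ (fun z => idealAct (γ : Mink ≃ₗ[ℝ] Mink) (stereo z)) z -
        mF ρ (fun z => idealAct (γ : Mink ≃ₗ[ℝ] Mink) (stereo z)) z ^ 2) := by
    refine setLIntegral_congr_fun hAm fun z hz => ?_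
    have hi := hρ.invariant _ _ hp γ γ.2 z (hAU hz)
    simp only [mE, mF, mG, d1, d2]
    rw [← hi (1, 0) (1, 0), ← hi (1, 0) (0, 1), ← hi (0, 1) (0, 1)]
    rfl
  rw [h3, ← h1, idealArea]
  have hsub : stereo ⁻¹' ((fun z => idealAct (γ : Mink ≃ₗ[ℝ] Mink) (stereo z)) '' A) ⊆
      lift2 ρ stereo ⁻¹' S ∩ stereo ⁻¹' discontinuityDomain Γ := by
    rintro u ⟨z, ⟨hz1, hz2⟩, hzu⟩
    simp only at hzu
    have hΩ := idealAct_omega hΓ γ.2 hz2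
    rw [hzu] at hΩ
    refine ⟨?_, hΩ⟩
    have := conformal_equivariant hΓ hρ γ.2 hz2
    rw [hzu] at this
    simp only [mem_preimage, lift2] at hz1 ⊢
    rw [← this]; exact hz1
  refine setLIntegral_congr ((LE.le.eventuallyLE hsub).antisymm ?_)
  refine ae_le_set.2 (Set.Subsingleton.measure_zero ?_ _)
  have key : ∀ u ∈ (lift2 ρ stereo ⁻¹' S ∩ stereo ⁻¹' discontinuityDomain Γ) \
      stereo ⁻¹' ((fun z => idealAct (γ : Mink ≃ₗ[ℝ] Mink) (stereo z)) '' A),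
      stereo u = idealAct (γ : Mink ≃ₗ[ℝ] Mink) (vecM 1) := by
    rintro u ⟨⟨hu1, hu2⟩, hu3⟩
    by_contra hne
    have hbΩ := idealAct_omega hΓ (Γ.inv_mem γ.2) hu2
    obtain ⟨z, hz⟩ := exists_stereo_eq hbΩ.1 fun h => hne (by
      rw [← h, idealAct_cancel_inv hΓ γ.2 hu2.1])
    have hzu : idealAct (γ : Mink ≃ₗ[ℝ] Mink) (stereo z) = stereo u := by
      rw [hz, idealAct_cancel_inv hΓ γ.2 hu2.1]
    have hzΩ : stereo z ∈ discontinuityDomain Γ := by rw [hz]; exact hbΩ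
    refine hu3 ⟨z, ⟨?_, hzΩ⟩, hzu⟩
    have := conformal_equivariant hΓ hρ γ.2 hzΩ
    rw [hzu] at this
    simp only [mem_preimage, lift2] at hu1 ⊢
    rw [smul_eq_apply, this]; exact hu1
  intro u hu w hw
  exact stereo_injective ((key u hu).trans (key w hw).symm)

theorem ae_coneMeasure (hρ : IsConformalMetric Γ ρ) {S : Set Mink} (hS : MeasurableSet S)
    (h : ∀ᵐ u, stereo u ∈ discontinuityDomain Γ → lift2 ρ stereo u ∈ S) :
    ∀ᵐ x ∂(coneMeasure Γ ρ), x ∈ S := by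
  refine coneMeasure_null hρ hS.compl ?_
  refine measure_mono_null ?_ h
  rintro u ⟨h1, h2⟩ h3
  exact h1 (h3 h2)

theorem proj_smul_group (γ : Mink ≃ₗ[ℝ] Mink) {x : Mink} (hx : x.1 ≠ 0) :
    proj (γ x) = idealAct γ (proj x) := by
  rw [proj, proj, idealAct_smul _ (inv_ne_zero hx), idealAct]

theorem fst_ne_zero_of_proj {x : Mink} (h : proj x ∈ idealSphere) : x.1 ≠ 0 := by
  intro h0
  have := h.2
  simp [proj, h0] at this

/-- Radial projection intertwines the linear action of Γ on the section of the light cone with the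
projective action at infinity, so a fundamental domain for the latter pulls back to one in the sense
of linear group actions on a measure space. -/
theorem isFundamentalDomain_cone (hΓ : IsHyperbolicManifoldGroup Γ) (hρ : IsConformalMetric Γ ρ)
    {S : Set Mink} (hS : MeasurableSet S) (hSΩ : S ⊆ discontinuityDomain Γ)
    (hcov : ∀ᵐ u, stereo u ∈ discontinuityDomain Γ → ∃ γ ∈ Γ, idealAct γ (stereo u) ∈ S)
    (hdis : ∀ γ ∈ Γ, ∀ b ∈ S, idealAct γ b ∈ S → γ = 1) :
    IsFundamentalDomain Γ (proj ⁻¹' S) (coneMeasure Γ ρ) := by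
  have := countable_group hΓ
  refine isFundamentalDomain_of (measurable_proj hS).nullMeasurableSet ?_ ?_
  · have hm : MeasurableSet {x : Mink | ∃ γ : Γ, γ • x ∈ proj ⁻¹' S} := by
      have : {x : Mink | ∃ γ : Γ, γ • x ∈ proj ⁻¹' S} =
          ⋃ γ : Γ, (γ : Mink ≃ₗ[ℝ] Mink) ⁻¹' (proj ⁻¹' S) := by
        ext x; simp [smul_eq_apply]
      rw [this]
      exact MeasurableSet.iUnion fun γ =>
        (continuous_lorentz (γ : Mink ≃ₗ[ℝ] Mink)).measurable (measurable_proj hS)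
    refine ae_coneMeasure hρ hm ?_
    filter_upwards [hcov] with u hu hΩ
    obtain ⟨γ, hγ, h⟩ := hu hΩ
    refine ⟨⟨γ, hγ⟩, ?_⟩
    rw [smul_eq_apply, mem_preimage, lift2, conformal_equivariant hΓ hρ hγ hΩ]
    have hΩ' := hSΩ h
    rwa [proj_smul hΩ'.1 (hρ.pos _ hΩ').ne']
  · intro γ x hx h
    have hx1 := fst_ne_zero_of_proj (hSΩ hx).1
    rw [smul_eq_apply, mem_preimage, proj_smul_group _ hx1] at h
    exact Subtype.ext (hdis γ γ.2 _ hx h)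

theorem idealArea_eq_of_fundamental (hΓ : IsHyperbolicManifoldGroup Γ)
    (hρ : IsConformalMetric Γ ρ) {B S : Set Mink}
    (hB : IsFundDomain Γ idealAct (discontinuityDomain Γ) B)
    (hS : MeasurableSet S) (hSΩ : S ⊆ discontinuityDomain Γ)
    (hcov : ∀ᵐ u, stereo u ∈ discontinuityDomain Γ → ∃ γ ∈ Γ, idealAct γ (stereo u) ∈ S)
    (hdis : ∀ γ ∈ Γ, ∀ b ∈ S, idealAct γ b ∈ S → γ = 1) : idealArea ρ B = idealArea ρ S := by
  have := countable_group hΓ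
  have := smulInvariant_coneMeasure hΓ hρ
  have := measurableConstSMul (Γ := Γ)
  rw [← coneMeasure_proj hρ hB.measurable hB.subset, ← coneMeasure_proj hρ hS hSΩ]
  refine (isFundamentalDomain_cone hΓ hρ hB.measurable hB.subset ?_ ?_).measure_eq
    (isFundamentalDomain_cone hΓ hρ hS hSΩ hcov hdis)
  · refine Eventually.of_forall fun u hu => ?_
    obtain ⟨γ, hγ, -⟩ := hB.existsUnique _ hu
    exact ⟨γ, hγ⟩
  · intro γ hγ b hb h
    exact eq_one_of_mem hB hb (idealAct_one (hB.subset hb).1) hγ h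

/-! ### The area of a fundamental domain at infinity -/

variable {Γ : Subgroup (Mink ≃ₗ[ℝ] Mink)} {ρ : Mink → ℝ}

theorem volume_tri_sdiff : volume (tri \ triInt) = 0 := by
  have h1 : volume {z : ℝ × ℝ | z.1 = 0} = 0 := by
    have : {z : ℝ × ℝ | z.1 = 0} = {0} ×ˢ univ := by ext; simp
    rw [this, Measure.volume_eq_prod, Measure.prod_prod]; simp
  have h2 : volume {z : ℝ × ℝ | z.2 = 0} = 0 := by
    have : {z : ℝ × ℝ | z.2 = 0} = univ ×ˢ {0} := by ext; simp
    rw [this, Measure.volume_eq_prod, Measure.prod_prod]; simp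
  have h3 : volume {z : ℝ × ℝ | z.1 + z.2 = 1} = 0 := by
    have : {z : ℝ × ℝ | z.1 + z.2 = 1} ⊆
        (fun z : ℝ × ℝ => (z.1 + 1 - z.2, z.2)) '' {z | z.1 = 0} := by
      intro z hz
      refine ⟨(0, z.2), rfl, ?_⟩
      have hz : z.1 + z.2 = 1 := hz
      refine Prod.ext ?_ rfl
      simp only; linarith
    refine measure_mono_null this
      (addHaar_image_eq_zero_of_differentiableOn_of_addHaar_eq_zero volume ?_ h1)
    fun_prop
  refine measure_mono_null ?_ (measure_union_null h1 (measure_union_null h2 h3))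
  rintro z ⟨⟨a1, a2, a3⟩, hn⟩
  by_contra hc
  simp only [mem_union, mem_ofPred_eq, not_or] at hc
  exact hn ⟨lt_of_le_of_ne a1 (Ne.symm hc.1), lt_of_le_of_ne a2 (Ne.symm hc.2.1),
    lt_of_le_of_ne a3 hc.2.2⟩

theorem triInt_ae_eq : triInt =ᵐ[volume] tri :=
  (LE.le.eventuallyLE triInt_subset).antisymm (ae_le_set.2 volume_tri_sdiff)

namespace SmoothTriangulation
variable (T : SmoothTriangulation Γ)

/-- The open triangle with vertex set `f`. -/
def cell (f : Finset (Fin T.n)) : Set Mink :=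
  (fun t => toSphere (T.tau f t)) '' {t | t ∈ realization T.n T.faces ∧ ∀ l, 0 < t l ↔ l ∈ f}

variable {a a' : Fin T.n × Fin T.n × Fin T.n}

theorem exists_flag {f : Finset (Fin T.n)} (hf : f ∈ T.faces) : ∃ a ∈ T.flags, T.verts a = f := by
  obtain ⟨i, j, k, -, -, -, rfl⟩ := Finset.card_eq_three.1 (T.card_face f hf)
  exact ⟨(i, j, k), T.mem_flags.2 hf, rfl⟩

theorem bary_snd (ha : a ∈ T.flags) (z : ℝ × ℝ) :
    (bary a.1 a.2.1 a.2.2 z a.2.1, bary a.1 a.2.1 a.2.2 z a.2.2) = z := by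
  obtain ⟨n1, n2, n3⟩ := T.flags_distinct ha
  simp [bary_apply, n1.symm, n2.symm, n3, n3.symm]

/-- Barycentric coordinates describe the open triangle without reference to an ordering, so its area
is a function of the vertex set, as `gauss_bonnet` requires. -/
theorem pm_image (ha : a ∈ T.flags) : T.pm a '' triInt = T.cell (T.verts a) := by
  have hf := T.mem_flags.1 ha
  ext b
  constructor
  · rintro ⟨z, hz, rfl⟩
    exact ⟨_, ⟨T.bary_mem hf (triInt_subset hz), T.bary_pos_iff hf hz⟩, rfl⟩
  · rintro ⟨t, ⟨ht, hpos⟩, rfl⟩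
    have h0 : ∀ l ∉ T.verts a, t l = 0 := fun l hl =>
      le_antisymm (not_lt.1 fun h => hl ((hpos l).1 h)) (ht.1 l)
    obtain ⟨hz, hb⟩ := T.exists_bary_eq hf ht h0
    refine ⟨(t a.2.1, t a.2.2), ⟨(hpos _).2 (by simp [verts]), (hpos _).2 (by simp [verts]), ?_⟩, ?_⟩
    · have h1 : 0 < t a.1 := (hpos _).2 (by simp [verts])
      obtain ⟨n1, n2, n3⟩ := T.flags_distinct ha
      rw [← hb, bary_apply] at h1
      simp only [if_true, if_neg n1, if_neg n2] at h1
      simp only; linarith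
    · simp only [pm, par, hb]; rfl

theorem injOn_pm (hΓ : IsHyperbolicManifoldGroup Γ) (ha : a ∈ T.flags) : InjOn (T.pm a) triInt := by
  intro z hz w hw h
  have hf := T.mem_flags.1 ha
  have := (T.act_par_ne hΓ hf hf Γ.one_mem Γ.one_mem hz hw (congrArg _ h)).2
  rw [← T.bary_snd ha z, ← T.bary_snd ha w, this]

theorem measurableSet_cell (hΓ : IsHyperbolicManifoldGroup Γ) {f : Finset (Fin T.n)}
    (hf : f ∈ T.faces) : MeasurableSet (T.cell f) := by
  obtain ⟨a, ha, rfl⟩ := T.exists_flag hf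
  obtain ⟨hp, ht⟩ := T.isLocalParam_par hf
  rw [← T.pm_image ha]
  exact isOpen_triInt.measurableSet.image_of_continuousOn_injOn
    (hp.smooth.continuousOn.mono (triInt_subset.trans ht)) (T.injOn_pm hΓ ha)

theorem cell_subset {f : Finset (Fin T.n)} (hf : f ∈ T.faces) :
    T.cell f ⊆ discontinuityDomain Γ := by
  obtain ⟨a, ha, rfl⟩ := T.exists_flag hf
  rw [← T.pm_image ha]
  rintro _ ⟨z, hz, rfl⟩
  exact T.par_mem hf (triInt_subset hz)

theorem eq_of_act_mem_cell (hΓ : IsHyperbolicManifoldGroup Γ) {f f' : Finset (Fin T.n)}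
    (hf : f ∈ T.faces) (hf' : f' ∈ T.faces) {γ : Mink ≃ₗ[ℝ] Mink} (hγ : γ ∈ Γ) {b : Mink}
    (hb : b ∈ T.cell f) (hb' : idealAct γ b ∈ T.cell f') : f = f' ∧ idealAct γ b = b := by
  obtain ⟨a, ha, rfl⟩ := T.exists_flag hf
  obtain ⟨a', ha', rfl⟩ := T.exists_flag hf'
  rw [← T.pm_image ha] at hb
  rw [← T.pm_image ha'] at hb'
  obtain ⟨z, hz, rfl⟩ := hb
  obtain ⟨z', hz', h⟩ := hb'
  have hone := idealAct_one (T.par_mem hf' (triInt_subset hz')).1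
  obtain ⟨h1, h2⟩ := T.act_par_ne hΓ hf hf' hγ Γ.one_mem hz hz' (h.symm.trans hone.symm)
  refine ⟨h1, ?_⟩
  rw [← h]
  simp only [pm, par, h1, h2]

theorem integrableOn_area (hρ : IsConformalMetric Γ ρ) (ha : a ∈ T.flags) :
    IntegrableOn (fun z => √(mE ρ (T.pm a) z * mG ρ (T.pm a) z - mF ρ (T.pm a) z ^ 2)) tri := by
  obtain ⟨hp, ht⟩ := T.isLocalParam_par (T.mem_flags.1 ha)
  have hm := isMetricOn hρ hp
  refine ContinuousOn.integrableOn_compact isCompact_tri ?_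
  have h1 := hm.smoothE.continuousOn.mono ht
  have h2 := hm.smoothF.continuousOn.mono ht
  have h3 := hm.smoothG.continuousOn.mono ht
  exact ((h1.mul h3).sub (h2.pow 2)).sqrt

theorem idealArea_cell (hΓ : IsHyperbolicManifoldGroup Γ) (hρ : IsConformalMetric Γ ρ)
    (ha : a ∈ T.flags) : idealArea ρ (T.cell (T.verts a)) = ENNReal.ofReal (T.triArea ρ a) := by
  obtain ⟨hp, ht⟩ := T.isLocalParam_par (T.mem_flags.1 ha)
  rw [← T.pm_image ha, idealArea_image hp (triInt_subset.trans ht) isOpen_triInt.measurableSet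
    (T.injOn_pm hΓ ha), setLIntegral_congr triInt_ae_eq, triArea,
    ofReal_integral_eq_lintegral_ofReal (T.integrableOn_area hρ ha)
      (Eventually.of_forall fun _ => Real.sqrt_nonneg _)]

theorem triArea_nonneg : 0 ≤ T.triArea ρ a := integral_nonneg fun _ => Real.sqrt_nonneg _

theorem exists_act_par (hΓ : IsHyperbolicManifoldGroup Γ) {b : Mink}
    (hb : b ∈ discontinuityDomain Γ) :
    ∃ γ ∈ Γ, ∃ a ∈ T.flags, ∃ z ∈ tri, idealAct γ (T.pm a z) = b := by
  obtain ⟨f, hf, h0⟩ := (T.loc ⟨_, hb⟩).2.2.2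
  obtain ⟨a, ha, rfl⟩ := T.exists_flag hf
  obtain ⟨hz, h⟩ := T.exists_bary_eq hf (T.loc ⟨_, hb⟩).2 h0
  have hl : T.loc ⟨_, T.par_mem hf hz⟩ = T.loc ⟨_, hb⟩ := by
    rw [T.loc_par hf hz]; exact Subtype.ext h
  obtain ⟨γ, hγ, h⟩ := (T.loc_eq_iff hΓ).1 hl
  exact ⟨γ, hγ, a, ha, _, hz, h⟩

/-- Almost every point has a translate in an open triangle. -/
theorem ae_exists_cell (hΓ : IsHyperbolicManifoldGroup Γ) :
    ∀ᵐ u, stereo u ∈ discontinuityDomain Γ →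
      ∃ γ ∈ Γ, idealAct γ (stereo u) ∈ ⋃ f ∈ T.faces, T.cell f := by
  have := countable_group hΓ
  have hnull : ∀ᵐ u, ∀ γ : Γ, ∀ a : Fin T.n × Fin T.n × Fin T.n, a ∈ T.flags →
      u ∉ stereo ⁻¹' ((fun z => idealAct (γ : Mink ≃ₗ[ℝ] Mink) (T.pm a z)) '' (tri \ triInt)) := by
    rw [ae_all_iff]; intro γ
    rw [ae_all_iff]; intro a
    rw [eventually_imp_distrib_left]; intro ha
    obtain ⟨hp, ht⟩ := T.isLocalParam_par (T.mem_flags.1 ha)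
    exact measure_eq_zero_iff_ae_notMem.1
      (idealArea_image_null (hp.act hΓ γ.2) (sdiff_subset.trans ht) volume_tri_sdiff)
  filter_upwards [hnull] with u hu hΩ
  obtain ⟨γ, hγ, a, ha, z, hz, h⟩ := T.exists_act_par hΓ hΩ
  refine ⟨γ⁻¹, Γ.inv_mem hγ, mem_biUnion (T.mem_flags.1 ha) ?_⟩
  rw [← h, idealAct_inv_cancel hΓ hγ (T.par_mem (T.mem_flags.1 ha) hz).1, ← T.pm_image ha]
  refine ⟨z, ?_, rfl⟩
  by_contra hn
  exact hu ⟨γ, hγ⟩ a ha ⟨z, ⟨hz, hn⟩, h⟩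

/-- The area of a hyperbolic metric is finite and is given by the Euler characteristic. -/
theorem idealArea_fundDomain (hΓ : IsHyperbolicManifoldGroup Γ) (hρ : IsHyperbolicMetric Γ ρ)
    {B : Set Mink} (hB : IsFundDomain Γ idealAct (discontinuityDomain Γ) B) :
    ∃ A : ℝ, 0 ≤ A ∧ 4 * A = -2 * Real.pi * T.eulerChar ∧ idealArea ρ B = ENNReal.ofReal A := by
  have hfree := freeAtInfinity_of_fundDomain hΓ hB
  have hρ' := hρ.toIsConformalMetric
  have har : ∀ a ∈ T.flags, T.triArea ρ a = (idealArea ρ (T.cell (T.verts a))).toReal := by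
    intro a ha
    rw [T.idealArea_cell hΓ hρ' ha, ENNReal.toReal_ofReal T.triArea_nonneg]
  refine ⟨_, ?_, T.gauss_bonnet hΓ hfree hρ (fun f => (idealArea ρ (T.cell f)).toReal) har, ?_⟩
  · exact Finset.sum_nonneg fun f _ => ENNReal.toReal_nonneg
  -- The chosen lifts of the open triangles form a fundamental domain up to a null set, so its area
  -- equals that of B.
  have hm : MeasurableSet (⋃ f ∈ T.faces, T.cell f) :=
    Finset.measurableSet_biUnion _ fun f hf => T.measurableSet_cell hΓ hf
  rw [idealArea_eq_of_fundamental hΓ hρ' hB hm (iUnion₂_subset fun f hf => T.cell_subset hf)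
    (T.ae_exists_cell hΓ)]
  · rw [idealArea, preimage_iUnion₂, lintegral_biUnion_finset]
    · rw [ENNReal.ofReal_sum_of_nonneg fun f _ => ENNReal.toReal_nonneg]
      refine Finset.sum_congr rfl fun f hf => ?_
      obtain ⟨a, ha, rfl⟩ := T.exists_flag hf
      have h := T.idealArea_cell hΓ hρ' ha
      rw [ENNReal.ofReal_toReal (by rw [h]; exact ENNReal.ofReal_ne_top)]
      rfl
    · intro f hf f' hf' hne
      refine disjoint_left.2 fun u hu hu' => hne ?_
      refine (T.eq_of_act_mem_cell hΓ hf hf' Γ.one_mem hu ?_).1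
      rw [idealAct_one (stereo_mem u)]; exact hu'
    · intro f hf
      exact measurableSet_stereo_preimage (T.measurableSet_cell hΓ hf)
  · intro γ hγ b hb h
    obtain ⟨f, hf, hb⟩ := mem_iUnion₂.1 hb
    obtain ⟨f', hf', h⟩ := mem_iUnion₂.1 h
    exact hfree γ hγ b (T.cell_subset hf hb) (T.eq_of_act_mem_cell hΓ hf hf' hγ hb h).2

theorem area_fundDomain (hΓ : IsHyperbolicManifoldGroup Γ) (hρ : IsHyperbolicMetric Γ ρ)
    {B : Set Mink} (hB : IsFundDomain Γ idealAct (discontinuityDomain Γ) B) :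
    IntegrableOn (fun u => lam ρ 1 u ^ 2) (stereo ⁻¹' B) ∧
    ∫ u in stereo ⁻¹' B, lam ρ 1 u ^ 2 = -(Real.pi * T.eulerChar) / 2 := by
  obtain ⟨A, hA0, hA, h⟩ := T.idealArea_fundDomain hΓ hρ hB
  have hsm : AEStronglyMeasurable (fun u => lam ρ 1 u ^ 2) (volume.restrict (stereo ⁻¹' B)) := by
    have hc := (contDiffOn_lam hρ.toIsConformalMetric (one_pow 2)).continuousOn.pow 2
    rw [chart_one] at hc
    exact (hc.aestronglyMeasurable (isLocalParam_stereo (Γ := Γ)).isOpen.measurableSet).mono_measure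
      (Measure.restrict_mono (preimage_mono hB.subset) le_rfl)
  have hn : 0 ≤ᵐ[volume.restrict (stereo ⁻¹' B)] fun u => lam ρ 1 u ^ 2 :=
    Eventually.of_forall fun u => sq_nonneg _
  have hsq : IntegrableOn (fun u => lam ρ 1 u ^ 2) (stereo ⁻¹' B) := by
    refine ⟨hsm, ?_⟩
    rw [hasFiniteIntegral_iff_ofReal hn]
    exact lt_of_eq_of_lt h ENNReal.ofReal_lt_top
  refine ⟨hsq, ?_⟩
  rw [integral_eq_lintegral_of_nonneg_ae hn hsm]
  rw [idealArea] at h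
  rw [h, ENNReal.toReal_ofReal hA0]
  linarith

end SmoothTriangulation

/-! ### Uniqueness of the hyperbolic metric -/

variable {Γ : Subgroup (Mink ≃ₗ[ℝ] Mink)} {ρ ρ' : Mink → ℝ}

/-- A negative second derivative would also make x a local maximum, so g would be locally constant
and its second derivative zero. -/
theorem deriv_deriv_nonneg_of_isLocalMin {g : ℝ → ℝ} {x : ℝ} (hg : IsLocalMin g x)
    (hc : ContinuousAt g x) : 0 ≤ deriv (deriv g) x := by
  by_contra! hneg
  have hmax := isLocalMax_of_deriv_deriv_neg hneg hg.deriv_eq_zero hc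
  have hconst : g =ᶠ[𝓝 x] fun _ => g x := by
    filter_upwards [hg, hmax] with y h1 h2 using le_antisymm h2 h1
  have h1 : deriv g =ᶠ[𝓝 x] fun _ => 0 := by
    filter_upwards [hconst.eventuallyEq_nhds] with y hy
    rw [hy.deriv_eq, deriv_const]
  rw [h1.deriv_eq, deriv_const] at hneg
  exact lt_irrefl _ hneg

theorem fderiv_fderiv_nonneg_of_isLocalMin {W : Set (ℝ × ℝ)} (hW : IsOpen W) {f : ℝ × ℝ → ℝ}
    (hf : ContDiffOn ℝ ∞ f W) {u : ℝ × ℝ} (hu : u ∈ W) (hmin : IsLocalMin f u) (v : ℝ × ℝ) :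
    0 ≤ fderiv ℝ (fun z => fderiv ℝ f z v) u v := by
  have hline : ∀ t : ℝ, HasDerivAt (fun t : ℝ => u + t • v) v t := fun t => by
    simpa using ((hasDerivAt_id t).smul_const v).const_add u
  have hcont : Continuous fun t : ℝ => u + t • v := by fun_prop
  have h0 : u + (0 : ℝ) • v = u := by simp
  have hd : ∀ᶠ t in 𝓝 (0 : ℝ), u + t • v ∈ W :=
    hcont.continuousAt.eventually_mem (hW.mem_nhds (by rwa [h0]))
  have h1 : deriv (fun t : ℝ => f (u + t • v)) =ᶠ[𝓝 0] fun t => fderiv ℝ f (u + t • v) v := by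
    filter_upwards [hd] with t ht
    exact ((differentiableAt_of_smooth hW hf ht).hasFDerivAt.comp_hasDerivAt t (hline t)).deriv
  have h2 : deriv (deriv fun t : ℝ => f (u + t • v)) 0 = fderiv ℝ (fun z => fderiv ℝ f z v) u v := by
    rw [h1.deriv_eq]
    have := differentiableAt_of_smooth hW (contDiffOn_fderiv_apply hW hf v) hu
    have h3 := this.hasFDerivAt
    rw [← h0] at h3
    have h4 := (h3.comp_hasDerivAt 0 (hline 0)).deriv
    rw [h0] at h4
    exact h4
  rw [← h2]
  refine deriv_deriv_nonneg_of_isLocalMin ?_ ?_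
  · have h4 : Tendsto (fun t : ℝ => u + t • v) (𝓝 0) (𝓝 u) := by
      simpa using hcont.tendsto 0
    have h5 := h4.eventually hmin
    filter_upwards [h5] with t ht
    rw [h0]; exact ht
  · refine ContinuousAt.comp (f := fun t : ℝ => u + t • v) ?_ hcont.continuousAt
    rw [h0]
    exact (differentiableAt_of_smooth hW hf hu).continuousAt

/-- The comparison principle for the curvature equation, at a maximum of the quotient of two
hyperbolic metrics. -/
theorem le_one_of_isMax (hρ : IsHyperbolicMetric Γ ρ) (hρ' : IsHyperbolicMetric Γ ρ') {b : Mink}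
    (hb : b ∈ discontinuityDomain Γ) {c : ℝ} (hcb : ρ' b = c * ρ b)
    (hmax : ∀ x ∈ discontinuityDomain Γ, ρ' x ≤ c * ρ x) : c ≤ 1 := by
  obtain ⟨sg, hsg, hne⟩ := exists_pole_ne b
  have hchart : chart sg (chartInv sg b) = b := chart_chartInv hsg hb.1 hne
  set u := chartInv sg b
  have hW := isOpen_chart_preimage (Γ := Γ) hsg
  have hu : u ∈ chart sg ⁻¹' discontinuityDomain Γ := by rwa [mem_preimage, hchart]
  have hl := contDiffOn_lam hρ.toIsConformalMetric hsg
  have hl' := contDiffOn_lam hρ'.toIsConformalMetric hsg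
  have hpos := lam_pos hρ.toIsConformalMetric hu
  have hpos' := lam_pos hρ'.toIsConformalMetric hu
  have L1 := liouville hρ hsg hu
  have L2 := liouville hρ' hsg hu
  set W := chart sg ⁻¹' discontinuityDomain Γ
  have hφ : ContDiffOn ℝ ∞ (fun z => c * lam ρ sg z - lam ρ' sg z) W :=
    (contDiffOn_const.mul hl).sub hl'
  have hval : lam ρ' sg u = c * lam ρ sg u := by
    rw [lam, lam, hchart, hcb, mul_assoc]
  -- The difference is nonnegative and vanishes at u. Hence the gradients of c l and l' agree there,
  -- and each pure second derivative of l' is at most that of c l.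
  have hmin : IsLocalMin (fun z => c * lam ρ sg z - lam ρ' sg z) u := by
    filter_upwards [hW.mem_nhds hu] with z hz
    rw [hval, sub_self, lam, lam, ← mul_assoc, ← sub_mul]
    exact mul_nonneg (sub_nonneg.2 (hmax _ hz)) (div_nonneg zero_le_two (one_add_sq_pos z).le)
  have e1 : ∀ v, EqOn (fun z => fderiv ℝ (fun z => c * lam ρ sg z - lam ρ' sg z) z v)
      (fun z => c * fderiv ℝ (lam ρ sg) z v - fderiv ℝ (lam ρ' sg) z v) W := by
    intro v z hz
    have h1 := (differentiableAt_of_smooth hW hl hz).hasFDerivAt.const_mul c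
    have h2 := (differentiableAt_of_smooth hW hl' hz).hasFDerivAt
    simp only
    rw [show fderiv ℝ (fun z => c * lam ρ sg z - lam ρ' sg z) z = _ from (h1.fun_sub h2).fderiv]
    simp
  have e2 : ∀ v, 0 ≤ c * fderiv ℝ (fun z => fderiv ℝ (lam ρ sg) z v) u v -
      fderiv ℝ (fun z => fderiv ℝ (lam ρ' sg) z v) u v := by
    intro v
    have h := fderiv_fderiv_nonneg_of_isLocalMin hW hφ hu hmin v
    rw [fderiv_congr_on hW (e1 v) hu] at h
    have h1 := (differentiableAt_of_smooth hW (contDiffOn_fderiv_apply hW hl v)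
      hu).hasFDerivAt.const_mul c
    have h2 := (differentiableAt_of_smooth hW (contDiffOn_fderiv_apply hW hl' v) hu).hasFDerivAt
    rw [show fderiv ℝ (fun z => c * fderiv ℝ (lam ρ sg) z v - fderiv ℝ (lam ρ' sg) z v) u = _ from
      (h1.fun_sub h2).fderiv] at h
    simpa using h
  have e3 : ∀ v, c * fderiv ℝ (lam ρ sg) u v = fderiv ℝ (lam ρ' sg) u v := by
    intro v
    have h := e1 v hu
    simp only [hmin.fderiv_eq_zero] at h
    rw [zero_apply] at h
    linarith
  have a1 : c * d1 (d1 (lam ρ sg)) u ≥ d1 (d1 (lam ρ' sg)) u :=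
    sub_nonneg.1 (e2 (1, 0))
  have a2 : c * d2 (d2 (lam ρ sg)) u ≥ d2 (d2 (lam ρ' sg)) u :=
    sub_nonneg.1 (e2 (0, 1))
  have b1 : c * d1 (lam ρ sg) u = d1 (lam ρ' sg) u := e3 _
  have b2 : c * d2 (lam ρ sg) u = d2 (lam ρ' sg) u := e3 _
  have hc : 0 < c := by
    rw [hval] at hpos'
    exact pos_of_mul_pos_left hpos' hpos.le
  rw [hval, ← b1, ← b2] at L2
  generalize lam ρ sg u = l at *
  generalize d1 (d1 (lam ρ sg)) u = x at *
  generalize d2 (d2 (lam ρ sg)) u = y at *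
  generalize d1 (d1 (lam ρ' sg)) u = x' at *
  generalize d2 (d2 (lam ρ' sg)) u = y' at *
  have h1 : c * l * (x' + y') ≤ c * l * (c * (x + y)) := by
    refine mul_le_mul_of_nonneg_left ?_ (mul_pos hc hpos).le
    linarith
  -- Liouville's equation for l', with l' = c l and equal gradients: 4 (cl)⁴ = cl Δl' - c² |∇l|² ≤
  -- c² (l Δl - |∇l|²) = c² · 4 l⁴.
  have h2 : 4 * (c * l) ^ 4 ≤ c ^ 2 * (4 * l ^ 4) := by
    rw [← L1, ← L2]; nlinarith
  have hl4 : 0 < 4 * l ^ 4 := by positivity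
  have h3 : c ^ 4 ≤ c ^ 2 := by
    have : c ^ 4 * (4 * l ^ 4) ≤ c ^ 2 * (4 * l ^ 4) := by
      calc c ^ 4 * (4 * l ^ 4) = 4 * (c * l) ^ 4 := by ring
        _ ≤ _ := h2
    exact le_of_mul_le_mul_right this hl4
  by_contra! hgt
  nlinarith [pow_pos hc 2, mul_pos (pow_pos hc 2) (mul_pos (sub_pos.2 hgt) (by linarith : 0 < c + 1))]

theorem conformal_factor_act (hΓ : IsHyperbolicManifoldGroup Γ) (hρ : IsConformalMetric Γ ρ)
    {γ : Mink ≃ₗ[ℝ] Mink} (hγ : γ ∈ Γ) {b : Mink} (hb : b ∈ discontinuityDomain Γ) :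
    ρ (idealAct γ b) = ρ b * (γ b).1 := by
  have h := congrArg Prod.fst (conformal_equivariant hΓ hρ hγ hb)
  have h1 := (idealAct_mem hΓ hγ hb.1).2
  simpa [h1] using h.symm

/-- The quotient ρ'/ρ is Γ-invariant and finitely many compact triangles meet every orbit, so it
attains its maximum, where `le_one_of_isMax` applies. -/
theorem SmoothTriangulation.hyperbolic_le (T : SmoothTriangulation Γ)
    (hΓ : IsHyperbolicManifoldGroup Γ) (hρ : IsHyperbolicMetric Γ ρ)
    (hρ' : IsHyperbolicMetric Γ ρ') {b : Mink} (hb : b ∈ discontinuityDomain Γ) : ρ' b ≤ ρ b := by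
  have hloc : ∀ a ∈ T.flags, ∃ z ∈ tri, ∀ w ∈ tri,
      ρ' (T.pm a w) / ρ (T.pm a w) ≤ ρ' (T.pm a z) / ρ (T.pm a z) := by
    intro a ha
    obtain ⟨hp, ht⟩ := T.isLocalParam_par (T.mem_flags.1 ha)
    refine isCompact_tri.exists_isMaxOn (f := fun w => ρ' (T.pm a w) / ρ (T.pm a w))
      ⟨(0, 0), le_rfl, le_rfl, by simp⟩ ?_
    exact ((hρ'.smooth _ _ hp).continuousOn.mono ht).div ((hρ.smooth _ _ hp).continuousOn.mono ht)
      fun z hz => (hρ.pos _ (hp.mapsTo (ht hz))).ne'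
  choose! z hz hmax using hloc
  obtain ⟨γ₀, hγ₀, a₀, ha₀, z₀, hz₀, hb₀⟩ := T.exists_act_par hΓ hb
  obtain ⟨a, ha, hamax⟩ := T.flags.exists_max_image
    (fun a => ρ' (T.pm a (z a)) / ρ (T.pm a (z a))) ⟨a₀, ha₀⟩
  set c := ρ' (T.pm a (z a)) / ρ (T.pm a (z a)) with hc
  have hmem := T.par_mem (T.mem_flags.1 ha) (hz a ha)
  have hall : ∀ x ∈ discontinuityDomain Γ, ρ' x ≤ c * ρ x := by
    intro x hx
    obtain ⟨γ, hγ, a₁, ha₁, w, hw, rfl⟩ := T.exists_act_par hΓ hx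
    have hw' := T.par_mem (T.mem_flags.1 ha₁) hw
    rw [conformal_factor_act hΓ hρ.toIsConformalMetric hγ hw',
      conformal_factor_act hΓ hρ'.toIsConformalMetric hγ hw', ← mul_assoc]
    refine mul_le_mul_of_nonneg_right ?_ (ideal_fst_pos hΓ hγ hw'.1).le
    rw [← div_le_iff₀ (hρ.pos _ hw')]
    exact (hmax a₁ ha₁ w hw).trans (hamax a₁ ha₁)
  have hc1 := le_one_of_isMax hρ hρ' hmem
    (by rw [hc, div_mul_cancel₀ _ (hρ.pos _ hmem).ne']) hall
  exact (hall b hb).trans (mul_le_of_le_one_left (hρ.pos _ hb).le hc1)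

/-- A hyperbolic metric in the conformal class at infinity is unique. -/
theorem SmoothTriangulation.hyperbolic_unique (T : SmoothTriangulation Γ)
    (hΓ : IsHyperbolicManifoldGroup Γ) (hρ : IsHyperbolicMetric Γ ρ)
    (hρ' : IsHyperbolicMetric Γ ρ') : EqOn ρ ρ' (discontinuityDomain Γ) := fun _ hb =>
  le_antisymm (T.hyperbolic_le hΓ hρ' hρ hb) (T.hyperbolic_le hΓ hρ hρ' hb)

/-! ### Independence of choices, expansions and the limit -/

variable {Γ : Subgroup (Mink ≃ₗ[ℝ] Mink)} {ρ ρ' : Mink → ℝ}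

namespace EquidistantFoliation
variable {F F' : EquidistantFoliation Γ}

theorem Induces.congr (hF : F.Induces ρ') (h : EqOn ρ ρ' (discontinuityDomain Γ)) :
    F.Induces ρ := by
  intro U p hp u hu v w
  rw [h (hp.mapsTo hu)]
  exact hF U p hp u hu v w

/-- The formula of `pt_chart` involves the metric only. -/
theorem pt_eq_pt (hρ : IsConformalMetric Γ ρ) (hF : F.Induces ρ) (hF' : F'.Induces ρ) {r : ℝ}
    (hr : F.r₀ ≤ r) (hr' : F'.r₀ ≤ r) {b : Mink} (hb : b ∈ discontinuityDomain Γ) :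
    F.pt r b = F'.pt r b := by
  obtain ⟨sg, hsg, hne⟩ := exists_pole_ne b
  have hchart : chart sg (chartInv sg b) = b := chart_chartInv hsg hb.1 hne
  have hu : chartInv sg b ∈ chart sg ⁻¹' discontinuityDomain Γ := by rwa [mem_preimage, hchart]
  rw [← hchart, F.pt_chart hρ hF hsg hr hu, F'.pt_chart hρ hF' hsg hr' hu]

/-- A point outside the body of F' lies on a leaf of F' with parameter t > r. That leaf is also a
leaf of F, and its points are outside `F.body r`. -/
theorem body_subset_body (hρ : IsConformalMetric Γ ρ) (hF : F.Induces ρ) (hF' : F'.Induces ρ)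
    {r : ℝ} (hr : F.r₀ ≤ r) (hr' : F'.r₀ ≤ r) : F.body r ⊆ F'.body r := by
  intro y hy
  by_contra hn
  obtain ⟨t, ht, b, hb, rfl⟩ := F'.exists_pt_eq hr' (F.subset r hr hy) hn
  rw [← pt_eq_pt hρ hF hF' (hr.trans ht.le) (hr'.trans ht.le) hb] at hy
  exact F.pt_notMem_body hr ht hb hy

/-- The metric at infinity determines the foliation. -/
theorem body_eq_body (hρ : IsConformalMetric Γ ρ) (hF : F.Induces ρ) (hF' : F'.Induces ρ)
    {r : ℝ} (hr : F.r₀ ≤ r) (hr' : F'.r₀ ≤ r) : F.body r = F'.body r :=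
  (body_subset_body hρ hF hF' hr hr').antisymm (body_subset_body hρ hF' hF hr' hr)

theorem vol_congr (hΓ : IsHyperbolicManifoldGroup Γ) {D D' : Set Mink}
    (hD : IsFundDomain Γ (fun γ => γ) H3 D) (hD' : IsFundDomain Γ (fun γ => γ) H3 D') {r : ℝ}
    (hr : F.r₀ ≤ r) (hb : F.body r = F'.body r) : F.vol D r = F'.vol D' r := by
  have := countable_group hΓ
  have := smulInvariant_hypVolume hΓ
  have := measurableConstSMul (Γ := Γ)
  rw [vol, vol, ← hb, (isFundamentalDomain_hyp hΓ hD).measure_set_eq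
    (isFundamentalDomain_hyp hΓ hD') (F.isClosed r hr).measurableSet]
  intro γ
  ext x
  simp only [mem_preimage, smul_eq_apply]
  refine ⟨fun h => ?_, F.invariant r hr γ γ.2 x⟩
  have h1 := F.invariant r hr _ (Γ.inv_mem γ.2) _ h
  simpa using h1

/-- The expansions of volume, area and mean curvature of the leaves. -/
theorem exists_expansion (hΓ : IsHyperbolicManifoldGroup Γ) {D : Set Mink}
    (hD : IsFundDomain Γ (fun γ => γ) H3 D) {B : Set Mink}
    (hB : IsFundDomain Γ idealAct (discontinuityDomain Γ) B) {χ : ℤ}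
    (hχ : IsEulerCharacteristic Γ χ) (hρ : IsHyperbolicMetric Γ ρ) (hF : F.Induces ρ) :
    ∃ A I w : ℝ, 0 ≤ A ∧ A = -(Real.pi * χ) / 2 ∧ ∀ r, F.r₀ ≤ r →
      F.area B r = (Real.exp r ^ 2 + 2) * A + Real.exp (-r) ^ 2 * I ∧
      F.totalMeanCurvature B r = Real.exp r ^ 2 * A - Real.exp (-r) ^ 2 * I ∧
      F.totalMeanCurvatureSubOne B r = -2 * A - 2 * Real.exp (-r) ^ 2 * I ∧
      F.vol D r = w + Real.exp r ^ 2 / 2 * A + 2 * r * A - Real.exp (-r) ^ 2 / 2 * I := by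
  obtain ⟨T, rfl⟩ := hχ
  obtain ⟨hsq, hA⟩ := T.area_fundDomain hΓ hρ hB
  refine ⟨∫ u in stereo ⁻¹' B, lam ρ 1 u ^ 2,
    ∫ u in stereo ⁻¹' B, lam ρ 1 u ^ 2 * shapeDet (lam ρ 1) u,
    -- The constant w is what makes the volume expansion exact at r = r₀.
    F.vol D F.r₀ - Real.exp F.r₀ ^ 2 / 2 * (∫ u in stereo ⁻¹' B, lam ρ 1 u ^ 2) -
      2 * F.r₀ * (∫ u in stereo ⁻¹' B, lam ρ 1 u ^ 2) +
      Real.exp (-F.r₀) ^ 2 / 2 * ∫ u in stereo ⁻¹' B, lam ρ 1 u ^ 2 * shapeDet (lam ρ 1) u,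
    integral_nonneg fun u => sq_nonneg _, hA, fun r hr => ⟨F.area_eq hB hρ hF hsq hr,
      F.totalMeanCurvature_eq hB hρ hF hsq hr, F.totalMeanCurvatureSubOne_eq hB hρ hF hsq hr,
      ?_⟩⟩
  rw [F.vol_eq hB hρ hF hsq hΓ hD le_rfl hr]
  ring

end EquidistantFoliation

theorem tendsto_exp_neg_sq : Tendsto (fun r : ℝ => Real.exp (-r) ^ 2) atTop (𝓝 0) := by
  simpa using (Real.tendsto_exp_neg_atTop_nhds_zero).pow 2

/-- By Gauss–Bonnet both integers equal -2/π times the area of the same fundamental domain. -/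
theorem eulerCharacteristic_unique (hΓ : IsHyperbolicManifoldGroup Γ) {B : Set Mink}
    (hB : IsFundDomain Γ idealAct (discontinuityDomain Γ) B) (hρ : IsHyperbolicMetric Γ ρ)
    {χ χ' : ℤ} (hχ : IsEulerCharacteristic Γ χ) (hχ' : IsEulerCharacteristic Γ χ') : χ = χ' := by
  obtain ⟨T, rfl⟩ := hχ
  obtain ⟨T', rfl⟩ := hχ'
  have h := (T.area_fundDomain hΓ hρ hB).2
  rw [(T'.area_fundDomain hΓ hρ hB).2] at h
  have h2 : Real.pi * (T.eulerChar : ℝ) = Real.pi * T'.eulerChar := by linarith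
  exact_mod_cast mul_left_cancel₀ Real.pi_ne_zero h2

/-- The constant term of the expansion of the volume is the renormalized volume. -/
theorem renormalizedVolume_eq (hΓ : IsHyperbolicManifoldGroup Γ) {D : Set Mink}
    (hD : IsFundDomain Γ (fun γ => γ) H3 D) {B : Set Mink}
    (hB : IsFundDomain Γ idealAct (discontinuityDomain Γ) B) {χ : ℤ}
    (hχ : IsEulerCharacteristic Γ χ) (hρ : IsHyperbolicMetric Γ ρ) {F : EquidistantFoliation Γ}
    (hF : F.Induces ρ) {A I w : ℝ} (hA : A = -(Real.pi * χ) / 2)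
    (hw : ∀ r, F.r₀ ≤ r → F.totalMeanCurvature B r = Real.exp r ^ 2 * A - Real.exp (-r) ^ 2 * I ∧
      F.vol D r = w + Real.exp r ^ 2 / 2 * A + 2 * r * A - Real.exp (-r) ^ 2 / 2 * I) :
    renormalizedVolume Γ = w := by
  have hex : ∃ v, IsRenormalizedVolume Γ v :=
    ⟨_, ρ, hρ, F, hF, D, B, hD, hB, χ, hχ, F.r₀, le_rfl, rfl⟩
  rw [renormalizedVolume, dif_pos hex]
  obtain ⟨ρ', hρ', F', hF', D', B', hD', hB', χ', hχ', r, hr, hv⟩ := hex.choose_spec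
  generalize hex.choose = v at hv
  obtain rfl := eulerCharacteristic_unique hΓ hB hρ hχ hχ'
  have heq : EqOn ρ ρ' (discontinuityDomain Γ) := by
    obtain ⟨T, -⟩ := hχ
    exact T.hyperbolic_unique hΓ hρ hρ'
  have hF'ρ := hF'.congr heq
  obtain ⟨A', I', w', -, hA', hexp⟩ := F'.exists_expansion hΓ hD' hB' hχ hρ hF'ρ
  obtain rfl : A = A' := hA.trans hA'.symm
  -- In the W-volume the exponential terms of the volume and of half the total mean curvature
  -- cancel, and 2rA' cancels rπχ, for every r; only the constant term survives.
  have hvw : v = w' := by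
    obtain ⟨-, h1, -, h2⟩ := hexp r hr
    rw [hv, h1, h2, hA]; ring
  rw [hvw]
  -- For parameters admissible for both foliations the bodies, hence the volumes, coincide. In the
  -- limit the terms with I and I' disappear, so these need not be compared.
  have hlim : Tendsto (fun r : ℝ => w' - w) atTop (𝓝 0) := by
    have h0 : Tendsto (fun r : ℝ => Real.exp (-r) ^ 2 * ((I' - I) / 2)) atTop (𝓝 0) := by
      simpa using tendsto_exp_neg_sq.mul_const ((I' - I) / 2)
    refine h0.congr' ?_
    filter_upwards [eventually_ge_atTop F.r₀, eventually_ge_atTop F'.r₀] with s hs hs'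
    have hvol := EquidistantFoliation.vol_congr hΓ hD hD' hs
      (EquidistantFoliation.body_eq_body hρ.toIsConformalMetric hF hF'ρ hs hs')
    rw [(hw s hs).2, (hexp s hs').2.2.2] at hvol
    linarith
  exact sub_eq_zero.1 (tendsto_nhds_unique tendsto_const_nhds hlim)

/-- Factor out e^{2r}: the quotient is e^{2r} (1 + o(1)), and half its logarithm is r + o(1). -/
theorem tendsto_log_sqrt_sub {A I : ℝ} (hA : 0 < A) :
    Tendsto (fun r : ℝ => Real.log √(((Real.exp r ^ 2 + 2) * A + Real.exp (-r) ^ 2 * I) / A) - r)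
      atTop (𝓝 0) := by
  have h1 : Tendsto (fun r : ℝ => 1 + Real.exp (-r) ^ 2 * 2 +
      Real.exp (-r) ^ 2 * Real.exp (-r) ^ 2 * (I / A)) atTop (𝓝 1) := by
    simpa using (tendsto_const_nhds (x := (1 : ℝ))).add (tendsto_exp_neg_sq.mul_const 2) |>.add
      ((tendsto_exp_neg_sq.mul tendsto_exp_neg_sq).mul_const (I / A))
  have h2 : Tendsto (fun r : ℝ => Real.log (1 + Real.exp (-r) ^ 2 * 2 +
      Real.exp (-r) ^ 2 * Real.exp (-r) ^ 2 * (I / A)) / 2) atTop (𝓝 0) := by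
    simpa using (h1.log one_ne_zero).div_const 2
  refine h2.congr' ?_
  filter_upwards [h1.eventually (lt_mem_nhds zero_lt_one)] with r hr
  have he : Real.exp r * Real.exp (-r) = 1 := by rw [← Real.exp_add]; simp
  have hx : ((Real.exp r ^ 2 + 2) * A + Real.exp (-r) ^ 2 * I) / A =
      Real.exp r ^ 2 * (1 + Real.exp (-r) ^ 2 * 2 +
        Real.exp (-r) ^ 2 * Real.exp (-r) ^ 2 * (I / A)) := by
    have e1 : Real.exp r ^ 2 * Real.exp (-r) ^ 2 = 1 := by rw [← mul_pow, he, one_pow]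
    calc _ = Real.exp r ^ 2 + 2 + Real.exp (-r) ^ 2 * (I / A) := by field_simp
      _ = Real.exp r ^ 2 + Real.exp r ^ 2 * Real.exp (-r) ^ 2 * 2 +
        Real.exp r ^ 2 * Real.exp (-r) ^ 2 * Real.exp (-r) ^ 2 * (I / A) := by rw [e1]; ring
      _ = _ := by ring
  rw [hx, Real.sqrt_mul (sq_nonneg _), Real.sqrt_sq (Real.exp_pos r).le,
    Real.log_mul (Real.exp_pos r).ne' (Real.sqrt_pos.2 hr).ne', Real.log_exp,
    Real.log_sqrt hr.le]
  ring

end RenVol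

end

open RenVol in
theorem mainTheorem10 (Γ : Subgroup (Mink ≃ₗ[ℝ] Mink)) (hΓ : IsHyperbolicManifoldGroup Γ)
    (D : Set Mink) (hD : IsFundDomain Γ (fun γ => γ) H3 D)
    (B : Set Mink) (hB : IsFundDomain Γ idealAct (discontinuityDomain Γ) B)
    (χ : ℤ) (hχ : IsEulerCharacteristic Γ χ)
    (ρ : Mink → ℝ) (hρ : IsHyperbolicMetric Γ ρ)
    (F : EquidistantFoliation Γ) (hF : F.Induces ρ) :
    Tendsto (fun r => F.vol D r - 1 / 2 * F.area B r +
        Real.pi * χ * Real.log (√(2 * F.area B r / (Real.pi * |(χ : ℝ)|)))) atTop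
      (𝓝 (renormalizedVolume Γ + Real.pi / 2 * χ)) ∧
    Tendsto (fun r => F.totalMeanCurvatureSubOne B r) atTop (𝓝 (Real.pi * χ)) := by
  obtain ⟨A, I, w, hA0, hA, hexp⟩ := F.exists_expansion hΓ hD hB hχ hρ hF
  rw [renormalizedVolume_eq hΓ hD hB hχ hρ hF hA fun r hr => ⟨(hexp r hr).2.1, (hexp r hr).2.2.2⟩]
  have hlog : Tendsto (fun r => Real.pi * χ * (Real.log (√(2 * F.area B r /
      (Real.pi * |(χ : ℝ)|))) - r)) atTop (𝓝 0) := by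
    -- For χ = 0 the quotient under the root is a division by zero, but the logarithm is multiplied
    -- by χ.
    by_cases h0 : (χ : ℝ) = 0
    · simp [h0]
    have hApos : 0 < A := lt_of_le_of_ne hA0 fun h => h0 (by
      have : Real.pi * χ = 0 := by linarith
      exact (mul_eq_zero.1 this).resolve_left Real.pi_ne_zero)
    have hχneg : (χ : ℝ) < 0 := by
      by_contra! hn
      have := mul_nonneg Real.pi_pos.le hn
      linarith
    -- This is the normalization in the logarithm: the quotient under the root is the area of the
    -- leaf divided by the area A of the metric at infinity.
    have h2A : Real.pi * |(χ : ℝ)| = 2 * A := by rw [abs_of_neg hχneg, hA]; ring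
    have h := (tendsto_log_sqrt_sub (I := I) hApos).const_mul (Real.pi * χ)
    rw [mul_zero] at h
    refine h.congr' ?_
    filter_upwards [eventually_ge_atTop F.r₀] with r hr
    rw [h2A, mul_div_mul_left _ _ two_ne_zero, (hexp r hr).1]
  constructor
  · have h := ((tendsto_const_nhds (x := w - A)).sub (tendsto_exp_neg_sq.mul_const I)).add hlog
    -- The term -A comes from the constant 2A in the area of the leaves, halved; Gauss–Bonnet
    -- converts it into πχ/2.
    have hlim : w - A - 0 * I + 0 = w + Real.pi / 2 * χ := by rw [hA]; ring
    rw [hlim] at h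
    refine h.congr' ?_
    filter_upwards [eventually_ge_atTop F.r₀] with r hr
    have hvol := (hexp r hr).2.2.2
    have harea := (hexp r hr).1
    have hχA : Real.pi * χ = -2 * A := by rw [hA]; ring
    generalize Real.log (√(2 * F.area B r / (Real.pi * |(χ : ℝ)|))) = l
    rw [hvol, harea, hχA]
    ring
  · have h := (tendsto_const_nhds (x := -2 * A)).sub (tendsto_exp_neg_sq.mul_const (2 * I))
    have hlim : -2 * A - 0 * (2 * I) = Real.pi * χ := by rw [hA]; ring
    rw [hlim] at h
    refine h.congr' ?_
    filter_upwards [eventually_ge_atTop F.r₀] with r hr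
    rw [(hexp r hr).2.2.1]
    ring
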